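/- Let $P\subset\mathbb C$ be a finite set and let $(E,\nabla)$ be a holomorphic vector bundle of rank $r$ on $\mathbb{CP}^1$ (affine coordinate $x$) with a meromorphic connection with poles in $P\cup\{\infty\}$ such that: * near each $p\in P$, in a suitable holomorphic frame, $\nabla=d+\mathrm{diag}(\mu^p_1,\dots,\mu^p_r)\frac{dx}{x-p}+(\text{holomorphic matrix})\,dx$; * near $\infty$, in a suitable holomorphic frame, $\nabla=d+\big(\mathrm{diag}(\alpha_1,\dots,\alpha_r)+\mathrm{diag}(\mu^\infty_1,\dots,\mu^\infty_r)\,x^{-1}+O(x^{-2})\big)dx$; * (resonance-freeness) for $p\in P$, the non-zero $\mu^p_i$ satisfy $\operatorname{Re}\mu^p_i\notin\mathbb Z$, and two non-zero $\mu^p_i,\mu^p_k$ do not differ by a non-zero integer; $\operatorname{Re}\mu^\infty_i\notin\mathbb Z$ for all $i$, and $\mu^\infty_i-\mu^\infty_k$ is not a non-zero integer if $\alpha_i=\alpha_k$. Put $\widehat P=\{\alpha_1,\dots,\alpha_r\}$. The meromorphic bundle $\mathcal M=E(*P\cup\{\infty\})$ is a $\mathcal D_{\mathbb{CP}^1}$-module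 through $\nabla$. It has a minimal extension $\mathcal M_{\min}\subset\mathcal M$: a $\mathcal D$-submodule with $\mathcal M_{\min}(*P\cup\{\infty\})=\mathcal M$ that has no non-zero submodule or quotient supported in a point. Let $\mathcal M_{\min}$ be such an extension, let $M_{\min}=H^0(\mathbb{CP}^1,\mathcal M_{\min})$, let $\widehat{M_{\min}}$ be its Laplace transform (the space $M_{\min}$, with $\xi$ acting as $\partial_x$) and let $(\widehat{M_{\min}})_{\xi_0}=\widehat{M_{\min}}/(\xi-\xi_0)\widehat{M_{\min}}$ be its fibre at $\xi_0$. 1. For every $\xi\in\mathbb C\setminus\widehat P$, the map sending the class of $m\in M_{\min}$ in $\mathbb H^1(\mathbb{CP}^1,\mathcal M_{\min}\xrightarrow{\partial_x-\xi}\mathcal M_{\min})$ to the class of $m$ in $(\widehat{M_{\min}})_\xi$ is well defined and gives a linear isomorphism $$\varphi_\xi:\ \mathbb H^1\big(\mathbb{CP}^1,\mathcal M_{\min}\xrightarrow{\partial_x-\xi}\mathcal M_{\min}\big)\ \cong\ (\widehat{M_{\min}})_\xi .$$ 2. On both sides these spaces are the fibres of a holomorphic vector bundle of finite rank on $\mathbb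 C\setminus\widehat P$ (on the left, holomorphic sections are those given locally by hypercocycles depending holomorphically on $\xi$; on the right, those that are locally combinations of elements of $\widehat{M_{\min}}$ with coefficients holomorphic in $\xi$), and $\varphi=(\varphi_\xi)_\xi$ is an isomorphism of holomorphic vector bundles. 3. Both bundles have natural extensions to meromorphic bundles on the compactified dual line $\widehat{\mathbb{CP}}{}^1=\mathbb C\cup\{\infty\}$ with poles along $\widehat P\cup\{\infty\}$, and $\varphi$ extends to an isomorphism between them. Here, on the right, the meromorphic sections near a point are the combinations of elements of $\widehat{M_{\min}}$ whose coefficients are meromorphic in $\xi$ with poles only in $\widehat P\cup\{\infty\}$. On the left, let $F$ be the sheaf of meromorphic sections of $E\otimes\Omega^1$ with at most a double pole at $\infty$ and at most simple poles at the points $p\in P$, with residues there in the image of $\mathrm{res}_p\nabla$. The meromorphic sections near $\xi_0\in\widehat P$ are those that become, after multiplication by a power of $\xi-\xi_0$, sections given by hypercocycles of $E\xrightarrow{\nabla-\xi dx}F$ depending holomorphically on $\xi$ near $\xi_0$. The meromorphic sections near $\infty$ are those that become, after multiplication by a power of $\zeta=\xi^{-1}$, sections given by hypercocycles of $E\xrightarrow{\zeta\nabla-dx}F$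 depending holomorphically on $\zeta$ near $0$; for $\zeta\ne0$, a hypercocycle $(a,b)$ of this complex, with $a$ in $F$ and $b$ in $E$, is identified with the hypercocycle $(\zeta^{-1}a,b)$ of $E\xrightarrow{\nabla-\xi dx}F$. -/

import Mathlib

open scoped Topology

noncomputable section

namespace MinLaplace

/-! ### The Riemann sphere -/

/-- The Riemann sphere: the one-point compactification of the complex line. -/
abbrev CP1 : Type := OnePoint ℂ

/-- The inverse of the chart `t = 1 / x` at infinity. -/
def invChart (t : ℂ) : CP1 := open Classical in if t = 0 then OnePoint.infty else ((t⁻¹ : ℂ) : CP1)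

/-- `f` is holomorphic in a neighbourhood of the point `x` of the sphere. -/
def HolAt (f : CP1 → ℂ) (x : CP1) : Prop :=
  (∀ z : ℂ, x = (z : CP1) → AnalyticAt ℂ (fun w : ℂ => f w) z) ∧
  (x = OnePoint.infty → AnalyticAt ℂ (fun t : ℂ => f (invChart t)) 0)

/-- `f` is holomorphic in a neighbourhood of `(x, η)` in (sphere) × (complex line). -/
def HolAt₂ (f : CP1 → ℂ → ℂ) (x : CP1) (η : ℂ) : Prop :=
  (∀ z : ℂ, x = (z : CP1) → AnalyticAt ℂ (fun w : ℂ × ℂ => f (w.1 : CP1) w.2) (z, η)) ∧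
  (x = OnePoint.infty → AnalyticAt ℂ (fun w : ℂ × ℂ => f (invChart w.1) w.2) (0, η))

/-- The local parameter at `x`, as a function of the affine coordinate `z`:
`z - p` at a finite point `p`, and `1 / z` at infinity. -/
def unif : CP1 → ℂ → ℂ
  | none, z => z⁻¹
  | some p, z => z - p

/-- The pole set `Q ∪ {∞}`. -/
def poles (Q : Finset ℂ) : Set CP1 := insert OnePoint.infty ((fun z : ℂ => (z : CP1)) '' (Q : Set ℂ))

/-- The sphere without the pole set `Q ∪ {∞}`, i.e. the complex line without `Q`. -/
abbrev Punct (Q : Finset ℂ) : Type := {z : ℂ // z ∉ Q}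

/-- The point of the sphere given by a point of the punctured line. -/
def Punct.pt {Q : Finset ℂ} (z : Punct Q) : CP1 := ((z : ℂ) : CP1)

/-! ### Meromorphic bundles on the sphere with poles along `Q ∪ {∞}`

A bundle over the punctured line is a family of vector spaces together with the knowledge of which
(germs of) sections are holomorphic.  An extension across the pole set tells
moreover which sections over punctured neighbourhoods of a pole are admitted. -/

section Mero

universe u

variable {Q : Finset ℂ} {V : Punct Q → Type u} [∀ ξ, AddCommGroup (V ξ)] [∀ ξ, Module ℂ (V ξ)]

/-- Let `Lat s x` say that `s` is, near `x`, a section of a given extension over the sphere of a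
bundle on the punctured line.  `MerExt Lat s x` says that `s` is near `x` a
section of the associated bundle with poles of arbitrary finite order along `Q ∪ {∞}`. -/
def MerExt (Lat : (∀ ξ, V ξ) → CP1 → Prop) (s : ∀ ξ, V ξ) (x : CP1) : Prop :=
  (x ∉ poles Q → Lat s x) ∧
  (x ∈ poles Q → ∃ k : ℕ, Lat (fun ξ => unif x ξ ^ k • s ξ) x)

/-- A function on the punctured line extends holomorphically at `x`. -/
def FunLat (f : Punct Q → ℂ) (x : CP1) : Prop :=
  ∃ g : CP1 → ℂ, HolAt g x ∧ ∃ W ∈ 𝓝 x, ∀ ξ : Punct Q, ξ.pt ∈ W → f ξ = g ξ.pt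

/-- A function on the punctured line is meromorphic at `x`, with poles only in `Q ∪ {∞}`. -/
def MerFun (f : Punct Q → ℂ) (x : CP1) : Prop :=
  MerExt (V := fun _ => ℂ) FunLat f x

/-- The sections singled out by `Mer` form a meromorphic bundle on the sphere, with poles along
`Q ∪ {∞}`: near every point of the sphere there is a frame, formed by a basis of every fibre off
the pole set, and the admitted sections at a point are those with meromorphic coefficients
(holomorphic ones off the pole set).  In particular, over the punctured line
this is a holomorphic vector bundle of finite rank with the fibres `V ξ`. -/
def IsMeroBundle (Mer : (∀ ξ, V ξ) → CP1 → Prop) : Prop :=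
  ∃ ρ : ℕ, ∀ x : CP1, ∃ W : Set CP1, IsOpen W ∧ x ∈ W ∧ ∃ e : Fin ρ → ∀ ξ, V ξ,
    (∀ ξ : Punct Q, ξ.pt ∈ W → LinearIndependent ℂ (fun i => e i ξ) ∧
      Submodule.span ℂ (Set.range fun i => e i ξ) = ⊤) ∧
    ∀ y ∈ W, ∀ s : ∀ ξ, V ξ, Mer s y ↔
      ∃ f : Fin ρ → Punct Q → ℂ, (∀ i, MerFun (f i) y) ∧
        ∃ W' ∈ 𝓝 y, ∀ ξ : Punct Q, ξ.pt ∈ W' → s ξ = ∑ i, f i ξ • e i ξ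

end Mero

/-! ### Holomorphic vector bundles on the sphere -/

universe u

/-- A holomorphic vector bundle of rank `r` on the sphere: a family of vector spaces, and the
sheaf of its holomorphic sections, given by its germs (`IsHol s x`: the section `s` is holomorphic
in a neighbourhood of `x`), such that locally there are frames. -/
structure HolBundle (r : ℕ) where
  Fib : CP1 → Type u
  [addCommGroup : ∀ x, AddCommGroup (Fib x)]
  [module : ∀ x, Module ℂ (Fib x)]
  IsHol : (∀ y, Fib y) → CP1 → Prop
  exists_frame : ∀ x : CP1, ∃ U : Set CP1, IsOpen U ∧ x ∈ U ∧ ∃ e : Fin r → ∀ y, Fib y,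
    ∀ y ∈ U, LinearIndependent ℂ (fun i => e i y) ∧
      Submodule.span ℂ (Set.range fun i => e i y) = ⊤ ∧
      ∀ s : ∀ y, Fib y, IsHol s y ↔ ∃ f : Fin r → CP1 → ℂ, (∀ i, HolAt (f i) y) ∧
        ∀ᶠ z in 𝓝 y, s z = ∑ i, f i z • e i z

attribute [instance] HolBundle.addCommGroup HolBundle.module

namespace HolBundle

variable {r : ℕ} (E : HolBundle.{u} r)

/-- `e` is a holomorphic frame of `E` over the open set `U`. -/
def IsFrame (U : Set CP1) (e : Fin r → ∀ y, E.Fib y) : Prop :=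
  IsOpen U ∧ ∀ y ∈ U, LinearIndependent ℂ (fun i => e i y) ∧
    Submodule.span ℂ (Set.range fun i => e i y) = ⊤ ∧ ∀ i, E.IsHol (e i) y

/-- Not necessarily continuous sections of `E` over the line without `P`.  All sheaves below are
sheaves of such sections: a section over an open set `U` of the sphere is considered through its
values on `U` without the poles. -/
abbrev Sec (P : Finset ℂ) : Type u := ∀ z : Punct P, E.Fib z.pt

variable {E} {P : Finset ℂ}

/-- Two sections agree near `x` (off the poles). -/
def GermEq (x : CP1) (s t : E.Sec P) : Prop :=
  ∃ W ∈ 𝓝 x, ∀ z : Punct P, z.pt ∈ W → s z = t z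

/-- Multiplication of a section by a function. -/
def mulSec (f : ℂ → ℂ) (s : E.Sec P) : E.Sec P := fun z => f z • s z

variable (E P)

/-- Germs at `x` of sections of `E`: those that extend to a holomorphic section near `x`. -/
def holGerms (x : CP1) : Set (E.Sec P) :=
  {s | ∃ σ : ∀ y, E.Fib y, E.IsHol σ x ∧ GermEq x s (fun z => σ z.pt)}

/-- Germs at `x` of sections of the meromorphic bundle `E(∗P ∪ {∞})`. -/
def merGerms (x : CP1) : Set (E.Sec P) :=
  {s | (x ∉ poles P → s ∈ E.holGerms P x) ∧
    (x ∈ poles P → ∃ k : ℕ, mulSec (fun z => unif x z ^ k) s ∈ E.holGerms P x)}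

end HolBundle

/-! ### The connection -/

/-- A holomorphic bundle `E` of rank `r` on the sphere, with a meromorphic connection `∇` that is
logarithmic with semi-simple residues in the points of `P` and has a singularity of Poincaré rank
one with diagonalizable polar part at infinity.  Here `D` is the covariant derivative of sections
over the complement of the poles in the direction of `∂ / ∂x`, i.e. `∇ s = D s dx`; its value
on sections that are not holomorphic has no meaning. -/
structure MeroConnection (r : ℕ) (P : Finset ℂ) where
  E : HolBundle.{u} r
  D : E.Sec P → E.Sec P
  D_local : ∀ (z : Punct P) (s t : E.Sec P), HolBundle.GermEq z.pt s t → D s z = D t z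
  D_hol : ∀ (z : Punct P) (s : E.Sec P), s ∈ E.holGerms P z.pt → D s ∈ E.holGerms P z.pt
  D_add : ∀ (z : Punct P) (s t : E.Sec P), s ∈ E.holGerms P z.pt → t ∈ E.holGerms P z.pt →
    D (s + t) z = D s z + D t z
  D_leibniz : ∀ (z : Punct P) (f : ℂ → ℂ) (s : E.Sec P), AnalyticAt ℂ f z →
    s ∈ E.holGerms P z.pt →
    D (HolBundle.mulSec f s) z = f z • D s z + deriv f z • s z
  /-- a frame near the point `p` of `P` in which the residue is diagonal -/
  frame : P → Fin r → ∀ y, E.Fib y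
  /-- the eigenvalues of the residue at the point `p` of `P` -/
  μ : P → Fin r → ℂ
  /-- near `p`, the connection is `d + diag(μ) dx / (x - p) + (holomorphic matrix) dx` -/
  log_form : ∀ p : P, ∃ U : Set CP1, ((p : ℂ) : CP1) ∈ U ∧ E.IsFrame U (frame p) ∧
    ∃ B : Fin r → Fin r → CP1 → ℂ, (∀ i j, HolAt (B i j) ((p : ℂ) : CP1)) ∧
      ∀ i, ∀ z : Punct P, z.pt ∈ U →
        D (fun w => frame p i w.pt) z =
          (μ p i / ((z : ℂ) - p)) • frame p i z.pt + ∑ j, B j i z.pt • frame p j z.pt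
  /-- the diagonal entries of the leading term at infinity -/
  α : Fin r → ℂ
  /-- the diagonal entries of the residue term at infinity -/
  μInf : Fin r → ℂ
  /-- near infinity, the connection is `d + (diag(α) + diag(μInf) / x + O(1 / x ^ 2)) dx` -/
  irr_form : ∃ U : Set CP1, OnePoint.infty ∈ U ∧ ∃ e : Fin r → ∀ y, E.Fib y, E.IsFrame U e ∧
    ∃ B : Fin r → Fin r → CP1 → ℂ, (∀ i j, HolAt (B i j) OnePoint.infty) ∧
      ∀ i, ∀ z : Punct P, z.pt ∈ U → (z : ℂ) ≠ 0 →
        D (fun w => e i w.pt) z =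
          (α i + μInf i / (z : ℂ)) • e i z.pt + ∑ j, (B j i z.pt / (z : ℂ) ^ 2) • e j z.pt

namespace MeroConnection

variable {r : ℕ} {P : Finset ℂ} (C : MeroConnection.{u} r P)

/-- The connection is resonance-free. -/
def ResonanceFree : Prop :=
  (∀ p i, C.μ p i ≠ 0 → ∀ n : ℤ, (C.μ p i).re ≠ n) ∧
  (∀ p i k, C.μ p i ≠ 0 → C.μ p k ≠ 0 → ∀ n : ℤ, C.μ p i - C.μ p k = n → n = 0) ∧
  (∀ i, ∀ n : ℤ, (C.μInf i).re ≠ n) ∧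
  (∀ i k, C.α i = C.α k → ∀ n : ℤ, C.μInf i - C.μInf k = n → n = 0)

/-- The set of the eigenvalues of the leading term at infinity. -/
def Phat : Finset ℂ := open Classical in Finset.univ.image C.α

/-- The image of the residue `diag(μ)` at the point `p` of `P`, in the fibre of `E`. -/
def imRes (p : P) : Submodule ℂ (C.E.Fib ((p : ℂ) : CP1)) :=
  Submodule.span ℂ (Set.range fun i => C.μ p i • C.frame p i ((p : ℂ) : CP1))

/-- Germs at `x` of sections of the sheaf `F` of `E`-valued one-forms with at most a double pole at
infinity, and at most a simple pole with residue in the image of the residue of `∇` at the points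
of `P`.  A one-form `s dx` is represented by `s`; as `dx` has a double pole at infinity,
the condition there is that `s` is a holomorphic section of `E`. -/
def formGerms (x : CP1) : Set (C.E.Sec P) :=
  {s | ((∀ p : P, x ≠ ((p : ℂ) : CP1)) → s ∈ C.E.holGerms P x) ∧
    ∀ p : P, x = ((p : ℂ) : CP1) → ∃ σ : ∀ y, C.E.Fib y, C.E.IsHol σ ((p : ℂ) : CP1) ∧
      HolBundle.GermEq x (HolBundle.mulSec (fun z => z - p) s) (fun z => σ z.pt) ∧
      σ ((p : ℂ) : CP1) ∈ C.imRes p}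

/-! ### Minimal extensions -/

/-- A `𝓓`-submodule of the meromorphic bundle `E(∗P ∪ {∞})` on the sphere: a subsheaf, given by its
germs (sections that restrict to the same germ are identified by `congr`, and a germ extends to a
neighbourhood by `spread`), stable under the holomorphic functions and under the derivation
`∂ / ∂x` at finite points, `x ^ 2 ∂ / ∂x = - ∂ / ∂(1 / x)` at infinity. -/
@[ext]
structure DSubmodule where
  stalk : CP1 → Submodule ℂ (C.E.Sec P)
  congr : ∀ x s t, s ∈ stalk x → HolBundle.GermEq x s t → t ∈ stalk x
  spread : ∀ x s, s ∈ stalk x → ∀ᶠ y in 𝓝 x, s ∈ stalk y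
  mem_mer : ∀ x s, s ∈ stalk x → s ∈ C.E.merGerms P x
  mul_mem : ∀ x s (f : CP1 → ℂ), HolAt f x → s ∈ stalk x →
    HolBundle.mulSec (fun z => f z) s ∈ stalk x
  der_mem : ∀ (x : ℂ) s, s ∈ stalk (x : CP1) → C.D s ∈ stalk (x : CP1)
  der_mem_infty : ∀ s, s ∈ stalk OnePoint.infty →
    HolBundle.mulSec (fun z => z ^ 2) (C.D s) ∈ stalk OnePoint.infty

namespace DSubmodule

variable {C} (N : C.DSubmodule)

/-- `N` is an extension of the meromorphic bundle: `N(∗P ∪ {∞}) = E(∗P ∪ {∞})`. -/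
def IsExtension : Prop :=
  ∀ x, ∀ s ∈ C.E.merGerms P x, (x ∉ poles P → s ∈ N.stalk x) ∧
    (x ∈ poles P → ∃ k : ℕ, HolBundle.mulSec (fun z => unif x z ^ k) s ∈ N.stalk x)

/-- `N` has no non-zero submodule supported in a point. -/
def NoPointSub : Prop :=
  ∀ N' : C.DSubmodule, (∀ x, N'.stalk x ≤ N.stalk x) → ∀ q : CP1,
    (∀ x, x ≠ q → ∀ s ∈ N'.stalk x, HolBundle.GermEq x s 0) →
    ∀ s ∈ N'.stalk q, HolBundle.GermEq q s 0

/-- `N` has no non-zero quotient `N / N'` supported in a point `q`, where the germs at `q` of a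
(coherent) `𝓓`-module supported in `q` are annihilated by powers of the local parameter. -/
def NoPointQuot : Prop :=
  ∀ N' : C.DSubmodule, (∀ x, N'.stalk x ≤ N.stalk x) → ∀ q : CP1,
    (∀ x, x ≠ q → N'.stalk x = N.stalk x) →
    (∀ s ∈ N.stalk q, ∃ k : ℕ, HolBundle.mulSec (fun z => unif q z ^ k) s ∈ N'.stalk q) →
    N'.stalk q = N.stalk q

/-- `N` is a minimal extension of the meromorphic bundle. -/
def IsMinimalExtension : Prop := N.IsExtension ∧ N.NoPointSub ∧ N.NoPointQuot

/-! Elementary facts needed for the constructions below. -/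

theorem notMem_poles (z : Punct P) : z.pt ∉ poles P := by
  rintro (h | ⟨w, hw, h⟩)
  · exact OnePoint.coe_ne_infty _ h
  · have : w = z := OnePoint.coe_injective h
    exact z.2 (this ▸ hw)

theorem hol_of_mem {z : Punct P} {s : C.E.Sec P} (h : s ∈ N.stalk z.pt) :
    s ∈ C.E.holGerms P z.pt := (N.mem_mer _ _ h).1 (notMem_poles z)

theorem D_add_of_mem {z : Punct P} {s t : C.E.Sec P} (hs : s ∈ N.stalk z.pt)
    (ht : t ∈ N.stalk z.pt) : C.D (s + t) z = C.D s z + C.D t z :=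
  C.D_add z s t (N.hol_of_mem hs) (N.hol_of_mem ht)

theorem D_smul_of_mem {z : Punct P} {s : C.E.Sec P} (c : ℂ) (hs : s ∈ N.stalk z.pt) :
    C.D (c • s) z = c • C.D s z := by
  have h := C.D_leibniz z (fun _ => c) s analyticAt_const (N.hol_of_mem hs)
  have e : HolBundle.mulSec (fun _ => c) s = c • s := rfl
  simpa [e] using h

theorem D_zero (N : C.DSubmodule) (z : Punct P) : C.D 0 z = 0 := by
  simpa using N.D_smul_of_mem (z := z) (s := 0) 0 (Submodule.zero_mem _)

theorem D_mem (x : CP1) (s : C.E.Sec P) (hs : s ∈ N.stalk x) : C.D s ∈ N.stalk x := by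
  induction x using OnePoint.rec with
  | coe x => exact N.der_mem x s hs
  | infty =>
    let f : CP1 → ℂ := fun y => unif OnePoint.infty (OnePoint.rec 0 id y) ^ 2
    have hf : HolAt f OnePoint.infty := by
      refine ⟨fun z hz => absurd hz (OnePoint.infty_ne_coe z), fun _ => ?_⟩
      have : (fun t : ℂ => f (invChart t)) = fun t => t ^ 2 := by
        funext t
        by_cases ht : t = 0
        · subst ht
          simp only [f, invChart, if_true]
          change ((0 : ℂ)⁻¹) ^ 2 = 0 ^ 2
          simp
        · simp only [f, invChart, if_neg ht]
          change ((t⁻¹)⁻¹) ^ 2 = t ^ 2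
          simp
      rw [this]
      exact analyticAt_id.pow 2
    refine N.congr _ _ _ (N.mul_mem _ _ f hf (N.der_mem_infty s hs)) ?_
    refine ⟨{((0 : ℂ) : CP1)}ᶜ, ?_, ?_⟩
    · exact isOpen_compl_singleton.mem_nhds (OnePoint.infty_ne_coe 0)
    · intro z hz
      have hz0 : (z : ℂ) ≠ 0 := by
        intro h
        apply hz
        simp [Punct.pt, h]
      change ((z : ℂ)⁻¹ ^ 2) • ((z : ℂ) ^ 2 • C.D s z) = C.D s z
      rw [smul_smul]
      have : ((z : ℂ)⁻¹ ^ 2) * (z : ℂ) ^ 2 = 1 := by field_simp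
      rw [this, one_smul]

/-! ### The Laplace transform -/

/-- The space of global sections of `N`. -/
def globalSections : Submodule ℂ (C.E.Sec P) := ⨅ x, N.stalk x

theorem mem_stalk_of_global (m : N.globalSections) (x : CP1) :
    (m : C.E.Sec P) ∈ N.stalk x := (Submodule.mem_iInf _).1 m.2 x

/-- The action of `∂ / ∂x` on the global sections. -/
def dx : N.globalSections →ₗ[ℂ] N.globalSections where
  toFun m := ⟨C.D m, (Submodule.mem_iInf _).2 fun x => N.D_mem x _ (N.mem_stalk_of_global m x)⟩
  map_add' m m' := Subtype.ext <| funext fun _ =>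
    N.D_add_of_mem (N.mem_stalk_of_global m _) (N.mem_stalk_of_global m' _)
  map_smul' c m := Subtype.ext <| funext fun _ =>
    N.D_smul_of_mem c (N.mem_stalk_of_global m _)

/-- The action of the dual variable `ξ` on the Laplace transform of the module of global sections:
the Laplace transform is the same space, on which `ξ` acts by `∂ / ∂x`. -/
def laplaceXi : N.globalSections →ₗ[ℂ] N.globalSections := N.dx

/-- The fibre at `ξ₀` of the Laplace transform: its quotient by `(ξ - ξ₀)` times itself. -/
abbrev LaplaceFiber (ξ₀ : ℂ) : Type u :=
  N.globalSections ⧸ LinearMap.range (N.laplaceXi - ξ₀ • LinearMap.id)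

/-- The value at `ξ₀` of the section of the Laplace transform given by `m`. -/
def laplaceClass (ξ₀ : ℂ) (m : N.globalSections) : N.LaplaceFiber ξ₀ :=
  Submodule.Quotient.mk m

/-- Near `x`, the section `s` is a combination, with holomorphic coefficients, of sections given by
elements of the Laplace transform. -/
def LaplaceLat (s : ∀ ξ : Punct C.Phat, N.LaplaceFiber ξ) (x : CP1) : Prop :=
  ∃ (n : ℕ) (m : Fin n → N.globalSections) (f : Fin n → CP1 → ℂ), (∀ i, HolAt (f i) x) ∧
    ∃ W ∈ 𝓝 x, ∀ ξ : Punct C.Phat, ξ.pt ∈ W → s ξ = ∑ i, f i ξ.pt • N.laplaceClass ξ (m i)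

/-- Germs of sections of the meromorphic bundle on the dual sphere, with poles along the set
`Phat ∪ {∞}`, of the Laplace transform; off the poles, these are the holomorphic sections. -/
def LaplaceMer (s : ∀ ξ : Punct C.Phat, N.LaplaceFiber ξ) (x : CP1) : Prop :=
  MerExt N.LaplaceLat s x

end DSubmodule

/-! ### Hypercohomology -/

/-- Čech cochains of degree one of a two-term complex, for covers of the sphere indexed by its
points: sections `a x` of the term of degree one and `b x y` of the term of degree zero. -/
abbrev Cochain : Type u := (CP1 → C.E.Sec P) × (CP1 → CP1 → C.E.Sec P)

/-- `c = (a, b)` is a Čech one-cocycle, relative to the open cover `U` (with `x ∈ U x`), of the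
complex of sheaves `K⁰ → K¹` with the differential `d`; the sheaves are given by their germs. -/
def IsCocycle (K₀ K₁ : CP1 → Set (C.E.Sec P)) (d : C.E.Sec P → C.E.Sec P) (U : CP1 → Set CP1)
    (c : C.Cochain) : Prop :=
  (∀ x, IsOpen (U x) ∧ x ∈ U x) ∧
  (∀ x, ∀ q ∈ U x, c.1 x ∈ K₁ q) ∧
  (∀ x y, ∀ q ∈ U x ∩ U y, c.2 x y ∈ K₀ q) ∧
  (∀ x y w, ∀ z : Punct P, z.pt ∈ U x ∩ U y ∩ U w → c.2 x y z + c.2 y w z = c.2 x w z) ∧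
  (∀ x y, ∀ z : Punct P, z.pt ∈ U x ∩ U y → d (c.2 x y) z = c.1 y z - c.1 x z)

/-- `c = (a, b)` is, relative to the cover `U`, the coboundary of a family of sections `g x`. -/
def IsCoboundary (K₀ : CP1 → Set (C.E.Sec P)) (d : C.E.Sec P → C.E.Sec P) (U : CP1 → Set CP1)
    (c : C.Cochain) : Prop :=
  (∀ x, IsOpen (U x) ∧ x ∈ U x) ∧ ∃ g : CP1 → C.E.Sec P,
    (∀ x, ∀ q ∈ U x, g x ∈ K₀ q) ∧
    (∀ x, ∀ z : Punct P, z.pt ∈ U x → c.1 x z = d (g x) z) ∧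
    (∀ x y, ∀ z : Punct P, z.pt ∈ U x ∩ U y → c.2 x y z = g y z - g x z)

/-- The twisted operator `∂ / ∂x - ξ`. -/
def twist (ξ : ℂ) (s : C.E.Sec P) : C.E.Sec P := C.D s - ξ • s

/-- The operator `ζ ∂ / ∂x - 1`, which is `ζ` times the twisted operator for `ξ = 1 / ζ`, and is
still defined for `ζ = 0`. -/
def twistInf (ζ : ℂ) (s : C.E.Sec P) : C.E.Sec P := ζ • C.D s - s

/-- The family `σ` of sections, depending on the parameter `η`, is near `(x, η₀)` a section of the
pullback to (sphere) × (complex line) of the sheaf with the germs `K`: a combination of germs in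
`K`, with coefficients holomorphic in both variables. -/
def HolFamily (K : CP1 → Set (C.E.Sec P)) (σ : ℂ → C.E.Sec P) (x : CP1) (η₀ : ℂ) : Prop :=
  ∃ (n : ℕ) (m : Fin n → C.E.Sec P) (f : Fin n → CP1 → ℂ → ℂ),
    (∀ i, m i ∈ K x) ∧ (∀ i, HolAt₂ (f i) x η₀) ∧
    ∃ W ∈ 𝓝 x, ∃ V ∈ 𝓝 η₀, ∀ z : Punct P, z.pt ∈ W → ∀ η ∈ V,
      σ η z = ∑ i, f i z.pt η • m i z

/-- `c` is a family of one-cocycles of the complexes `K⁰ → K¹` with differentials `d η`, relative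
to the cover `U`, which depends holomorphically on the parameter `η ∈ V`. -/
def IsCocycleFamily (K₀ K₁ : CP1 → Set (C.E.Sec P)) (d : ℂ → C.E.Sec P → C.E.Sec P)
    (U : CP1 → Set CP1) (V : Set ℂ) (c : ℂ → C.Cochain) : Prop :=
  (∀ η ∈ V, C.IsCocycle K₀ K₁ (d η) U (c η)) ∧
  (∀ x, ∀ q ∈ U x, ∀ η ∈ V, C.HolFamily K₁ (fun η => (c η).1 x) q η) ∧
  (∀ x y, ∀ q ∈ U x ∩ U y, ∀ η ∈ V, C.HolFamily K₀ (fun η => (c η).2 x y) q η)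

namespace DSubmodule

variable {C} (N : C.DSubmodule)

/-- The sheaf `N`, through its germs. -/
def germs (x : CP1) : Set (C.E.Sec P) := N.stalk x

theorem twist_add_of_mem {ξ : ℂ} {z : Punct P} {s t : C.E.Sec P} (hs : s ∈ N.stalk z.pt)
    (ht : t ∈ N.stalk z.pt) : C.twist ξ (s + t) z = C.twist ξ s z + C.twist ξ t z := by
  simp only [twist, Pi.sub_apply, Pi.smul_apply, Pi.add_apply, N.D_add_of_mem hs ht, smul_add]
  abel

theorem twist_smul_of_mem {ξ : ℂ} {z : Punct P} {s : C.E.Sec P} (c : ℂ)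
    (hs : s ∈ N.stalk z.pt) : C.twist ξ (c • s) z = c • C.twist ξ s z := by
  simp only [twist, Pi.sub_apply, Pi.smul_apply, N.D_smul_of_mem c hs, smul_sub, smul_comm ξ c]

theorem twist_zero (N : C.DSubmodule) (ξ : ℂ) (z : Punct P) : C.twist ξ 0 z = 0 := by
  simp [twist, N.D_zero z]

/-- The Čech one-cocycles of the twisted de Rham complex of `N`, over all covers. -/
def cocycles (ξ : ℂ) : Submodule ℂ C.Cochain where
  carrier := {c | ∃ U, C.IsCocycle N.germs N.germs (C.twist ξ) U c}
  zero_mem' := ⟨fun _ => Set.univ, fun _ => ⟨isOpen_univ, trivial⟩,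
    fun _ q _ => (N.stalk q).zero_mem, fun _ _ q _ => (N.stalk q).zero_mem,
    fun _ _ _ _ _ => by simp, fun _ _ z _ => by simpa using N.twist_zero ξ z⟩
  add_mem' := by
    rintro c c' ⟨U, h1, h2, h3, h4, h5⟩ ⟨U', h1', h2', h3', h4', h5'⟩
    refine ⟨fun x => U x ∩ U' x, fun x => ⟨(h1 x).1.inter (h1' x).1, (h1 x).2, (h1' x).2⟩,
      fun x q hq => (N.stalk q).add_mem (h2 x q hq.1) (h2' x q hq.2),
      fun x y q hq => (N.stalk q).add_mem (h3 x y q ⟨hq.1.1, hq.2.1⟩) (h3' x y q ⟨hq.1.2, hq.2.2⟩),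
      fun x y w z hz => ?_, fun x y z hz => ?_⟩
    · have e := h4 x y w z ⟨⟨hz.1.1.1, hz.1.2.1⟩, hz.2.1⟩
      have e' := h4' x y w z ⟨⟨hz.1.1.2, hz.1.2.2⟩, hz.2.2⟩
      simp only [Prod.snd_add, Pi.add_apply, ← e, ← e']
      abel
    · have hz1 : z.pt ∈ U x ∩ U y := ⟨hz.1.1, hz.2.1⟩
      have hz2 : z.pt ∈ U' x ∩ U' y := ⟨hz.1.2, hz.2.2⟩
      have e := h5 x y z hz1
      have e' := h5' x y z hz2
      have := N.twist_add_of_mem (ξ := ξ) (h3 x y _ hz1) (h3' x y _ hz2)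
      simp only [Prod.snd_add, Prod.fst_add, Pi.add_apply, this, e, e']
      abel
  smul_mem' := by
    rintro a c ⟨U, h1, h2, h3, h4, h5⟩
    refine ⟨U, h1, fun x q hq => (N.stalk q).smul_mem a (h2 x q hq),
      fun x y q hq => (N.stalk q).smul_mem a (h3 x y q hq), fun x y w z hz => ?_,
      fun x y z hz => ?_⟩
    · simp only [Prod.smul_snd, Pi.smul_apply, ← h4 x y w z hz, smul_add]
    · have := N.twist_smul_of_mem (ξ := ξ) a (h3 x y _ hz)
      simp only [Prod.smul_snd, Prod.smul_fst, Pi.smul_apply, this, h5 x y z hz, smul_sub]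

/-- The Čech one-coboundaries of the twisted de Rham complex of `N`, over all covers. -/
def coboundaries (ξ : ℂ) : Submodule ℂ C.Cochain where
  carrier := {c | ∃ U, C.IsCoboundary N.germs (C.twist ξ) U c}
  zero_mem' := ⟨fun _ => Set.univ, fun _ => ⟨isOpen_univ, trivial⟩, 0,
    fun _ q _ => (N.stalk q).zero_mem, fun _ z _ => (N.twist_zero ξ z).symm,
    fun _ _ _ _ => by simp⟩
  add_mem' := by
    rintro c c' ⟨U, h1, g, h2, h3, h4⟩ ⟨U', h1', g', h2', h3', h4'⟩
    refine ⟨fun x => U x ∩ U' x, fun x => ⟨(h1 x).1.inter (h1' x).1, (h1 x).2, (h1' x).2⟩, g + g',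
      fun x q hq => (N.stalk q).add_mem (h2 x q hq.1) (h2' x q hq.2),
      fun x z hz => ?_, fun x y z hz => ?_⟩
    · have := N.twist_add_of_mem (ξ := ξ) (h2 x _ hz.1) (h2' x _ hz.2)
      simp only [Prod.fst_add, Pi.add_apply, this, h3 x z hz.1, h3' x z hz.2]
    · simp only [Prod.snd_add, Pi.add_apply, h4 x y z ⟨hz.1.1, hz.2.1⟩,
        h4' x y z ⟨hz.1.2, hz.2.2⟩]
      abel
  smul_mem' := by
    rintro a c ⟨U, h1, g, h2, h3, h4⟩
    refine ⟨U, h1, a • g, fun x q hq => (N.stalk q).smul_mem a (h2 x q hq),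
      fun x z hz => ?_, fun x y z hz => ?_⟩
    · have := N.twist_smul_of_mem (ξ := ξ) a (h2 x _ hz)
      simp only [Prod.smul_fst, Pi.smul_apply, this, h3 x z hz]
    · simp only [Prod.smul_snd, Pi.smul_apply, h4 x y z hz, smul_sub]

/-- The first hypercohomology of the twisted de Rham complex `∂ / ∂x - ξ : N → N` on the sphere,
as Čech hypercohomology in the limit over all open covers: cocycles and coboundaries are
taken over arbitrary covers, and passing to a finer cover does not change the class. -/
abbrev H1 (ξ : ℂ) : Type u :=
  N.cocycles ξ ⧸ (N.coboundaries ξ).submoduleOf (N.cocycles ξ)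

/-- `v` is the class of the cocycle `c`. -/
def HasClass (ξ : ℂ) (v : N.H1 ξ) (c : C.Cochain) : Prop :=
  ∃ h : c ∈ N.cocycles ξ, v = Submodule.Quotient.mk ⟨c, h⟩

/-- The class in the first hypercohomology of a global section of the term of degree one. -/
def globalClass (ξ : ℂ) (m : N.globalSections) : N.H1 ξ :=
  Submodule.Quotient.mk ⟨(fun _ => m, 0), fun _ => Set.univ, fun _ => ⟨isOpen_univ, trivial⟩,
    fun _ q _ => N.mem_stalk_of_global m q, fun _ _ q _ => (N.stalk q).zero_mem,
    fun _ _ _ _ _ => by simp, fun _ _ z _ => by simpa using N.twist_zero ξ z⟩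

/-- Holomorphy at `ξ₀` of a section of the bundle of first hypercohomologies, off `Phat`: locally
it is given by cocycles of the twisted de Rham complex that depend holomorphically on `ξ`. -/
def HyperHol (s : ∀ ξ : Punct C.Phat, N.H1 ξ) (ξ₀ : ℂ) : Prop :=
  ∃ V ∈ 𝓝 ξ₀, ∃ U c, C.IsCocycleFamily N.germs N.germs C.twist U V c ∧
    ∀ ξ : Punct C.Phat, (ξ : ℂ) ∈ V → N.HasClass ξ (s ξ) (c ξ)

/-- The extension of the bundle of first hypercohomologies to the point `ξ₀` of `Phat`: sections
given by cocycles of the complexes `∇ - ξ dx : E → F`, holomorphic in `ξ` near `ξ₀`. -/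
def HyperLatAt (s : ∀ ξ : Punct C.Phat, N.H1 ξ) (ξ₀ : ℂ) : Prop :=
  ∃ V ∈ 𝓝 ξ₀, ∃ U c, C.IsCocycleFamily (C.E.holGerms P) C.formGerms C.twist U V c ∧
    ∀ ξ : Punct C.Phat, (ξ : ℂ) ∈ V → N.HasClass ξ (s ξ) (c ξ)

/-- The extension of the bundle of first hypercohomologies to infinity: sections given by cocycles
of the complexes `ζ ∇ - dx : E → F`, holomorphic in `ζ` near `0`.  For `ζ = 1 / ξ`,
such a cocycle `(a, b)` gives the cocycle `(ξ a, b)` for `∇ - ξ dx`. -/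
def HyperLatInf (s : ∀ ξ : Punct C.Phat, N.H1 ξ) : Prop :=
  ∃ V ∈ 𝓝 (0 : ℂ), ∃ U c, C.IsCocycleFamily (C.E.holGerms P) C.formGerms C.twistInf U V c ∧
    ∀ ξ : Punct C.Phat, (ξ : ℂ) ≠ 0 → (ξ : ℂ)⁻¹ ∈ V →
      N.HasClass ξ (s ξ) ((ξ : ℂ) • (c (ξ : ℂ)⁻¹).1, (c (ξ : ℂ)⁻¹).2)

/-- Germs of sections of the bundle of first hypercohomologies, extended to the dual sphere. -/
def HyperLat (s : ∀ ξ : Punct C.Phat, N.H1 ξ) (x : CP1) : Prop :=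
  (∀ ξ₀ : ℂ, x = (ξ₀ : CP1) → ξ₀ ∉ C.Phat → N.HyperHol s ξ₀) ∧
  (∀ ξ₀ : ℂ, x = (ξ₀ : CP1) → ξ₀ ∈ C.Phat → N.HyperLatAt s ξ₀) ∧
  (x = OnePoint.infty → N.HyperLatInf s)

/-- Germs of sections of the meromorphic extension of the bundle of first hypercohomologies, with
poles along `Phat ∪ {∞}`; off the poles, these are the holomorphic sections. -/
def HyperMer (s : ∀ ξ : Punct C.Phat, N.H1 ξ) (x : CP1) : Prop :=
  MerExt N.HyperLat s x

end DSubmodule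

end MeroConnection

end MinLaplace

end

open scoped Topology

noncomputable section

namespace MinLaplace

open MeasureTheory Complex Filter Set

/-! ### The Cauchy–Riemann operator -/

/-! The isomorphism comes from splitting cocycles. Let `N` be the minimal extension. A hypercocycle
`(a, b)` of `∂/∂x - ξ` on `N` is cohomologous to a global section as soon as `b x y = g y - g x`
with `g x` in `N`, for then the sections `a x - (∂/∂x - ξ) g x` glue. The `g x` are found in a frame
of `E` over the affine line that is meromorphic at infinity (`exists_global_frame`): the coordinates
of `b` form a cocycle of holomorphic functions, which is split smoothly by a partition of unity and
corrected by a Cauchy transform (`Cover`). Every pole lies in one set of the cover only, so nothing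
has to be split there; `g x` is holomorphic on the affine line and meromorphic at infinity, hence in
`N`. So global sections surject onto the hypercohomology, and the kernel is the image of `∂/∂x - ξ`
(`ker_globalLin`). In a holomorphic family of cocycles the resulting global sections have poles of
bounded order, so they stay in a finite-dimensional space, where they depend holomorphically on the
parameter (`exists_split`).

The frame needs no finiteness theorem of cohomology. `Patch.exists_sections` solves the
Cauchy–Riemann equations for `r` sections by a fixed point: weights `q ^ n` turn the integral
operator into a contraction for large `n`, at the price of polynomial factors. These sections
generate up to a common denominator, and freeness of submodules over the principal ideal domain
`ℂ[X]` turns them into a frame.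

Resonance-freeness pins down `N`. The derivation multiplies the leading term of `(x - p) ^ (K + 1) •
e i` by `μ i + K + 1`, which is not zero, and there is a similar formula at infinity. Hence a
submodule that contains the sections of `E` up to powers of the local parameters contains them
outright, and contains every meromorphic germ at infinity (`hol_le_of_pow`, `mer_le_of_pow`). So
there is a smallest such submodule, generated by `E` over the affine line (`minExt_le`), and each
minimal extension equals it (`stalk_eq_of_isMinimal`). Moreover `F` is contained in `N`
(`IsFull.form`).

On the Laplace side, `∏ (∂/∂x - α i)` kills the leading coefficients at infinity. Up to powers of
this operator, all global sections therefore come from a finite-dimensional space of them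
(`exists_ladder`), and since `∂/∂x - ξ` is always injective, they become free of finite rank over
`ℂ[X]` localized off `Phat` (`exists_free_generators`). This gives a frame of the meromorphic
bundle.

It remains to compare the extensions at `Phat` and at infinity. As `E → F` is a subcomplex of `N →
N`, its cocycles are split as before. Conversely, a global section that is holomorphic on the affine
line becomes, after multiplication by a power of `∏ (α l * u - v)`, a cocycle of `E → F` for the
operator `u ∂/∂x - v` (`representable_of_hol`); for the remaining sections one uses that `u ∂/∂x m`
and `v m` are cohomologous (`exists_representable`). The bundle structure is then carried over from
the Laplace side to the hypercohomology. -/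

/-- The Cauchy–Riemann operator `∂/∂x + i ∂/∂y`. -/
def dbar (f : ℂ → ℂ) (z : ℂ) : ℂ := fderiv ℝ f z 1 + I * fderiv ℝ f z I

theorem dbar_congr {f g : ℂ → ℂ} {z : ℂ} (h : f =ᶠ[𝓝 z] g) : dbar f z = dbar g z := by
  simp only [dbar, h.fderiv_eq]

theorem dbar_sub {f g : ℂ → ℂ} {z : ℂ} (hf : DifferentiableAt ℝ f z)
    (hg : DifferentiableAt ℝ g z) : dbar (fun w => f w - g w) z = dbar f z - dbar g z := by
  simp only [dbar, fderiv_fun_sub hf hg, _root_.sub_apply]; ring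

theorem dbar_mul {f g : ℂ → ℂ} {z : ℂ} (hf : DifferentiableAt ℝ f z)
    (hg : DifferentiableAt ℝ g z) :
    dbar (fun w => f w * g w) z = dbar f z * g z + f z * dbar g z := by
  simp only [dbar, fderiv_fun_mul hf hg, _root_.add_apply,
    _root_.smul_apply, smul_eq_mul]
  ring

theorem dbar_sum {ι : Type*} {s : Finset ι} {f : ι → ℂ → ℂ} {z : ℂ}
    (hf : ∀ i ∈ s, DifferentiableAt ℝ (f i) z) :
    dbar (fun w => ∑ i ∈ s, f i w) z = ∑ i ∈ s, dbar (f i) z := by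
  simp only [dbar, fderiv_fun_sum hf, _root_.sum_apply, Finset.sum_add_distrib,
    Finset.mul_sum]

theorem dbar_eq_zero {f : ℂ → ℂ} {z : ℂ} (hf : DifferentiableAt ℂ f z) : dbar f z = 0 := by
  have h := (differentiableAt_complex_iff_differentiableAt_real.1 hf).2
  simp only [dbar, h, smul_eq_mul, ← mul_assoc, I_mul_I]
  ring

theorem differentiableAt_of_dbar_eq_zero {f : ℂ → ℂ} {z : ℂ} (hf : DifferentiableAt ℝ f z)
    (h : dbar f z = 0) : DifferentiableAt ℂ f z := by
  refine differentiableAt_complex_iff_differentiableAt_real.2 ⟨hf, ?_⟩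
  have h' : I * (fderiv ℝ f z 1 + I * fderiv ℝ f z I) = 0 := by
    rw [show fderiv ℝ f z 1 + I * fderiv ℝ f z I = 0 from h, mul_zero]
  rw [mul_add, ← mul_assoc, I_mul_I] at h'
  rw [smul_eq_mul]
  linear_combination -h'

theorem analyticAt_of_dbar_eq_zero {f : ℂ → ℂ} {z : ℂ}
    (hf : ∀ᶠ w in 𝓝 z, DifferentiableAt ℝ f w ∧ dbar f w = 0) : AnalyticAt ℂ f z :=
  analyticAt_iff_eventually_differentiableAt.2 <| hf.mono fun _ h =>
    differentiableAt_of_dbar_eq_zero h.1 h.2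

theorem continuous_dbar {f : ℂ → ℂ} (hf : ContDiff ℝ 1 f) : Continuous (dbar f) := by
  have h := hf.continuous_fderiv one_ne_zero
  unfold dbar
  fun_prop

/-! ### The Cauchy transform -/

/-- The Cauchy transform, a right inverse of the Cauchy–Riemann operator. -/
def cauchyTr (φ : ℂ → ℂ) (z : ℂ) : ℂ := ∫ w : ℂ, (2 * Real.pi * w)⁻¹ * φ (z - w)

theorem cauchyTr_eq (φ : ℂ → ℂ) (z : ℂ) :
    cauchyTr φ z = ∫ w : ℂ, φ w * (2 * Real.pi * (z - w))⁻¹ := by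
  rw [cauchyTr, ← integral_sub_left_eq_self _ volume z]
  simp only [sub_sub_cancel, mul_comm]

/-- The Jacobian `r` of polar coordinates cancels the simple pole, so on a ball the integrand is at
most one. -/
theorem locallyIntegrable_inv : LocallyIntegrable (fun w : ℂ => (2 * Real.pi * w)⁻¹) := by
  refine locallyIntegrable_iff.2 fun K hK => ?_
  obtain ⟨R, hR⟩ := hK.isBounded.subset_closedBall (0 : ℂ)
  refine IntegrableOn.mono_set ?_ hR
  refine ⟨(by fun_prop : Measurable fun w : ℂ => (2 * Real.pi * w)⁻¹).aestronglyMeasurable, ?_⟩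
  rw [HasFiniteIntegral, ← lintegral_indicator Metric.isClosed_closedBall.measurableSet,
    ← Complex.lintegral_comp_polarCoord_symm]
  refine lt_of_le_of_lt (b := ∫⁻ _ in Set.Ioc 0 R ×ˢ Set.Ioo (-Real.pi) Real.pi, (1 : ENNReal)) ?_ ?_
  · rw [← lintegral_indicator (by measurability), ← lintegral_indicator (by measurability)]
    refine lintegral_mono fun p => ?_
    by_cases hp : p ∈ polarCoord.target
    · rw [Set.indicator_of_mem hp]
      rw [polarCoord_target] at hp
      have hp1 : 0 < p.1 := hp.1
      by_cases h : Complex.polarCoord.symm p ∈ Metric.closedBall (0 : ℂ) R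
      · have hpR : p.1 ≤ R := by
          rw [mem_closedBall_zero_iff, Complex.norm_polarCoord_symm, abs_of_pos hp1] at h
          exact h
        have hmem : p ∈ Set.Ioc 0 R ×ˢ Set.Ioo (-Real.pi) Real.pi := ⟨⟨hp1, hpR⟩, hp.2⟩
        rw [Set.indicator_of_mem h, Set.indicator_of_mem hmem, smul_eq_mul, ← ofReal_norm,
          ← ENNReal.ofReal_mul hp1.le, ← ENNReal.ofReal_one]
        refine ENNReal.ofReal_le_ofReal ?_
        rw [norm_inv, norm_mul, Complex.norm_polarCoord_symm, abs_of_pos hp1]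
        have hpi := Real.pi_gt_three
        simp only [norm_mul, Complex.norm_ofNat, Complex.norm_real, Real.norm_eq_abs,
          abs_of_pos Real.pi_pos]
        rw [mul_inv, mul_comm, mul_assoc, inv_mul_cancel₀ hp1.ne', mul_one]
        exact inv_le_one_of_one_le₀ (by linarith)
      · rw [Set.indicator_of_notMem h]; simp
    · rw [Set.indicator_of_notMem hp]; exact zero_le
  · rw [setLIntegral_one, Measure.volume_eq_prod, Measure.prod_prod, Real.volume_Ioc,
      Real.volume_Ioo]
    exact ENNReal.mul_lt_top ENNReal.ofReal_lt_top ENNReal.ofReal_lt_top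

/-- In polar coordinates around `z` the kernel times the Jacobian turns `dbar φ` into a radial
derivative plus `I` times an angular one. The first integrates along each ray to `φ z`, the second
vanishes over a full circle. The constant is `2π` and not `π` because `dbar` is twice the usual
`∂/∂z̄`. -/
theorem integral_dbar_polar {φ : ℂ → ℂ} (hφ : ContDiff ℝ 1 φ) (hc : HasCompactSupport φ) (z : ℂ) :
    ∫ w : ℂ, (2 * Real.pi * w)⁻¹ * dbar φ (z - w) = φ z := by
  obtain ⟨R, hR⟩ := hc.isCompact.isBounded.subset_closedBall z
  have hR0 : ∀ w : ℂ, R < ‖w‖ → φ (z - w) = 0 ∧ fderiv ℝ φ (z - w) = 0 := by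
    intro w hw
    have : z - w ∉ tsupport φ := fun h => by
      have := hR h
      rw [mem_closedBall_iff_norm, sub_sub_cancel_left, norm_neg] at this
      linarith
    exact ⟨image_eq_zero_of_notMem_tsupport this,
      image_eq_zero_of_notMem_tsupport fun h => this (tsupport_fderiv_subset ℝ h)⟩
  have hφ' := hφ.continuous_fderiv one_ne_zero
  have hdiff : Differentiable ℝ φ := hφ.differentiable one_ne_zero
  set e : ℝ → ℂ := fun θ => Real.cos θ + Real.sin θ * I with he
  have hec : Continuous e := by fun_prop
  have hen : ∀ θ, ‖e θ‖ = 1 := fun θ => by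
    simp [he]
  -- `F` is the derivative of `-φ (z - r * e θ)` in `r`, and `G` is its derivative in `θ` divided by
  -- `r`.
  set F : ℝ × ℝ → ℂ := fun p => fderiv ℝ φ (z - p.1 * e p.2) (e p.2) with hF
  set G : ℝ × ℝ → ℂ := fun p => fderiv ℝ φ (z - p.1 * e p.2) (I * e p.2) with hG
  have hFc : Continuous F := by rw [hF]; fun_prop
  have hGc : Continuous G := by rw [hG]; fun_prop
  have hInt : ∀ H : ℝ × ℝ → ℂ, Continuous H → (∀ p, R < |p.1| → H p = 0) →
      IntegrableOn H (Ioi 0 ×ˢ Ioo (-Real.pi) Real.pi) := by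
    intro H hH h0
    have h1 : IntegrableOn H (Icc 0 R ×ˢ Icc (-Real.pi) Real.pi) :=
      hH.continuousOn.integrableOn_compact (isCompact_Icc.prod isCompact_Icc)
    refine (h1.of_forall_sdiff_eq_zero (by measurability : MeasurableSet
      (Ioi (0:ℝ) ×ˢ Icc (-Real.pi) Real.pi)) ?_).mono_set
        (prod_mono_right Ioo_subset_Icc_self)
    rintro ⟨a, b⟩ ⟨⟨ha, hb⟩, hn⟩
    refine h0 _ ?_
    by_contra hle
    push Not at hle
    exact hn ⟨⟨ha.le, (le_abs_self _).trans hle⟩, hb⟩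
  have hF0 : ∀ p, R < |p.1| → F p = 0 := fun p hp => by
    simp [hF, (hR0 (p.1 * e p.2) (by simpa [hen] using hp)).2]
  have hG0 : ∀ p, R < |p.1| → G p = 0 := fun p hp => by
    simp [hG, (hR0 (p.1 * e p.2) (by simpa [hen] using hp)).2]
  have hFi := hInt F hFc hF0
  have hGi := hInt G hGc hG0
  have hFint : ∫ p in Ioi 0 ×ˢ Ioo (-Real.pi) Real.pi, F p = 2 * Real.pi * φ z := by
    have hFi' : IntegrableOn F (Ioi 0 ×ˢ Ioo (-Real.pi) Real.pi) (volume.prod volume) := hFi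
    have hswap := setIntegral_prod (F ∘ Prod.swap) hFi'.swap
    simp only [Function.comp_apply] at hswap
    rw [Measure.volume_eq_prod, ← setIntegral_prod_swap, hswap]
    have h1 : ∀ θ : ℝ, ∫ r in Ioi (0:ℝ), F (r, θ) = φ z := by
      intro θ
      have hd : ∀ r ∈ Ici (0:ℝ), HasDerivAt (fun r : ℝ => - φ (z - r * e θ)) (F (r, θ)) r := by
        intro r _
        have h2 : HasDerivAt (fun r : ℝ => z - r * e θ) (-(e θ)) r := by
          simpa using (((hasDerivAt_id r).ofReal_comp).mul_const (e θ)).const_sub z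
        have h3 := ((hdiff (z - r * e θ)).hasFDerivAt.comp_hasDerivAt r h2).neg
        refine HasDerivAt.congr_deriv (f := fun r : ℝ => - φ (z - r * e θ)) h3 ?_
        simp [hF]
      have hcs : ∀ᶠ r : ℝ in atTop, R < |r| :=
        (eventually_gt_atTop R).mono fun r hr => hr.trans_le (le_abs_self r)
      have ht : Tendsto (fun r : ℝ => - φ (z - r * e θ)) atTop (𝓝 0) := by
        refine tendsto_const_nhds.congr' (hcs.mono fun r hr => ?_)
        simp only
        rw [(hR0 (r * e θ) (by simpa [hen] using hr)).1, neg_zero]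
      have hi : IntegrableOn (fun r => F (r, θ)) (Ioi 0) := by
        have h1 : IntegrableOn (fun r => F (r, θ)) (Icc 0 R) :=
          Continuous.integrableOn_Icc (by fun_prop)
        refine h1.of_forall_sdiff_eq_zero measurableSet_Ioi ?_
        rintro a ⟨ha, hn⟩
        refine hF0 _ ?_
        by_contra hle
        push Not at hle
        exact hn ⟨ha.le, (le_abs_self _).trans hle⟩
      rw [integral_Ioi_of_hasDerivAt_of_tendsto' hd hi ht]
      simp
    simp only [Prod.swap_prod_mk, h1, setIntegral_const]
    rw [Measure.real, Real.volume_Ioo, ENNReal.toReal_ofReal (by linarith [Real.pi_pos])]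
    simp only [real_smul]; push_cast; ring
  have hGint : ∫ p in Ioi 0 ×ˢ Ioo (-Real.pi) Real.pi, G p = 0 := by
    have hGi' : IntegrableOn G (Ioi 0 ×ˢ Ioo (-Real.pi) Real.pi) (volume.prod volume) := hGi
    rw [Measure.volume_eq_prod, setIntegral_prod _ hGi']
    refine setIntegral_eq_zero_of_forall_eq_zero fun r hr => ?_
    have hr0 : (r : ℂ) ≠ 0 := by exact_mod_cast (ne_of_gt hr)
    have hd : ∀ θ : ℝ, HasDerivAt (fun θ : ℝ => - (r : ℂ)⁻¹ * φ (z - r * e θ)) (G (r, θ)) θ := by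
      intro θ
      have h1 : HasDerivAt e (I * e θ) θ := by
        have := (((Complex.hasDerivAt_cos θ).comp_ofReal).add
          (((Complex.hasDerivAt_sin θ).comp_ofReal).mul_const I))
        refine (this.congr_deriv ?_).congr_of_eventuallyEq (Eventually.of_forall fun t => ?_)
        · simp only [he, ofReal_cos, ofReal_sin, mul_add]
          linear_combination (-Complex.sin θ) * I_mul_I
        · simp [he]
      have h2 : HasDerivAt (fun θ : ℝ => z - r * e θ) (-(r * (I * e θ))) θ :=
        (h1.const_mul (r : ℂ)).const_sub z
      have h3 := ((hdiff (z - r * e θ)).hasFDerivAt.comp_hasDerivAt θ h2).const_mul (-(r : ℂ)⁻¹)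
      refine h3.congr_deriv ?_
      have : (-(r * (I * e θ)) : ℂ) = (-r : ℝ) • (I * e θ) := by simp
      rw [this, map_smul]
      simp only [hG, real_smul]
      push_cast
      field_simp
    rw [← integral_Ioc_eq_integral_Ioo, ← intervalIntegral.integral_of_le (by linarith [Real.pi_pos]),
      intervalIntegral.integral_eq_sub_of_hasDerivAt (fun θ _ => hd θ)
        (Continuous.intervalIntegrable (by fun_prop) _ _)]
    simp [he]
  rw [← Complex.integral_comp_polarCoord_symm, polarCoord_target]
  have key : ∀ p ∈ Ioi (0:ℝ) ×ˢ Ioo (-Real.pi) Real.pi,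
      p.1 • ((2 * Real.pi * Complex.polarCoord.symm p)⁻¹ *
        dbar φ (z - Complex.polarCoord.symm p)) = (2 * Real.pi : ℂ)⁻¹ * (F p + I * G p) := by
    rintro ⟨a, θ⟩ ⟨ha, -⟩
    have ha0 : (a : ℂ) ≠ 0 := by exact_mod_cast (ne_of_gt ha)
    have hp : Complex.polarCoord.symm (a, θ) = a * e θ := by simp [he]
    have he0 : e θ ≠ 0 := fun h => by simpa [h] using hen θ
    rw [hp]
    simp only [hF, hG]
    set L := fderiv ℝ φ (z - a * e θ) with hL
    have h1 : L (e θ) = Real.cos θ * L 1 + Real.sin θ * L I := by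
      have : e θ = Real.cos θ • (1 : ℂ) + Real.sin θ • I := by simp [he]
      rw [this, map_add, map_smul, map_smul, real_smul, real_smul]
    have h2 : L (I * e θ) = Real.cos θ * L I - Real.sin θ * L 1 := by
      have : I * e θ = Real.cos θ • I - Real.sin θ • (1 : ℂ) := by
        simp only [he, real_smul, mul_add]; linear_combination (Real.sin θ : ℂ) * I_mul_I
      rw [this, map_sub, map_smul, map_smul, real_smul, real_smul]
    have h3 : e θ * (Real.cos θ - Real.sin θ * I) = 1 := by
      have := Complex.cos_sq_add_sin_sq (θ : ℂ)
      simp only [he, ofReal_cos, ofReal_sin]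
      linear_combination this - (Complex.sin θ) ^ 2 * I_mul_I
    have hpi : (Real.pi : ℂ) ≠ 0 := by exact_mod_cast Real.pi_ne_zero
    rw [h1, h2, dbar, ← hL, real_smul]
    have h4 : (2 * Real.pi * (a * e θ) : ℂ)⁻¹ = (2 * Real.pi : ℂ)⁻¹ * (a : ℂ)⁻¹ *
        (Real.cos θ - Real.sin θ * I) := by
      rw [mul_inv, mul_inv (a : ℂ), ← eq_inv_of_mul_eq_one_right h3]; ring
    rw [h4]
    have h5 : (a : ℂ) * (a : ℂ)⁻¹ = 1 := mul_inv_cancel₀ ha0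
    linear_combination ((2 * Real.pi : ℂ)⁻¹ * (Real.cos θ - Real.sin θ * I) * (L 1 + I * L I)) * h5
      - (2 * Real.pi : ℂ)⁻¹ * Real.sin θ * L I * I_mul_I
  rw [setIntegral_congr_fun (by measurability) key, integral_const_mul,
    integral_add hFi (hGi.const_mul I), integral_const_mul, hFint, hGint]
  have hpi : (Real.pi : ℂ) ≠ 0 := by exact_mod_cast Real.pi_ne_zero
  field_simp
  ring

/-- The transform is a convolution with a locally integrable kernel, so the derivative falls on the
smooth factor, and `integral_dbar_polar` evaluates the result. -/
theorem hasFDerivAt_cauchyTr {φ : ℂ → ℂ} (hφ : ContDiff ℝ 1 φ) (hc : HasCompactSupport φ) (z : ℂ) :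
    DifferentiableAt ℝ (cauchyTr φ) z ∧ dbar (cauchyTr φ) z = φ z := by
  have e : cauchyTr φ = convolution (fun w : ℂ => (2 * Real.pi * w)⁻¹) φ
      (ContinuousLinearMap.mul ℝ ℂ) volume := by
    funext z; simp [cauchyTr, convolution]
  have h := hc.hasFDerivAt_convolution_right (ContinuousLinearMap.mul ℝ ℂ)
    (μ := volume) locallyIntegrable_inv hφ z
  rw [← e] at h
  refine ⟨h.differentiableAt, ?_⟩
  have hInt : ConvolutionExistsAt (fun w : ℂ => (2 * Real.pi * w)⁻¹) (fderiv ℝ φ) z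
      ((ContinuousLinearMap.mul ℝ ℂ).precompR ℂ) volume :=
    (hc.fderiv (𝕜 := ℝ)).convolutionExists_right _ locallyIntegrable_inv
      (hφ.continuous_fderiv one_ne_zero) z
  rw [dbar, h.fderiv, convolution, ContinuousLinearMap.integral_apply hInt,
    ContinuousLinearMap.integral_apply hInt, ← integral_const_mul, ← integral_add]
  · rw [← integral_dbar_polar hφ hc z]
    congr 1
    funext w
    change (2 * Real.pi * w)⁻¹ * fderiv ℝ φ (z - w) 1 +
      I * ((2 * Real.pi * w)⁻¹ * fderiv ℝ φ (z - w) I) = _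
    rw [dbar]
    ring
  · exact hInt.apply_continuousLinearMap 1
  · exact (hInt.apply_continuousLinearMap I).const_mul I

/-! ### Integrals depending holomorphically on a parameter -/

/-- Differentiation under the integral sign needs no hypothesis on the derivative: Cauchy's estimate
on circles of radius `ε / 2` bounds it by the maximum of `g` on a compact set. -/
theorem hasDerivAt_setIntegral_param {K V : Set ℂ} (hK : IsCompact K) (hV : IsOpen V)
    {g : ℂ → ℂ → ℂ} (hg : ContinuousOn (Function.uncurry g) (K ×ˢ V))
    (hd : ∀ w ∈ K, DifferentiableOn ℂ (g w) V) {η : ℂ} (hη : η ∈ V) :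
    HasDerivAt (fun η => ∫ w in K, g w η) (∫ w in K, deriv (g w) η) η := by
  obtain ⟨ε, hε, hεV⟩ := Metric.nhds_basis_closedBall.mem_iff.1 (hV.mem_nhds hη)
  have hcomp : IsCompact (K ×ˢ Metric.closedBall η ε) := hK.prod (isCompact_closedBall η ε)
  obtain ⟨M, hM⟩ := hcomp.exists_bound_of_continuousOn
    (hg.mono (prod_mono_right hεV))
  have hsec : ∀ y ∈ V, ContinuousOn (fun w => g w y) K := fun y hy =>
    hg.comp (f := fun w => (w, y)) (by fun_prop) fun w hw => ⟨hw, hy⟩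
  have hmeas : ∀ y ∈ V, AEStronglyMeasurable (fun w => g w y) (volume.restrict K) :=
    fun y hy => (hsec y hy).aestronglyMeasurable hK.measurableSet
  have hball : ∀ y ∈ Metric.ball η (ε / 2), Metric.closedBall y (ε / 2) ⊆ Metric.closedBall η ε :=
    fun y hy => Metric.closedBall_subset_closedBall' (by
      have := (Metric.mem_ball.1 hy).le; linarith)
  have hDer : ∀ w ∈ K, HasDerivAt (g w) (deriv (g w) η) η := fun w hw =>
    ((hd w hw).differentiableAt (hV.mem_nhds hη)).hasDerivAt
  refine (hasDerivAt_integral_of_dominated_loc_of_deriv_le (F := fun y w => g w y)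
    (F' := fun y w => deriv (g w) y) (bound := fun _ => M / (ε / 2))
    (Metric.ball_mem_nhds η (half_pos hε)) ?_ ?_ ?_ ?_ ?_ ?_).2
  · filter_upwards [hV.mem_nhds hη] with y hy using hmeas y hy
  · exact (hsec η hη).integrableOn_compact hK
  -- The derivative is measurable in `w` as a pointwise limit of difference quotients, taken along
  -- the increments `ε / (n + 1)`.
  · have hseq : Tendsto (fun n : ℕ => η + ((ε / (n + 1) : ℝ) : ℂ)) atTop (𝓝[≠] η) := by
      refine tendsto_nhdsWithin_iff.2 ⟨?_, Eventually.of_forall fun n => ?_⟩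
      · have h0 : Tendsto (fun n : ℕ => ε / ((n : ℝ) + 1)) atTop (𝓝 0) := by
          have := (tendsto_const_div_atTop_nhds_zero_nat ε).comp (tendsto_add_atTop_nat 1)
          refine this.congr fun n => ?_
          simp
        simpa using (tendsto_const_nhds (x := η)).add
          ((continuous_ofReal.tendsto 0).comp h0)
      · have : (ε / ((n : ℝ) + 1)) ≠ 0 := by positivity
        simp only [mem_compl_iff, mem_singleton_iff, add_eq_left, ofReal_eq_zero]
        exact this
    refine aestronglyMeasurable_of_tendsto_ae atTop
      (f := fun (n : ℕ) w => slope (g w) η (η + ((ε / (n + 1) : ℝ) : ℂ))) (fun n => ?_) ?_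
    · have hmem : η + ((ε / (n + 1) : ℝ) : ℂ) ∈ V := by
        refine hεV ?_
        rw [Metric.mem_closedBall, dist_self_add_left, norm_real, Real.norm_of_nonneg (by positivity)]
        exact div_le_self hε.le (by linarith [n.cast_nonneg (α := ℝ)])
      simp only [slope, vsub_eq_sub]
      exact ((hmeas _ hmem).fun_sub (hmeas η hη)).fun_const_smul _
    · filter_upwards [ae_restrict_mem hK.measurableSet] with w hw
      exact (hDer w hw).tendsto_slope.comp hseq
  · filter_upwards [ae_restrict_mem hK.measurableSet] with w hw y hy
    refine norm_deriv_le_of_forall_mem_sphere_norm_le (half_pos hε) ?_ fun y' hy' => ?_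
    · refine DifferentiableOn.diffContOnCl_ball (U := V) (hd w hw) ((hball y hy).trans hεV)
    · exact hM (w, y') ⟨hw, hball y hy (Metric.sphere_subset_closedBall hy')⟩
  · exact integrableOn_const hK.measure_lt_top.ne
  · filter_upwards [ae_restrict_mem hK.measurableSet] with w hw y hy
    have hyV : y ∈ V := hεV (hball y hy (Metric.mem_closedBall_self (half_pos hε).le))
    exact ((hd w hw).differentiableAt (hV.mem_nhds hyV)).hasDerivAt

theorem analyticAt_setIntegral_param {K V : Set ℂ} (hK : IsCompact K) (hV : IsOpen V)
    {g : ℂ → ℂ → ℂ} (hg : ContinuousOn (Function.uncurry g) (K ×ˢ V))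
    (hd : ∀ w ∈ K, DifferentiableOn ℂ (g w) V) {η : ℂ} (hη : η ∈ V) :
    AnalyticAt ℂ (fun η => ∫ w in K, g w η) η :=
  DifferentiableOn.analyticAt (s := V) (fun _ hy =>
    (hasDerivAt_setIntegral_param hK hV hg hd hy).differentiableAt.differentiableWithinAt)
    (hV.mem_nhds hη)

theorem cauchyTr_eq_setIntegral {φ : ℂ → ℂ} {K : Set ℂ}
    (h0 : ∀ w ∉ K, φ w = 0) (z : ℂ) :
    cauchyTr φ z = ∫ w in K, φ w * (2 * Real.pi * (z - w))⁻¹ := by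
  rw [cauchyTr_eq, setIntegral_eq_integral_of_forall_compl_eq_zero]
  intro w hw
  rw [h0 w hw, zero_mul]

/-- The Cauchy integral over a compact set is holomorphic off this set. -/
theorem analyticAt_cauchyInt {K : Set ℂ} (hK : IsCompact K) {g : ℂ → ℂ} (hg : ContinuousOn g K)
    {z : ℂ} (hz : z ∉ K) :
    AnalyticAt ℂ (fun z => ∫ w in K, g w * (2 * Real.pi * (z - w))⁻¹) z := by
  have hne : ∀ w ∈ K, ∀ z ∈ Kᶜ, (2 * Real.pi * (z - w) : ℂ) ≠ 0 := fun w hw z hz =>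
    mul_ne_zero (by exact_mod_cast Real.two_pi_pos.ne') (sub_ne_zero.2 fun h => hz (h ▸ hw))
  refine analyticAt_setIntegral_param hK hK.isClosed.isOpen_compl ?_ (fun w hw => ?_) hz
  · refine ContinuousOn.mul (hg.comp continuousOn_fst fun p hp => hp.1)
      (ContinuousOn.inv₀ (by fun_prop) fun p hp => hne _ hp.1 _ hp.2)
  · refine DifferentiableOn.const_mul (DifferentiableOn.fun_inv (by fun_prop)
      fun z hz => hne _ hw _ hz) _

/-- The Cauchy integral over a compact set is holomorphic at infinity, and vanishes there. -/
theorem cauchyInt_infty {K : Set ℂ} (hK : IsCompact K) {g : ℂ → ℂ} (hg : ContinuousOn g K) :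
    ∃ G : ℂ → ℂ, AnalyticAt ℂ G 0 ∧ G 0 = 0 ∧
      ∀ z : ℂ, z ≠ 0 → ∫ w in K, g w * (2 * Real.pi * (z - w))⁻¹ = G z⁻¹ := by
  obtain ⟨R, hR⟩ := hK.isBounded.subset_closedBall (0 : ℂ)
  set R' := max R 1
  have hR' : 0 < R' := lt_max_of_lt_right one_pos
  have hne : ∀ w ∈ K, ∀ t ∈ Metric.ball (0 : ℂ) R'⁻¹, (2 * Real.pi * (1 - t * w) : ℂ) ≠ 0 := by
    intro w hw t ht
    refine mul_ne_zero (by exact_mod_cast Real.two_pi_pos.ne') (sub_ne_zero.2 fun h => ?_)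
    have h1 : ‖t * w‖ < 1 := by
      rw [norm_mul]
      have h2 : ‖w‖ ≤ R' := (mem_closedBall_zero_iff.1 (hR hw)).trans (le_max_left _ _)
      have h3 := mem_ball_zero_iff.1 ht
      calc ‖t‖ * ‖w‖ ≤ ‖t‖ * R' := by gcongr
        _ < R'⁻¹ * R' := by gcongr
        _ = 1 := inv_mul_cancel₀ hR'.ne'
    rw [← h] at h1
    simp at h1
  -- For `t = 1 / z` the kernel `1 / (z - w)` becomes `t / (1 - t * w)`, which is holomorphic for
  -- small `t` and vanishes at `t = 0`.
  refine ⟨fun t => ∫ w in K, g w * (t * (2 * Real.pi * (1 - t * w))⁻¹), ?_, by simp, ?_⟩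
  · refine analyticAt_setIntegral_param hK Metric.isOpen_ball ?_ (fun w hw => ?_)
      (Metric.mem_ball_self (inv_pos.2 hR'))
    · refine ContinuousOn.mul (hg.comp continuousOn_fst fun p hp => hp.1)
        (ContinuousOn.mul continuousOn_snd
          (ContinuousOn.inv₀ (by fun_prop) fun p hp => hne _ hp.1 _ hp.2))
    · refine DifferentiableOn.const_mul (DifferentiableOn.fun_mul differentiableOn_id
        (DifferentiableOn.fun_inv (by fun_prop) fun z hz => hne _ hw _ hz)) _
  · intro z hz
    congr 1
    funext w
    have : (2 * Real.pi * (1 - z⁻¹ * w) : ℂ) = (2 * Real.pi * (z - w)) * z⁻¹ := by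
      field_simp
    rw [this, mul_inv _ z⁻¹, inv_inv]
    field_simp

/-! ### Entire functions with a pole at infinity -/

/-- Taylor expansion of an analytic germ. -/
theorem exists_taylor {f : ℂ → ℂ} {a : ℂ} (hf : AnalyticAt ℂ f a) (n : ℕ) :
    ∃ (q : Polynomial ℂ) (g : ℂ → ℂ), AnalyticAt ℂ g a ∧
      ∀ z, f z = q.eval z + (z - a) ^ n * g z := by
  induction n with
  | zero => exact ⟨0, f, hf, fun z => by simp⟩
  | succ n ih =>
    obtain ⟨q, g, hg, h⟩ := ih
    refine ⟨q + Polynomial.C (g a) * (Polynomial.X - Polynomial.C a) ^ n, dslope g a, ?_, fun z => ?_⟩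
    · obtain ⟨p, hp⟩ := hg
      exact hp.has_fpower_series_dslope_fslope.analyticAt
    · have := sub_smul_dslope g a z
      rw [smul_eq_mul] at this
      simp only [Polynomial.eval_add, Polynomial.eval_mul, Polynomial.eval_pow, Polynomial.eval_sub,
        Polynomial.eval_X, Polynomial.eval_C]
      rw [h z, pow_succ]
      linear_combination -(z - a) ^ n * this

/-- Liouville's theorem, by induction on the growth: the difference quotient `dslope f 0` is entire
and grows by one power less. -/
theorem exists_polynomial_of_bound {f : ℂ → ℂ} (hf : Differentiable ℂ f) (n : ℕ) :
    (∃ M R : ℝ, ∀ z, R ≤ ‖z‖ → ‖f z‖ ≤ M * ‖z‖ ^ n) →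
      ∃ q : Polynomial ℂ, q.natDegree ≤ n ∧ ∀ z, f z = q.eval z := by
  induction n generalizing f with
  | zero =>
    rintro ⟨M, R, h⟩
    obtain ⟨B, hB⟩ := (isCompact_closedBall (0 : ℂ) R).exists_bound_of_continuousOn
      hf.continuous.continuousOn
    obtain ⟨c, hc⟩ := hf.exists_const_forall_eq_of_bounded (by
      refine (Metric.isBounded_closedBall (x := (0 : ℂ)) (r := max B M)).subset ?_
      rintro _ ⟨z, rfl⟩
      rw [mem_closedBall_zero_iff]
      rcases le_total R ‖z‖ with h1 | h1
      · exact le_max_of_le_right (by simpa using h z h1)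
      · exact le_max_of_le_left (hB z (by simpa using h1)))
    exact ⟨Polynomial.C c, by simp, fun z => by simp [hc z]⟩
  | succ n ih =>
    rintro ⟨M, R, h⟩
    have hd : Differentiable ℂ (dslope f 0) := by
      have := (Complex.differentiableOn_dslope (f := f) (c := 0) univ_mem).2 hf.differentiableOn
      exact fun z => this.differentiableAt univ_mem
    obtain ⟨q, hq, hq'⟩ := ih hd ⟨M + ‖f 0‖, max R 1, fun z hz => by
      have hz1 : 1 ≤ ‖z‖ := (le_max_right _ _).trans hz
      have hz0 : z ≠ 0 := fun h0 => by simp [h0] at hz1; linarith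
      rw [dslope_of_ne _ hz0, slope_def_module, norm_smul, sub_zero, norm_inv]
      have h1 : ‖f z - f 0‖ ≤ (M + ‖f 0‖) * ‖z‖ ^ (n + 1) := by
        have := h z ((le_max_left _ _).trans hz)
        have h2 : ‖f 0‖ * 1 ≤ ‖f 0‖ * ‖z‖ ^ (n + 1) := by gcongr; exact one_le_pow₀ hz1
        calc ‖f z - f 0‖ ≤ ‖f z‖ + ‖f 0‖ := norm_sub_le _ _
          _ ≤ _ := by linarith
      rw [inv_mul_le_iff₀ (by linarith)]
      calc _ ≤ _ := h1
        _ = _ := by ring⟩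
    refine ⟨Polynomial.C (f 0) + Polynomial.X * q, ?_, fun z => ?_⟩
    · refine (Polynomial.natDegree_add_le _ _).trans (max_le (by simp) ?_)
      refine Polynomial.natDegree_mul_le.trans ?_
      have := Polynomial.natDegree_X_le (R := ℂ)
      omega
    · have := sub_smul_dslope f 0 z
      rw [smul_eq_mul, sub_zero] at this
      simp only [Polynomial.eval_add, Polynomial.eval_mul, Polynomial.eval_X, Polynomial.eval_C,
        ← hq']
      linear_combination -this

/-- A function that is holomorphic on the complex line up to removable singularities in a finite
set, with at most a pole of order `n` at infinity, is a polynomial of degree at most `n`. -/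
theorem exists_polynomial {f : ℂ → ℂ} {P : Finset ℂ} {n : ℕ}
    (hf : ∀ z, ∃ g : ℂ → ℂ, AnalyticAt ℂ g z ∧ ∀ᶠ w in 𝓝 z, w ∉ P → f w = g w)
    (hinf : ∃ g : ℂ → ℂ, AnalyticAt ℂ g 0 ∧
      ∀ᶠ z in Bornology.cobounded ℂ, z ∉ P → f z = z ^ n * g z⁻¹) :
    ∃ q : Polynomial ℂ, q.natDegree ≤ n ∧ ∀ z, z ∉ P → f z = q.eval z := by
  choose g hg hfg using hf
  have hP : ∀ z, ∀ᶠ w in 𝓝[≠] z, w ∉ P := fun z => by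
    have h1 : ((P : Set ℂ) \ {z})ᶜ ∈ 𝓝 z :=
      (P.finite_toSet.subset sdiff_subset).isClosed.isOpen_compl.mem_nhds (by simp)
    filter_upwards [mem_nhdsWithin_of_mem_nhds h1, self_mem_nhdsWithin] with w hw hw' hwP
    exact hw ⟨hwP, hw'⟩
  -- The local extensions are glued along the diagonal. Near each point they agree, since all of
  -- them agree with `f` off a finite set.
  set F : ℂ → ℂ := fun z => g z z with hF
  have hFg : ∀ z, F =ᶠ[𝓝 z] g z := by
    intro z
    have h1 := (hfg z).eventually_nhds
    have h2 := (hg z).eventually_analyticAt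
    filter_upwards [h1, h2] with w hw1 hw2
    have e : g w =ᶠ[𝓝[≠] w] g z := by
      filter_upwards [hP w, mem_nhdsWithin_of_mem_nhds hw1,
        mem_nhdsWithin_of_mem_nhds (hfg w)] with v h1 h2 h3
      rw [← h2 h1, h3 h1]
    exact (AnalyticAt.frequently_eq_iff_eventually_eq (hg w) hw2).1 e.frequently |>.self_of_nhds
  have hFf : ∀ z, z ∉ P → f z = F z := fun z hz => (hfg z).self_of_nhds hz
  have hFd : Differentiable ℂ F := fun z => ((hg z).congr (hFg z).symm).differentiableAt
  obtain ⟨g₀, hg₀, h0⟩ := hinf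
  have hb : ∀ᶠ t in 𝓝 (0 : ℂ), ‖g₀ t‖ ≤ ‖g₀ 0‖ + 1 :=
    (hg₀.continuousAt.norm.eventually_lt continuousAt_const (by simp)).mono fun t ht => ht.le
  have hcob : ∀ᶠ z in Bornology.cobounded ℂ, ‖F z‖ ≤ (‖g₀ 0‖ + 1) * ‖z‖ ^ n := by
    have hPc : ∀ᶠ z in Bornology.cobounded ℂ, z ∉ P := Bornology.isBounded_def.1 P.finite_toSet.isBounded
    filter_upwards [h0, hPc, tendsto_inv₀_cobounded.eventually hb] with z hz hzP hb
    rw [← hFf z hzP, hz hzP, norm_mul, norm_pow, mul_comm]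
    gcongr
  obtain ⟨R, hR⟩ := (Metric.hasBasis_cobounded_compl_closedBall (0 : ℂ)).eventually_iff.1 hcob
  obtain ⟨q, hq, hq'⟩ := exists_polynomial_of_bound hFd n ⟨‖g₀ 0‖ + 1, R + 1, fun z hz => hR.2 (by
    simp only [mem_compl_iff, mem_closedBall_zero_iff, not_le]; linarith)⟩
  exact ⟨q, hq, fun z hz => by rw [hFf z hz, hq' z]⟩

end MinLaplace

namespace MinLaplace

open Filter Set

/-! ### Charts of the sphere -/

/-- The trace on the complex line of the neighbourhoods of a point of the sphere. -/
def nf (x : CP1) : Filter ℂ := comap (fun z : ℂ => (z : CP1)) (𝓝 x)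

theorem nf_coe (z : ℂ) : nf (z : CP1) = 𝓝 z :=
  (OnePoint.isOpenEmbedding_coe.nhds_eq_comap z).symm

theorem nf_infty : nf OnePoint.infty = Bornology.cobounded ℂ := by
  rw [nf, OnePoint.comap_coe_nhds_infty, coclosedCompact_eq_cocompact,
    Metric.cobounded_eq_cocompact]

instance nf_neBot (x : CP1) : (nf x).NeBot := by
  induction x using OnePoint.rec with
  | coe z => rw [nf_coe]; infer_instance
  | infty => rw [nf_infty]; infer_instance

theorem eventually_nf_notMem (P : Finset ℂ) {x : CP1} (hx : x ∉ poles P) :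
    ∀ᶠ z in nf x, z ∉ P := by
  induction x using OnePoint.rec with
  | infty => exact absurd (mem_insert _ _) hx
  | coe w =>
    rw [nf_coe]
    have : w ∉ P := fun h => hx (mem_insert_of_mem _ ⟨w, h, rfl⟩)
    exact P.finite_toSet.isClosed.isOpen_compl.mem_nhds this

theorem eventually_infty_notMem (P : Finset ℂ) : ∀ᶠ z in nf OnePoint.infty, z ∉ P := by
  rw [nf_infty]
  exact Bornology.isBounded_def.1 P.finite_toSet.isBounded

theorem eventually_infty_ne_zero : ∀ᶠ z in nf OnePoint.infty, z ≠ 0 := by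
  simpa using eventually_infty_notMem {0}

theorem coe_mem_poles {P : Finset ℂ} {z : ℂ} : (z : CP1) ∈ poles P ↔ z ∈ P := by
  constructor
  · rintro (h | ⟨w, hw, h⟩)
    · exact absurd h (OnePoint.coe_ne_infty _)
    · rwa [← OnePoint.coe_injective h]
  · exact fun h => mem_insert_of_mem _ ⟨z, h, rfl⟩

theorem infty_mem_poles {P : Finset ℂ} : (OnePoint.infty : CP1) ∈ poles P := mem_insert _ _

/-- This turns equalities of germs on the sphere, tested off the poles, into eventual statements
along a filter on the complex line, where `filter_upwards` can combine them. -/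
theorem exists_nhds_iff_nf {P : Finset ℂ} {x : CP1} {p : Punct P → Prop} :
    (∃ W ∈ 𝓝 x, ∀ z : Punct P, z.pt ∈ W → p z) ↔ ∀ᶠ z in nf x, ∀ h : z ∉ P, p ⟨z, h⟩ := by
  constructor
  · rintro ⟨W, hW, h⟩
    filter_upwards [preimage_mem_comap hW] with z hz hP using h ⟨z, hP⟩ hz
  · rintro h
    obtain ⟨W, hW, h⟩ := mem_comap.1 h
    exact ⟨W, hW, fun z hz => h hz z.2⟩

theorem germEq_iff {r : ℕ} {E : HolBundle r} {P : Finset ℂ} {x : CP1} {s t : E.Sec P} :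
    HolBundle.GermEq x s t ↔ ∀ᶠ z in nf x, ∀ h : z ∉ P, s ⟨z, h⟩ = t ⟨z, h⟩ :=
  exists_nhds_iff_nf

theorem eventually_nf_of_nhds {x : CP1} {p : CP1 → Prop} (h : ∀ᶠ y in 𝓝 x, p y) :
    ∀ᶠ z in nf x, p (z : ℂ) := preimage_mem_comap h

/-- A property that holds near `x` off `x` and the poles, spreads. -/
theorem eventually_nhds_of_nf {x : CP1} {p : ℂ → Prop} (h : ∀ᶠ z in nf x, p z) :
    ∀ᶠ y in 𝓝 x, ∀ᶠ z in nf y, p z := by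
  obtain ⟨W, hW, hp⟩ := mem_comap.1 h
  filter_upwards [eventually_mem_nhds_iff.2 hW] with y hy
  exact mem_of_superset (preimage_mem_comap hy) hp

theorem tendsto_inv_nf_infty : Tendsto (fun z : ℂ => z⁻¹) (nf OnePoint.infty) (𝓝 0) := by
  rw [nf_infty]; exact tendsto_inv₀_cobounded

theorem unif_coe (p z : ℂ) : unif (p : CP1) z = z - p := rfl

theorem unif_infty (z : ℂ) : unif OnePoint.infty z = z⁻¹ := rfl

theorem unif_ne_zero {P : Finset ℂ} {x : CP1} (hx : x ∈ poles P) :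
    ∀ᶠ z in nf x, z ∉ P → unif x z ≠ 0 := by
  induction x using OnePoint.rec with
  | coe w =>
    refine Eventually.of_forall fun z hz => ?_
    rw [unif_coe, sub_ne_zero]
    rintro rfl
    exact hz (coe_mem_poles.1 hx)
  | infty => exact eventually_infty_ne_zero.mono fun z hz _ => inv_ne_zero hz

theorem continuousAt_invChart : Tendsto invChart (𝓝 0) (𝓝 OnePoint.infty) := by
  rw [OnePoint.nhds_infty_eq, ← pure_sup_nhdsNE (0 : ℂ), sup_comm]
  refine Tendsto.sup_sup ?_ ?_
  · have h : Tendsto (fun t : ℂ => t⁻¹) (𝓝[≠] 0) (coclosedCompact ℂ) := by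
      rw [coclosedCompact_eq_cocompact, ← Metric.cobounded_eq_cocompact]
      exact tendsto_inv₀_nhdsNE_zero
    refine (tendsto_map.comp h).congr' ?_
    filter_upwards [self_mem_nhdsWithin] with t ht
    simp [invChart, show t ≠ 0 from ht]
  · rw [tendsto_pure_left]
    intro s hs
    simpa [invChart] using hs

theorem invChart_inv {z : ℂ} (hz : z ≠ 0) : invChart z⁻¹ = z := by
  simp [invChart, hz]

theorem invChart_of_ne {t : ℂ} (ht : t ≠ 0) : invChart t = ((t⁻¹ : ℂ) : CP1) := by
  simp [invChart, ht]

/-- A neighbourhood of infinity in the chart. -/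
theorem eventually_infty_iff {p : CP1 → Prop} :
    (∀ᶠ y in 𝓝 OnePoint.infty, p y) ↔ ∀ᶠ t in 𝓝 (0 : ℂ), p (invChart t) := by
  refine ⟨fun h => continuousAt_invChart.eventually h, fun h => ?_⟩
  rw [OnePoint.nhds_infty_eq, coclosedCompact_eq_cocompact, ← Metric.cobounded_eq_cocompact]
  refine eventually_sup.2 ⟨?_, ?_⟩
  · have h2 : ∀ᶠ z in Bornology.cobounded ℂ, z ≠ 0 := by
      rw [← nf_infty]; exact eventually_infty_ne_zero
    rw [eventually_map]
    filter_upwards [tendsto_inv₀_cobounded.eventually h, h2] with z hz h0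
    rwa [invChart_inv h0] at hz
  · rw [eventually_pure]
    simpa [invChart] using h.self_of_nhds

theorem holAt_coe {f : CP1 → ℂ} {z : ℂ} :
    HolAt f (z : CP1) ↔ AnalyticAt ℂ (fun w : ℂ => f w) z :=
  ⟨fun h => h.1 z rfl, fun h => ⟨fun w hw => by rwa [← OnePoint.coe_injective hw],
    fun h' => absurd h' (OnePoint.coe_ne_infty z)⟩⟩

theorem holAt_infty {f : CP1 → ℂ} :
    HolAt f OnePoint.infty ↔ AnalyticAt ℂ (fun t : ℂ => f (invChart t)) 0 :=
  ⟨fun h => h.2 rfl, fun h => ⟨fun w hw => absurd hw.symm (OnePoint.coe_ne_infty w),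
    fun _ => h⟩⟩

namespace HolAt

variable {f g : CP1 → ℂ} {x : CP1}

theorem const (c : ℂ) (x : CP1) : HolAt (fun _ => c) x :=
  ⟨fun _ _ => analyticAt_const, fun _ => analyticAt_const⟩

theorem add (hf : HolAt f x) (hg : HolAt g x) : HolAt (fun y => f y + g y) x :=
  ⟨fun z h => (hf.1 z h).fun_add (hg.1 z h), fun h => (hf.2 h).fun_add (hg.2 h)⟩

theorem mul (hf : HolAt f x) (hg : HolAt g x) : HolAt (fun y => f y * g y) x :=
  ⟨fun z h => (hf.1 z h).fun_mul (hg.1 z h), fun h => (hf.2 h).fun_mul (hg.2 h)⟩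

theorem sum {ι : Type*} {s : Finset ι} {f : ι → CP1 → ℂ} (hf : ∀ i ∈ s, HolAt (f i) x) :
    HolAt (fun y => ∑ i ∈ s, f i y) x := by
  classical
  induction s using Finset.induction_on with
  | empty => simpa using const 0 x
  | insert a s ha ih =>
    simp only [Finset.sum_insert ha]
    exact (hf a (by simp)).add (ih fun i hi => hf i (by simp [hi]))

theorem prod {ι : Type*} {s : Finset ι} {f : ι → CP1 → ℂ} (hf : ∀ i ∈ s, HolAt (f i) x) :
    HolAt (fun y => ∏ i ∈ s, f i y) x := by
  classical
  induction s using Finset.induction_on with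
  | empty => simpa using const 1 x
  | insert a s ha ih =>
    simp only [Finset.prod_insert ha]
    exact (hf a (by simp)).mul (ih fun i hi => hf i (by simp [hi]))

theorem inv (hf : HolAt f x) (h0 : f x ≠ 0) : HolAt (fun y => (f y)⁻¹) x :=
  ⟨fun z h => (hf.1 z h).fun_inv (by rwa [← h]),
    fun h => (hf.2 h).fun_inv (by simpa [invChart, ← h] using h0)⟩

theorem continuousAt (hf : HolAt f x) : ContinuousAt f x := by
  induction x using OnePoint.rec with
  | coe z =>
    exact OnePoint.continuousAt_coe.2 (holAt_coe.1 hf).continuousAt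
  | infty =>
    have h := (holAt_infty.1 hf).continuousAt
    intro s hs
    refine (eventually_infty_iff (p := fun y => f y ∈ s)).2 (h ?_)
    simpa [invChart] using hs

theorem eventually (hf : HolAt f x) : ∀ᶠ y in 𝓝 x, HolAt f y := by
  induction x using OnePoint.rec with
  | coe z =>
    have h := (holAt_coe.1 hf).eventually_analyticAt
    rw [OnePoint.nhds_coe_eq, eventually_map]
    exact h.mono fun w hw => holAt_coe.2 hw
  | infty =>
    rw [eventually_infty_iff]
    filter_upwards [(holAt_infty.1 hf).eventually_analyticAt] with t ht
    by_cases h0 : t = 0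
    · subst h0; simpa [invChart] using hf
    · rw [invChart_of_ne h0, holAt_coe]
      have h1 : AnalyticAt ℂ (fun w : ℂ => f (invChart w⁻¹)) t⁻¹ := by
        have h2 : AnalyticAt ℂ (fun w : ℂ => w⁻¹) t⁻¹ := analyticAt_id.fun_inv (inv_ne_zero h0)
        exact AnalyticAt.fun_comp (g := fun w => f (invChart w)) (f := fun w : ℂ => w⁻¹)
          (by simpa using ht) h2
      refine h1.congr ?_
      filter_upwards [isOpen_ne.mem_nhds (inv_ne_zero h0)] with w hw
      rw [invChart_inv hw]

/-- A holomorphic germ, as a function of the local parameter. -/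
theorem exists_analyticAt (hf : HolAt f x) :
    ∃ g : ℂ → ℂ, AnalyticAt ℂ g 0 ∧ g 0 = f x ∧ ∀ᶠ z : ℂ in nf x, f z = g (unif x z) := by
  induction x using OnePoint.rec with
  | coe p =>
    refine ⟨fun t => f ((t + p : ℂ) : CP1), ?_, by simp, Eventually.of_forall fun z => ?_⟩
    · have h1 : AnalyticAt ℂ (fun t : ℂ => t + p) 0 := by fun_prop
      exact AnalyticAt.fun_comp (g := fun w : ℂ => f w) (f := fun t : ℂ => t + p)
        (by simpa using holAt_coe.1 hf) h1
    · simp only [unif_coe, sub_add_cancel]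
  | infty =>
    refine ⟨_, holAt_infty.1 hf, by simp [invChart], ?_⟩
    filter_upwards [eventually_infty_ne_zero] with z hz
    rw [unif_infty, invChart_inv hz]

end HolAt

/-- A holomorphic germ given by a function of the local parameter. -/
theorem exists_holAt (x : CP1) {g : ℂ → ℂ} (hg : AnalyticAt ℂ g 0) :
    ∃ f : CP1 → ℂ, HolAt f x ∧ f x = g 0 ∧ ∀ z : ℂ, f z = g (unif x z) := by
  induction x using OnePoint.rec with
  | coe p =>
    refine ⟨fun y => y.elim 0 (fun z => g (z - p)), ?_, ?_, fun z => rfl⟩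
    · rw [holAt_coe]
      have h1 : AnalyticAt ℂ (fun t : ℂ => t - p) p := by fun_prop
      exact AnalyticAt.fun_comp (g := g) (f := fun t : ℂ => t - p) (by simpa using hg) h1
    · change g (p - p) = g 0
      rw [sub_self]
  | infty =>
    refine ⟨fun y => y.elim (g 0) (fun z => g z⁻¹), ?_, rfl, fun z => rfl⟩
    rw [holAt_infty]
    convert hg using 1
    funext t
    by_cases h : t = 0
    · subst h; simp [invChart]
    · rw [invChart_of_ne h]
      change g (t⁻¹)⁻¹ = g t
      rw [inv_inv]

/-! ### Bases and transition matrices -/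

section Linear

universe v

variable {r : ℕ} {V : Type v} [AddCommGroup V] [Module ℂ V]

/-- `e` is a basis of the vector space. -/
def IsB (e : Fin r → V) : Prop :=
  LinearIndependent ℂ e ∧ Submodule.span ℂ (range e) = ⊤

/-- The coefficients of a vector in the basis `e`. -/
def coef (e : Fin r → V) : V →ₗ[ℂ] (Fin r → ℂ) := open Classical in
  -- The default value makes `coef e` linear for every family `e`, so that it may be written down
  -- outside the domain of a frame.
  if h : IsB e then (Module.Basis.mk h.1 h.2.ge).equivFun.toLinearMap else 0

theorem IsB.sum_coef {e : Fin r → V} (h : IsB e) (v : V) : ∑ i, coef e v i • e i = v := by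
  simp only [coef, dif_pos h]
  have := (Module.Basis.mk h.1 h.2.ge).sum_equivFun v
  simpa using this

theorem IsB.coef_sum {e : Fin r → V} (h : IsB e) (c : Fin r → ℂ) :
    coef e (∑ i, c i • e i) = c := by
  have h1 := h.sum_coef (∑ i, c i • e i)
  funext i
  exact Fintype.linearIndependent_iff.1 h.1 (fun i => coef e (∑ i, c i • e i) i - c i)
    (by simp only [sub_smul, Finset.sum_sub_distrib]; rw [h1, sub_self]) i |> sub_eq_zero.1

theorem IsB.eq_coef {e : Fin r → V} (h : IsB e) {v : V} {c : Fin r → ℂ}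
    (hv : v = ∑ i, c i • e i) : coef e v = c := by rw [hv, h.coef_sum]

theorem isB_of_linearIndependent {e e' : Fin r → V} (h : IsB e') (h' : LinearIndependent ℂ e) :
    IsB e := by
  refine ⟨h', ?_⟩
  have hr : Module.finrank ℂ V = r := by
    simpa using Module.finrank_eq_card_basis (Module.Basis.mk h.1 h.2.ge)
  have : FiniteDimensional ℂ V := (Module.Basis.mk h.1 h.2.ge).finiteDimensional_of_finite
  exact h'.span_eq_top_of_card_eq_finrank' (by simp [hr])

theorem sum_mulVec {e e' : Fin r → V} {a : Matrix (Fin r) (Fin r) ℂ}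
    (h : ∀ i, e i = ∑ j, a j i • e' j) (c : Fin r → ℂ) :
    ∑ i, c i • e i = ∑ j, (a.mulVec c) j • e' j := by
  simp only [h, Finset.smul_sum, Matrix.mulVec, dotProduct, Finset.sum_smul, smul_smul]
  rw [Finset.sum_comm]
  simp only [mul_comm]

theorem det_ne_zero_of_isB {e e' : Fin r → V} {a : Matrix (Fin r) (Fin r) ℂ}
    (h : ∀ i, e i = ∑ j, a j i • e' j) (he : LinearIndependent ℂ e) : a.det ≠ 0 := by
  intro h0
  obtain ⟨c, hc, hc0⟩ := Matrix.exists_mulVec_eq_zero_iff.2 h0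
  have := sum_mulVec h c
  rw [hc0] at this
  simp only [Pi.zero_apply, zero_smul, Finset.sum_const_zero] at this
  exact hc (funext (Fintype.linearIndependent_iff.1 he c this))

theorem linearIndependent_of_det_ne_zero {e e' : Fin r → V} {a : Matrix (Fin r) (Fin r) ℂ}
    (h : ∀ i, e i = ∑ j, a j i • e' j) (he' : LinearIndependent ℂ e') (h0 : a.det ≠ 0) :
    LinearIndependent ℂ e := by
  refine Fintype.linearIndependent_iff.2 fun c hc => ?_
  rw [sum_mulVec h] at hc
  have h1 : a.mulVec c = 0 := funext (Fintype.linearIndependent_iff.1 he' _ hc)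
  by_contra hne
  push Not at hne
  exact h0 (Matrix.exists_mulVec_eq_zero_iff.1 ⟨c, fun h => by
    obtain ⟨i, hi⟩ := hne; exact hi (congrFun h i), h1⟩)

/-- Cramer's rule. The adjugate keeps the new coefficients holomorphic, or meromorphic, if the
matrix and the old ones are. -/
theorem sum_inv_mulVec {e e' : Fin r → V} {a : Matrix (Fin r) (Fin r) ℂ}
    (h : ∀ i, e i = ∑ j, a j i • e' j) (h0 : a.det ≠ 0) (c : Fin r → ℂ) :
    ∑ j, c j • e' j = ∑ i, (a.det⁻¹ • a.adjugate.mulVec c) i • e i := by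
  rw [sum_mulVec h]
  congr 1
  funext j
  rw [Matrix.mulVec_smul, Matrix.mulVec_mulVec, Matrix.mul_adjugate, Matrix.smul_mulVec,
    smul_smul, inv_mul_cancel₀ h0, one_smul, Matrix.one_mulVec]

end Linear

theorem HolAt.det {r : ℕ} {x : CP1} {a : Fin r → Fin r → CP1 → ℂ} (ha : ∀ i j, HolAt (a i j) x) :
    HolAt (fun y => (Matrix.of fun i j => a i j y).det) x := by
  simp only [Matrix.det_apply']
  exact HolAt.sum fun σ _ => (HolAt.const _ x).mul (HolAt.prod fun i _ => ha _ _)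

theorem HolAt.adjugate {r : ℕ} {x : CP1} {a : Fin r → Fin r → CP1 → ℂ}
    (ha : ∀ i j, HolAt (a i j) x) (i j : Fin r) :
    HolAt (fun y => (Matrix.of fun i j => a i j y).adjugate i j) x := by
  simp only [Matrix.adjugate_apply, Matrix.det_apply']
  refine HolAt.sum fun σ _ => (HolAt.const _ x).mul (HolAt.prod fun k _ => ?_)
  simp only [Matrix.updateRow_apply]
  split_ifs
  · exact HolAt.const _ x
  · exact ha _ _

/-! ### Frames -/

namespace HolBundle

universe u

variable {r : ℕ} {E : HolBundle.{u} r} {P : Finset ℂ}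

theorem exists_isFrame (E : HolBundle.{u} r) (x : CP1) : ∃ U e, x ∈ U ∧ E.IsFrame U e ∧
    ∀ y ∈ U, ∀ s : ∀ y, E.Fib y, E.IsHol s y ↔ ∃ f : Fin r → CP1 → ℂ, (∀ i, HolAt (f i) y) ∧
        ∀ᶠ z in 𝓝 y, s z = ∑ i, f i z • e i z := by
  obtain ⟨U, hU, hx, e, he⟩ := E.exists_frame x
  refine ⟨U, e, hx, ⟨hU, fun y hy => ⟨(he y hy).1, (he y hy).2.1, fun i => ?_⟩⟩,
    fun y hy => (he y hy).2.2⟩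
  refine ((he y hy).2.2 _).2 ⟨fun j _ => if j = i then 1 else 0, fun j => HolAt.const _ _, ?_⟩
  exact Eventually.of_forall fun z => by simp

theorem IsFrame.isB {U : Set CP1} {e : Fin r → ∀ y, E.Fib y} (h : E.IsFrame U e) {y : CP1}
    (hy : y ∈ U) : IsB (fun i => e i y) := ⟨(h.2 y hy).1, (h.2 y hy).2.1⟩

/-- Transition between two families of holomorphic sections, the second one being a frame. -/
theorem IsFrame.isHol_iff {U : Set CP1} {e : Fin r → ∀ y, E.Fib y} (h : E.IsFrame U e) {y : CP1}
    (hy : y ∈ U) (s : ∀ y, E.Fib y) : E.IsHol s y ↔ ∃ f : Fin r → CP1 → ℂ, (∀ i, HolAt (f i) y) ∧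
      ∀ᶠ z in 𝓝 y, s z = ∑ i, f i z • e i z := by
  obtain ⟨U', e', hy', he', hol⟩ := E.exists_isFrame y
  choose a ha hae using fun i => (hol y hy' (e i)).1 ((h.2 y hy).2.2 i)
  have hae' : ∀ᶠ z in 𝓝 y, ∀ i, e i z = ∑ j, (Matrix.of fun j i => a i j z) j i • e' j z := by
    simpa using eventually_all.2 hae
  rw [hol y hy']
  constructor
  · rintro ⟨f, hf, hs⟩
    -- The matrix from `e` to a trivializing frame has holomorphic entries and is invertible at `y`,
    -- so its inverse is holomorphic near `y`.
    have hdet := HolAt.det (a := fun j i => a i j) (fun j i => ha i j)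
    have hadj := HolAt.adjugate (a := fun j i => a i j) (fun j i => ha i j)
    have h0 : (Matrix.of fun j i => a i j y).det ≠ 0 :=
      det_ne_zero_of_isB hae'.self_of_nhds (h.2 y hy).1
    refine ⟨fun i z => ∑ j, (Matrix.of fun j i => a i j z).det⁻¹ *
      ((Matrix.of fun j i => a i j z).adjugate i j * f j z), fun i => HolAt.sum fun j _ =>
        (hdet.inv h0).mul ((hadj i j).mul (hf j)), ?_⟩
    filter_upwards [hs, hae', hdet.continuousAt.eventually_ne h0] with z h1 h2 h3
    rw [h1, sum_inv_mulVec h2 h3]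
    refine Finset.sum_congr rfl fun i _ => ?_
    simp only [Pi.smul_apply, Matrix.mulVec, dotProduct, Finset.mul_sum, smul_eq_mul]
  · rintro ⟨f, hf, hs⟩
    refine ⟨fun j z => ∑ i, a i j z * f i z, fun j => HolAt.sum fun i _ => (ha i j).mul (hf i), ?_⟩
    filter_upwards [hs, hae'] with z h1 h2
    rw [h1, sum_mulVec h2]
    simp [Matrix.mulVec, dotProduct]

variable {s t : ∀ y, E.Fib y} {x : CP1}

theorem isHol_sum {n : ℕ} {s : Fin n → ∀ y, E.Fib y} {f : Fin n → CP1 → ℂ}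
    (hs : ∀ k, E.IsHol (s k) x) (hf : ∀ k, HolAt (f k) x) :
    E.IsHol (fun y => ∑ k, f k y • s k y) x := by
  obtain ⟨U, e, hx, he, -⟩ := E.exists_isFrame x
  choose g hg hgs using fun k => (he.isHol_iff hx _).1 (hs k)
  refine (he.isHol_iff hx _).2 ⟨fun i y => ∑ k, f k y * g k i y,
    fun i => HolAt.sum fun k _ => (hf k).mul (hg k i), ?_⟩
  filter_upwards [eventually_all.2 hgs] with z hz
  simp only [hz, Finset.smul_sum, smul_smul, Finset.sum_smul]
  rw [Finset.sum_comm]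

theorem IsHol.congr (hs : E.IsHol s x) (h : ∀ᶠ y in 𝓝 x, s y = t y) : E.IsHol t x := by
  obtain ⟨U, e, hx, he, -⟩ := E.exists_isFrame x
  obtain ⟨f, hf, hfs⟩ := (he.isHol_iff hx _).1 hs
  refine (he.isHol_iff hx _).2 ⟨f, hf, ?_⟩
  filter_upwards [hfs, h] with z h1 h2
  rw [← h2, h1]

theorem IsHol.eventually (hs : E.IsHol s x) : ∀ᶠ y in 𝓝 x, E.IsHol s y := by
  obtain ⟨U, e, hx, he, -⟩ := E.exists_isFrame x
  obtain ⟨f, hf, hfs⟩ := (he.isHol_iff hx _).1 hs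
  filter_upwards [hfs.eventually_nhds, eventually_all.2 fun i => (hf i).eventually,
    he.1.mem_nhds hx] with y h1 h2 h3
  exact (he.isHol_iff h3 _).2 ⟨f, h2, h1⟩

/-- Holomorphic germs in a frame, through the local parameter. -/
theorem mem_holGerms_iff {U : Set CP1} {e : Fin r → ∀ y, E.Fib y} (he : E.IsFrame U e)
    (hx : x ∈ U) {s : E.Sec P} : s ∈ E.holGerms P x ↔ ∃ f : Fin r → ℂ → ℂ,
      (∀ i, AnalyticAt ℂ (f i) 0) ∧
      ∀ᶠ z in nf x, ∀ h : z ∉ P, s ⟨z, h⟩ = ∑ i, f i (unif x z) • e i z := by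
  constructor
  · rintro ⟨σ, hσ, hs⟩
    obtain ⟨f, hf, hfs⟩ := (he.isHol_iff hx _).1 hσ
    choose g hg _ hgf using fun i => (hf i).exists_analyticAt
    refine ⟨g, hg, ?_⟩
    filter_upwards [germEq_iff.1 hs, eventually_nf_of_nhds hfs, eventually_all.2 hgf]
      with z h1 h2 h3 hz
    rw [h1 hz]
    simp only [← h3]
    exact h2
  · rintro ⟨g, hg, hs⟩
    choose f hf _ hfg using fun i => exists_holAt x (hg i)
    refine ⟨fun y => ∑ i, f i y • e i y, isHol_sum (fun i => (he.2 x hx).2.2 i) hf, ?_⟩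
    refine germEq_iff.2 (hs.mono fun z hz hP => ?_)
    rw [hz hP]
    exact Finset.sum_congr rfl fun i _ => by rw [← hfg]; rfl

theorem holGerms_congr {s t : E.Sec P} (hs : s ∈ E.holGerms P x)
    (h : ∀ᶠ z in nf x, ∀ h : z ∉ P, s ⟨z, h⟩ = t ⟨z, h⟩) : t ∈ E.holGerms P x := by
  obtain ⟨σ, hσ, hs⟩ := hs
  refine ⟨σ, hσ, germEq_iff.2 ?_⟩
  filter_upwards [germEq_iff.1 hs, h] with z h1 h2 hz
  rw [← h2 hz, h1 hz]

theorem holGerms_sum {n : ℕ} {s : Fin n → E.Sec P} {f : Fin n → ℂ → ℂ}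
    (hs : ∀ k, s k ∈ E.holGerms P x) (hf : ∀ k, AnalyticAt ℂ (f k) 0) :
    (fun z : Punct P => ∑ k, f k (unif x z) • s k z) ∈ E.holGerms P x := by
  choose σ hσ hs using hs
  choose g hg _ hgf using fun i => exists_holAt x (hf i)
  refine ⟨fun y => ∑ k, g k y • σ k y, isHol_sum hσ hg, germEq_iff.2 ?_⟩
  filter_upwards [eventually_all.2 fun k => germEq_iff.1 (hs k)] with z h1 hz
  refine Finset.sum_congr rfl fun k _ => ?_
  rw [h1 k hz, ← hgf k]
  rfl

theorem holGerms_add {s t : E.Sec P} (hs : s ∈ E.holGerms P x) (ht : t ∈ E.holGerms P x) :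
    s + t ∈ E.holGerms P x := by
  refine holGerms_congr (holGerms_sum (n := 2) (s := ![s, t]) (f := fun _ _ => 1) ?_
    fun _ => analyticAt_const) (Eventually.of_forall fun z hz => by simp)
  intro k; fin_cases k <;> simpa

theorem holGerms_mul {s : E.Sec P} {f : ℂ → ℂ} (hs : s ∈ E.holGerms P x)
    (hf : AnalyticAt ℂ f 0) : mulSec (fun z => f (unif x z)) s ∈ E.holGerms P x :=
  holGerms_congr (holGerms_sum (n := 1) (s := fun _ => s) (f := fun _ => f) (fun _ => hs)
    fun _ => hf) (Eventually.of_forall fun z hz => by simp [mulSec])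

theorem holGerms_smul {s : E.Sec P} (c : ℂ) (hs : s ∈ E.holGerms P x) :
    c • s ∈ E.holGerms P x := holGerms_mul (f := fun _ => c) hs analyticAt_const

theorem holGerms_zero : (0 : E.Sec P) ∈ E.holGerms P x :=
  holGerms_congr (holGerms_sum (n := 0) (s := fun _ => 0) (f := fun _ => 0) (fun k => k.elim0)
    fun k => k.elim0) (Eventually.of_forall fun z hz => by simp)

theorem holGerms_eventually {s : E.Sec P} (hs : s ∈ E.holGerms P x) :
    ∀ᶠ y in 𝓝 x, s ∈ E.holGerms P y := by
  obtain ⟨σ, hσ, hs⟩ := hs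
  filter_upwards [hσ.eventually, eventually_nhds_of_nf (germEq_iff.1 hs)] with y h1 h2
  exact ⟨σ, h1, germEq_iff.2 h2⟩

end HolBundle

end MinLaplace

namespace MinLaplace

open MeasureTheory Filter Set

/-! ### An integral equation -/

theorem contDiff_dbar {f : ℂ → ℂ} (hf : ContDiff ℝ 2 f) : ContDiff ℝ 1 (dbar f) := by
  have h : ContDiff ℝ 1 (fderiv ℝ f) := hf.fderiv_right (by norm_num)
  unfold dbar
  exact (h.clm_apply contDiff_const).add (contDiff_const.mul (h.clm_apply contDiff_const))

/-- A weighted Cauchy integral over a set `S`. -/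
def wInt (S : Set ℂ) (q : ℂ → ℂ) (n : ℕ) (ψ : ℂ → ℂ) (z : ℂ) : ℂ :=
  (q z ^ n)⁻¹ * ∫ w in S, q w ^ n * ψ w * (2 * Real.pi * (z - w))⁻¹

theorem analyticAt_wInt {S : Set ℂ} {q : ℂ → ℂ} (n : ℕ) {ψ : ℂ → ℂ} (hS : IsCompact S)
    (hq : ContinuousOn q S) (hψ : ContinuousOn ψ S) {z : ℂ} (hz : z ∉ S) (hqz : AnalyticAt ℂ q z)
    (h0 : q z ≠ 0) : AnalyticAt ℂ (wInt S q n ψ) z :=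
  ((hqz.fun_pow n).fun_inv (pow_ne_zero n h0)).fun_mul
    (analyticAt_cauchyInt hS ((hq.pow n).mul hψ) hz)

/-- Bound of a weighted Cauchy integral. -/
theorem norm_wInt_le {S : Set ℂ} {q : ℂ → ℂ} (n : ℕ) {ψ : ℂ → ℂ} (hS : IsCompact S) {z : ℂ}
    {a b δ B : ℝ} (hb : 0 < b) (hδ : 0 < δ) (ha : ∀ w ∈ S, ‖q w‖ ≤ a) (hbz : b ≤ ‖q z‖)
    (hd : ∀ w ∈ S, δ ≤ ‖z - w‖) (hB : ∀ w ∈ S, ‖ψ w‖ ≤ B) (ha0 : 0 ≤ a) (hB0 : 0 ≤ B) :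
    ‖wInt S q n ψ z‖ ≤ (a / b) ^ n * (B * δ⁻¹ * volume.real S) := by
  have h1 : ‖∫ w in S, q w ^ n * ψ w * (2 * Real.pi * (z - w))⁻¹‖ ≤
      (a ^ n * B * δ⁻¹) * volume.real S := by
    refine norm_setIntegral_le_of_norm_le_const hS.measure_lt_top fun w hw => ?_
    rw [norm_mul, norm_mul, norm_pow, norm_inv]
    have h2 : δ ≤ ‖(2 * Real.pi * (z - w) : ℂ)‖ := by
      rw [norm_mul]
      have h3 : (1 : ℝ) ≤ ‖(2 * Real.pi : ℂ)‖ := by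
        have := Real.pi_gt_three
        rw [show (2 * Real.pi : ℂ) = ((2 * Real.pi : ℝ) : ℂ) by push_cast; ring, Complex.norm_real,
          Real.norm_of_nonneg (by positivity)]
        linarith
      nlinarith [hd w hw, norm_nonneg (z - w)]
    gcongr
    · exact ha w hw
    · exact hB w hw
  rw [wInt, norm_mul, norm_inv, norm_pow]
  calc (‖q z‖ ^ n)⁻¹ * _ ≤ (b ^ n)⁻¹ * ((a ^ n * B * δ⁻¹) * volume.real S) := by gcongr
    _ = _ := by rw [div_pow]; ring

/-- Solvability of the integral equation for large weights. -/
theorem exists_solution {ι : Type} [Fintype ι] {S Z : ι → Set ℂ} {q : ι → ℂ → ℂ}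
    {A : ι → ι → ℂ → ℂ} {a b : ι → ℝ} (hS : ∀ i, IsCompact (S i)) (hZ : ∀ i, IsCompact (Z i))
    (hA : ∀ i j, ContDiff ℝ 1 (A i j)) (hAZ : ∀ i j, ∀ z ∉ Z j, A i j z = 0)
    (hqS : ∀ i, ∀ z ∈ S i, AnalyticAt ℂ (q i) z) (hqZ : ∀ i, ∀ z ∈ Z i, AnalyticAt ℂ (q i) z)
    (ha0 : ∀ i, 0 ≤ a i) (hab : ∀ i, a i < b i) (ha : ∀ i, ∀ z ∈ S i, ‖q i z‖ ≤ a i)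
    (hb : ∀ i, ∀ z ∈ Z i, b i ≤ ‖q i z‖) :
    ∃ n : ℕ, ∀ φ : ι → ℂ → ℂ, (∀ i, ContDiff ℝ 1 (φ i)) → (∀ i, HasCompactSupport (φ i)) →
      ∃ ψ : ι → ℂ → ℂ, (∀ i, ContDiff ℝ 1 (ψ i)) ∧
        ∀ i z, ψ i z = φ i z - ∑ j, A i j z * wInt (S j) (q j) n (ψ j) z := by
  classical
  have hbpos : ∀ i, 0 < b i := fun i => (ha0 i).trans_lt (hab i)
  -- The bounds `a < b` on the weights keep `S` and `Z` apart, so the Cauchy kernel is bounded on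
  -- their product.
  have hdis : ∀ i, Disjoint (Z i) (S i) := fun i => Set.disjoint_left.2 fun z h1 h2 =>
    absurd ((hb i z h1).trans (ha i z h2)) (not_le.2 (hab i))
  choose δ hδ hδ' using fun i => (hdis i).exists_thickenings (hZ i) (hS i).isClosed
  have hdist : ∀ i, ∀ z ∈ Z i, ∀ w ∈ S i, δ i ≤ ‖z - w‖ := by
    intro i z hz w hw
    by_contra hlt
    push Not at hlt
    refine Set.disjoint_left.1 (hδ' i) (Metric.mem_thickening_iff.2 ⟨z, hz, ?_⟩)
      (Metric.self_subset_thickening (hδ i) _ hw)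
    rwa [dist_comm, dist_eq_norm]
  have hqc : ∀ i, ContinuousOn (q i) (S i) := fun i z hz => (hqS i z hz).continuousAt.continuousWithinAt
  have hAb : ∀ i j, ∃ M : ℝ, 0 ≤ M ∧ ∀ z, ‖A i j z‖ ≤ M := by
    intro i j
    obtain ⟨M, hM⟩ := (hZ j).exists_bound_of_continuousOn (hA i j).continuous.continuousOn
    refine ⟨max M 0, le_max_right _ _, fun z => ?_⟩
    by_cases hz : z ∈ Z j
    · exact (hM z hz).trans (le_max_left _ _)
    · rw [hAZ i j z hz, norm_zero]; exact le_max_right _ _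
  choose M hM0 hM using hAb
  -- The operator is smoothing: `A i j` lives on `Z j`, where the Cauchy integral over `S j` is
  -- analytic. Hence a merely continuous fixed point is automatically of class `C¹`.
  have hsm : ∀ ψ : ι → ℂ → ℂ, (∀ i, Continuous (ψ i)) → ∀ n i j,
      ContDiff ℝ 1 (fun z => A i j z * wInt (S j) (q j) n (ψ j) z) := by
    intro ψ hψ n i j
    refine contDiff_iff_contDiffAt.2 fun z => ?_
    by_cases hz : z ∈ Z j
    · have h1 := analyticAt_wInt n (hS j) (hqc j) (hψ j).continuousOn
        (Set.disjoint_left.1 (hdis j) hz) (hqZ j z hz)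
        (norm_pos_iff.1 ((hbpos j).trans_le (hb j z hz)))
      exact (hA i j).contDiffAt.mul (h1.contDiffAt.restrict_scalars ℝ)
    · refine ContDiffAt.congr_of_eventuallyEq (contDiffAt_const (c := (0 : ℂ))) ?_
      filter_upwards [(hZ j).isClosed.isOpen_compl.mem_nhds hz] with w hw
      rw [hAZ i j w hw, zero_mul]
  set N : ℝ := ∑ i, ∑ j, M i j * ((δ j)⁻¹ * volume.real (S j)) with hN
  have hN0 : 0 ≤ N := Finset.sum_nonneg fun i _ => Finset.sum_nonneg fun j _ =>
    mul_nonneg (hM0 i j) (mul_nonneg (inv_nonneg.2 (hδ j).le) measureReal_nonneg)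
  -- The factor `(a / b) ^ n` in the bound of the weighted integral beats the constant `N`, so the
  -- operator has norm at most one half. The exponent is fixed before `φ` is given; this matters
  -- because the right-hand side used later involves `z ^ n`.
  have hex : ∃ n : ℕ, ∀ j, (a j / b j) ^ n ≤ (2 * (N + 1))⁻¹ := by
    have h1 : ∀ j, ∀ᶠ n : ℕ in atTop, (a j / b j) ^ n ≤ (2 * (N + 1))⁻¹ := fun j =>
      (tendsto_pow_atTop_nhds_zero_of_lt_one (div_nonneg (ha0 j) (hbpos j).le)
        ((div_lt_one (hbpos j)).2 (hab j))).eventually_le_const (by positivity)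
    exact (eventually_all.2 h1).exists
  obtain ⟨n, hn⟩ := hex
  have hbound : ∀ ψ : ι → ℂ → ℂ, ∀ B : ℝ, 0 ≤ B → (∀ i z, ‖ψ i z‖ ≤ B) → ∀ i z,
      ‖∑ j, A i j z * wInt (S j) (q j) n (ψ j) z‖ ≤ B / 2 := by
    intro ψ B hB0 hB i z
    have hterm : ∀ j, ‖A i j z * wInt (S j) (q j) n (ψ j) z‖ ≤
        (M i j * ((δ j)⁻¹ * volume.real (S j))) * ((2 * (N + 1))⁻¹ * B) := by
      intro j
      by_cases hz : z ∈ Z j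
      · rw [norm_mul]
        have h1 := norm_wInt_le n (hS j) (hbpos j) (hδ j) (ha j) (hb j z hz) (hdist j z hz)
          (fun w _ => hB j w) (ha0 j) hB0
        have h3 : (0:ℝ) ≤ volume.real (S j) := measureReal_nonneg
        have h4 := hδ j
        calc ‖A i j z‖ * ‖wInt (S j) (q j) n (ψ j) z‖
            ≤ M i j * ((a j / b j) ^ n * (B * (δ j)⁻¹ * volume.real (S j))) := by
              gcongr
              · exact hM0 i j
              · exact hM i j z
          _ ≤ M i j * ((2 * (N + 1))⁻¹ * (B * (δ j)⁻¹ * volume.real (S j))) := by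
              gcongr
              · exact hM0 i j
              · exact hn j
          _ = _ := by ring
      · rw [hAZ i j z hz, zero_mul, norm_zero]
        have h3 : (0:ℝ) ≤ volume.real (S j) := measureReal_nonneg
        have h4 := hδ j
        have h5 := hM0 i j
        positivity
    have hle : ∑ j, M i j * ((δ j)⁻¹ * volume.real (S j)) ≤ N :=
      Finset.single_le_sum (f := fun i => ∑ j, M i j * ((δ j)⁻¹ * volume.real (S j)))
        (fun i _ => Finset.sum_nonneg fun j _ =>
          mul_nonneg (hM0 i j) (mul_nonneg (inv_nonneg.2 (hδ j).le) measureReal_nonneg))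
        (Finset.mem_univ i)
    calc _ ≤ ∑ j, ‖A i j z * wInt (S j) (q j) n (ψ j) z‖ := norm_sum_le _ _
      _ ≤ ∑ j, (M i j * ((δ j)⁻¹ * volume.real (S j))) * ((2 * (N + 1))⁻¹ * B) :=
        Finset.sum_le_sum fun j _ => hterm j
      _ = (∑ j, M i j * ((δ j)⁻¹ * volume.real (S j))) * ((2 * (N + 1))⁻¹ * B) := by
        rw [Finset.sum_mul]
      _ ≤ N * ((2 * (N + 1))⁻¹ * B) := by gcongr
      _ = (N / (N + 1)) * (B / 2) := by field_simp
      _ ≤ 1 * (B / 2) := by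
        gcongr
        exact (div_le_one (by positivity)).2 (by linarith)
      _ = B / 2 := one_mul _
  refine ⟨n, fun φ hφ hφc => ?_⟩
  obtain ⟨Bφ, hBφ⟩ : ∃ B : ℝ, ∀ z, ‖fun i => φ i z‖ ≤ B := by
    choose B hB using fun i => (hφ i).continuous.bounded_above_of_compact_support (hφc i)
    refine ⟨∑ i, |B i|, fun z => (pi_norm_le_iff_of_nonneg (by positivity)).2 fun i => ?_⟩
    exact (hB i z).trans ((le_abs_self _).trans
      (Finset.single_le_sum (f := fun i => |B i|) (fun i _ => abs_nonneg _) (Finset.mem_univ i)))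
  -- The integral equation is the fixed point equation of this map of bounded continuous functions,
  -- to which Banach's theorem applies.
  let T : BoundedContinuousFunction ℂ (ι → ℂ) → BoundedContinuousFunction ℂ (ι → ℂ) := fun ψ =>
    BoundedContinuousFunction.ofNormedAddCommGroup
      (fun z i => φ i z - ∑ j, A i j z * wInt (S j) (q j) n (fun w => ψ w j) z)
      (continuous_pi fun i => (hφ i).continuous.sub (continuous_finsetSum _ fun j _ =>
        (hsm (fun j w => ψ w j) (fun j => by fun_prop) n i j).continuous))
      (Bφ + ‖ψ‖ / 2) (fun z => (pi_norm_le_iff_of_nonneg (by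
        have := (norm_nonneg _).trans (hBφ 0); positivity)).2 fun i =>
        (norm_sub_le _ _).trans (add_le_add ((norm_le_pi_norm _ i).trans (hBφ z))
          (hbound (fun j w => ψ w j) ‖ψ‖ (norm_nonneg _) (fun i z =>
            (norm_le_pi_norm (ψ z) i).trans (ψ.norm_coe_le_norm z)) i z)))
  have hlin : ∀ (ψ ψ' : BoundedContinuousFunction ℂ (ι → ℂ)) j z, z ∈ Z j →
      wInt (S j) (q j) n (fun w => ψ w j) z - wInt (S j) (q j) n (fun w => ψ' w j) z =
      wInt (S j) (q j) n (fun w => ψ w j - ψ' w j) z := by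
    intro ψ ψ' j z hz
    have hInt : ∀ ψ : BoundedContinuousFunction ℂ (ι → ℂ), IntegrableOn
        (fun w => q j w ^ n * ψ w j * (2 * Real.pi * (z - w))⁻¹) (S j) := by
      intro ψ
      refine ContinuousOn.integrableOn_compact (hS j) ?_
      refine (((hqc j).pow n).mul (by fun_prop)).mul (ContinuousOn.inv₀ (by fun_prop) fun w hw => ?_)
      refine mul_ne_zero (by exact_mod_cast Real.two_pi_pos.ne') (sub_ne_zero.2 fun h => ?_)
      exact Set.disjoint_left.1 (hdis j) hz (h ▸ hw)
    rw [wInt, wInt, wInt, ← mul_sub, ← integral_sub (hInt ψ) (hInt ψ')]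
    congr 2
    funext w
    ring
  have hT : ContractingWith (1 / 2) T := by
    refine ⟨by norm_num, LipschitzWith.of_dist_le_mul fun ψ ψ' => ?_⟩
    rw [BoundedContinuousFunction.dist_le (by positivity)]
    intro z
    rw [dist_eq_norm, pi_norm_le_iff_of_nonneg (by positivity)]
    intro i
    have h1 : (T ψ z - T ψ' z) i = -∑ j, A i j z *
        wInt (S j) (q j) n (fun w => ψ w j - ψ' w j) z := by
      change (φ i z - _) - (φ i z - _) = _
      rw [sub_sub_sub_cancel_left, ← Finset.sum_sub_distrib, ← Finset.sum_neg_distrib]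
      refine Finset.sum_congr rfl fun j _ => ?_
      by_cases hz : z ∈ Z j
      · rw [← hlin ψ ψ' j z hz]; ring
      · rw [hAZ i j z hz]; ring
    rw [h1, norm_neg]
    refine (hbound (fun j w => ψ w j - ψ' w j) (dist ψ ψ') dist_nonneg (fun i z => ?_) i z).trans ?_
    · rw [← dist_eq_norm]
      exact (dist_le_pi_dist _ _ i).trans (BoundedContinuousFunction.dist_coe_le_dist z)
    · simp only [one_div, NNReal.coe_inv, NNReal.coe_ofNat]
      linarith
  set ψ := hT.fixedPoint T with hψ
  have hfix : T ψ = ψ := hT.fixedPoint_isFixedPt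
  have heq : ∀ i z, ψ z i = φ i z - ∑ j, A i j z * wInt (S j) (q j) n (fun w => ψ w j) z := by
    intro i z
    conv_lhs => rw [← hfix]
    rfl
  refine ⟨fun i z => ψ z i, fun i => ?_, heq⟩
  have : (fun z => ψ z i) = fun z =>
      φ i z - ∑ j, A i j z * wInt (S j) (q j) n (fun w => ψ w j) z := funext (heq i)
  change ContDiff ℝ 1 (fun z => ψ z i)
  rw [this]
  exact (hφ i).sub (ContDiff.sum fun j _ => hsm (fun j w => ψ w j) (fun j => by fun_prop) n i j)

end MinLaplace

namespace MinLaplace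

open MeasureTheory Filter Set

universe u

/-! ### Meromorphic sections of a bundle -/

/-- A finite cover of the complex line by open sets with frames (one of them a neighbourhood of
infinity), with a partition of unity `χ` and cut-off functions `χ'`, and functions `q` that
separate the support of `χ` from that of the derivatives of `χ'`. -/
structure Patch {r : ℕ} (E : HolBundle.{u} r) where
  J : Type
  [fin : Fintype J]
  o : J
  U : J → Set CP1
  e : J → Fin r → ∀ y, E.Fib y
  frame : ∀ j, E.IsFrame (U j) (e j)
  χ : J → ℂ → ℂ
  χ' : J → ℂ → ℂ
  χ_smooth : ∀ j, ContDiff ℝ 1 (χ j)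
  χ'_smooth : ∀ j, ContDiff ℝ 2 (χ' j)
  χ_sum : ∀ z, ∑ j, χ j z = 1
  χ_supp : ∀ j, ∀ z ∈ tsupport (χ j), (z : CP1) ∈ U j
  χ'_supp : ∀ j, ∀ z ∈ tsupport (χ' j), (z : CP1) ∈ U j
  S : J → Set ℂ
  Z : J → Set ℂ
  S_compact : ∀ j, IsCompact (S j)
  Z_compact : ∀ j, IsCompact (Z j)
  χ'_one : ∀ j, ∀ z ∈ S j, χ' j z = 1
  dbar_χ' : ∀ j, ∀ z ∉ Z j, dbar (χ' j) z = 0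
  S_supp : ∀ i j, ∀ z ∉ S j, χ j z * dbar (χ' i) z = 0
  q : J → ℂ → ℂ
  q_S : ∀ j, ∀ z ∈ S j, AnalyticAt ℂ (q j) z
  q_Z : ∀ j, ∀ z ∈ Z j, AnalyticAt ℂ (q j) z
  a : J → ℝ
  b : J → ℝ
  a_nonneg : ∀ j, 0 ≤ a j
  a_lt_b : ∀ j, a j < b j
  q_le : ∀ j, ∀ z ∈ S j, ‖q j z‖ ≤ a j
  le_q : ∀ j, ∀ z ∈ Z j, b j ≤ ‖q j z‖
  infty_mem : OnePoint.infty ∈ U o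
  χ'_o : ∀ᶠ z in nf OnePoint.infty, χ' o z = 1
  χ'_ne : ∀ j, j ≠ o → ∀ᶠ z in nf OnePoint.infty, χ' j z = 0
  poly : ∀ n : ℕ, ∃ (Q : Polynomial ℂ) (Qj : J → Polynomial ℂ), Q ≠ 0 ∧
    Qj o = Q * Polynomial.X ^ n ∧
    ∀ j, ∀ z ∈ S j ∪ Z j, Q.eval z = (Qj j).eval z * q j z ^ n

attribute [instance] Patch.fin

namespace Patch

variable {r : ℕ} {E : HolBundle.{u} r} (p : Patch E)

/-- The coefficients of the frame `i` in the frame `j`. -/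
def τ (j i : p.J) (l k : Fin r) (z : ℂ) : ℂ :=
  coef (fun m => p.e j m (z : CP1)) (p.e i l (z : CP1)) k

theorem analyticAt_coef {U : Set CP1} {e : Fin r → ∀ y, E.Fib y} (he : E.IsFrame U e) {z : ℂ}
    (hz : (z : CP1) ∈ U) {s : ∀ y, E.Fib y} (hs : E.IsHol s (z : CP1)) (k : Fin r) :
    AnalyticAt ℂ (fun w : ℂ => coef (fun m => e m (w : CP1)) (s w) k) z := by
  obtain ⟨f, hf, hfs⟩ := (he.isHol_iff hz s).1 hs
  refine (holAt_coe.1 (hf k)).congr ?_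
  rw [EventuallyEq, ← nf_coe]
  filter_upwards [eventually_nf_of_nhds hfs, eventually_nf_of_nhds (he.1.mem_nhds hz)] with w h1 h2
  rw [(he.isB h2).eq_coef h1]

/-- A cut-off transition function is smooth. -/
theorem cut {j i : p.J} (l k : Fin r) {c : ℂ → ℂ} {n : ℕ} (hc : ContDiff ℝ n c) {z : ℂ}
    (hs : z ∈ tsupport c → (z : CP1) ∈ p.U i) (hz : (z : CP1) ∈ p.U j) :
    ContDiffAt ℝ n (fun w => c w * p.τ j i l k w) z ∧
      (n ≠ 0 → ∀ᶠ w in 𝓝 z, dbar (fun w => c w * p.τ j i l k w) w = dbar c w * p.τ j i l k w) := by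
  by_cases h : z ∈ tsupport c
  · have h1 : AnalyticAt ℂ (p.τ j i l k) z :=
      analyticAt_coef (p.frame j) hz (((p.frame i).2 _ (hs h)).2.2 l) k
    refine ⟨hc.contDiffAt.mul (h1.contDiffAt.restrict_scalars ℝ), fun hn => ?_⟩
    filter_upwards [h1.eventually_analyticAt] with w hw
    rw [dbar_mul (hc.differentiable (by exact_mod_cast hn) w)
      (hw.differentiableAt.restrictScalars ℝ), dbar_eq_zero hw.differentiableAt, mul_zero, add_zero]
  · have h0 : ∀ᶠ w in 𝓝 z, c w = 0 := notMem_tsupport_iff_eventuallyEq.1 h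
    refine ⟨ContDiffAt.congr_of_eventuallyEq (contDiffAt_const (c := (0 : ℂ)))
      (h0.mono fun w hw => by simp only [hw, zero_mul]), fun _ => ?_⟩
    filter_upwards [h0.eventually_nhds] with w hw
    rw [dbar_congr (g := fun _ => 0) (hw.mono fun v hv => by simp only [hv, zero_mul]),
      dbar_congr (g := fun _ => 0) hw, dbar_eq_zero (differentiableAt_const _), zero_mul]

/-- The coefficient of the integral equation. -/
def A (x y : p.J × Fin r) (z : ℂ) : ℂ := p.χ x.1 z * (dbar (p.χ' y.1) z * p.τ x.1 y.1 y.2 x.2 z)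

theorem tsupport_dbar {f : ℂ → ℂ} {z : ℂ} (hz : z ∈ tsupport (dbar f)) : z ∈ tsupport f := by
  by_contra h
  refine (notMem_tsupport_iff_eventuallyEq.2 ?_) hz
  filter_upwards [(notMem_tsupport_iff_eventuallyEq.1 h).eventually_nhds] with w hw
  rw [dbar_congr (g := fun _ => 0) hw, dbar_eq_zero (differentiableAt_const _)]; rfl

/-- A transition function has a meaning only where both frames are defined; the supports of `χ j`
and `c` lie there, so the product extends smoothly by zero. -/
theorem contDiff_cut {j i : p.J} (l k : Fin r) {c : ℂ → ℂ} (hc : ContDiff ℝ 1 c)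
    (hs : ∀ z ∈ tsupport c, (z : CP1) ∈ p.U i) :
    ContDiff ℝ 1 (fun z => p.χ j z * (c z * p.τ j i l k z)) := by
  refine contDiff_iff_contDiffAt.2 fun z => ?_
  by_cases h : z ∈ tsupport (p.χ j)
  · exact (p.χ_smooth j).contDiffAt.mul
      (p.cut (n := 1) l k hc (hs z) (p.χ_supp j z h)).1
  · refine ContDiffAt.congr_of_eventuallyEq (contDiffAt_const (c := (0 : ℂ))) ?_
    filter_upwards [notMem_tsupport_iff_eventuallyEq.1 h] with w hw
    rw [hw, Pi.zero_apply, zero_mul]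

/-- For every vector of the frame at infinity there is a section of the bundle over the complex
line, whose leading term at infinity is a multiple of this vector. -/
theorem exists_sections : ∃ (Q : Polynomial ℂ) (σ : Fin r → ∀ y, E.Fib y)
    (G : Fin r → Fin r → ℂ → ℂ), Q ≠ 0 ∧ (∀ l (z : ℂ), E.IsHol (σ l) (z : CP1)) ∧
    (∀ l k, AnalyticAt ℂ (G l k) 0 ∧ G l k 0 = if k = l then 1 else 0) ∧
    ∀ l, ∀ᶠ z : ℂ in nf OnePoint.infty,
      σ l (z : CP1) = Q.eval z • ∑ k, G l k z⁻¹ • p.e p.o k (z : CP1) := by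
  classical
  -- Each section is sought as the sum over the frames of `χ' * coeA * e`. Here `coeA` is the vector
  -- `Q * z ^ n` in the chosen direction at infinity, minus `Qj * c` with `c` the Cauchy transform
  -- of `q ^ n * ψ`. Its Cauchy–Riemann equation becomes the integral equation for `ψ`: on `S`,
  -- where `χ' = 1`, one has `Qj * q ^ n = Q`, and on `Z`, where `χ'` varies, `Qj * c` is `Q` times
  -- the weighted integral of `ψ`.
  obtain ⟨n, hn⟩ := exists_solution (ι := p.J × Fin r) (S := fun x => p.S x.1) (Z := fun x => p.Z x.1)
    (q := fun x => p.q x.1) (A := p.A) (a := fun x => p.a x.1) (b := fun x => p.b x.1)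
    (fun x => p.S_compact _) (fun x => p.Z_compact _)
    (fun x y => p.contDiff_cut _ _ (contDiff_dbar (p.χ'_smooth y.1))
      fun z hz => p.χ'_supp _ _ (tsupport_dbar hz))
    (fun x y z hz => by simp only [A, p.dbar_χ' _ z hz]; ring)
    (fun x => p.q_S _) (fun x => p.q_Z _) (fun x => p.a_nonneg _) (fun x => p.a_lt_b _)
    (fun x => p.q_le _) (fun x => p.le_q _)
  obtain ⟨Q, Qj, hQ0, hQo, hQ⟩ := p.poly n
  have hphi := fun l : Fin r => hn
    (fun x z => p.χ x.1 z * ((z ^ n * dbar (p.χ' p.o) z) * p.τ x.1 p.o l x.2 z))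
    (fun x => p.contDiff_cut _ _ ((by fun_prop : ContDiff ℝ 1 fun z : ℂ => z ^ n).mul
        (contDiff_dbar (p.χ'_smooth _))) fun z hz => p.χ'_supp _ _
          (tsupport_dbar (tsupport_mul_subset_right hz)))
    (fun x => HasCompactSupport.intro (p.Z_compact p.o) fun z hz => by
      rw [p.dbar_χ' _ z hz]; ring)
  choose ψ hψ hψeq using hphi
  have hψS : ∀ l x, ∀ z ∉ p.S x.1, ψ l x z = 0 := by
    intro l x z hz
    rw [hψeq, Finset.sum_eq_zero, sub_zero]
    · linear_combination (z ^ n * p.τ x.1 p.o l x.2 z) * p.S_supp p.o x.1 z hz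
    · intro y _
      rw [A, ← mul_assoc, p.S_supp y.1 x.1 z hz]; ring
  set Ψ : Fin r → p.J × Fin r → ℂ → ℂ := fun l x w => p.q x.1 w ^ n * ψ l x w with hΨ
  have hΨS : ∀ l x, ∀ z ∉ p.S x.1, Ψ l x z = 0 := fun l x z hz => by
    simp only [hΨ, hψS l x z hz, mul_zero]
  have hΨc : ∀ l x, HasCompactSupport (Ψ l x) := fun l x =>
    HasCompactSupport.intro (p.S_compact x.1) (hΨS l x)
  have hΨd : ∀ l x, ContDiff ℝ 1 (Ψ l x) := by
    intro l x
    refine contDiff_iff_contDiffAt.2 fun z => ?_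
    by_cases hz : z ∈ p.S x.1
    · exact (((p.q_S _ z hz).contDiffAt.restrict_scalars ℝ).pow n).mul (hψ l x).contDiffAt
    · refine ContDiffAt.congr_of_eventuallyEq (contDiffAt_const (c := (0 : ℂ))) ?_
      filter_upwards [(p.S_compact x.1).isClosed.isOpen_compl.mem_nhds hz] with w hw
      exact hΨS l x w hw
  set c : Fin r → p.J × Fin r → ℂ → ℂ := fun l x => cauchyTr (Ψ l x) with hc
  have hcd : ∀ l x z, DifferentiableAt ℝ (c l x) z ∧ dbar (c l x) z = Ψ l x z := fun l x z =>
    hasFDerivAt_cauchyTr (hΨd l x) (hΨc l x) z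
  have hcw : ∀ l x z, z ∈ p.Z x.1 → (Qj x.1).eval z * c l x z =
      Q.eval z * wInt (p.S x.1) (p.q x.1) n (ψ l x) z := by
    intro l x z hz
    have h0 : p.q x.1 z ^ n ≠ 0 := pow_ne_zero n (norm_pos_iff.1
      (((p.a_nonneg x.1).trans_lt (p.a_lt_b x.1)).trans_le (p.le_q _ z hz)))
    rw [hQ x.1 z (Or.inr hz), wInt, hc]
    simp only
    rw [cauchyTr_eq_setIntegral (hΨS l x)]
    field_simp
    rfl
  let coeA : Fin r → p.J × Fin r → ℂ → ℂ := fun l x z =>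
    (if x = (p.o, l) then Q.eval z * z ^ n else 0) - (Qj x.1).eval z * c l x z
  let σ : Fin r → ∀ y, E.Fib y := fun l y => OnePoint.rec (C := fun y => E.Fib y) 0 (fun z =>
    ∑ x : p.J × Fin r, (p.χ' x.1 z * coeA l x z) • p.e x.1 x.2 (z : CP1)) y
  have hσ : ∀ l (z : ℂ), σ l (z : CP1) =
    ∑ x : p.J × Fin r, (p.χ' x.1 z * coeA l x z) • p.e x.1 x.2 (z : CP1) := fun l z => rfl
  have hA : ∀ l x z, DifferentiableAt ℝ (coeA l x) z ∧
      dbar (coeA l x) z = -((Qj x.1).eval z * Ψ l x z) := by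
    intro l x z
    have h1 : DifferentiableAt ℂ (fun z => if x = (p.o, l) then Q.eval z * z ^ n else 0) z := by
      split_ifs <;> fun_prop
    have h2 : DifferentiableAt ℂ (fun z => (Qj x.1).eval z) z := by fun_prop
    have h3 : DifferentiableAt ℝ (fun z => (Qj x.1).eval z * c l x z) z :=
      (h2.restrictScalars ℝ).mul (hcd l x z).1
    refine ⟨(h1.restrictScalars ℝ).sub h3, ?_⟩
    rw [dbar_sub (h1.restrictScalars ℝ) h3, dbar_eq_zero h1, dbar_mul (h2.restrictScalars ℝ)
      (hcd l x z).1, dbar_eq_zero h2, (hcd l x z).2]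
    ring
  refine ⟨Q * Polynomial.X ^ n, σ, ?_⟩
  have hKo : ∀ l k, ∃ G : ℂ → ℂ, AnalyticAt ℂ G 0 ∧ G 0 = 0 ∧ ∀ z : ℂ, z ≠ 0 →
      c l (p.o, k) z = G z⁻¹ := by
    intro l k
    obtain ⟨G, h1, h2, h3⟩ := cauchyInt_infty (p.S_compact p.o) (g := Ψ l (p.o, k))
      (hΨd l _).continuous.continuousOn
    exact ⟨G, h1, h2, fun z hz => by
      rw [← h3 z hz, hc]; simp only; rw [cauchyTr_eq_setIntegral (hΨS l (p.o, k))]⟩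
  choose G hG hG0 hGc using hKo
  refine ⟨fun l k t => (if k = l then 1 else 0) - G l k t, mul_ne_zero hQ0 (by simp), ?_,
    fun l k => ⟨analyticAt_const.fun_sub (hG l k), by simp [hG0]⟩, ?_⟩
  · intro l z₀
    obtain ⟨j, hj⟩ : ∃ j, p.χ j z₀ ≠ 0 := by
      by_contra h
      push Not at h
      simpa [h] using p.χ_sum z₀
    have hjU : (z₀ : CP1) ∈ p.U j := p.χ_supp j z₀ (subset_tsupport _ hj)
    have hev : ∀ᶠ w : ℂ in 𝓝 z₀, (w : CP1) ∈ p.U j := by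
      rw [← nf_coe]; exact eventually_nf_of_nhds ((p.frame j).1.mem_nhds hjU)
    refine ((p.frame j).isHol_iff hjU _).2 ⟨fun k y => coef (fun m => p.e j m y) (σ l y) k,
      fun k => holAt_coe.2 ?_, ?_⟩
    · have hexp : ∀ᶠ w : ℂ in 𝓝 z₀, coef (fun m => p.e j m (w : CP1)) (σ l (w : CP1)) k =
          ∑ x : p.J × Fin r, coeA l x w * (p.χ' x.1 w * p.τ j x.1 x.2 k w) := by
        filter_upwards with w
        rw [hσ, map_sum, Finset.sum_apply]
        refine Finset.sum_congr rfl fun x _ => ?_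
        rw [map_smul, Pi.smul_apply, smul_eq_mul, τ]; ring
      refine AnalyticAt.congr (f := fun w =>
        ∑ x : p.J × Fin r, coeA l x w * (p.χ' x.1 w * p.τ j x.1 x.2 k w)) ?_
        (hexp.mono fun w hw => hw.symm)
      refine analyticAt_of_dbar_eq_zero ?_
      filter_upwards [hev] with w hw
      have hd : ∀ x : p.J × Fin r, DifferentiableAt ℝ (fun w => p.χ' x.1 w * p.τ j x.1 x.2 k w) w :=
        fun x => ((p.cut (n := 2) x.2 k (p.χ'_smooth x.1) (p.χ'_supp x.1 w) hw).1).differentiableAt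
          (by norm_num)
      have hdb : ∀ x : p.J × Fin r, dbar (fun w => p.χ' x.1 w * p.τ j x.1 x.2 k w) w =
          dbar (p.χ' x.1) w * p.τ j x.1 x.2 k w := fun x =>
        ((p.cut (n := 2) x.2 k (p.χ'_smooth x.1) (p.χ'_supp x.1 w) hw).2 (by norm_num)).self_of_nhds
      refine ⟨DifferentiableAt.fun_sum fun x _ => (hA l x w).1.fun_mul (hd x), ?_⟩
      rw [dbar_sum fun x _ => (hA l x w).1.fun_mul (hd x)]
      simp only [fun x => dbar_mul (hA l x w).1 (hd x), hdb, fun x => (hA l x w).2]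
      -- the sum over the frames of the solution of the integral equation
      set B : E.Fib (w : CP1) := ∑ x : p.J × Fin r, (dbar (p.χ' x.1) w * coeA l x w) •
        p.e x.1 x.2 (w : CP1) with hB
      have hcB : ∀ i k, coef (fun m => p.e i m (w : CP1)) B k =
          ∑ x : p.J × Fin r, coeA l x w * (dbar (p.χ' x.1) w * p.τ i x.1 x.2 k w) := by
        intro i k
        rw [hB, map_sum, Finset.sum_apply]
        refine Finset.sum_congr rfl fun x _ => ?_
        rw [map_smul, Pi.smul_apply, smul_eq_mul, τ]; ring
      -- The integral equation says that `Q * ψ` consists of the coordinates of `B` in the various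
      -- frames, cut off by the partition of unity. Summed over the partition this is `B`, so the
      -- derivatives of the cut-offs cancel those of the Cauchy transforms.
      have hψB : ∀ x : p.J × Fin r, Q.eval w * ψ l x w =
          p.χ x.1 w * coef (fun m => p.e x.1 m (w : CP1)) B x.2 := by
        intro x
        rw [hψeq, hcB, mul_sub, Finset.mul_sum, Finset.mul_sum]
        have h1 : ∀ y : p.J × Fin r, Q.eval w * (p.A x y w *
            wInt (p.S y.1) (p.q y.1) n (ψ l y) w) = p.χ x.1 w *
            ((Qj y.1).eval w * c l y w * (dbar (p.χ' y.1) w * p.τ x.1 y.1 y.2 x.2 w)) := by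
          intro y
          by_cases hz : w ∈ p.Z y.1
          · rw [hcw l y w hz, A]; ring
          · rw [A, p.dbar_χ' _ w hz]; ring
        simp only [h1]
        have h2 : ∀ y : p.J × Fin r, p.χ x.1 w * (coeA l y w *
            (dbar (p.χ' y.1) w * p.τ x.1 y.1 y.2 x.2 w)) =
            (if y = (p.o, l) then p.χ x.1 w * (Q.eval w * w ^ n *
              (dbar (p.χ' y.1) w * p.τ x.1 y.1 y.2 x.2 w)) else 0) - p.χ x.1 w *
            ((Qj y.1).eval w * c l y w * (dbar (p.χ' y.1) w * p.τ x.1 y.1 y.2 x.2 w)) := by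
          intro y
          simp only [coeA]
          split_ifs <;> ring
        simp only [h2, Finset.sum_sub_distrib, Finset.sum_ite_eq', Finset.mem_univ, if_true]
        ring
      have hterm : ∀ x : p.J × Fin r, -((Qj x.1).eval w * Ψ l x w) *
          (p.χ' x.1 w * p.τ j x.1 x.2 k w) = -(Q.eval w * ψ l x w * p.τ j x.1 x.2 k w) := by
        intro x
        by_cases hz : w ∈ p.S x.1
        · rw [p.χ'_one _ w hz, hQ x.1 w (Or.inl hz), hΨ]; ring
        · rw [hΨS l x w hz, hψS l x w hz]; ring
      simp only [hterm, Finset.sum_add_distrib, ← hcB]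
      have hsum : ∑ x : p.J × Fin r, (Q.eval w * ψ l x w) • p.e x.1 x.2 (w : CP1) = B := by
        simp only [hψB]
        rw [Fintype.sum_prod_type]
        have h1 : ∀ i : p.J, ∑ m, (p.χ i w * coef (fun m => p.e i m (w : CP1)) B m) •
            p.e i m (w : CP1) = p.χ i w • B := by
          intro i
          by_cases hi : p.χ i w = 0
          · simp [hi]
          · have hiU := p.χ_supp i w (subset_tsupport _ hi)
            simp only [mul_smul, ← Finset.smul_sum, ((p.frame i).isB hiU).sum_coef B]
        simp only [h1, ← Finset.sum_smul, p.χ_sum, one_smul]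
      have hfin : coef (fun m => p.e j m (w : CP1)) B k =
          ∑ x : p.J × Fin r, Q.eval w * ψ l x w * p.τ j x.1 x.2 k w := by
        conv_lhs => rw [← hsum, map_sum, Finset.sum_apply]
        refine Finset.sum_congr rfl fun x _ => ?_
        rw [map_smul, Pi.smul_apply, smul_eq_mul, τ]
      rw [hfin, Finset.sum_neg_distrib]
      ring
    · filter_upwards [(p.frame j).1.mem_nhds hjU] with y hy
      exact (((p.frame j).isB hy).sum_coef _).symm
  -- Near infinity only the frame `o` contributes, with coefficients `Q * z ^ n` times the identity
  -- matrix minus Cauchy transforms, and the latter vanish at infinity.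
  · intro l
    filter_upwards [p.χ'_o, eventually_all.2 fun j => eventually_imp_distrib_left.2 (p.χ'_ne j),
      eventually_infty_ne_zero] with z h1 h2 h3
    rw [hσ, Fintype.sum_prod_type, Finset.sum_eq_single p.o]
    · rw [Finset.smul_sum]
      refine Finset.sum_congr rfl fun k _ => ?_
      rw [h1, smul_smul]
      congr 1
      simp only [coeA, Prod.mk.injEq, true_and, hQo, hGc l k z h3, Polynomial.eval_mul,
        Polynomial.eval_pow, Polynomial.eval_X]
      split_ifs <;> ring
    · intro j _ hj
      simp [h2 j hj]
    · simp

end Patch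

end MinLaplace

/-! ### Cut-off functions, partitions of unity and the existence of patches. -/

namespace MinLaplace

open MeasureTheory Filter Set

universe u

open scoped Manifold ContDiff

/-- A smooth cut-off function, as a complex function. -/
theorem exists_bump (c : ℂ) {ρ ρ' : ℝ} (h : 0 < ρ) (h' : ρ < ρ') :
    ∃ β : ℂ → ℂ, ContDiff ℝ 2 β ∧ (∀ z ∈ Metric.closedBall c ρ, β z = 1) ∧
      (∀ z ∉ Metric.ball c ρ', β z = 0) ∧
      ∀ z ∉ Metric.closedBall c ρ' \ Metric.ball c ρ, dbar β z = 0 := by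
  let b : ContDiffBump c := ⟨ρ, ρ', h, h'⟩
  have h1 : ∀ z ∈ Metric.closedBall c ρ, ((b z : ℝ) : ℂ) = 1 := fun z hz => by
    rw [b.one_of_mem_closedBall hz]; simp
  have h0 : ∀ z ∉ Metric.ball c ρ', ((b z : ℝ) : ℂ) = 0 := fun z hz => by
    have : b z = 0 := by
      by_contra hne
      have : z ∈ Function.support b := hne
      rw [b.support_eq] at this
      exact hz this
    rw [this]; simp
  refine ⟨fun z => ((b z : ℝ) : ℂ), ?_, h1, h0, fun z hz => ?_⟩
  · exact Complex.ofRealCLM.contDiff.comp (b.contDiff (n := 2))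
  · rw [Set.mem_sdiff, not_and_or, not_not] at hz
    rcases hz with hz | hz
    · rw [dbar_congr (g := fun _ => 0), dbar_eq_zero (differentiableAt_const _)]
      filter_upwards [Metric.isClosed_closedBall.isOpen_compl.mem_nhds hz] with w hw
      exact h0 w fun hw' => hw (Metric.ball_subset_closedBall hw')
    · rw [dbar_congr (g := fun _ => 1), dbar_eq_zero (differentiableAt_const _)]
      filter_upwards [Metric.isOpen_ball.mem_nhds hz] with w hw
      exact h1 w (Metric.ball_subset_closedBall hw)

theorem dbar_const_sub {f : ℂ → ℂ} (z : ℂ) (hf : DifferentiableAt ℝ f z) :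
    dbar (fun w => 1 - f w) z = - dbar f z := by
  rw [dbar_sub (differentiableAt_const _) hf, dbar_eq_zero (differentiableAt_const _), zero_sub]

/-- A smooth partition of unity by complex functions, for a finite cover of the complex line. -/
theorem exists_partition {J : Type} [Fintype J] {V : J → Set ℂ} (hV : ∀ j, IsOpen (V j))
    (hc : ∀ z, ∃ j, z ∈ V j) : ∃ χ : J → ℂ → ℂ, (∀ j, ContDiff ℝ 2 (χ j)) ∧
      (∀ j, tsupport (χ j) ⊆ V j) ∧ ∀ z, ∑ j, χ j z = 1 := by
  obtain ⟨f, hf⟩ := SmoothPartitionOfUnity.exists_isSubordinate 𝓘(ℝ, ℂ) (s := (univ : Set ℂ))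
    isClosed_univ V hV (fun z _ => mem_iUnion.2 (hc z))
  refine ⟨fun j z => ((f j z : ℝ) : ℂ), fun j => ?_, fun j => ?_, fun z => ?_⟩
  · have h1 : ContDiff ℝ ∞ (f j) := contMDiff_iff_contDiff.1 (f j).contMDiff
    exact Complex.ofRealCLM.contDiff.comp (contDiff_infty.1 h1 2)
  · refine (closure_mono ?_).trans (hf j)
    intro z hz
    simpa using hz
  · have := f.sum_eq_one (mem_univ z)
    rw [finsum_eq_sum_of_fintype] at this
    simp only
    exact_mod_cast congrArg (fun x : ℝ => (x : ℂ)) this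

/-- For a disc with centre `c`, the partition lives within radius `ρ` and the cut-off varies between
`2 * ρ` and `3 * ρ`, so the weight `z - c` is smaller on `S` than on `Z`. At infinity the roles are
reversed: `χ` lives outside the radius `R + 3`, the cut-off varies between `R + 1` and `R + 2`, and
the weight is `1 / z`. -/
theorem exists_patch {r : ℕ} (E : HolBundle.{u} r) : Nonempty (Patch E) := by
  classical
  obtain ⟨Ui, ei, hUi, hei, -⟩ := E.exists_isFrame OnePoint.infty
  have hcob : ∀ᶠ z : ℂ in Bornology.cobounded ℂ, (z : CP1) ∈ Ui := by
    rw [← nf_infty]; exact eventually_nf_of_nhds (hei.1.mem_nhds hUi)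
  obtain ⟨R₁, hR₁⟩ := (Metric.hasBasis_cobounded_compl_closedBall (0 : ℂ)).eventually_iff.1 hcob
  obtain ⟨R, hRp, hR⟩ : ∃ R : ℝ, 0 < R ∧ ∀ z : ℂ, R < ‖z‖ → (z : CP1) ∈ Ui :=
    ⟨max R₁ 1, lt_max_of_lt_right one_pos, fun z hz => hR₁.2 (by
      simpa using (le_max_left _ _).trans_lt hz)⟩
  choose Uf ef hUf hef _ using fun z : ℂ => E.exists_isFrame (z : CP1)
  have hρ : ∀ z : ℂ, ∃ ρ : ℝ, 0 < ρ ∧ ∀ w ∈ Metric.closedBall z (3 * ρ), (w : CP1) ∈ Uf z := by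
    intro z
    have h1 : ∀ᶠ w : ℂ in 𝓝 z, (w : CP1) ∈ Uf z := by
      rw [← nf_coe]; exact eventually_nf_of_nhds ((hef z).1.mem_nhds (hUf z))
    obtain ⟨ε, hε, h2⟩ := Metric.nhds_basis_closedBall.eventually_iff.1 h1
    exact ⟨ε / 3, by positivity, fun w hw => h2 (by rwa [mul_div_cancel₀ _ (by norm_num)] at hw)⟩
  choose ρ hρ hρU using hρ
  obtain ⟨T, -, hT⟩ := (isCompact_closedBall (0 : ℂ) (R + 4)).elim_nhds_subcover
    (fun z => Metric.ball z (ρ z)) fun z _ => Metric.ball_mem_nhds z (hρ z)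
  -- The partition function at infinity has unbounded support, but it only matters where some
  -- cut-off varies. Truncation at a radius that encloses all the sets `Z` makes the `S` of infinity
  -- compact.
  obtain ⟨R₂, hR₂⟩ : ∃ R₂ : ℝ, R + 2 ≤ R₂ ∧ ∀ c ∈ T, Metric.closedBall c (3 * ρ c) ⊆
      Metric.closedBall 0 R₂ := by
    have : Bornology.IsBounded (⋃ c ∈ T, Metric.closedBall c (3 * ρ c)) :=
      (Bornology.isBounded_biUnion_finset T).2 fun c _ => Metric.isBounded_closedBall
    obtain ⟨R', hR'⟩ := this.subset_closedBall 0
    refine ⟨max R' (R + 2), le_max_right _ _, fun c hc => ?_⟩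
    refine (subset_iUnion₂_of_subset c hc subset_rfl).trans (hR'.trans ?_)
    exact Metric.closedBall_subset_closedBall (le_max_left _ _)
  let V : Option T → Set ℂ := fun j => j.elim (Metric.closedBall 0 (R + 3))ᶜ
    fun c => Metric.ball c (ρ c)
  obtain ⟨χ, hχ, hχs, hχ1⟩ := exists_partition (V := V) (fun j => by
      cases j
      · exact Metric.isClosed_closedBall.isOpen_compl
      · exact Metric.isOpen_ball) (fun z => by
      by_cases hz : z ∈ Metric.closedBall (0 : ℂ) (R + 3)
      · have hz' : z ∈ Metric.closedBall (0 : ℂ) (R + 4) :=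
          Metric.closedBall_subset_closedBall (by linarith) hz
        obtain ⟨c, hc, hzc⟩ := mem_iUnion₂.1 (hT hz')
        exact ⟨some ⟨c, hc⟩, hzc⟩
      · exact ⟨none, hz⟩)
  choose β hβ hβ1 hβ0 hβd using fun c : ℂ =>
    exists_bump c (ρ := 2 * ρ c) (ρ' := 3 * ρ c) (by linarith [hρ c]) (by linarith [hρ c])
  obtain ⟨βi, hβi, hβi1, hβi0, hβid⟩ := exists_bump 0 (ρ := R + 1) (ρ' := R + 2) (by linarith)
    (by linarith)
  have hcl : ∀ {f : ℂ → ℂ} {K : Set ℂ}, IsClosed K → (∀ z ∉ K, f z = 0) → tsupport f ⊆ K :=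
    fun hK h => closure_minimal (fun z hz => by_contra fun h' => hz (h z h')) hK
  let S : Option T → Set ℂ := fun j => j.elim
    (Metric.closedBall 0 R₂ ∩ (Metric.ball 0 (R + 3))ᶜ) fun c => Metric.closedBall c (ρ c)
  let Z : Option T → Set ℂ := fun j => j.elim
    (Metric.closedBall 0 (R + 2) \ Metric.ball 0 (R + 1))
    fun c => Metric.closedBall (c : ℂ) (3 * ρ c) \ Metric.ball (c : ℂ) (2 * ρ c)
  let χ' : Option T → ℂ → ℂ := fun j => j.elim (fun z => 1 - βi z) fun c => β c
  have hdχ' : ∀ j, ∀ z ∉ Z j, dbar (χ' j) z = 0 := by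
    rintro (_ | c) z hz
    · change dbar (fun z => 1 - βi z) z = 0
      rw [dbar_const_sub z (hβi.differentiable (by norm_num) z), hβid z hz, neg_zero]
    · exact hβd c z hz
  have hZR : ∀ j, Z j ⊆ Metric.closedBall 0 R₂ := by
    rintro (_ | c)
    · exact sdiff_subset.trans (Metric.closedBall_subset_closedBall hR₂.1)
    · exact sdiff_subset.trans (hR₂.2 c c.2)
  refine ⟨{
    J := Option T
    o := none
    U := fun j => j.elim Ui fun c => Uf c
    e := fun j => j.elim ei fun c => ef c
    frame := by rintro (_ | c); exacts [hei, hef c]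
    χ := χ
    χ' := χ'
    χ_smooth := fun j => (hχ j).of_le (by norm_num)
    χ'_smooth := by
      rintro (_ | c)
      · exact contDiff_const.sub hβi
      · exact hβ c
    χ_sum := hχ1
    χ_supp := ?_
    χ'_supp := ?_
    S := S
    Z := Z
    S_compact := ?_
    Z_compact := ?_
    χ'_one := ?_
    dbar_χ' := hdχ'
    S_supp := ?_
    q := fun j => j.elim (fun z => z⁻¹) fun c z => z - c
    q_S := ?_
    q_Z := ?_
    a := fun j => j.elim (R + 3)⁻¹ fun c => ρ c
    b := fun j => j.elim (R + 2)⁻¹ fun c => 2 * ρ c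
    a_nonneg := ?_
    a_lt_b := ?_
    q_le := ?_
    le_q := ?_
    infty_mem := hUi
    χ'_o := ?_
    χ'_ne := ?_
    poly := ?_ }⟩
  · rintro (_ | c) z hz
    · refine hR z ?_
      have : z ∈ (Metric.closedBall (0 : ℂ) (R + 3))ᶜ := hχs none hz
      simp only [mem_compl_iff, mem_closedBall_zero_iff, not_le] at this
      linarith
    · exact hρU c z (Metric.closedBall_subset_closedBall (by linarith [hρ c])
        (Metric.ball_subset_closedBall (hχs (some c) hz)))
  · rintro (_ | c) z hz
    · refine hR z ?_
      have : z ∈ (Metric.ball (0 : ℂ) (R + 1))ᶜ := hcl Metric.isOpen_ball.isClosed_compl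
        (fun z hz => by
          change 1 - βi z = 0
          rw [notMem_compl_iff] at hz
          rw [hβi1 z (Metric.ball_subset_closedBall hz), sub_self]) hz
      simp only [mem_compl_iff, mem_ball_zero_iff, not_lt] at this
      linarith
    · exact hρU c z (hcl Metric.isClosed_closedBall (fun z hz =>
        hβ0 c z fun h => hz (Metric.ball_subset_closedBall h)) hz)
  · rintro (_ | c)
    · exact (isCompact_closedBall 0 R₂).inter_right Metric.isOpen_ball.isClosed_compl
    · exact isCompact_closedBall _ _
  · rintro (_ | c)
    · exact (isCompact_closedBall _ _).diff Metric.isOpen_ball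
    · exact (isCompact_closedBall _ _).diff Metric.isOpen_ball
  · rintro (_ | c) z hz
    · change 1 - βi z = 1
      have h1 : z ∉ Metric.ball (0 : ℂ) (R + 3) := hz.2
      rw [hβi0 z fun h => h1 (Metric.ball_subset_ball (by linarith) h), sub_zero]
    · exact hβ1 c z (Metric.closedBall_subset_closedBall (by linarith [hρ c]) hz)
  · rintro i (_ | c) z hz
    · by_cases h : z ∈ Metric.closedBall (0 : ℂ) R₂
      · have h2 : χ none z = 0 := by
          by_contra hne
          have h3 : z ∈ (Metric.closedBall (0 : ℂ) (R + 3))ᶜ := hχs none (subset_tsupport _ hne)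
          exact hz ⟨h, fun h4 => h3 (Metric.ball_subset_closedBall h4)⟩
        rw [h2, zero_mul]
      · rw [hdχ' i z fun h' => h (hZR i h'), mul_zero]
    · have h2 : χ (some c) z = 0 := by
        by_contra hne
        exact hz (Metric.ball_subset_closedBall (hχs (some c) (subset_tsupport _ hne)))
      rw [h2, zero_mul]
  · rintro (_ | c) z hz
    · refine analyticAt_id.fun_inv ?_
      rintro rfl
      exact hz.2 (Metric.mem_ball_self (by linarith))
    · exact analyticAt_id.fun_sub analyticAt_const
  · rintro (_ | c) z hz
    · refine analyticAt_id.fun_inv ?_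
      rintro rfl
      exact hz.2 (Metric.mem_ball_self (by linarith))
    · exact analyticAt_id.fun_sub analyticAt_const
  · rintro (_ | c)
    · exact inv_nonneg.2 (by linarith)
    · exact (hρ c).le
  · rintro (_ | c)
    · exact inv_strictAnti₀ (by linarith) (by linarith)
    · change ρ c < 2 * ρ c
      linarith [hρ c]
  · rintro (_ | c) z hz
    · have h1 : z ∉ Metric.ball (0 : ℂ) (R + 3) := hz.2
      rw [mem_ball_zero_iff, not_lt] at h1
      change ‖z⁻¹‖ ≤ (R + 3)⁻¹
      rw [norm_inv]
      exact inv_anti₀ (by linarith) h1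
    · exact mem_closedBall_iff_norm.1 hz
  · rintro (_ | c) z hz
    · have h1 : z ∈ Metric.closedBall (0 : ℂ) (R + 2) := hz.1
      have h2 : z ∉ Metric.ball (0 : ℂ) (R + 1) := hz.2
      rw [mem_ball_zero_iff, not_lt] at h2
      change (R + 2)⁻¹ ≤ ‖z⁻¹‖
      rw [norm_inv]
      exact inv_anti₀ (by linarith) (mem_closedBall_zero_iff.1 h1)
    · have h2 : z ∉ Metric.ball (c : ℂ) (2 * ρ c) := hz.2
      rwa [mem_ball_iff_norm, not_lt] at h2
  · have : ∀ᶠ z in nf OnePoint.infty, z ∉ Metric.ball (0 : ℂ) (R + 2) := by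
      rw [nf_infty]; exact Bornology.isBounded_def.1 Metric.isBounded_ball
    filter_upwards [this] with z hz
    change 1 - βi z = 1
    rw [hβi0 z hz, sub_zero]
  · rintro (_ | c) hj
    · exact absurd rfl hj
    · have : ∀ᶠ z in nf OnePoint.infty, z ∉ Metric.ball (c : ℂ) (3 * ρ c) := by
        rw [nf_infty]; exact Bornology.isBounded_def.1 Metric.isBounded_ball
      filter_upwards [this] with z hz
      exact hβ0 c z hz
  -- With `Q` the product of all `(X - c) ^ n`, the weight of the disc at `c` is divided out by
  -- omitting one factor, and the weight `1 / z` at infinity by a further `X ^ n`.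
  · intro n
    refine ⟨∏ c : T, (Polynomial.X - Polynomial.C (c : ℂ)) ^ n, fun j => j.elim
      ((∏ c : T, (Polynomial.X - Polynomial.C (c : ℂ)) ^ n) * Polynomial.X ^ n)
      fun c => ∏ c' ∈ Finset.univ.erase c, (Polynomial.X - Polynomial.C (c' : ℂ)) ^ n, ?_, rfl, ?_⟩
    · exact Finset.prod_ne_zero_iff.2 fun c _ => pow_ne_zero n (Polynomial.X_sub_C_ne_zero _)
    · rintro (_ | c) z hz
      · have hz0 : z ≠ 0 := by
          rintro rfl
          rcases hz with hz | hz
          · exact hz.2 (Metric.mem_ball_self (by linarith))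
          · exact hz.2 (Metric.mem_ball_self (by linarith))
        change _ = Polynomial.eval z (_ * Polynomial.X ^ n) * (z⁻¹) ^ n
        rw [Polynomial.eval_mul, Polynomial.eval_pow, Polynomial.eval_X, mul_assoc, ← mul_pow,
          mul_inv_cancel₀ hz0, one_pow, mul_one]
      · change _ = Polynomial.eval z (∏ c' ∈ Finset.univ.erase c, _) * (z - c) ^ n
        rw [← Finset.mul_prod_erase Finset.univ _ (Finset.mem_univ c), Polynomial.eval_mul, mul_comm]
        simp

end MinLaplace

namespace MinLaplace

open Filter Set

universe u

/-! ### Meromorphic germs at infinity -/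

/-- A function is meromorphic at infinity. -/
def MerInf (f : ℂ → ℂ) : Prop := MeromorphicAt (fun t => f t⁻¹) 0

theorem tendsto_inv_nhdsNE : Tendsto (fun t : ℂ => t⁻¹) (𝓝[≠] 0) (nf OnePoint.infty) := by
  rw [nf_infty]; exact tendsto_inv₀_nhdsNE_zero

namespace MerInf

variable {f g : ℂ → ℂ}

theorem congr (hf : MerInf f) (h : ∀ᶠ z in nf OnePoint.infty, f z = g z) : MerInf g :=
  MeromorphicAt.congr hf (tendsto_inv_nhdsNE.eventually h)

theorem const (c : ℂ) : MerInf fun _ => c := MeromorphicAt.const c 0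

theorem id : MerInf fun z => z := (MeromorphicAt.id 0).inv

theorem sub (hf : MerInf f) (hg : MerInf g) : MerInf fun z => f z - g z := MeromorphicAt.sub hf hg

theorem mul (hf : MerInf f) (hg : MerInf g) : MerInf fun z => f z * g z := MeromorphicAt.mul hf hg

theorem inv (hf : MerInf f) : MerInf fun z => (f z)⁻¹ := MeromorphicAt.inv hf

theorem pow (hf : MerInf f) (n : ℕ) : MerInf fun z => f z ^ n := MeromorphicAt.pow hf n

theorem sum {ι : Type*} {s : Finset ι} {f : ι → ℂ → ℂ} (hf : ∀ i ∈ s, MerInf (f i)) :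
    MerInf fun z => ∑ i ∈ s, f i z := MeromorphicAt.fun_sum hf

theorem prod {ι : Type*} {s : Finset ι} {f : ι → ℂ → ℂ} (hf : ∀ i ∈ s, MerInf (f i)) :
    MerInf fun z => ∏ i ∈ s, f i z := MeromorphicAt.fun_prod hf

theorem of_analyticAt {g : ℂ → ℂ} (hg : AnalyticAt ℂ g 0) : MerInf fun z => g z⁻¹ := by
  simpa [MerInf] using hg.meromorphicAt

theorem eval (q : Polynomial ℂ) : MerInf fun z => q.eval z := by
  simp only [Polynomial.eval_eq_sum, Polynomial.sum]
  exact sum fun i _ => (const _).mul (id.pow i)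

theorem exists_eq (hf : MerInf f) : ∃ (n : ℕ) (g : ℂ → ℂ), AnalyticAt ℂ g 0 ∧
    ∀ᶠ z in nf OnePoint.infty, f z = z ^ n * g z⁻¹ := by
  obtain ⟨n, hn⟩ := hf
  simp only [sub_zero, smul_eq_mul] at hn
  refine ⟨n, _, hn, ?_⟩
  filter_upwards [eventually_infty_ne_zero] with z hz
  simp only [inv_inv, inv_pow]
  field_simp

theorem det {r : ℕ} {a : Fin r → Fin r → ℂ → ℂ} (ha : ∀ i j, MerInf (a i j)) :
    MerInf (fun y => (Matrix.of fun i j => a i j y).det) := by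
  simp only [Matrix.det_apply']
  exact sum fun σ _ => (const _).mul (prod fun i _ => ha _ _)

theorem adjugate {r : ℕ} {a : Fin r → Fin r → ℂ → ℂ} (ha : ∀ i j, MerInf (a i j)) (i j : Fin r) :
    MerInf (fun y => (Matrix.of fun i j => a i j y).adjugate i j) := by
  simp only [Matrix.adjugate_apply, Matrix.det_apply']
  refine sum fun σ _ => (const _).mul (prod fun k _ => ?_)
  simp only [Matrix.updateRow_apply]
  split_ifs
  · exact const _
  · exact ha _ _

end MerInf

theorem analyticAt_eval (q : Polynomial ℂ) (z : ℂ) : AnalyticAt ℂ (fun w => q.eval w) z :=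
  q.differentiable.analyticAt z

/-! ### Global frames over the complex line -/

section

variable {r : ℕ} {E : HolBundle.{u} r}

/-- Holomorphic sections that agree near a point off that point, agree at the point. -/
theorem eq_of_eventually_eq {s t : ∀ y, E.Fib y} {z : ℂ} (hs : E.IsHol s (z : CP1))
    (ht : E.IsHol t (z : CP1)) (h : ∃ᶠ w : ℂ in 𝓝[≠] z, s (w : CP1) = t (w : CP1)) :
    ∀ᶠ w : ℂ in 𝓝 z, s (w : CP1) = t (w : CP1) := by
  obtain ⟨U, e, hz, he, -⟩ := E.exists_isFrame (z : CP1)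
  have hU : ∀ᶠ w : ℂ in 𝓝 z, (w : CP1) ∈ U := by
    rw [← nf_coe]; exact eventually_nf_of_nhds (he.1.mem_nhds hz)
  have h1 := fun k => Patch.analyticAt_coef he hz hs k
  have h2 := fun k => Patch.analyticAt_coef he hz ht k
  have h3 := fun k => ((h1 k).frequently_eq_iff_eventually_eq (h2 k)).1
    (h.mono fun w hw => by rw [hw])
  filter_upwards [hU, eventually_all.2 h3] with w hw h4
  rw [← (he.isB hw).sum_coef (s w), ← (he.isB hw).sum_coef (t w)]
  simp only [h4]

theorem holAt_affine {f : ℂ → ℂ} {z : ℂ} (hf : AnalyticAt ℂ f z) :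
    HolAt (fun y => y.elim 0 f) (z : CP1) := holAt_coe.2 hf

/-- Division of a holomorphic section by a linear function. -/
theorem exists_div {s : ∀ y, E.Fib y} (hs : ∀ z : ℂ, E.IsHol s (z : CP1)) {z₀ : ℂ}
    (h0 : s (z₀ : CP1) = 0) : ∃ s' : ∀ y, E.Fib y, (∀ z : ℂ, E.IsHol s' (z : CP1)) ∧
      ∀ z : ℂ, s (z : CP1) = (z - z₀) • s' (z : CP1) := by
  classical
  obtain ⟨U, e, hz, he, -⟩ := E.exists_isFrame (z₀ : CP1)
  have hU : ∀ᶠ w : CP1 in 𝓝 (z₀ : CP1), w ∈ U := he.1.mem_nhds hz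
  let c : Fin r → ℂ → ℂ := fun k w => coef (fun m => e m (w : CP1)) (s (w : CP1)) k
  have hc : ∀ k, AnalyticAt ℂ (c k) z₀ := fun k => Patch.analyticAt_coef he hz (hs z₀) k
  have hd : ∀ k, AnalyticAt ℂ (dslope (c k) z₀) z₀ := fun k => by
    obtain ⟨p, hp⟩ := hc k
    exact hp.has_fpower_series_dslope_fslope.analyticAt
  let t : ∀ y, E.Fib y := fun y => OnePoint.rec (C := fun y => E.Fib y) 0
    (fun z => if z = z₀ then ∑ k, dslope (c k) z₀ z • e k (z : CP1) else (z - z₀)⁻¹ • s (z : CP1)) y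
  have ht : ∀ z : ℂ, t (z : CP1) = if z = z₀ then ∑ k, dslope (c k) z₀ z • e k (z : CP1)
    else (z - z₀)⁻¹ • s (z : CP1) := fun z => rfl
  refine ⟨t, fun z => ?_, fun z => ?_⟩
  · by_cases h : z = z₀
    · subst h
      refine (he.isHol_iff hz _).2 ⟨fun k => fun y => y.elim 0 (dslope (c k) z),
        fun k => holAt_affine (hd k), ?_⟩
      filter_upwards [hU, OnePoint.isOpenEmbedding_coe.isOpen_range.mem_nhds ⟨z, rfl⟩]
      rintro _ hw ⟨w, rfl⟩
      rw [ht]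
      split_ifs with h
      · rfl
      · have h1 := (he.isB hw).sum_coef (s w)
        rw [← h1, Finset.smul_sum]
        refine Finset.sum_congr rfl fun k _ => ?_
        rw [smul_smul]
        congr 1
        change _ = dslope (c k) z w
        rw [dslope_of_ne _ h, slope_def_module, smul_eq_mul]
        have : c k z = 0 := by simp only [c, h0, map_zero, Pi.zero_apply]
        rw [this, sub_zero]
    · have h1 : AnalyticAt ℂ (fun w : ℂ => (w - z₀)⁻¹) z :=
        (analyticAt_id.fun_sub analyticAt_const).fun_inv (sub_ne_zero.2 h)
      have h2 := HolBundle.isHol_sum (n := 1) (s := fun _ => s)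
        (f := fun _ y => y.elim 0 fun w : ℂ => (w - z₀)⁻¹) (fun _ => hs z) fun _ => holAt_affine h1
      refine h2.congr ?_
      rw [OnePoint.nhds_coe_eq, eventually_map]
      filter_upwards [isOpen_ne.mem_nhds h] with w hw
      rw [ht, if_neg hw]
      simp
  · rw [ht]
    split_ifs with h
    · rw [h, sub_self, zero_smul, h0]
    · rw [smul_smul, mul_inv_cancel₀ (sub_ne_zero.2 h), one_smul]

/-- A section is meromorphic at infinity, with respect to a frame there. -/
def MerSec (e : Fin r → ∀ y, E.Fib y) (s : ∀ y, E.Fib y) : Prop :=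
  ∃ f : Fin r → ℂ → ℂ, (∀ k, MerInf (f k)) ∧
    ∀ᶠ z : ℂ in nf OnePoint.infty, s (z : CP1) = ∑ k, f k z • e k (z : CP1)

variable {U : Set CP1} {e : Fin r → ∀ y, E.Fib y}

theorem MerSec.sum {n : ℕ} {s : Fin n → ∀ y, E.Fib y} {f : Fin n → ℂ → ℂ} {t : ∀ y, E.Fib y}
    (hs : ∀ k, MerSec e (s k)) (hf : ∀ k, MerInf (f k))
    (h : ∀ᶠ z : ℂ in nf OnePoint.infty, t (z : CP1) = ∑ k, f k z • s k (z : CP1)) : MerSec e t := by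
  choose g hg hgs using hs
  refine ⟨fun i z => ∑ k, f k z * g k i z,
    fun i => MerInf.sum fun k _ => (hf k).mul (hg k i), ?_⟩
  filter_upwards [eventually_all.2 hgs, h] with z hz h
  rw [h]
  simp only [hz, Finset.smul_sum, smul_smul, Finset.sum_smul]
  rw [Finset.sum_comm]

/-- The sections `σ`, which form a frame near infinity, generate up to a common denominator. -/
theorem exists_denominator {σ : Fin r → ∀ y, E.Fib y} (hσ : ∀ l (z : ℂ), E.IsHol (σ l) (z : CP1))
    (hm : ∀ l, MerSec e (σ l)) (hli : ∀ᶠ z : ℂ in nf OnePoint.infty,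
      LinearIndependent ℂ fun l => σ l (z : CP1)) :
    {z : ℂ | ¬ LinearIndependent ℂ fun l => σ l (z : CP1)}.Finite ∧
    ∃ d : Polynomial ℂ, d ≠ 0 ∧ ∀ s : ∀ y, E.Fib y, (∀ z : ℂ, E.IsHol s (z : CP1)) → MerSec e s →
      ∃ q : Fin r → Polynomial ℂ, ∀ z : ℂ,
        d.eval z • s (z : CP1) = ∑ i, (q i).eval z • σ i (z : CP1) := by
  classical
  let L : ℂ → Prop := fun z => LinearIndependent ℂ fun l => σ l (z : CP1)
  -- the local determinant
  have hloc : ∀ z₀ : ℂ, ∃ (U : Set CP1) (e' : Fin r → ∀ y, E.Fib y) (a : Fin r → Fin r → ℂ → ℂ),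
      (z₀ : CP1) ∈ U ∧ E.IsFrame U e' ∧ AnalyticAt ℂ (fun z => (Matrix.of fun j i => a j i z).det) z₀ ∧
      (∀ i j, AnalyticAt ℂ (fun z => (Matrix.of fun j i => a j i z).adjugate i j) z₀) ∧
      ∀ᶠ z : ℂ in 𝓝 z₀, (z : CP1) ∈ U ∧ (∀ i, σ i (z : CP1) = ∑ j,
        (Matrix.of fun j i => a j i z) j i • e' j (z : CP1)) ∧
        (L z ↔ (Matrix.of fun j i => a j i z).det ≠ 0) := by
    intro z₀
    obtain ⟨U, e', hz, he', -⟩ := E.exists_isFrame (z₀ : CP1)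
    choose a ha hae using fun i => (he'.isHol_iff hz (σ i)).1 (hσ i z₀)
    refine ⟨U, e', fun j i z => a i j (z : CP1), hz, he',
      holAt_coe.1 (HolAt.det (a := fun j i => a i j) fun j i => ha i j),
      fun i j => holAt_coe.1 (HolAt.adjugate (a := fun j i => a i j) (fun j i => ha i j) i j), ?_⟩
    rw [← nf_coe]
    filter_upwards [eventually_nf_of_nhds (he'.1.mem_nhds hz),
      eventually_nf_of_nhds (eventually_all.2 hae)] with z h1 h2
    have h2' : ∀ i, σ i (z : CP1) = ∑ j, (Matrix.of fun j i => a i j (z : CP1)) j i •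
      e' j (z : CP1) := h2
    exact ⟨h1, h2', fun h => det_ne_zero_of_isB h2' h,
      fun h => linearIndependent_of_det_ne_zero h2' (he'.isB h1).1 h⟩
  have hdich : ∀ z₀, (∀ᶠ z in 𝓝 z₀, ¬ L z) ∨ ∀ᶠ z in 𝓝[≠] z₀, L z := by
    intro z₀
    obtain ⟨U, e', a, -, -, hdet, -, hev⟩ := hloc z₀
    rcases hdet.eventually_eq_zero_or_eventually_ne_zero with h | h
    · left
      filter_upwards [h, hev] with z h1 h2
      rw [h2.2.2, not_not]; exact h1
    · right
      filter_upwards [h, mem_nhdsWithin_of_mem_nhds hev] with z h1 h2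
      rw [h2.2.2]; exact h1
  -- Identity theorem: the points near which the sections are dependent throughout form a set that
  -- is open and closed, and it is not the whole line because the sections are independent near
  -- infinity.
  have hLp : ∀ z₀, ∀ᶠ z in 𝓝[≠] z₀, L z := by
    have hopen : IsOpen {z₀ : ℂ | ∀ᶠ z in 𝓝 z₀, ¬ L z} := isOpen_setOfPred_eventually_nhds
    have hopen' : IsOpen {z₀ : ℂ | ∀ᶠ z in 𝓝[≠] z₀, L z} := by
      refine isOpen_iff_mem_nhds.2 fun z₀ hz₀ => ?_
      filter_upwards [(eventually_nhdsWithin_iff.1 hz₀).eventually_nhds] with y hy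
      by_cases h : y = z₀
      · exact h ▸ hz₀
      · filter_upwards [mem_nhdsWithin_of_mem_nhds hy,
          mem_nhdsWithin_of_mem_nhds (isOpen_ne.mem_nhds h)] with w h1 h2 using h1 h2
    have hcompl : {z₀ : ℂ | ∀ᶠ z in 𝓝 z₀, ¬ L z}ᶜ = {z₀ : ℂ | ∀ᶠ z in 𝓝[≠] z₀, L z} := by
      ext z₀
      constructor
      · intro h; exact (hdich z₀).resolve_left h
      · intro h h'
        have h : ∀ᶠ z in 𝓝[≠] z₀, L z := h
        have h' : ∀ᶠ z in 𝓝 z₀, ¬ L z := h'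
        obtain ⟨w, hw1, hw2⟩ := (h.and (h'.filter_mono nhdsWithin_le_nhds)).exists
        exact hw2 hw1
    have hclop : IsClopen {z₀ : ℂ | ∀ᶠ z in 𝓝 z₀, ¬ L z} :=
      ⟨⟨by rw [hcompl]; exact hopen'⟩, hopen⟩
    rcases isClopen_iff.1 hclop with h | h
    · intro z₀
      have : z₀ ∈ {z₀ : ℂ | ∀ᶠ z in 𝓝 z₀, ¬ L z}ᶜ := by rw [h]; simp
      rwa [hcompl] at this
    · exfalso
      obtain ⟨z, hz⟩ := hli.exists
      have : z ∈ {z₀ : ℂ | ∀ᶠ z in 𝓝 z₀, ¬ L z} := by rw [h]; trivial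
      exact this.self_of_nhds hz
  have hfin : {z : ℂ | ¬ L z}.Finite := by
    by_contra hinf
    have hinf : {z : ℂ | ¬ L z}.Infinite := hinf
    have hb : Bornology.IsBounded {z : ℂ | ¬ L z} := by
      rw [Bornology.isBounded_def, ← nf_infty]
      filter_upwards [hli] with z hz h using h hz
    obtain ⟨R, hR⟩ := hb.subset_closedBall 0
    obtain ⟨x, -, hx⟩ := hinf.exists_accPt_of_subset_isCompact (isCompact_closedBall _ _) hR
    have := accPt_iff_frequently_nhdsNE.1 hx
    exact this (by simpa using hLp x)
  refine ⟨hfin, ?_⟩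
  -- the local denominators
  have hk : ∀ z₀ : ℂ, ∃ k : ℕ, ∀ s : ∀ y, E.Fib y, E.IsHol s (z₀ : CP1) → ∀ i,
      ∃ g : ℂ → ℂ, AnalyticAt ℂ g z₀ ∧ ∀ᶠ z in 𝓝 z₀, L z →
        (z - z₀) ^ k * coef (fun l => σ l (z : CP1)) (s (z : CP1)) i = g z := by
    intro z₀
    obtain ⟨U, e', a, hz, he', hdet, hadj, hev⟩ := hloc z₀
    have hne : ¬ ∀ᶠ z in 𝓝 z₀, (Matrix.of fun j i => a j i z).det = 0 := by
      intro h
      obtain ⟨w, hw1, hw2⟩ := ((hLp z₀).and ((h.and hev).filter_mono nhdsWithin_le_nhds)).exists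
      exact (hw2.2.2.2.1 hw1) hw2.1
    obtain ⟨k, g, hg, hg0, hgd⟩ := hdet.exists_eventuallyEq_pow_smul_nonzero_iff.2 hne
    refine ⟨k, fun s hs i => ⟨fun z => (g z)⁻¹ * ∑ j, (Matrix.of fun j i => a j i z).adjugate i j *
      coef (fun m => e' m (z : CP1)) (s (z : CP1)) j, (hg.fun_inv hg0).fun_mul
      (Finset.analyticAt_fun_sum _ fun j _ =>
        (hadj i j).fun_mul (Patch.analyticAt_coef he' hz hs j)), ?_⟩⟩
    filter_upwards [hev, hgd, hg.continuousAt.eventually_ne hg0] with z h1 h2 h3 hL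
    have hd0 := h1.2.2.1 hL
    have h5 := sum_inv_mulVec h1.2.1 hd0 (coef (fun m => e' m (z : CP1)) (s (z : CP1)))
    rw [(he'.isB h1.1).sum_coef] at h5
    have h6 : IsB fun l => σ l (z : CP1) := isB_of_linearIndependent (he'.isB h1.1) hL
    rw [h6.eq_coef h5, Pi.smul_apply, smul_eq_mul, h2, smul_eq_mul]
    have h7 : (z - z₀) ^ k ≠ 0 := by
      intro h
      rw [h2, h, zero_smul] at hd0
      exact hd0 rfl
    rw [mul_inv, ← mul_assoc, ← mul_assoc, mul_inv_cancel₀ h7, one_mul]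
    rfl
  choose k hk using hk
  let Zr := hfin.toFinset
  have hZr : ∀ z, z ∉ Zr ↔ L z := fun z => by simp [Zr]
  let d : Polynomial ℂ := ∏ c ∈ Zr, (Polynomial.X - Polynomial.C c) ^ k c
  refine ⟨d, Finset.prod_ne_zero_iff.2 fun c _ => pow_ne_zero _ (Polynomial.X_sub_C_ne_zero _),
    fun s hs hms => ?_⟩
  -- The coordinates of `s` times `d` have removable singularities in the zeros of the determinant
  -- and are meromorphic at infinity, so they are polynomials.
  have hpoly : ∀ i, ∃ q : Polynomial ℂ, ∀ z, z ∉ Zr →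
      d.eval z * coef (fun l => σ l (z : CP1)) (s (z : CP1)) i = q.eval z := by
    intro i
    have hmer : MerInf fun z => d.eval z * coef (fun l => σ l (z : CP1)) (s (z : CP1)) i := by
      choose T hT hTσ using hm
      obtain ⟨f, hf, hfs⟩ := hms
      have hdet := MerInf.det (a := fun j i => T i j) fun j i => hT i j
      have hadj := MerInf.adjugate (a := fun j i => T i j) fun j i => hT i j
      refine (MerInf.eval d).mul (MerInf.congr (f := fun z =>
        (Matrix.of fun j i => T i j z).det⁻¹ *
          ∑ j, (Matrix.of fun j i => T i j z).adjugate i j * f j z) ?_ ?_)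
      · exact hdet.inv.mul (MerInf.sum fun j _ => (hadj i j).mul (hf j))
      · filter_upwards [hfs, eventually_all.2 hTσ, hli] with z h1 h2 h3
        have h2' : ∀ i, σ i (z : CP1) = ∑ j, (Matrix.of fun j i => T i j z) j i •
          e j (z : CP1) := h2
        have hd0 := det_ne_zero_of_isB h2' h3
        have h5 := sum_inv_mulVec h2' hd0 fun j => f j z
        rw [← h1] at h5
        obtain ⟨U', e', hz, he', -⟩ := E.exists_isFrame (z : CP1)
        have h6 : IsB fun l => σ l (z : CP1) := isB_of_linearIndependent (he'.isB hz) h3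
        rw [h6.eq_coef h5]
        rfl
    obtain ⟨n, g, hg, hgz⟩ := hmer.exists_eq
    obtain ⟨q, -, hq⟩ := exists_polynomial (P := Zr) (n := n)
      (f := fun z => d.eval z * coef (fun l => σ l (z : CP1)) (s (z : CP1)) i) (fun z₀ => by
        obtain ⟨g, hg, hgs⟩ := hk z₀ s (hs z₀) i
        by_cases hz : z₀ ∈ Zr
        · refine ⟨fun z => (∏ c ∈ Zr.erase z₀, (Polynomial.X - Polynomial.C c) ^ k c).eval z * g z,
            (analyticAt_eval _ z₀).fun_mul hg, ?_⟩
          filter_upwards [hgs] with z h1 h2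
          simp only [← h1 ((hZr z).1 h2), d]
          rw [← Finset.mul_prod_erase _ _ hz, Polynomial.eval_mul]
          simp only [Polynomial.eval_pow, Polynomial.eval_sub, Polynomial.eval_X, Polynomial.eval_C]
          ring
        · obtain ⟨g', hg', hgs'⟩ : ∃ g : ℂ → ℂ, AnalyticAt ℂ g z₀ ∧ ∀ᶠ z in 𝓝 z₀, L z →
              coef (fun l => σ l (z : CP1)) (s (z : CP1)) i = g z := by
            obtain ⟨U, e', a, hzU, he', hdet, hadj, hev⟩ := hloc z₀
            have hd0 := hev.self_of_nhds.2.2.1 ((hZr z₀).1 hz)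
            refine ⟨fun z => ((Matrix.of fun j i => a j i z).det)⁻¹ *
              ∑ j, (Matrix.of fun j i => a j i z).adjugate i j *
              coef (fun m => e' m (z : CP1)) (s (z : CP1)) j, (hdet.fun_inv hd0).fun_mul
              (Finset.analyticAt_fun_sum _ fun j _ =>
                (hadj i j).fun_mul (Patch.analyticAt_coef he' hzU (hs z₀) j)), ?_⟩
            filter_upwards [hev] with z h1 hL
            have h5 := sum_inv_mulVec h1.2.1 (h1.2.2.1 hL)
              (coef (fun m => e' m (z : CP1)) (s (z : CP1)))
            rw [(he'.isB h1.1).sum_coef] at h5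
            rw [(isB_of_linearIndependent (he'.isB h1.1) hL).eq_coef h5]
            rfl
          refine ⟨fun z => d.eval z * g' z, (analyticAt_eval _ z₀).fun_mul hg', ?_⟩
          filter_upwards [hgs'] with z h1 h2
          simp only [← h1 ((hZr z).1 h2)])
      ⟨g, hg, by rw [← nf_infty]; exact hgz.mono fun z hz _ => hz⟩
    exact ⟨q, hq⟩
  choose q hq using hpoly
  refine ⟨q, fun z₀ => ?_⟩
  have h1 : E.IsHol (fun y => ∑ i : Fin 1, (y.elim 0 fun w : ℂ => d.eval w) • s y) (z₀ : CP1) :=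
    HolBundle.isHol_sum (fun _ => hs z₀) fun _ => holAt_affine (analyticAt_eval _ _)
  have h2 : E.IsHol (fun y => ∑ i, (y.elim 0 fun w : ℂ => (q i).eval w) • σ i y) (z₀ : CP1) :=
    HolBundle.isHol_sum (fun i => hσ i z₀) fun _ => holAt_affine (analyticAt_eval _ _)
  have h3 := (eq_of_eventually_eq h1 h2 (Eventually.frequently ?_)).self_of_nhds
  · simpa using h3
  · filter_upwards [hLp z₀] with z hz
    obtain ⟨U', e', hzU, he', -⟩ := E.exists_isFrame (z : CP1)
    have h6 : IsB fun l => σ l (z : CP1) := isB_of_linearIndependent (he'.isB hzU) hz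
    simp only [Finset.univ_unique, Finset.sum_const, Finset.card_singleton, one_smul]
    conv_lhs => rw [← h6.sum_coef (s (z : CP1)), Finset.smul_sum]
    refine Finset.sum_congr rfl fun i _ => ?_
    rw [smul_smul]
    congr 1
    exact hq i z ((hZr z).2 hz)

end

end MinLaplace

/-! ### Triviality of bundles over the affine line, with control at infinity. -/

namespace MinLaplace

open Filter Set Polynomial

universe u

section

variable {r : ℕ} {E : HolBundle.{u} r} {U : Set CP1} {e : Fin r → ∀ y, E.Fib y}

theorem MerInf.of_holAt {f : CP1 → ℂ} (hf : HolAt f OnePoint.infty) :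
    MerInf fun z => f (z : CP1) := by
  obtain ⟨g, hg, -, h⟩ := hf.exists_analyticAt
  exact (MerInf.of_analyticAt hg).congr (h.mono fun z hz => hz.symm)

theorem MerSec.of_isHol (he : E.IsFrame U e) (hU : OnePoint.infty ∈ U) {s : ∀ y, E.Fib y}
    (hs : E.IsHol s OnePoint.infty) : MerSec e s := by
  obtain ⟨f, hf, h⟩ := (he.isHol_iff hU s).1 hs
  exact ⟨fun k z => f k (z : CP1), fun k => MerInf.of_holAt (hf k), eventually_nf_of_nhds h⟩

theorem MerSec.change {e' : Fin r → ∀ y, E.Fib y} {s : ∀ y, E.Fib y} (hs : MerSec e' s)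
    (h : ∀ i, MerSec e (e' i)) : MerSec e s := by
  obtain ⟨f, hf, hfs⟩ := hs
  exact MerSec.sum h hf hfs

theorem eventually_infty_eval_ne {q : ℂ[X]} (hq : q ≠ 0) :
    ∀ᶠ z in nf OnePoint.infty, q.eval z ≠ 0 := by
  classical
  filter_upwards [eventually_infty_notMem q.roots.toFinset] with z hz h
  exact hz (by simpa [hq] using h)

/-- Up to the scalar factor `Q`, the sections of `Patch.exists_sections` are given in the frame at
infinity by a matrix that is the identity at infinity, so they are independent near infinity. -/
theorem exists_meromorphic_sections (E : HolBundle.{u} r) : ∃ (U : Set CP1)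
    (e : Fin r → ∀ y, E.Fib y) (σ : Fin r → ∀ y, E.Fib y), OnePoint.infty ∈ U ∧ E.IsFrame U e ∧
    (∀ l (z : ℂ), E.IsHol (σ l) (z : CP1)) ∧ (∀ l, MerSec e (σ l)) ∧
    ∀ᶠ z : ℂ in nf OnePoint.infty, LinearIndependent ℂ fun l => σ l (z : CP1) := by
  obtain ⟨p⟩ := exists_patch E
  obtain ⟨Q, σ, G, hQ, hσ, hG, hGσ⟩ := p.exists_sections
  refine ⟨p.U p.o, p.e p.o, σ, p.infty_mem, p.frame p.o, hσ, fun l =>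
    ⟨fun k z => Q.eval z * G l k z⁻¹, fun k => (MerInf.eval Q).mul
      (MerInf.of_analyticAt (hG l k).1), ?_⟩, ?_⟩
  · filter_upwards [hGσ l] with z hz
    rw [hz, Finset.smul_sum]
    simp only [smul_smul]
  · let D : ℂ → ℂ := fun t => (Matrix.of fun k l => G l k t).det
    have hD : AnalyticAt ℂ D 0 := by
      simp only [D, Matrix.det_apply']
      exact Finset.analyticAt_fun_sum _ fun τ _ => analyticAt_const.fun_mul
        (Finset.analyticAt_fun_prod _ fun i _ => (hG _ _).1)
    have hD0 : D 0 ≠ 0 := by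
      have : (Matrix.of fun k l => G l k 0) = (1 : Matrix (Fin r) (Fin r) ℂ) := by
        ext k l; simp [(hG l k).2, Matrix.one_apply]
      simp only [D, this, Matrix.det_one]; exact one_ne_zero
    filter_upwards [eventually_all.2 hGσ, eventually_infty_eval_ne hQ,
      tendsto_inv_nf_infty.eventually (hD.continuousAt.eventually_ne hD0),
      eventually_nf_of_nhds ((p.frame p.o).1.mem_nhds p.infty_mem)] with z h1 h2 h3 h4
    have h5 : LinearIndependent ℂ fun l => ∑ k, G l k z⁻¹ • p.e p.o k (z : CP1) :=
      linearIndependent_of_det_ne_zero (a := Matrix.of fun k l => G l k z⁻¹)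
        (fun l => by simp) ((p.frame p.o).isB h4).1 h3
    refine Fintype.linearIndependent_iff.2 fun c hc => ?_
    refine Fintype.linearIndependent_iff.1 h5 c ?_
    simp only [h1, smul_comm _ (Q.eval z), ← Finset.smul_sum] at hc
    exact (smul_eq_zero.1 hc).resolve_left h2

/-- A holomorphic bundle on the sphere has a frame over the complex line that is meromorphic
at infinity. -/
theorem exists_global_frame (E : HolBundle.{u} r) : ∃ ε : Fin r → ∀ y, E.Fib y,
    E.IsFrame {OnePoint.infty}ᶜ ε ∧
    ∀ U e, E.IsFrame U e → OnePoint.infty ∈ U → ∀ l, MerSec e (ε l) := by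
  classical
  obtain ⟨U, e, σ, hU, he, hσ, hm, hli⟩ := exists_meromorphic_sections E
  obtain ⟨hfin, d, hd, hden⟩ := exists_denominator hσ hm hli
  -- functional equations determine the polynomials
  have huniq : ∀ q q' : Fin r → ℂ[X], (∀ z : ℂ, ∑ i, (q i).eval z • σ i (z : CP1) =
      ∑ i, (q' i).eval z • σ i (z : CP1)) → q = q' := by
    intro q q' h
    funext i
    refine Polynomial.eq_of_infinite_eval_eq _ _ (hfin.infinite_compl.mono fun z hz => ?_)
    have hz : LinearIndependent ℂ fun l => σ l (z : CP1) := by simpa using hz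
    have := Fintype.linearIndependent_iff.1 hz (fun i => (q i).eval z - (q' i).eval z)
      (by simp only [sub_smul, Finset.sum_sub_distrib, h z, sub_self]) i
    exact sub_eq_zero.1 this
  have holsum : ∀ {n : ℕ} (s : Fin n → ∀ y, E.Fib y) (q : Fin n → ℂ[X]),
      (∀ k (z : ℂ), E.IsHol (s k) (z : CP1)) → ∀ z : ℂ,
      E.IsHol (fun y => ∑ k, (y.elim 0 fun w : ℂ => (q k).eval w) • s k y) (z : CP1) :=
    fun s q hs z => HolBundle.isHol_sum (fun k => hs k z) fun k =>
      holAt_affine (analyticAt_eval _ _)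
  -- A vector `q` belongs to `M` if `∑ q i • σ i`, divided by `d`, is holomorphic on the affine
  -- line. As a submodule of a free module over a principal ideal domain, `M` is free; the sections
  -- given by a basis will be the frame.
  let M : Submodule ℂ[X] (Fin r → ℂ[X]) :=
    { carrier := {q | ∃ s : ∀ y, E.Fib y, (∀ z : ℂ, E.IsHol s (z : CP1)) ∧
        ∀ z : ℂ, d.eval z • s (z : CP1) = ∑ i, (q i).eval z • σ i (z : CP1)}
      zero_mem' := ⟨_, holsum (n := 0) (fun _ => 0) (fun _ => 0) (fun k => k.elim0),
        fun z => by simp⟩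
      add_mem' := by
        rintro a b ⟨s, hs, h⟩ ⟨s', hs', h'⟩
        refine ⟨_, holsum (n := 2) ![s, s'] (fun _ => 1) (fun k => ?_), fun z => ?_⟩
        · fin_cases k
          exacts [hs, hs']
        · simp [add_smul, Finset.sum_add_distrib, smul_add, h, h']
      smul_mem' := by
        rintro p a ⟨s, hs, h⟩
        refine ⟨_, holsum (n := 1) (fun _ => s) (fun _ => p) (fun _ => hs), fun z => ?_⟩
        simp only [Finset.univ_unique, Finset.sum_const, Finset.card_singleton, one_smul,
          Pi.smul_apply, smul_eq_mul, eval_mul, ← smul_smul, ← Finset.smul_sum, ← h]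
        exact smul_comm _ _ _ }
  obtain ⟨n, ⟨b⟩⟩ := Submodule.nonempty_basis_of_pid (Pi.basisFun ℂ[X] (Fin r)) M
  choose s hs hsd using fun k => (b k).2
  have hmer : ∀ k, MerSec e (s k) := fun k => by
    refine MerSec.sum hm (f := fun i z => (d.eval z)⁻¹ * ((b k : Fin r → ℂ[X]) i).eval z)
      (fun i => (MerInf.eval d).inv.mul (MerInf.eval _)) ?_
    filter_upwards [eventually_infty_eval_ne hd] with z hz
    simp only [← smul_smul, ← Finset.smul_sum, ← hsd k z]
    rw [smul_smul, inv_mul_cancel₀ hz, one_smul]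
  have hdsum : ∀ (a : Fin n → ℂ[X]) (z : ℂ), ∑ i, ((∑ k, a k • (b k : Fin r → ℂ[X])) i).eval z •
      σ i (z : CP1) = d.eval z • ∑ k, (a k).eval z • s k (z : CP1) := by
    intro a z
    simp only [Finset.smul_sum, smul_comm (d.eval z), hsd]
    rw [Finset.sum_comm]
    simp [Finset.sum_apply, Polynomial.eval_finsetSum, Finset.sum_smul, smul_smul]
  -- If a combination of the basis sections vanishes at `z₀`, its quotient by `z - z₀` is again a
  -- section of the same kind. So the combination lies in `(X - z₀) M`, and its coordinates in the
  -- basis, being constants divisible by `X - z₀`, are zero.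
  have hLI : ∀ z : ℂ, LinearIndependent ℂ fun k => s k (z : CP1) := by
    intro z₀
    refine Fintype.linearIndependent_iff.2 fun c hc => ?_
    have h1 := holsum s (fun k => C (c k)) hs
    obtain ⟨s', hs', hss'⟩ := exists_div h1 (z₀ := z₀) (by simpa using hc)
    have hss : ∀ z : ℂ, ∑ k, c k • s k (z : CP1) = (z - z₀) • s' (z : CP1) := fun z => by
      simpa using hss' z
    have hm' : MerSec e s' := by
      refine MerSec.sum hmer (f := fun k z => (z - z₀)⁻¹ * c k)
        (fun k => (MerInf.id.sub (MerInf.const _)).inv.mul (MerInf.const _)) ?_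
      filter_upwards [eventually_infty_notMem {z₀}] with z hz
      simp only [← smul_smul, ← Finset.smul_sum, hss]
      rw [smul_smul, inv_mul_cancel₀ (sub_ne_zero.2 (by simpa using hz)), one_smul]
    obtain ⟨q, hq⟩ := hden s' hs' hm'
    have hqM : q ∈ M := ⟨s', hs', hq⟩
    have h2 : (∑ k, C (c k) • b k : M) = (X - C z₀) • (⟨q, hqM⟩ : M) := by
      apply Subtype.ext
      simp only [Submodule.coe_sum, Submodule.coe_smul]
      refine huniq _ _ fun z => ?_
      rw [hdsum]
      simp only [eval_C, hss, Pi.smul_apply, smul_eq_mul, eval_mul, eval_sub, eval_X,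
        ← smul_smul, ← Finset.smul_sum, ← hq]
      exact smul_comm _ _ _
    intro k
    have h3 := congrArg (fun v => b.repr v k) h2
    simp only [map_sum, map_smul, Finsupp.coe_finsetSum, Finset.sum_apply, Finsupp.smul_apply,
      b.repr_self, Finsupp.single_apply, smul_eq_mul] at h3
    simpa using congrArg (eval z₀) h3
  -- The rank can be read off at one point near infinity where `d` does not vanish and the `σ i` are
  -- a basis: as `d • σ i` belongs to `M`, the basis sections span there too.
  have hn : n = r := by
    obtain ⟨z, hz1, hz2⟩ := (hli.and (eventually_infty_eval_ne hd)).exists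
    obtain ⟨U', e', hz', he', -⟩ := E.exists_isFrame (z : CP1)
    have hB := isB_of_linearIndependent (he'.isB hz') hz1
    have hspan : Submodule.span ℂ (range fun k => s k (z : CP1)) = ⊤ := by
      rw [eq_top_iff, ← hB.2, Submodule.span_le]
      rintro _ ⟨i, rfl⟩
      have hmem : (Pi.single i d : Fin r → ℂ[X]) ∈ M := by
        refine ⟨σ i, hσ i, fun z => ?_⟩
        rw [Finset.sum_eq_single i] <;> simp +contextual
      have h1 := b.sum_repr ⟨_, hmem⟩
      have h2 := hdsum (fun k => b.repr ⟨_, hmem⟩ k) z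
      have h3 := congrArg Subtype.val h1
      simp only [Submodule.coe_sum, Submodule.coe_smul] at h3
      rw [h3, Finset.sum_eq_single i (by simp +contextual) (by simp),
        Pi.single_eq_same] at h2
      have h4 := smul_right_injective (E.Fib (z : CP1)) hz2 h2
      change σ i (z : CP1) ∈ Submodule.span ℂ _
      rw [h4]
      exact Submodule.sum_mem _ fun k _ => Submodule.smul_mem _ _
        (Submodule.subset_span ⟨k, rfl⟩)
    have h1 := Module.finrank_eq_card_basis (Module.Basis.mk hB.1 hB.2.ge)
    have h2 := Module.finrank_eq_card_basis (Module.Basis.mk (hLI z) hspan.ge)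
    simpa using h2.symm.trans h1
  subst hn
  refine ⟨s, ⟨isOpen_compl_singleton, fun y hy => ?_⟩, fun U' e' he' hU' l => ?_⟩
  · obtain ⟨z, rfl⟩ := OnePoint.ne_infty_iff_exists.1 hy
    obtain ⟨U', e', hz', he', -⟩ := E.exists_isFrame (z : CP1)
    have := isB_of_linearIndependent (he'.isB hz') (hLI z)
    exact ⟨this.1, this.2, fun i => hs i z⟩
  · exact (hmer l).change fun i => MerSec.of_isHol he' hU' ((he.2 _ hU).2.2 i)

/-- The inverse of the transition between a frame at infinity and a global frame. -/
theorem exists_inverse_transition {ε : Fin r → ∀ y, E.Fib y} (hε : E.IsFrame {OnePoint.infty}ᶜ ε)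
    (hm : ∀ l, MerSec e (ε l)) (i : Fin r) :
    MerSec ε (e i) := by
  choose T hT hTε using hm
  have hdet := MerInf.det (a := fun j i => T i j) fun j i => hT i j
  have hadj := MerInf.adjugate (a := fun j i => T i j) fun j i => hT i j
  refine ⟨fun k z => (Matrix.of fun j i => T i j z).det⁻¹ *
    (Matrix.of fun j i => T i j z).adjugate k i, fun k => hdet.inv.mul (hadj k i), ?_⟩
  filter_upwards [eventually_all.2 hTε] with z h2
  have h2' : ∀ i, ε i (z : CP1) = ∑ j, (Matrix.of fun j i => T i j z) j i • e j (z : CP1) := h2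
  have hd0 := det_ne_zero_of_isB h2' (hε.isB (OnePoint.coe_ne_infty z)).1
  have h5 := sum_inv_mulVec h2' hd0 fun j => if j = i then 1 else 0
  simpa [Matrix.mulVec, dotProduct] using h5

end

end MinLaplace

namespace MinLaplace

open Filter Set HolBundle

universe u

/-! ### Germs of sections -/

namespace HolBundle

variable {r : ℕ} {E : HolBundle.{u} r} {P : Finset ℂ} {x : CP1} {s t : E.Sec P}

theorem GermEq.refl (s : E.Sec P) : GermEq x s s := ⟨univ, univ_mem, fun _ _ => rfl⟩

theorem GermEq.symm (h : GermEq x s t) : GermEq x t s := by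
  obtain ⟨W, hW, h⟩ := h
  exact ⟨W, hW, fun z hz => (h z hz).symm⟩

theorem GermEq.trans {v : E.Sec P} (h : GermEq x s t) (h' : GermEq x t v) : GermEq x s v :=
  germEq_iff.2 (by
    filter_upwards [germEq_iff.1 h, germEq_iff.1 h'] with z h1 h2 hz using (h1 hz).trans (h2 hz))

theorem GermEq.eventually (h : GermEq x s t) : ∀ᶠ y in 𝓝 x, GermEq y s t :=
  (eventually_nhds_of_nf (germEq_iff.1 h)).mono fun _ hy => germEq_iff.2 hy

theorem mulSec_apply (f : ℂ → ℂ) (s : E.Sec P) (z : Punct P) : mulSec f s z = f z • s z := rfl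

theorem unif_tendsto_analyticAt {f : ℂ → ℂ} {x : ℂ} (hf : AnalyticAt ℂ f x) :
    AnalyticAt ℂ (fun t => f (t + x)) 0 := by
  have h1 : AnalyticAt ℂ (fun t : ℂ => t + x) 0 := by fun_prop
  exact AnalyticAt.fun_comp (g := f) (f := fun t : ℂ => t + x) (by simpa using hf) h1

theorem holGerms_sum_coe {x : ℂ} {n : ℕ} {s : Fin n → E.Sec P} {f : Fin n → ℂ → ℂ}
    (hs : ∀ k, s k ∈ E.holGerms P (x : CP1)) (hf : ∀ k, AnalyticAt ℂ (f k) x) :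
    (fun z : Punct P => ∑ k, f k z • s k z) ∈ E.holGerms P (x : CP1) :=
  holGerms_congr (holGerms_sum hs fun k => unif_tendsto_analyticAt (hf k))
    (Eventually.of_forall fun z hz => by simp [unif_coe])

theorem holGerms_mul_coe {x : ℂ} {s : E.Sec P} {f : ℂ → ℂ} (hs : s ∈ E.holGerms P (x : CP1))
    (hf : AnalyticAt ℂ f x) : mulSec f s ∈ E.holGerms P (x : CP1) :=
  holGerms_congr (holGerms_mul hs (unif_tendsto_analyticAt hf))
    (Eventually.of_forall fun z hz => by simp [unif_coe, mulSec_apply])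

/-- The restriction of a section to the complement of the poles. -/
def res (P : Finset ℂ) (σ : ∀ y, E.Fib y) : E.Sec P := fun z => σ z.pt

theorem res_mem {σ : ∀ y, E.Fib y} (h : E.IsHol σ x) : res P σ ∈ E.holGerms P x :=
  ⟨σ, h, GermEq.refl _⟩

theorem mem_holGerms_coe {U : Set CP1} {e : Fin r → ∀ y, E.Fib y} (he : E.IsFrame U e) {x : ℂ}
    (hx : (x : CP1) ∈ U) (hs : s ∈ E.holGerms P (x : CP1)) : ∃ f : Fin r → ℂ → ℂ,
      (∀ i, AnalyticAt ℂ (f i) x) ∧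
      GermEq (x : CP1) s fun z => ∑ i, f i z • res P (e i) z := by
  obtain ⟨f, hf, h⟩ := (mem_holGerms_iff he hx).1 hs
  refine ⟨fun i z => f i (z - x), fun i => ?_, germEq_iff.2 h⟩
  exact AnalyticAt.fun_comp (g := f i) (f := fun t : ℂ => t - x) (by simpa using hf i)
    (by fun_prop)

theorem mem_merGerms_iff (hx : x ∈ poles P) : s ∈ E.merGerms P x ↔
    ∃ k : ℕ, mulSec (fun z => unif x z ^ k) s ∈ E.holGerms P x :=
  ⟨fun h => h.2 hx, fun h => ⟨fun h' => absurd hx h', fun _ => h⟩⟩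

theorem merGerms_of_hol (hs : s ∈ E.holGerms P x) : s ∈ E.merGerms P x :=
  ⟨fun _ => hs, fun _ => ⟨0, by
    have h : mulSec (fun z => unif x z ^ 0) s = s := by funext z; simp [mulSec]
    rwa [h]⟩⟩

theorem merGerms_congr (hs : s ∈ E.merGerms P x) (h : GermEq x s t) : t ∈ E.merGerms P x := by
  rw [germEq_iff] at h
  refine ⟨fun hx => holGerms_congr (hs.1 hx) h, fun hx => ?_⟩
  obtain ⟨k, hk⟩ := hs.2 hx
  exact ⟨k, holGerms_congr hk (h.mono fun z h1 hz => by simp only [mulSec_apply, h1 hz])⟩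

theorem unif_pow_mem {k l : ℕ} (hkl : k ≤ l)
    (h : mulSec (fun z => unif x z ^ k) s ∈ E.holGerms P x) :
    mulSec (fun z => unif x z ^ l) s ∈ E.holGerms P x := by
  refine holGerms_congr (holGerms_mul (f := fun t => t ^ (l - k)) h (by fun_prop))
    (Eventually.of_forall fun z hz => ?_)
  simp only [mulSec_apply, smul_smul, ← pow_add, Nat.sub_add_cancel hkl]

theorem merGerms_add (hs : s ∈ E.merGerms P x) (ht : t ∈ E.merGerms P x) :
    s + t ∈ E.merGerms P x := by
  refine ⟨fun hx => holGerms_add (hs.1 hx) (ht.1 hx), fun hx => ?_⟩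
  obtain ⟨k, hk⟩ := hs.2 hx
  obtain ⟨l, hl⟩ := ht.2 hx
  refine ⟨max k l, holGerms_congr (holGerms_add (unif_pow_mem (le_max_left k l) hk)
    (unif_pow_mem (le_max_right k l) hl)) (Eventually.of_forall fun z hz => ?_)⟩
  simp [mulSec_apply]

theorem merGerms_mul {f : ℂ → ℂ} (hs : s ∈ E.merGerms P x) (hf : AnalyticAt ℂ f 0) :
    mulSec (fun z => f (unif x z)) s ∈ E.merGerms P x := by
  refine ⟨fun hx => holGerms_mul (hs.1 hx) hf, fun hx => ?_⟩
  obtain ⟨k, hk⟩ := hs.2 hx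
  refine ⟨k, holGerms_congr (holGerms_mul hk hf) (Eventually.of_forall fun z hz => ?_)⟩
  simp only [mulSec_apply]
  exact smul_comm _ _ _

theorem merGerms_near (hs : s ∈ E.merGerms P x) :
    ∀ᶠ z in nf x, z ∉ P → s ∈ E.holGerms P (z : CP1) := by
  by_cases hx : x ∈ poles P
  · obtain ⟨k, hk⟩ := hs.2 hx
    filter_upwards [eventually_nf_of_nhds (holGerms_eventually hk),
      eventually_nf_of_nhds (eventually_nhds_of_nf (unif_ne_zero hx)), unif_ne_zero hx]
      with z h1 h2 h3 hz
    have ha : AnalyticAt ℂ (fun w => (unif x w ^ k)⁻¹) z := by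
      induction x using OnePoint.rec with
      | coe p =>
        simp only [unif_coe]
        exact ((analyticAt_id.fun_sub analyticAt_const).fun_pow k).fun_inv
          (pow_ne_zero _ (by simpa [unif_coe] using h3 hz))
      | infty =>
        simp only [unif_infty, inv_pow, inv_inv]
        exact analyticAt_id.fun_pow k
    refine holGerms_congr (holGerms_mul_coe h1 ha) ?_
    filter_upwards [h2] with w hw hw'
    simp only [mulSec_apply, smul_smul]
    rw [inv_mul_cancel₀ (pow_ne_zero _ (hw hw')), one_smul]
  · filter_upwards [eventually_nf_of_nhds (holGerms_eventually (hs.1 hx))] with z h1 hz using h1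

end HolBundle

/-! ### The connection in frames -/

namespace MeroConnection

variable {r : ℕ} {P : Finset ℂ} (C : MeroConnection.{u} r P)

theorem D_germ {x : CP1} {s t : C.E.Sec P} (h : GermEq x s t) : GermEq x (C.D s) (C.D t) := by
  refine germEq_iff.2 ((eventually_nf_of_nhds h.eventually).mono fun z hz hP => ?_)
  exact C.D_local ⟨z, hP⟩ s t hz

theorem D_sum (z : Punct P) {n : ℕ} (f : Fin n → ℂ → ℂ) (s : Fin n → C.E.Sec P)
    (hf : ∀ k, AnalyticAt ℂ (f k) z) (hs : ∀ k, s k ∈ C.E.holGerms P z.pt) :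
    C.D (fun w => ∑ k, f k w • s k w) z =
      ∑ k, (f k z • C.D (s k) z + deriv (f k) z • s k z) := by
  induction n with
  | zero =>
    simp only [Finset.univ_eq_empty, Finset.sum_empty]
    have h := C.D_leibniz z (fun _ => 0) 0 analyticAt_const holGerms_zero
    have h0 : mulSec (fun _ => 0) (0 : C.E.Sec P) = fun _ => 0 := by funext w; simp [mulSec]
    rw [h0] at h
    simpa using h
  | succ n ih =>
    have h1 : (fun w : Punct P => ∑ k, f k w • s k w) =
        (fun w : Punct P => ∑ k : Fin n, f k.castSucc w • s k.castSucc w) +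
          mulSec (f (Fin.last n)) (s (Fin.last n)) := by
      funext w; simp [Fin.sum_univ_castSucc, mulSec]
    rw [h1, C.D_add z _ _ (holGerms_sum_coe (fun k => hs _) fun k => hf _)
      (holGerms_mul_coe (hs _) (hf _)), ih _ _ (fun k => hf _) (fun k => hs _),
      C.D_leibniz z _ _ (hf _) (hs _), Fin.sum_univ_castSucc]

theorem D_mul_germ {x : CP1} {s : C.E.Sec P} {f : ℂ → ℂ} (hs : s ∈ C.E.merGerms P x)
    (hf : ∀ᶠ z in nf x, z ∉ P → AnalyticAt ℂ f z) :
    GermEq x (C.D (mulSec f s)) (mulSec f (C.D s) + mulSec (deriv f) s) := by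
  refine germEq_iff.2 ?_
  filter_upwards [merGerms_near hs, hf] with z h1 h2 hz
  exact C.D_leibniz ⟨z, hz⟩ f s (h2 hz) (h1 hz)

theorem D_add_germ {x : CP1} {s t : C.E.Sec P} (hs : s ∈ C.E.merGerms P x)
    (ht : t ∈ C.E.merGerms P x) : GermEq x (C.D (s + t)) (C.D s + C.D t) := by
  refine germEq_iff.2 ?_
  filter_upwards [merGerms_near hs, merGerms_near ht] with z h1 h2 hz
  exact C.D_add ⟨z, hz⟩ s t (h1 hz) (h2 hz)

/-- In the frame `e` at the finite point `x`, the connection is `d + diag(μ) dx / (x - p) + B dx`. -/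
def IsLog (x : ℂ) (e : Fin r → ∀ y, C.E.Fib y) (μ : Fin r → ℂ) (B : Fin r → Fin r → ℂ → ℂ) :
    Prop :=
  (∃ U, (x : CP1) ∈ U ∧ C.E.IsFrame U e) ∧ (∀ i j, AnalyticAt ℂ (B i j) x) ∧
  ∀ i, GermEq (x : CP1) (C.D (res P (e i))) fun z =>
    (μ i / ((z : ℂ) - x)) • res P (e i) z + ∑ j, B j i z • res P (e j) z

theorem isLog_frame (p : P) : ∃ B, C.IsLog p (C.frame p) (C.μ p) B := by
  obtain ⟨U, hp, he, B, hB, h⟩ := C.log_form p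
  refine ⟨fun i j z => B i j z, ⟨U, hp, he⟩, fun i j => holAt_coe.1 (hB i j), fun i => ?_⟩
  exact ⟨U, he.1.mem_nhds hp, fun z hz => h i z hz⟩

theorem exists_isLog_of_notMem {x : ℂ} (hx : x ∉ P) : ∃ e B, C.IsLog x e 0 B := by
  obtain ⟨U, e, hxU, he, -⟩ := C.E.exists_isFrame (x : CP1)
  have h1 := fun i => C.D_hol ⟨x, hx⟩ _ (res_mem (P := P) ((he.2 _ hxU).2.2 i))
  choose f hf h using fun i => mem_holGerms_coe he hxU (h1 i)
  exact ⟨e, fun j i => f i j, ⟨U, hxU, he⟩, fun j i => hf i j, fun i => by simpa using h i⟩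

/-- The exponents at a finite point: those of the residue at `p ∈ P`, and zero elsewhere. -/
theorem exists_isLog (hC : C.ResonanceFree) (x : ℂ) : ∃ e μ B, C.IsLog x e μ B ∧
    (∀ i, ∀ k : ℕ, μ i + ((k + 1 : ℕ) : ℂ) ≠ 0) ∧ (x ∉ P → μ = 0) := by
  have hn : ∀ k : ℕ, (0 : ℂ) + ((k + 1 : ℕ) : ℂ) ≠ 0 := fun k => by
    rw [zero_add]; exact_mod_cast Nat.succ_ne_zero k
  by_cases hx : x ∈ P
  · obtain ⟨B, hB⟩ := C.isLog_frame ⟨x, hx⟩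
    refine ⟨_, _, B, hB, fun i k h => ?_, fun h => absurd hx h⟩
    by_cases h0 : C.μ ⟨x, hx⟩ i = 0
    · rw [h0] at h; exact hn k h
    · refine hC.1 _ i h0 (-(k + 1 : ℕ)) ?_
      have := congrArg Complex.re (eq_neg_of_add_eq_zero_left h)
      simpa using this
  · obtain ⟨e, B, h⟩ := C.exists_isLog_of_notMem hx
    exact ⟨e, 0, B, h, fun i k => hn k, fun _ => rfl⟩

variable {C}

theorem IsLog.D_eq {x : ℂ} {e : Fin r → ∀ y, C.E.Fib y} {μ : Fin r → ℂ}
    {B : Fin r → Fin r → ℂ → ℂ} (h : C.IsLog x e μ B) {f : Fin r → ℂ → ℂ}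
    (hf : ∀ᶠ z in 𝓝 x, z ∉ P → ∀ i, AnalyticAt ℂ (f i) z) :
    GermEq (x : CP1) (C.D fun z => ∑ i, f i z • res P (e i) z) fun z =>
      ∑ i, (deriv (f i) z + μ i / ((z : ℂ) - x) * f i z + ∑ j, B i j z * f j z) •
        res P (e i) z := by
  obtain ⟨⟨U, hx, he⟩, hB, h⟩ := h
  refine germEq_iff.2 ?_
  have h' := eventually_all.2 fun i => germEq_iff.1 (h i)
  filter_upwards [h', eventually_nf_of_nhds (he.1.mem_nhds hx), (nf_coe x).symm ▸ hf]
    with z h1 h2 h3 hz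
  have h1 := fun i => h1 i hz
  rw [C.D_sum ⟨z, hz⟩ _ _ (h3 hz) fun i => res_mem ((he.2 _ h2).2.2 i)]
  simp only [h1, smul_add, Finset.smul_sum, smul_smul, add_smul, Finset.sum_add_distrib,
    Finset.sum_smul]
  rw [Finset.sum_comm]
  simp only [mul_comm]
  abel

/-- A section near a finite point times the local parameter has a holomorphic derivative. -/
theorem hol_unif_D (hC : C.ResonanceFree) {x : ℂ} {s : C.E.Sec P}
    (hs : s ∈ C.E.holGerms P (x : CP1)) :
    mulSec (fun z => z - x) (C.D s) ∈ C.E.holGerms P (x : CP1) := by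
  obtain ⟨e, μ, B, h, -, -⟩ := C.exists_isLog hC x
  obtain ⟨⟨U, hx, he⟩, hB, -⟩ := id h
  obtain ⟨f, hf, hfs⟩ := mem_holGerms_coe he hx hs
  have h1 := h.D_eq (f := f)
    ((eventually_all.2 fun i => (hf i).eventually_analyticAt).mono fun z hz _ => hz)
  have h2 := (C.D_germ hfs).trans h1
  rw [germEq_iff, nf_coe] at h2
  by_cases hxP : x ∈ P
  · refine holGerms_congr (holGerms_sum_coe (f := fun i z => (z - x) * deriv (f i) z + μ i * f i z +
      (z - x) * ∑ j, B i j z * f j z) (fun i => res_mem ((he.2 _ hx).2.2 i)) fun i => ?_) ?_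
    · have h3 : AnalyticAt ℂ (fun z => z - x) x := by fun_prop
      exact ((h3.fun_mul (hf i).deriv).fun_add (analyticAt_const.fun_mul (hf i))).fun_add
        (h3.fun_mul (Finset.analyticAt_fun_sum _ fun j _ => (hB i j).fun_mul (hf j)))
    · rw [nf_coe]
      filter_upwards [h2] with z h2 hz
      have h3 : z - x ≠ 0 := sub_ne_zero.2 fun h => hz (h ▸ hxP)
      rw [mulSec_apply, h2 hz, Finset.smul_sum]
      refine Finset.sum_congr rfl fun i _ => ?_
      rw [smul_smul]
      congr 1
      field_simp
  · exact holGerms_mul_coe (C.D_hol ⟨x, hxP⟩ s hs) (by fun_prop)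

/-- The derivation preserves the meromorphic germs at finite points. -/
theorem mer_D (hC : C.ResonanceFree) {x : ℂ} {s : C.E.Sec P}
    (hs : s ∈ C.E.merGerms P (x : CP1)) : C.D s ∈ C.E.merGerms P (x : CP1) := by
  by_cases hxP : (x : CP1) ∈ poles P
  · obtain ⟨k, hk⟩ := hs.2 hxP
    refine (mem_merGerms_iff hxP).2 ⟨k + 1, ?_⟩
    refine holGerms_congr (holGerms_add (hol_unif_D hC hk) (holGerms_smul (-k : ℂ) hk)) ?_
    filter_upwards [germEq_iff.1 (C.D_mul_germ (f := fun z => (z - x) ^ k) hs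
      (Eventually.of_forall fun z _ => by fun_prop)), unif_ne_zero hxP] with z h1 h2 hz
    have h1 := h1 hz
    have h2 := h2 hz
    simp only [unif_coe] at h2 ⊢
    simp only [mulSec_apply, Pi.add_apply, Pi.smul_apply] at h1 ⊢
    rw [h1, smul_add, smul_smul, smul_smul, add_assoc, smul_smul, ← add_smul]
    have h3 : deriv (fun z => (z - x) ^ k) z = k * (z - x) ^ (k - 1) := by simp
    rw [h3]
    have h4 : (z - x) * (k * (z - x) ^ (k - 1)) + -k * (z - x) ^ k = 0 := by
      rcases k with _ | k
      · simp
      · simp [pow_succ]; ring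
    rw [h4, zero_smul, add_zero, pow_succ']
  · have hx : x ∉ P := fun h => hxP (coe_mem_poles.2 h)
    exact merGerms_of_hol (C.D_hol ⟨x, hx⟩ s (hs.1 hxP))

end MeroConnection

end MinLaplace

namespace MinLaplace

open Filter Set HolBundle

universe u

namespace MeroConnection

variable {r : ℕ} {P : Finset ℂ} {C : MeroConnection.{u} r P}

/-! ### The connection at infinity -/

variable (C) in
/-- In the frame `e` at infinity, the connection is `d + (diag(α) + diag(μ) / x + B / x ^ 2) dx`. -/
def IsIrr (e : Fin r → ∀ y, C.E.Fib y) (B : Fin r → Fin r → ℂ → ℂ) : Prop :=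
  (∃ U, OnePoint.infty ∈ U ∧ C.E.IsFrame U e) ∧ (∀ i j, AnalyticAt ℂ (B i j) 0) ∧
  ∀ i, GermEq OnePoint.infty (C.D (res P (e i))) fun z =>
    (C.α i + C.μInf i / (z : ℂ)) • res P (e i) z +
      ∑ j, (B j i (z : ℂ)⁻¹ / (z : ℂ) ^ 2) • res P (e j) z

variable (C) in
theorem exists_isIrr : ∃ e B, C.IsIrr e B := by
  obtain ⟨U, hU, e, he, B, hB, h⟩ := C.irr_form
  choose g hg _ hgB using fun i j => (hB i j).exists_analyticAt
  refine ⟨e, g, ⟨U, hU, he⟩, hg, fun i => germEq_iff.2 ?_⟩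
  filter_upwards [eventually_nf_of_nhds (he.1.mem_nhds hU), eventually_infty_ne_zero,
    eventually_all.2 fun i => eventually_all.2 fun j => hgB i j] with z h1 h2 h3 hz
  have h4 := h i ⟨z, hz⟩ h1 h2
  refine h4.trans ?_
  simp only [← unif_infty, ← h3]
  rfl

variable {e : Fin r → ∀ y, C.E.Fib y} {B : Fin r → Fin r → ℂ → ℂ}

theorem IsIrr.D_eq (h : C.IsIrr e B) {f : Fin r → ℂ → ℂ}
    (hf : ∀ᶠ z in nf OnePoint.infty, ∀ i, AnalyticAt ℂ (f i) z) :
    GermEq OnePoint.infty (C.D fun z => ∑ i, f i z • res P (e i) z) fun z =>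
      ∑ i, (deriv (f i) z + (C.α i + C.μInf i / (z : ℂ)) * f i z +
        ∑ j, B i j (z : ℂ)⁻¹ / (z : ℂ) ^ 2 * f j z) • res P (e i) z := by
  obtain ⟨⟨U, hx, he⟩, hB, h⟩ := h
  refine germEq_iff.2 ?_
  have h' := eventually_all.2 fun i => germEq_iff.1 (h i)
  filter_upwards [h', eventually_nf_of_nhds (he.1.mem_nhds hx), hf]
    with z h1 h2 h3 hz
  have h1 := fun i => h1 i hz
  rw [C.D_sum ⟨z, hz⟩ _ _ h3 fun i => res_mem ((he.2 _ h2).2.2 i)]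
  simp only [h1, smul_add, Finset.smul_sum, smul_smul, Finset.sum_add_distrib,
    Finset.sum_smul, add_smul]
  rw [Finset.sum_comm]
  simp only [mul_comm, mul_add, add_smul, Finset.sum_add_distrib]
  abel

/-- A meromorphic germ at infinity in a frame. -/
theorem mem_mer_infty {U : Set CP1} (hU : OnePoint.infty ∈ U) (he : C.E.IsFrame U e)
    {s : C.E.Sec P} : s ∈ C.E.merGerms P OnePoint.infty ↔ ∃ (k : ℕ) (f : Fin r → ℂ → ℂ),
      (∀ i, AnalyticAt ℂ (f i) 0) ∧
      GermEq OnePoint.infty s fun z => ∑ i, ((z : ℂ) ^ k * f i (z : ℂ)⁻¹) • res P (e i) z := by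
  rw [mem_merGerms_iff infty_mem_poles]
  refine exists_congr fun k => ?_
  rw [mem_holGerms_iff he hU]
  refine exists_congr fun f => and_congr_right fun _ => ?_
  rw [germEq_iff]
  refine eventually_congr ?_
  filter_upwards [eventually_infty_ne_zero] with z h0
  refine forall_congr' fun hz => ?_
  simp only [mulSec_apply, unif_infty, ← smul_smul, ← Finset.smul_sum, res]
  have h1 : z ^ k ≠ 0 := pow_ne_zero _ h0
  rw [inv_pow]
  constructor
  · intro h
    rw [show (∑ i, f i z⁻¹ • e i (Punct.pt ⟨z, hz⟩) : C.E.Fib (Punct.pt ⟨z, hz⟩)) = _ from h.symm,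
      smul_smul, mul_inv_cancel₀ h1, one_smul]
  · intro h
    rw [h, smul_smul, inv_mul_cancel₀ h1, one_smul]
    rfl

theorem eventually_analyticAt_inv {f : ℂ → ℂ} (hf : AnalyticAt ℂ f 0) :
    ∀ᶠ z in nf OnePoint.infty, AnalyticAt ℂ (fun w => f w⁻¹) z := by
  filter_upwards [tendsto_inv_nf_infty.eventually hf.eventually_analyticAt,
    eventually_infty_ne_zero] with z h1 h2
  exact AnalyticAt.fun_comp (g := f) (f := fun w : ℂ => w⁻¹) h1 (analyticAt_id.fun_inv h2)

theorem deriv_zpow_mul_inv {f : ℂ → ℂ} (hf : AnalyticAt ℂ f 0) (k : ℤ) :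
    ∀ᶠ z in nf OnePoint.infty, deriv (fun w => w ^ k * f w⁻¹) z =
      z ^ k * (k * z⁻¹ * f z⁻¹ - deriv f z⁻¹ * z⁻¹ ^ 2) := by
  filter_upwards [tendsto_inv_nf_infty.eventually hf.eventually_analyticAt,
    eventually_infty_ne_zero] with z h1 h2
  have h3 : HasDerivAt (fun w : ℂ => f w⁻¹) (deriv f z⁻¹ * (-(z ^ 2)⁻¹)) z :=
    HasDerivAt.comp z h1.differentiableAt.hasDerivAt (hasDerivAt_inv h2)
  have h4 := (hasDerivAt_zpow k z (Or.inl h2)).mul h3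
  rw [HasDerivAt.deriv (f := fun w => w ^ k * f w⁻¹) h4, zpow_sub_one₀ h2]
  field_simp
  ring

/-- The section `s` is `x ^ k` times the section with the coefficients `f (1 / x)` in the
frame `e`, near infinity. -/
def InfForm (e : Fin r → ∀ y, C.E.Fib y) (k : ℤ) (f : Fin r → ℂ → ℂ) (s : C.E.Sec P) : Prop :=
  (∀ i, AnalyticAt ℂ (f i) 0) ∧
  GermEq OnePoint.infty s fun z => ∑ i, ((z : ℂ) ^ k * f i (z : ℂ)⁻¹) • res P (e i) z

variable (C) in
/-- The coefficients of the derivative of a section at infinity. -/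
def infDer (B : Fin r → Fin r → ℂ → ℂ) (k : ℤ) (f : Fin r → ℂ → ℂ) (i : Fin r) (t : ℂ) : ℂ :=
  k * t * f i t - deriv (f i) t * t ^ 2 + (C.α i + C.μInf i * t) * f i t +
    ∑ j, B i j t * t ^ 2 * f j t

/-- In the coordinate `t = 1 / x` the derivation is `-t² ∂/∂t`, so it does not raise the order at
infinity. At `t = 0` only the term `α i * f i` of the coefficient survives; all later reductions of
the order rest on this. -/
theorem InfForm.der (h : C.IsIrr e B) {k : ℤ} {f : Fin r → ℂ → ℂ} {s : C.E.Sec P}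
    (hs : InfForm e k f s) : InfForm e k (C.infDer B k f) (C.D s) := by
  obtain ⟨⟨U, hU, he⟩, hB, -⟩ := id h
  obtain ⟨hf, hs⟩ := hs
  have h1 := h.D_eq (f := fun i z => z ^ k * f i z⁻¹) (eventually_all.2 fun i => by
    filter_upwards [eventually_analyticAt_inv (hf i), eventually_infty_ne_zero] with z hz h0
    exact (analyticAt_id.fun_zpow h0).fun_mul hz)
  refine ⟨fun i => ?_, ((C.D_germ hs).trans h1).trans (germEq_iff.2 ?_)⟩
  · have h1 : AnalyticAt ℂ (fun t : ℂ => t) 0 := analyticAt_id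
    have h2 : ∀ c : ℂ, AnalyticAt ℂ (fun t : ℂ => c) 0 := fun c => analyticAt_const
    exact (((((h2 k).fun_mul h1).fun_mul (hf i)).fun_sub
      ((hf i).deriv.fun_mul (h1.fun_pow 2))).fun_add
      (((h2 _).fun_add ((h2 _).fun_mul h1)).fun_mul (hf i))).fun_add
      (Finset.analyticAt_fun_sum _ fun j _ => ((hB i j).fun_mul (h1.fun_pow 2)).fun_mul (hf j))
  · filter_upwards [eventually_all.2 fun i => deriv_zpow_mul_inv (hf i) k,
      eventually_infty_ne_zero] with z h2 h0 hz
    refine Finset.sum_congr rfl fun i _ => ?_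
    congr 1
    simp only [h2, mul_add, Finset.mul_sum, infDer]
    congr 1
    · field_simp
    · refine Finset.sum_congr rfl fun j _ => ?_
      field_simp

/-- The derivation preserves the meromorphic germs at infinity. -/
theorem mer_D_infty {s : C.E.Sec P} (hs : s ∈ C.E.merGerms P OnePoint.infty) :
    C.D s ∈ C.E.merGerms P OnePoint.infty := by
  obtain ⟨e, B, h⟩ := C.exists_isIrr
  obtain ⟨⟨U, hU, he⟩, hB, -⟩ := id h
  obtain ⟨k, f, hf, hs⟩ := (mem_mer_infty hU he).1 hs
  have h1 : InfForm e k f s := ⟨hf, by simpa using hs⟩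
  obtain ⟨h2, h3⟩ := h1.der h
  exact (mem_mer_infty hU he).2 ⟨k, _, h2, by simpa using h3⟩

end MeroConnection

namespace MeroConnection.DSubmodule

variable {r : ℕ} {P : Finset ℂ} {C : MeroConnection.{u} r P} (N : C.DSubmodule)

/-! ### Germs of an extension -/

theorem mul_mem_coe {x : ℂ} {s : C.E.Sec P} {f : ℂ → ℂ} (hf : AnalyticAt ℂ f x)
    (hs : s ∈ N.stalk (x : CP1)) : mulSec f s ∈ N.stalk (x : CP1) :=
  N.mul_mem _ s (fun y => y.elim 0 f) (holAt_affine hf) hs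

theorem mul_mem_infty {s : C.E.Sec P} {f : ℂ → ℂ} (hf : AnalyticAt ℂ f 0)
    (hs : s ∈ N.stalk OnePoint.infty) : mulSec (fun z => f z⁻¹) s ∈ N.stalk OnePoint.infty := by
  obtain ⟨g, hg, -, hgf⟩ := exists_holAt OnePoint.infty hf
  refine N.congr _ _ _ (N.mul_mem _ s g hg hs) (germEq_iff.2 (Eventually.of_forall fun z hz => ?_))
  simp only [mulSec_apply, hgf, unif_infty]

/-- A submodule contains the holomorphic germs if it does so up to multiplication by powers of the
local parameter. -/
theorem hol_le_of_pow (hC : C.ResonanceFree) {x : ℂ}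
    (h : ∀ s ∈ C.E.holGerms P (x : CP1), ∃ k : ℕ,
      mulSec (fun z => (z - x) ^ k) s ∈ N.stalk (x : CP1))
    {s : C.E.Sec P} (hs : s ∈ C.E.holGerms P (x : CP1)) : s ∈ N.stalk (x : CP1) := by
  obtain ⟨e, μ, B, hl, hμ, hμ0⟩ := C.exists_isLog hC x
  obtain ⟨⟨U, hx, he⟩, hB, hD⟩ := id hl
  have hpow : ∀ (k n : ℕ) {s : C.E.Sec P}, mulSec (fun z => (z - x) ^ k) s ∈ N.stalk (x : CP1) →
      mulSec (fun z => (z - x) ^ (k + n)) s ∈ N.stalk (x : CP1) := by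
    intro k n s hs
    refine N.congr _ _ _ (N.mul_mem_coe (f := fun z => (z - x) ^ n) (by fun_prop) hs)
      (germEq_iff.2 (Eventually.of_forall fun z hz => ?_))
    simp only [mulSec_apply, smul_smul]
    congr 1; ring
  choose k hk using fun i => h _ (res_mem (P := P) ((he.2 _ hx).2.2 i))
  have hK : ∀ i, mulSec (fun z => (z - x) ^ (∑ i, k i)) (res P (e i)) ∈ N.stalk (x : CP1) := by
    intro i
    have h1 : k i ≤ ∑ i, k i := Finset.single_le_sum (fun _ _ => Nat.zero_le _) (Finset.mem_univ i)
    have := hpow (k i) (∑ i, k i - k i) (hk i)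
    rwa [Nat.add_sub_cancel' h1] at this
  -- Applied to `(z - x) ^ (K + 1)` times a frame vector, the derivation yields `(μ i + K + 1) * (z
  -- - x) ^ K` times this vector, plus terms already in the submodule. The scalar is invertible, so
  -- the exponent can be lowered to zero.
  have hdesc : ∀ K : ℕ, (∀ i, mulSec (fun z => (z - x) ^ K) (res P (e i)) ∈ N.stalk (x : CP1)) →
      ∀ i, res P (e i) ∈ N.stalk (x : CP1) := by
    intro K
    induction K with
    | zero => intro h i; exact N.congr _ _ _ (h i) (germEq_iff.2
        (Eventually.of_forall fun z hz => by simp [mulSec_apply]))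
    | succ K ih =>
      intro h
      refine ih fun i => ?_
      have h1 : ∑ j, mulSec (B j i) (mulSec (fun z => (z - x) ^ (K + 1)) (res P (e j))) ∈
          N.stalk (x : CP1) :=
        Submodule.sum_mem _ fun j _ => N.mul_mem_coe (hB j i) (h j)
      have h2 := (N.stalk _).smul_mem (μ i + ((K + 1 : ℕ) : ℂ))⁻¹
        ((N.stalk _).sub_mem (N.der_mem x _ (h i)) h1)
      refine N.congr _ _ _ h2 (germEq_iff.2 ?_)
      have h3 := C.D_mul_germ (f := fun z => (z - x) ^ (K + 1))
        (merGerms_of_hol (res_mem (P := P) ((he.2 _ hx).2.2 i)))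
        (Eventually.of_forall fun z _ => by fun_prop)
      filter_upwards [germEq_iff.1 h3, germEq_iff.1 (hD i)] with z h3 h4 hz
      have hμ' := hμ i K
      rw [Pi.smul_apply, Pi.sub_apply, h3 hz]
      simp only [Pi.add_apply, mulSec_apply, Finset.sum_apply]
      rw [h4 hz]
      have h5 : deriv (fun z => (z - x) ^ (K + 1)) z = ((K + 1 : ℕ) : ℂ) * (z - x) ^ K := by simp
      -- If `x ∉ P`, the point `z = x` is tested as well, and there the quotient is a division by
      -- zero; this is harmless since then `μ = 0`.
      have h6 : (z - x) ^ (K + 1) * (μ i / (z - x)) = μ i * (z - x) ^ K := by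
        by_cases h0 : z - x = 0
        · by_cases hxP : x ∈ P
          · exact absurd (sub_eq_zero.1 h0 ▸ hxP) hz
          · rw [hμ0 hxP]; simp
        · rw [pow_succ]; field_simp
      simp only [smul_add, Finset.smul_sum, smul_smul, h5, h6, mul_comm ((z - x) ^ (K + 1))]
      rw [add_right_comm, add_sub_cancel_right, ← add_smul, ← add_mul, smul_smul, ← mul_assoc,
        inv_mul_cancel₀ hμ', one_mul]
  obtain ⟨f, hf, hfs⟩ := mem_holGerms_coe he hx hs
  have h1 : ∑ i, mulSec (f i) (res P (e i)) ∈ N.stalk (x : CP1) :=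
    Submodule.sum_mem _ fun i _ => N.mul_mem_coe (hf i) (hdesc _ hK i)
  refine N.congr _ _ _ h1 (germEq_iff.2 ?_)
  filter_upwards [germEq_iff.1 hfs] with z h1 hz
  rw [h1 hz]
  simp [Finset.sum_apply, mulSec_apply]

/-- A submodule contains all meromorphic germs at infinity if it does so up to multiplication by
powers of the local parameter. -/
theorem mer_le_of_pow (hC : C.ResonanceFree)
    (h : ∀ s ∈ C.E.holGerms P OnePoint.infty, ∃ k : ℕ,
      mulSec (fun z => z⁻¹ ^ k) s ∈ N.stalk OnePoint.infty)
    {s : C.E.Sec P} (hs : s ∈ C.E.merGerms P OnePoint.infty) : s ∈ N.stalk OnePoint.infty := by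
  obtain ⟨e, B, hl⟩ := C.exists_isIrr
  obtain ⟨⟨U, hx, he⟩, hB, hD⟩ := id hl
  have hdown : ∀ (a : ℤ) (n : ℕ) {s : C.E.Sec P},
      mulSec (fun z => z ^ a) s ∈ N.stalk OnePoint.infty →
      mulSec (fun z => z ^ (a - n)) s ∈ N.stalk OnePoint.infty := by
    intro a n s hs
    refine N.congr _ _ _ (N.mul_mem_infty (f := fun t => t ^ n) (by fun_prop) hs)
      (germEq_iff.2 ?_)
    filter_upwards [eventually_infty_ne_zero] with z h0 hz
    simp only [mulSec_apply, smul_smul]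
    congr 1
    rw [zpow_sub₀ h0, zpow_natCast, inv_pow]; ring
  choose k hk using fun i => h _ (res_mem (P := P) ((he.2 _ hx).2.2 i))
  have hK : ∀ i, mulSec (fun z => z ^ (-(∑ i, k i : ℕ) : ℤ)) (res P (e i)) ∈
      N.stalk OnePoint.infty := by
    intro i
    have h1 : k i ≤ ∑ i, k i := Finset.single_le_sum (fun _ _ => Nat.zero_le _) (Finset.mem_univ i)
    have h2 : mulSec (fun z => z ^ (-(k i : ℕ) : ℤ)) (res P (e i)) ∈ N.stalk OnePoint.infty := by
      refine N.congr _ _ _ (hk i) (germEq_iff.2 (Eventually.of_forall fun z hz => ?_))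
      simp [mulSec_apply]
    have := hdown (-(k i : ℕ) : ℤ) (∑ i, k i - k i) h2
    convert this using 3
    rw [Nat.cast_sub h1]; ring_nf
  -- Here `x ^ 2 * D` raises the power of `x`: up to terms in the submodule, `x ^ a` times a frame
  -- vector goes to `α i * x ^ (a + 2) + (a + μInf i) * x ^ (a + 1)` times it. If `α i = 0`, the
  -- scalar `a + μInf i` is not zero because the real part of `μInf i` is not an integer; otherwise
  -- the factor is `x ^ (a + 2)` times a unit. Either way the exponent `a + 1` is reached.
  have hasc : ∀ n : ℕ, ∀ a : ℤ,
      (∀ i, mulSec (fun z => z ^ a) (res P (e i)) ∈ N.stalk OnePoint.infty) →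
      ∀ i, mulSec (fun z => z ^ (a + n)) (res P (e i)) ∈ N.stalk OnePoint.infty := by
    intro n
    induction n with
    | zero => intro a h i; simpa using h i
    | succ n ih =>
      intro a h i
      rw [show a + (n + 1 : ℕ) = (a + 1) + n by push_cast; ring]
      refine ih (a + 1) (fun i => ?_) i
      have h1 : ∑ j, mulSec (fun z => B j i z⁻¹) (mulSec (fun z => z ^ a) (res P (e j))) ∈
          N.stalk OnePoint.infty :=
        Submodule.sum_mem _ fun j _ => N.mul_mem_infty (hB j i) (h j)
      have h2 := (N.stalk _).sub_mem (N.der_mem_infty _ (h i)) h1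
      have h3 := C.D_mul_germ (f := fun z => z ^ a)
        (merGerms_of_hol (res_mem (P := P) ((he.2 _ hx).2.2 i)))
        (eventually_infty_ne_zero.mono fun z h0 _ => analyticAt_id.zpow h0)
      have key : GermEq OnePoint.infty
          (mulSec (fun z => z ^ 2) (C.D (mulSec (fun z => z ^ a) (res P (e i)))) -
            ∑ j, mulSec (fun z => B j i z⁻¹) (mulSec (fun z => z ^ a) (res P (e j))))
          (mulSec (fun z => C.α i * z ^ (a + 2) + (a + C.μInf i) * z ^ (a + 1)) (res P (e i))) := by
        refine germEq_iff.2 ?_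
        filter_upwards [germEq_iff.1 h3, germEq_iff.1 (hD i), eventually_infty_ne_zero]
          with z h3 h4 h0 hz
        rw [Pi.sub_apply, mulSec_apply, h3 hz]
        simp only [Pi.add_apply, mulSec_apply, Finset.sum_apply]
        rw [h4 hz]
        have h5 : deriv (fun z : ℂ => z ^ a) z = a * z ^ (a - 1) := by simp
        have h6 : ∀ j, z ^ 2 * (z ^ a * (B j i z⁻¹ / z ^ 2)) = B j i z⁻¹ * z ^ a := fun j => by
          field_simp
        simp only [smul_add, Finset.smul_sum, smul_smul, h5, h6]
        rw [add_right_comm, add_sub_cancel_right, ← add_smul]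
        congr 1
        rw [zpow_add₀ h0, zpow_add₀ h0, zpow_sub₀ h0]
        simp only [zpow_ofNat]
        field_simp
        ring
      have h4 := N.congr _ _ _ h2 key
      by_cases hα : C.α i = 0
      · have hne : (a : ℂ) + C.μInf i ≠ 0 := by
          intro h0
          refine hC.2.2.1 i (-a) ?_
          have := congrArg Complex.re (eq_neg_of_add_eq_zero_right h0)
          simpa using this
        refine N.congr _ _ _ ((N.stalk _).smul_mem ((a : ℂ) + C.μInf i)⁻¹ h4)
          (germEq_iff.2 (Eventually.of_forall fun z hz => ?_))
        simp only [Pi.smul_apply, mulSec_apply, smul_smul, hα, zero_mul, zero_add]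
        rw [← mul_assoc, inv_mul_cancel₀ hne, one_mul]
      · have hc : AnalyticAt ℂ (fun t : ℂ => C.α i + (a + C.μInf i) * t) 0 := by fun_prop
        have hc0 : C.α i + (a + C.μInf i) * 0 ≠ 0 := by simpa using hα
        have ha : AnalyticAt ℂ (fun t : ℂ => t * (C.α i + (a + C.μInf i) * t)⁻¹) 0 :=
          analyticAt_id.fun_mul (hc.fun_inv hc0)
        refine N.congr _ _ _ (N.mul_mem_infty ha h4) (germEq_iff.2 ?_)
        filter_upwards [eventually_infty_ne_zero,
          tendsto_inv_nf_infty.eventually (hc.continuousAt.eventually_ne hc0)] with z h0 h1 hz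
        simp only [mulSec_apply, smul_smul]
        congr 1
        have h5 : C.α i * z ^ (a + 2) + (a + C.μInf i) * z ^ (a + 1) =
            (C.α i + (a + C.μInf i) * z⁻¹) * z * z ^ (a + 1) := by
          rw [zpow_add₀ h0, zpow_add₀ h0]
          simp only [zpow_ofNat]
          field_simp
        rw [h5]
        generalize C.α i + (a + C.μInf i) * z⁻¹ = c at h1 ⊢
        field_simp
  obtain ⟨n, f, hf, hfs⟩ := (mem_mer_infty hx he).1 hs
  have h1 := hasc ((∑ i, k i) + n) _ hK
  have h2 : ∑ i, mulSec (fun z => f i z⁻¹) (mulSec (fun z => z ^ n) (res P (e i))) ∈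
      N.stalk OnePoint.infty :=
    Submodule.sum_mem _ fun i _ => N.mul_mem_infty (hf i) (by
      refine N.congr _ _ _ (h1 i) (germEq_iff.2 (Eventually.of_forall fun z hz => ?_))
      simp only [mulSec_apply]
      congr 1
      push_cast
      rw [neg_add_cancel_left, zpow_natCast])
  refine N.congr _ _ _ h2 (germEq_iff.2 ?_)
  filter_upwards [germEq_iff.1 hfs] with z h1 hz
  rw [h1 hz]
  simp [Finset.sum_apply, mulSec_apply, smul_smul, mul_comm]

/-- A submodule contains the holomorphic germs up to powers of the local parameter. -/
def IsFull : Prop := ∀ x, ∀ s ∈ C.E.holGerms P x, ∃ k : ℕ,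
  mulSec (fun z => unif x z ^ k) s ∈ N.stalk x

variable {N}

theorem IsFull.hol (h : N.IsFull) (hC : C.ResonanceFree) {x : CP1} {s : C.E.Sec P}
    (hs : s ∈ C.E.holGerms P x) : s ∈ N.stalk x := by
  induction x using OnePoint.rec with
  | coe x => exact N.hol_le_of_pow hC (h (x : CP1)) hs
  | infty => exact N.mer_le_of_pow hC (h OnePoint.infty) (merGerms_of_hol hs)

theorem IsFull.mer (h : N.IsFull) (hC : C.ResonanceFree) {s : C.E.Sec P}
    (hs : s ∈ C.E.merGerms P OnePoint.infty) : s ∈ N.stalk OnePoint.infty :=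
  N.mer_le_of_pow hC (h OnePoint.infty) hs

theorem IsExtension.isFull (h : N.IsExtension) : N.IsFull := fun x s hs => by
  obtain ⟨h1, h2⟩ := h x s (merGerms_of_hol hs)
  by_cases hx : x ∈ poles P
  · exact h2 hx
  · exact ⟨0, N.congr _ _ _ (h1 hx) (germEq_iff.2 (Eventually.of_forall fun z hz => by
      simp [mulSec_apply]))⟩

/-- The sheaf of forms is contained in every extension. -/
theorem IsFull.form (h : N.IsFull) (hC : C.ResonanceFree) {x : CP1} {s : C.E.Sec P}
    (hs : s ∈ C.formGerms x) : s ∈ N.stalk x := by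
  by_cases hx : ∀ p : P, x ≠ ((p : ℂ) : CP1)
  · exact h.hol hC (hs.1 hx)
  · push Not at hx
    obtain ⟨p, rfl⟩ := hx
    obtain ⟨σ, hσ, hsσ, hσp⟩ := hs.2 p rfl
    obtain ⟨B, hl⟩ := C.isLog_frame p
    obtain ⟨⟨U, hx, he⟩, hB, hD⟩ := id hl
    obtain ⟨f, hf, hfσ⟩ := (he.isHol_iff hx σ).1 hσ
    -- The condition on the residue says that no vector of the frame with eigenvalue zero occurs in
    -- it.
    have hf0 : ∀ i, C.μ p i = 0 → f i ((p : ℂ) : CP1) = 0 := by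
      intro i hi
      have h1 := hfσ.self_of_nhds
      have h2 := (he.isB hx).eq_coef h1
      rw [← congrFun h2 i]
      have : C.imRes p ≤ LinearMap.ker ((LinearMap.proj i).comp
          (coef fun i => C.frame p i ((p : ℂ) : CP1))) := by
        refine Submodule.span_le.2 ?_
        rintro _ ⟨j, rfl⟩
        have h3 : C.μ p j • C.frame p j ((p : ℂ) : CP1) = ∑ k, (if k = j then C.μ p j else 0) •
            C.frame p k ((p : ℂ) : CP1) := by simp
        have h4 := (he.isB hx).eq_coef h3
        simp only [SetLike.mem_coe, LinearMap.mem_ker, LinearMap.comp_apply, LinearMap.proj_apply]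
        rw [h4]
        change (if i = j then C.μ p j else 0) = 0
        split_ifs with h5
        · rw [← h5, hi]
        · rfl
      exact this hσp
    -- A simple pole along a vector with eigenvalue `μ ≠ 0` is obtained by differentiation: it is
    -- the derivative of the vector minus holomorphic terms, divided by `μ`.
    have hinv : ∀ i, C.μ p i ≠ 0 →
        mulSec (fun z => (z - p)⁻¹) (res P (C.frame p i)) ∈ N.stalk ((p : ℂ) : CP1) := by
      intro i hi
      have hh := fun j => h.hol hC (res_mem (P := P) ((he.2 _ hx).2.2 j))
      have h1 := N.der_mem p _ (hh i)
      have h2 : ∑ j, mulSec (B j i) (res P (C.frame p j)) ∈ N.stalk ((p : ℂ) : CP1) :=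
        Submodule.sum_mem _ fun j _ => N.mul_mem_coe (hB j i) (hh j)
      refine N.congr _ _ _ ((N.stalk _).smul_mem (C.μ p i)⁻¹ ((N.stalk _).sub_mem h1 h2))
        (germEq_iff.2 ?_)
      filter_upwards [germEq_iff.1 (hD i)] with z h3 hz
      rw [Pi.smul_apply, Pi.sub_apply, h3 hz]
      simp only [Finset.sum_apply, mulSec_apply]
      rw [add_sub_cancel_right, smul_smul]
      congr 1
      field_simp
    have hg : ∀ i, AnalyticAt ℂ (dslope (fun z : ℂ => f i (z : CP1)) p) p := fun i => by
      obtain ⟨q, hq⟩ := holAt_coe.1 (hf i)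
      exact hq.has_fpower_series_dslope_fslope.analyticAt
    have h1 : ∑ i, (f i ((p : ℂ) : CP1) • mulSec (fun z => (z - p)⁻¹) (res P (C.frame p i)) +
        mulSec (dslope (fun z : ℂ => f i (z : CP1)) p) (res P (C.frame p i))) ∈
        N.stalk ((p : ℂ) : CP1) := by
      refine Submodule.sum_mem _ fun i _ => (N.stalk _).add_mem ?_ (N.mul_mem_coe (hg i)
        (h.hol hC (res_mem (P := P) ((he.2 _ hx).2.2 i))))
      by_cases hi : C.μ p i = 0
      · rw [hf0 i hi, zero_smul]; exact Submodule.zero_mem _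
      · exact (N.stalk _).smul_mem _ (hinv i hi)
    refine N.congr _ _ _ h1 (germEq_iff.2 ?_)
    filter_upwards [germEq_iff.1 hsσ, eventually_nf_of_nhds hfσ] with z h2 h3 hz
    have h0 : z - p ≠ 0 := sub_ne_zero.2 fun h => hz (h ▸ p.2)
    have h2 : (z - p) • s ⟨z, hz⟩ = σ (Punct.pt ⟨z, hz⟩) := h2 hz
    have h3 : σ (Punct.pt ⟨z, hz⟩) = ∑ i, f i (z : CP1) • res P (C.frame p i) ⟨z, hz⟩ := h3
    have h4 : s ⟨z, hz⟩ = (z - p)⁻¹ • σ (Punct.pt ⟨z, hz⟩) := by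
      rw [← h2, smul_smul, inv_mul_cancel₀ h0, one_smul]
    rw [h4, h3, Finset.smul_sum, Finset.sum_apply]
    refine Finset.sum_congr rfl fun i _ => ?_
    simp only [Pi.add_apply, Pi.smul_apply, mulSec_apply, smul_smul]
    rw [← add_smul]
    congr 1
    rw [dslope_of_ne _ (sub_ne_zero.1 h0), slope_def_field]
    field_simp
    ring

end MeroConnection.DSubmodule

end MinLaplace

/-! ### Existence and uniqueness of the minimal extension. -/

namespace MinLaplace

open Filter Set HolBundle

universe u

namespace MeroConnection

variable {r : ℕ} {P : Finset ℂ} (C : MeroConnection.{u} r P)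

/-- The germs generated by the holomorphic ones under the derivation. -/
inductive Gen (x : CP1) : C.E.Sec P → Prop
  | hol (s : C.E.Sec P) : s ∈ C.E.holGerms P x → Gen x s
  | add (s t : C.E.Sec P) : Gen x s → Gen x t → Gen x (s + t)
  | der (s : C.E.Sec P) : Gen x s → Gen x (C.D s)
  | congr (s t : C.E.Sec P) : Gen x s → GermEq x s t → Gen x t

variable {C}

theorem Gen.mer (hC : C.ResonanceFree) {x : ℂ} {s : C.E.Sec P} (h : C.Gen (x : CP1) s) :
    s ∈ C.E.merGerms P (x : CP1) := by
  induction h with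
  | hol s h => exact merGerms_of_hol h
  | add s t _ _ h h' => exact merGerms_add h h'
  | der s _ h => exact mer_D hC h
  | congr s t _ h h' => exact merGerms_congr h' h

/-- Multiplication need not be built into `Gen`: by `f • D s = D (f • s) - f' • s`, stability under
the derivation gives it by induction, with `f` left arbitrary. -/
theorem Gen.mul (hC : C.ResonanceFree) {x : ℂ} {s : C.E.Sec P} (h : C.Gen (x : CP1) s) :
    ∀ {f : ℂ → ℂ}, AnalyticAt ℂ f x → C.Gen (x : CP1) (mulSec f s) := by
  induction h with
  | hol s h => exact fun hf => .hol _ (holGerms_mul_coe h hf)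
  | add s t _ _ h h' =>
    intro f hf
    refine .congr _ _ (.add _ _ (h hf) (h' hf)) (germEq_iff.2 (Eventually.of_forall fun z hz => ?_))
    simp [mulSec_apply]
  | der s hs h =>
    intro f hf
    refine .congr _ _ (.add _ _ (.der _ (h hf)) (h hf.deriv.neg)) (germEq_iff.2 ?_)
    have h2 : ∀ᶠ z in nf (x : CP1), z ∉ P → AnalyticAt ℂ f z := by
      rw [nf_coe]; exact hf.eventually_analyticAt.mono fun z hz _ => hz
    filter_upwards [germEq_iff.1 (C.D_mul_germ (hs.mer hC) h2)] with z h1 hz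
    rw [Pi.add_apply, h1 hz]
    simp [mulSec_apply]
  | congr s t _ h h' =>
    intro f hf
    refine .congr _ _ (h' hf) (germEq_iff.2 ?_)
    filter_upwards [germEq_iff.1 h] with z h1 hz
    simp only [mulSec_apply, h1 hz]

theorem Gen.spread {x : CP1} {s : C.E.Sec P} (h : C.Gen x s) : ∀ᶠ y in 𝓝 x, C.Gen y s := by
  induction h with
  | hol s h => exact (holGerms_eventually h).mono fun y hy => .hol _ hy
  | add s t _ _ h h' => filter_upwards [h, h'] with y h h' using .add _ _ h h'
  | der s _ h => exact h.mono fun y hy => .der _ hy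
  | congr s t _ h h' => filter_upwards [h', h.eventually] with y h1 h2 using .congr _ _ h1 h2

/-- The stalks of the minimal extension. -/
def minStalk (hC : C.ResonanceFree) : CP1 → Submodule ℂ (C.E.Sec P)
  | none =>
    { carrier := C.E.merGerms P OnePoint.infty
      add_mem' := merGerms_add
      zero_mem' := merGerms_of_hol holGerms_zero
      smul_mem' := fun c _ hs => merGerms_mul (f := fun _ => c) hs analyticAt_const }
  | some x =>
    { carrier := {s | C.Gen (x : CP1) s}
      add_mem' := fun h h' => .add _ _ h h'
      zero_mem' := .hol _ holGerms_zero
      smul_mem' := fun _ _ hs => Gen.mul hC hs analyticAt_const }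

theorem mem_minStalk_infty (hC : C.ResonanceFree) {s : C.E.Sec P} :
    s ∈ minStalk hC OnePoint.infty ↔ s ∈ C.E.merGerms P OnePoint.infty := Iff.rfl

theorem hol_minStalk (hC : C.ResonanceFree) {x : CP1} {s : C.E.Sec P}
    (hs : s ∈ C.E.holGerms P x) : s ∈ minStalk hC x := by
  induction x using OnePoint.rec with
  | infty => exact merGerms_of_hol hs
  | coe x => exact Gen.hol _ hs

theorem pow_two_mer {s : C.E.Sec P} (hs : s ∈ C.E.merGerms P OnePoint.infty) :
    mulSec (fun z => z ^ 2) s ∈ C.E.merGerms P OnePoint.infty := by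
  obtain ⟨k, hk⟩ := hs.2 infty_mem_poles
  refine (mem_merGerms_iff infty_mem_poles).2 ⟨k + 2, holGerms_congr hk ?_⟩
  filter_upwards [eventually_infty_ne_zero] with z h0 hz
  simp only [mulSec_apply, unif_infty, smul_smul]
  congr 1
  rw [pow_add, mul_assoc, inv_pow z 2, inv_mul_cancel₀ (pow_ne_zero 2 h0), mul_one]

/-- The minimal extension. -/
def minExt (hC : C.ResonanceFree) : C.DSubmodule where
  stalk := minStalk hC
  congr x s t hs h := by
    induction x using OnePoint.rec with
    | infty => exact merGerms_congr hs h
    | coe x => exact Gen.congr _ _ hs h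
  spread x s hs := by
    induction x using OnePoint.rec with
    | coe x =>
      have h1 : ∀ᶠ y in 𝓝 (x : CP1), C.Gen y s := Gen.spread hs
      filter_upwards [h1, isOpen_compl_singleton.mem_nhds (OnePoint.coe_ne_infty x)] with y h2 h3
      obtain ⟨y, rfl⟩ := OnePoint.ne_infty_iff_exists.1 h3
      exact h2
    | infty =>
      have h1 := merGerms_near hs
      rw [OnePoint.nhds_infty_eq, eventually_sup, eventually_map, eventually_pure,
        coclosedCompact_eq_cocompact, ← Metric.cobounded_eq_cocompact, ← nf_infty]
      refine ⟨?_, hs⟩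
      filter_upwards [h1, eventually_infty_notMem P] with z h1 h2
      exact Gen.hol _ (h1 h2)
  mem_mer x s hs := by
    induction x using OnePoint.rec with
    | infty => exact hs
    | coe x => exact Gen.mer hC hs
  mul_mem x s f hf hs := by
    induction x using OnePoint.rec with
    | coe x => exact Gen.mul hC hs (holAt_coe.1 hf)
    | infty =>
      obtain ⟨g, hg, -, hgf⟩ := hf.exists_analyticAt
      refine merGerms_congr (merGerms_mul (mem_minStalk_infty hC |>.1 hs) hg) (germEq_iff.2 ?_)
      filter_upwards [hgf] with z h1 hz
      simp only [mulSec_apply, h1]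
  der_mem x s hs := Gen.der _ hs
  der_mem_infty s hs := pow_two_mer (mer_D_infty hs)

theorem minExt_isExtension (hC : C.ResonanceFree) : (minExt hC).IsExtension := by
  intro x s hs
  refine ⟨fun hx => hol_minStalk hC (hs.1 hx), fun hx => ?_⟩
  obtain ⟨k, hk⟩ := hs.2 hx
  exact ⟨k, hol_minStalk hC hk⟩

/-- Absence of resonance puts the holomorphic germs into every full submodule, and with them all
that the derivation generates; at infinity such a submodule contains all meromorphic germs. -/
theorem minExt_le (hC : C.ResonanceFree) {N : C.DSubmodule} (hN : N.IsFull) (x : CP1) :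
    (minExt hC).stalk x ≤ N.stalk x := by
  intro s hs
  induction x using OnePoint.rec with
  | infty => exact hN.mer hC hs
  | coe x =>
    replace hs : C.Gen (x : CP1) s := hs
    induction hs with
    | hol s h => exact hN.hol hC h
    | add s t _ _ h h' => exact Submodule.add_mem _ h h'
    | der s _ h => exact N.der_mem x s h
    | congr s t _ h h' => exact N.congr _ _ _ h' h

/-- A meromorphic germ that is zero off `q` is zero near `q`: if `q` is a pole, germs are only
tested off `q`, and otherwise the identity theorem applies. So the condition holds for all
submodules of the meromorphic bundle. -/
theorem noPointSub (N : C.DSubmodule) : N.NoPointSub := by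
  intro N' hle q hq s hs
  have h1 := N'.spread q s hs
  have hnear : ∀ᶠ y in 𝓝 q, y ≠ q → GermEq y s 0 := h1.mono fun y hy hne => hq y hne s hy
  refine germEq_iff.2 ?_
  by_cases hqp : q ∈ poles P
  · filter_upwards [eventually_nf_of_nhds hnear] with z h2 hz
    have hne : (z : CP1) ≠ q := fun h => hz (coe_mem_poles.1 (h ▸ hqp))
    have := germEq_iff.1 (h2 hne)
    rw [nf_coe] at this
    exact this.self_of_nhds hz
  · obtain ⟨σ, hσ, hsσ⟩ := (N'.mem_mer q s hs).1 hqp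
    induction q using OnePoint.rec with
    | infty => exact absurd infty_mem_poles hqp
    | coe q =>
      have h0 := holGerms_zero (E := C.E) (P := P) (x := (q : CP1))
      obtain ⟨τ, hτ, h0τ⟩ := h0
      have hz0 : ∀ᶠ z : ℂ in 𝓝 q, z ∉ P := by
        rw [← nf_coe]; exact eventually_nf_notMem P hqp
      have hsσ := germEq_iff.1 hsσ
      have h0τ := germEq_iff.1 h0τ
      have hev := eq_of_eventually_eq hσ hτ (Eventually.frequently (by
        have h3 := eventually_nf_of_nhds hnear
        rw [nf_coe] at h3 hsσ h0τ
        filter_upwards [mem_nhdsWithin_of_mem_nhds h3, mem_nhdsWithin_of_mem_nhds hsσ,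
          mem_nhdsWithin_of_mem_nhds h0τ, mem_nhdsWithin_of_mem_nhds hz0,
          self_mem_nhdsWithin] with z h3 h4 h5 h6 h7
        have h8 := germEq_iff.1 (h3 fun h => h7 (OnePoint.coe_injective h))
        rw [nf_coe] at h8
        exact (h4 h6).symm.trans ((h8.self_of_nhds h6).trans (h5 h6))))
      rw [nf_coe] at hsσ h0τ ⊢
      filter_upwards [hsσ, h0τ, hev] with z h1 h2 h3 hz
      exact (h1 hz).trans (h3.trans (h2 hz).symm)

/-- A submodule whose quotient is torsion supported in a point is still full, so `minExt_le` makes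
it everything. -/
theorem minExt_isMinimal (hC : C.ResonanceFree) : (minExt hC).IsMinimalExtension := by
  refine ⟨minExt_isExtension hC, noPointSub _, fun N' hle q hq htor => le_antisymm (hle q) ?_⟩
  refine minExt_le hC (fun x s hs => ?_) q
  by_cases hx : x = q
  · subst hx; exact htor s (hol_minStalk hC hs)
  · refine ⟨0, ?_⟩
    rw [hq x hx]
    exact hol_minStalk hC (holGerms_congr hs (Eventually.of_forall fun z hz => by
      simp [mulSec_apply]))

/-- A minimal extension is the one generated by the holomorphic sections. -/
theorem stalk_eq_of_isMinimal (hC : C.ResonanceFree) {N : C.DSubmodule}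
    (hN : N.IsMinimalExtension) (q : CP1) : N.stalk q = minStalk hC q := by
  classical
  have hle := minExt_le hC hN.1.isFull
  -- Only the stalk at `q` is replaced by the smaller one of `minExt`. The quotient is then
  -- supported in `q`, so minimality of `N` forces it to vanish.
  let N' : C.DSubmodule :=
    { stalk := fun x => if x = q then (minExt hC).stalk x else N.stalk x
      congr := fun x s t hs h => by
        split_ifs at hs ⊢
        · exact (minExt hC).congr x s t hs h
        · exact N.congr x s t hs h
      spread := fun x s hs => by
        by_cases hx : x = q
        · rw [if_pos hx] at hs
          filter_upwards [(minExt hC).spread x s hs] with y hy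
          split_ifs
          · exact hy
          · exact hle y hy
        · rw [if_neg hx] at hs
          filter_upwards [N.spread x s hs, isOpen_ne.mem_nhds hx] with y hy hne
          rwa [if_neg hne]
      mem_mer := fun x s hs => by
        split_ifs at hs
        · exact (minExt hC).mem_mer x s hs
        · exact N.mem_mer x s hs
      mul_mem := fun x s f hf hs => by
        split_ifs at hs ⊢
        · exact (minExt hC).mul_mem x s f hf hs
        · exact N.mul_mem x s f hf hs
      der_mem := fun x s hs => by
        split_ifs at hs ⊢
        · exact (minExt hC).der_mem x s hs
        · exact N.der_mem x s hs
      der_mem_infty := fun s hs => by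
        split_ifs at hs ⊢
        · exact (minExt hC).der_mem_infty s hs
        · exact N.der_mem_infty s hs }
  have h1 : ∀ x, N'.stalk x = if x = q then (minExt hC).stalk x else N.stalk x := fun x => rfl
  have h := hN.2.2 N' (fun x => by
      rw [h1]; split_ifs
      · exact hle x
      · exact le_rfl) q (fun x hx => by rw [h1, if_neg hx]) (fun s hs => by
      rw [h1, if_pos rfl]
      have h2 := minExt_isExtension hC q s (N.mem_mer q s hs)
      by_cases hq : q ∈ poles P
      · exact h2.2 hq
      · exact ⟨0, (minExt hC).congr _ _ _ (h2.1 hq) (germEq_iff.2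
          (Eventually.of_forall fun z hz => by simp [mulSec_apply]))⟩)
  rw [← h, h1, if_pos rfl]
  rfl

end MeroConnection

end MinLaplace

namespace MinLaplace

open Filter Set HolBundle Polynomial

universe u

namespace MeroConnection

variable {r : ℕ} {P : Finset ℂ} {C : MeroConnection.{u} r P}

/-! ### Expansions at infinity -/

section Infty

variable {e : Fin r → ∀ y, C.E.Fib y} {k : ℤ} {f g : Fin r → ℂ → ℂ} {s t : C.E.Sec P}

theorem InfForm.add (hs : InfForm e k f s) (ht : InfForm e k g t) :
    InfForm e k (fun i t => f i t + g i t) (s + t) := by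
  refine ⟨fun i => (hs.1 i).fun_add (ht.1 i), germEq_iff.2 ?_⟩
  filter_upwards [germEq_iff.1 hs.2, germEq_iff.1 ht.2] with z h1 h2 hz
  rw [Pi.add_apply, h1 hz, h2 hz]
  simp only [mul_add, add_smul, Finset.sum_add_distrib]

theorem InfForm.smul (hs : InfForm e k f s) (c : ℂ) : InfForm e k (fun i t => c * f i t) (c • s) := by
  refine ⟨fun i => analyticAt_const.fun_mul (hs.1 i), germEq_iff.2 ?_⟩
  filter_upwards [germEq_iff.1 hs.2] with z h1 hz
  rw [Pi.smul_apply, h1 hz, Finset.smul_sum]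
  simp only [smul_smul, mul_left_comm]

theorem InfForm.sub (hs : InfForm e k f s) (ht : InfForm e k g t) :
    InfForm e k (fun i t => f i t - g i t) (s - t) := by
  have := hs.add (ht.smul (-1))
  simp only [neg_one_mul, neg_one_smul, ← sub_eq_add_neg] at this
  exact this

theorem InfForm.zero : InfForm e k (fun _ _ => 0) (0 : C.E.Sec P) :=
  ⟨fun _ => analyticAt_const, germEq_iff.2 (Eventually.of_forall fun z hz => by simp)⟩

theorem InfForm.congr (hs : InfForm e k f s) (h : GermEq OnePoint.infty s t) : InfForm e k f t :=
  ⟨hs.1, h.symm.trans hs.2⟩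

theorem InfForm.raise (hs : InfForm e k f s) (n : ℕ) :
    InfForm e (k + n) (fun i t => t ^ n * f i t) s := by
  refine ⟨fun i => (analyticAt_id.fun_pow n).fun_mul (hs.1 i), hs.2.trans (germEq_iff.2 ?_)⟩
  filter_upwards [eventually_infty_ne_zero] with z h0 hz
  refine Finset.sum_congr rfl fun i _ => ?_
  congr 1
  rw [zpow_add₀ h0, zpow_natCast, inv_pow]
  field_simp

theorem InfForm.lower (hs : InfForm e (k + 1) f s) (h0 : ∀ i, f i 0 = 0) :
    InfForm e k (fun i => dslope (f i) 0) s := by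
  refine ⟨fun i => ?_, hs.2.trans (germEq_iff.2 ?_)⟩
  · obtain ⟨q, hq⟩ := hs.1 i
    exact hq.has_fpower_series_dslope_fslope.analyticAt
  · filter_upwards [eventually_infty_ne_zero] with z hz0 hz
    refine Finset.sum_congr rfl fun i _ => ?_
    congr 1
    rw [dslope_of_ne _ (inv_ne_zero hz0), slope_def_field, h0 i, zpow_add_one₀ hz0]
    field_simp
    ring

theorem InfForm.mul (hs : InfForm e k f s) (q : ℂ → ℂ) (n : ℕ) (g : ℂ → ℂ) (hg : AnalyticAt ℂ g 0)
    (hq : ∀ᶠ z in nf OnePoint.infty, q z = z ^ n * g z⁻¹) :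
    InfForm e (k + n) (fun i t => g t * f i t) (mulSec q s) := by
  refine ⟨fun i => hg.fun_mul (hs.1 i), germEq_iff.2 ?_⟩
  filter_upwards [germEq_iff.1 hs.2, hq, eventually_infty_ne_zero] with z h1 h2 h0 hz
  rw [mulSec_apply, h1 hz, Finset.smul_sum]
  refine Finset.sum_congr rfl fun i _ => ?_
  rw [smul_smul, h2, zpow_add₀ h0, zpow_natCast]
  congr 1
  ring

theorem exists_infForm {U : Set CP1} (hU : OnePoint.infty ∈ U) (he : C.E.IsFrame U e)
    (hs : s ∈ C.E.merGerms P OnePoint.infty) : ∃ (k : ℕ) (f : _), InfForm e k f s := by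
  obtain ⟨k, f, hf, hs⟩ := (mem_mer_infty hU he).1 hs
  exact ⟨k, f, hf, by simpa using hs⟩

theorem InfForm.mer {U : Set CP1} (hU : OnePoint.infty ∈ U) (he : C.E.IsFrame U e) {k : ℕ}
    (hs : InfForm e k f s) : s ∈ C.E.merGerms P OnePoint.infty :=
  (mem_mer_infty hU he).2 ⟨k, f, hs.1, by simpa using hs.2⟩

/-- A solution of `D s = ξ s` has an arbitrarily small leading exponent at infinity. -/
theorem InfForm.descend (hC : C.ResonanceFree) {B : Fin r → Fin r → ℂ → ℂ} (h : C.IsIrr e B)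
    (hs : InfForm e k f s) {ξ : ℂ} (hξ : GermEq OnePoint.infty (C.D s) (ξ • s)) (i : Fin r) :
    f i 0 = 0 := by
  obtain ⟨⟨U, hU, he⟩, hB, -⟩ := id h
  have h1 := hs.der h
  have h2 := (hs.smul ξ).congr hξ.symm
  have heq : ∀ i, ∀ᶠ t in 𝓝[≠] (0 : ℂ), C.infDer B k f i t = ξ * f i t := by
    intro i
    have h3 := germEq_iff.1 h1.2
    have h4 := germEq_iff.1 h2.2
    have h5 : ∀ᶠ z in nf OnePoint.infty, C.infDer B k f i z⁻¹ = ξ * f i z⁻¹ := by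
      filter_upwards [h3, h4, eventually_infty_ne_zero, eventually_infty_notMem P,
        eventually_nf_of_nhds (he.1.mem_nhds hU)] with z h3 h4 h0 hz hzU
      have h5 : ∑ i, (z ^ k * C.infDer B k f i z⁻¹) • e i (z : CP1) =
        ∑ i, (z ^ k * (ξ * f i z⁻¹)) • e i (z : CP1) := (h3 hz).symm.trans (h4 hz)
      have h6 := (he.isB hzU).eq_coef (h5.trans rfl)
      rw [(he.isB hzU).coef_sum] at h6
      exact mul_left_cancel₀ (zpow_ne_zero k h0) (congrFun h6 i)
    simpa using tendsto_inv_nhdsNE.eventually h5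
  have h3 := ((h1.1 i).frequently_eq_iff_eventually_eq (h2.1 i)).1 (heq i).frequently
  -- At `t = 0` the equation reads `(α i - ξ) * f i 0 = 0`. If the factor vanishes, one power of `t`
  -- can be divided out, and the next order gives `(k + μInf i) * f i 0 = 0` with a factor that is
  -- not zero because the real part of `μInf i` is not an integer.
  by_cases hα : C.α i = ξ
  · -- the next coefficient
    let G : ℂ → ℂ := fun t => k * f i t - deriv (f i) t * t + C.μInf i * f i t +
      ∑ j, B i j t * t * f j t
    have hG : AnalyticAt ℂ G 0 := by
      have h1 : AnalyticAt ℂ (fun t : ℂ => t) 0 := analyticAt_id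
      have h2 : ∀ c : ℂ, AnalyticAt ℂ (fun t : ℂ => c) 0 := fun c => analyticAt_const
      exact ((((h2 k).fun_mul (hs.1 i)).fun_sub
        ((hs.1 i).deriv.fun_mul h1)).fun_add ((h2 _).fun_mul (hs.1 i))).fun_add
        (Finset.analyticAt_fun_sum _ fun j _ => ((hB i j).fun_mul h1).fun_mul (hs.1 j))
    have hG0 : ∀ᶠ t in 𝓝[≠] (0 : ℂ), G t = 0 := by
      filter_upwards [heq i, self_mem_nhdsWithin] with t ht h0
      have : t * G t = 0 := by
        simp only [infDer] at ht
        simp only [G]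
        have h5 : t * ∑ j, B i j t * t * f j t = ∑ j, B i j t * t ^ 2 * f j t := by
          rw [Finset.mul_sum]; exact Finset.sum_congr rfl fun j _ => by ring
        rw [mul_add, h5]
        rw [hα] at ht
        linear_combination ht
      exact (mul_eq_zero.1 this).resolve_left h0
    have h4 := ((hG.frequently_eq_iff_eventually_eq analyticAt_const).1
      hG0.frequently).self_of_nhds
    have h5 : ((k : ℂ) + C.μInf i) * f i 0 = 0 := by
      simp only [G, mul_zero, zero_mul, Finset.sum_const_zero] at h4
      linear_combination h4
    refine (mul_eq_zero.1 h5).resolve_left fun h0 => hC.2.2.1 i (-k) ?_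
    have := congrArg Complex.re (eq_neg_of_add_eq_zero_right h0)
    simpa using this
  · have h4 := h3.self_of_nhds
    simp only [infDer, mul_zero, zero_mul, ne_eq, OfNat.ofNat_ne_zero, not_false_eq_true,
      zero_pow, sub_zero, add_zero, zero_add, Finset.sum_const_zero, mul_eq_mul_right_iff] at h4
    exact h4.resolve_left hα

/-- By `InfForm.descend` the leading exponent can be lowered without end, so the coefficients vanish
to infinite order and, being analytic, vanish identically near infinity. -/
theorem eventually_zero_of_eq (hC : C.ResonanceFree) {B : Fin r → Fin r → ℂ → ℂ} (h : C.IsIrr e B)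
    (hs : s ∈ C.E.merGerms P OnePoint.infty) {ξ : ℂ}
    (hξ : GermEq OnePoint.infty (C.D s) (ξ • s)) : GermEq OnePoint.infty s 0 := by
  obtain ⟨⟨U, hU, he⟩, hB, -⟩ := id h
  obtain ⟨k, f, hf⟩ := exists_infForm hU he hs
  have hn : ∀ n : ℕ, ∃ g : Fin r → ℂ → ℂ, InfForm e ((k : ℤ) - n) g s ∧
      ∀ i, ∀ᶠ t in 𝓝 (0 : ℂ), f i t = t ^ n * g i t := by
    intro n
    induction n with
    | zero => exact ⟨f, by simpa using hf, fun i => by simp⟩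
    | succ n ih =>
      obtain ⟨g, hg, hfg⟩ := ih
      have h0 := hg.descend hC h hξ
      have h1 : (k : ℤ) - n = ((k : ℤ) - (n + 1 : ℕ)) + 1 := by push_cast; ring
      rw [h1] at hg
      refine ⟨_, hg.lower h0, fun i => ?_⟩
      filter_upwards [hfg i] with t ht
      rw [ht, pow_succ, mul_assoc]
      congr 1
      have := sub_smul_dslope (g i) 0 t
      rw [h0 i] at this
      simpa using this.symm
  have hz : ∀ i, ∀ᶠ t in 𝓝 (0 : ℂ), f i t = 0 := by
    intro i
    rw [← analyticOrderAt_eq_top]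
    refine ENat.eq_top_iff_forall_ge.2 fun n => ?_
    obtain ⟨g, hg, hfg⟩ := hn n
    exact (natCast_le_analyticOrderAt (hf.1 i)).2 ⟨g i, hg.1 i, by simpa using hfg i⟩
  refine germEq_iff.2 ?_
  filter_upwards [germEq_iff.1 hf.2, tendsto_inv_nf_infty.eventually (eventually_all.2 hz)]
    with z h1 h2 hz
  rw [h1 hz]
  simp [h2]

end Infty

/-! ### Germs vanishing to a given order -/

/-- Germs that are holomorphic and vanish to the order `n` at the finite point `x`. -/
def VanishAt (n : ℕ) (x : ℂ) (s : C.E.Sec P) : Prop :=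
  ∃ h ∈ C.E.holGerms P (x : CP1), GermEq (x : CP1) s (mulSec (fun z => (z - x) ^ n) h)

theorem VanishAt.add {n : ℕ} {x : ℂ} {s t : C.E.Sec P} (hs : VanishAt n x s)
    (ht : VanishAt n x t) : VanishAt n x (s + t) := by
  obtain ⟨h, hh, hs⟩ := hs
  obtain ⟨h', hh', ht⟩ := ht
  refine ⟨h + h', holGerms_add hh hh', germEq_iff.2 ?_⟩
  filter_upwards [germEq_iff.1 hs, germEq_iff.1 ht] with z h1 h2 hz
  rw [Pi.add_apply, h1 hz, h2 hz]
  simp [mulSec_apply]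

theorem VanishAt.smul {n : ℕ} {x : ℂ} {s : C.E.Sec P} (hs : VanishAt n x s) (c : ℂ) :
    VanishAt n x (c • s) := by
  obtain ⟨h, hh, hs⟩ := hs
  refine ⟨c • h, holGerms_smul c hh, germEq_iff.2 ?_⟩
  filter_upwards [germEq_iff.1 hs] with z h1 hz
  rw [Pi.smul_apply, h1 hz]
  simp only [mulSec_apply, Pi.smul_apply, smul_comm c]

theorem VanishAt.congr {n : ℕ} {x : ℂ} {s t : C.E.Sec P} (hs : VanishAt n x s)
    (h : GermEq (x : CP1) s t) : VanishAt n x t := by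
  obtain ⟨h', hh, hs⟩ := hs
  exact ⟨h', hh, h.symm.trans hs⟩

theorem VanishAt.hol {n : ℕ} {x : ℂ} {s : C.E.Sec P} (hs : VanishAt n x s) :
    s ∈ C.E.holGerms P (x : CP1) := by
  obtain ⟨h', hh, hs⟩ := hs
  exact holGerms_congr (holGerms_mul_coe (f := fun z => (z - x) ^ n) hh (by fun_prop))
    (germEq_iff.1 hs.symm)

theorem VanishAt.pred {n : ℕ} {x : ℂ} {s : C.E.Sec P} (hs : VanishAt (n + 1) x s) :
    VanishAt n x s := by
  obtain ⟨h', hh, hs⟩ := hs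
  refine ⟨_, holGerms_mul_coe (f := fun z => z - x) hh (by fun_prop), hs.trans
    (germEq_iff.2 (Eventually.of_forall fun z hz => ?_))⟩
  simp only [mulSec_apply, smul_smul, pow_succ]

/-- The pole of the connection is simple, so a derivative costs exactly one order of vanishing, also
at the points of `P`. -/
theorem VanishAt.der (hC : C.ResonanceFree) {n : ℕ} {x : ℂ} {s : C.E.Sec P}
    (hs : VanishAt (n + 1) x s) : VanishAt n x (C.D s) := by
  obtain ⟨h, hh, hs⟩ := hs
  refine ⟨((n + 1 : ℕ) : ℂ) • h + mulSec (fun z => z - x) (C.D h),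
    holGerms_add (holGerms_smul _ hh) (hol_unif_D hC hh), (C.D_germ hs).trans ?_⟩
  refine (C.D_mul_germ (merGerms_of_hol hh) (Eventually.of_forall fun z _ => by fun_prop)).trans
    (germEq_iff.2 (Eventually.of_forall fun z hz => ?_))
  have h5 : deriv (fun z => (z - x) ^ (n + 1)) z = ((n + 1 : ℕ) : ℂ) * (z - x) ^ n := by simp
  simp only [Pi.add_apply, mulSec_apply, Pi.smul_apply, h5, smul_add, smul_smul]
  rw [add_comm, pow_succ, mul_comm ((n + 1 : ℕ) : ℂ)]

end MeroConnection

end MinLaplace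

namespace MinLaplace

open Filter Set HolBundle Polynomial

universe u

/-- A frame over the complex line that is meromorphic at infinity. -/
def HolBundle.IsGlobalFrame {r : ℕ} (E : HolBundle.{u} r) (ε : Fin r → ∀ y, E.Fib y) : Prop :=
  E.IsFrame {OnePoint.infty}ᶜ ε ∧
    ∀ U e, E.IsFrame U e → OnePoint.infty ∈ U → ∀ l, MerSec e (ε l)

theorem HolBundle.IsGlobalFrame.isB {r : ℕ} {P : Finset ℂ} {E : HolBundle.{u} r}
    {ε : Fin r → ∀ y, E.Fib y} (hε : E.IsGlobalFrame ε) (z : Punct P) :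
    IsB fun i => res P (ε i) z := hε.1.isB (OnePoint.coe_ne_infty z.1)

namespace MeroConnection

variable {r : ℕ} {P : Finset ℂ} {C : MeroConnection.{u} r P} {ε : Fin r → ∀ y, C.E.Fib y}

/-! ### Polynomial sections -/

variable (P) in
/-- The sections with polynomial coefficients in the frame `ε`. -/
def polySec (ε : Fin r → ∀ y, C.E.Fib y) : (Fin r → ℂ[X]) →ₗ[ℂ] C.E.Sec P where
  toFun q z := ∑ i, (q i).eval (z : ℂ) • res P (ε i) z
  map_add' q q' := by
    funext z; simp only [Pi.add_apply, eval_add, add_smul, Finset.sum_add_distrib]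
  map_smul' c q := by
    funext z
    simp only [Pi.smul_apply, eval_smul, RingHom.id_apply, Finset.smul_sum, smul_eq_mul, smul_smul]

theorem polySec_apply (q : Fin r → ℂ[X]) (z : Punct P) :
    polySec P ε q z = ∑ i, (q i).eval (z : ℂ) • res P (ε i) z := rfl

theorem polySec_hol (hε : C.E.IsGlobalFrame ε) (q : Fin r → ℂ[X]) (x : ℂ) :
    polySec P ε q ∈ C.E.holGerms P (x : CP1) :=
  holGerms_sum_coe (fun i => res_mem ((hε.1.2 _ (OnePoint.coe_ne_infty x)).2.2 i))
    fun _ => analyticAt_eval _ _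

/-- The polynomial sections whose coefficients have a given degree, have bounded order at
infinity. -/
theorem exists_infForm_polySec (hε : C.E.IsGlobalFrame ε) {U : Set CP1}
    {e : Fin r → ∀ y, C.E.Fib y} (hU : OnePoint.infty ∈ U) (he : C.E.IsFrame U e) (d : ℕ) :
    ∃ n : ℕ, ∀ q : Fin r → ℂ[X], (∀ i, (q i).natDegree ≤ d) →
      ∃ f, InfForm e n f (polySec P ε q) := by
  choose T hT hTε using hε.2 U e he hU
  choose n g hg hgT using fun i j => (hT i j).exists_eq
  have hX : ∀ (a : Fin r × Fin (d + 1)), ∃ (n : ℕ) (f : _),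
      InfForm e n f (mulSec (fun z => z ^ (a.2 : ℕ)) (res P (ε a.1))) := by
    intro a
    refine exists_infForm hU he ?_
    refine (mem_merGerms_iff infty_mem_poles).2 ⟨(∑ j, n a.1 j) + a.2,
      (mem_holGerms_iff he hU).2 ⟨fun j t => t ^ (∑ j, n a.1 j - n a.1 j) * g a.1 j t,
        fun j => (analyticAt_id.fun_pow _).fun_mul (hg _ _), ?_⟩⟩
    filter_upwards [hTε a.1, eventually_all.2 (hgT a.1), eventually_infty_ne_zero] with z h1 h2 h0 hz
    have h1 : res P (ε a.1) ⟨z, hz⟩ = ∑ k, T a.1 k z • res P (e k) ⟨z, hz⟩ := h1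
    rw [mulSec_apply, mulSec_apply, h1, Finset.smul_sum, Finset.smul_sum]
    refine Finset.sum_congr rfl fun j _ => ?_
    rw [smul_smul, smul_smul, h2]
    change _ = _ • res P (e j) ⟨z, hz⟩
    congr 1
    have h3 : n a.1 j ≤ ∑ j, n a.1 j :=
      Finset.single_le_sum (fun _ _ => Nat.zero_le _) (Finset.mem_univ j)
    obtain ⟨m, hm⟩ := Nat.exists_eq_add_of_le h3
    simp only [hm, unif_infty, inv_pow, Nat.add_sub_cancel_left, pow_add]
    field_simp
  choose m F hF using hX
  let M := ∑ a, m a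
  have hF' : ∀ a, InfForm e M (fun i t => t ^ (M - m a) * F a i t)
      (mulSec (fun z => z ^ (a.2 : ℕ)) (res P (ε a.1))) := by
    intro a
    have h3 : m a ≤ M := Finset.single_le_sum (fun _ _ => Nat.zero_le _) (Finset.mem_univ a)
    have := (hF a).raise (M - m a)
    rwa [← Nat.cast_add, Nat.add_sub_cancel' h3] at this
  refine ⟨M, fun q hq => ?_⟩
  have hsum : ∀ s : Finset (Fin r × Fin (d + 1)), ∃ f, InfForm e M f
      (∑ a ∈ s, ((q a.1).coeff a.2) • mulSec (fun z => z ^ (a.2 : ℕ)) (res P (ε a.1))) := by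
    classical
    intro s
    induction s using Finset.induction_on with
    | empty => exact ⟨_, InfForm.zero⟩
    | insert a s ha ih =>
      obtain ⟨f, hf⟩ := ih
      rw [Finset.sum_insert ha]
      exact ⟨_, ((hF' a).smul _).add hf⟩
  obtain ⟨f, hf⟩ := hsum Finset.univ
  refine ⟨f, hf.congr (germEq_iff.2 (Eventually.of_forall fun z hz => ?_))⟩
  rw [polySec_apply, Fintype.sum_prod_type]
  simp only [Finset.sum_apply, Pi.smul_apply, mulSec_apply, smul_smul]
  refine Finset.sum_congr rfl fun i _ => ?_
  rw [← Finset.sum_smul, eval_eq_sum_range' (Nat.lt_succ_of_le (hq i)),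
    Fin.sum_univ_eq_sum_range (fun j => (q i).coeff j * z ^ j)]

/-- Sections that are holomorphic on the complex line and meromorphic at infinity are polynomial,
with a bound on the degrees. -/
theorem exists_polySec (hε : C.E.IsGlobalFrame ε) {U : Set CP1}
    {e : Fin r → ∀ y, C.E.Fib y} (hU : OnePoint.infty ∈ U) (he : C.E.IsFrame U e) :
    ∃ n : ℕ, ∀ (k : ℕ) (f : Fin r → ℂ → ℂ) (s : C.E.Sec P),
      (∀ x : ℂ, s ∈ C.E.holGerms P (x : CP1)) → InfForm e k f s →
      ∃ q : Fin r → ℂ[X], (∀ i, (q i).natDegree ≤ k + n) ∧ s = polySec P ε q := by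
  classical
  choose S hS hSe using fun i => exists_inverse_transition hε.1 (hε.2 U e he hU) i
  choose n g hg hgS using fun i j => (hS i j).exists_eq
  -- This sum bounds the order of all entries of the inverse transition matrix at infinity; it is
  -- the excess of the degree over the order of the section.
  let n₀ := ∑ i, ∑ j, n i j
  refine ⟨n₀, fun k f s hs hf => ?_⟩
  let c : Fin r → ℂ → ℂ := fun i z => if h : z ∉ P then
    coef (fun i => res P (ε i) ⟨z, h⟩) (s ⟨z, h⟩) i else 0
  have hc : ∀ i, ∃ q : ℂ[X], q.natDegree ≤ k + n₀ ∧ ∀ z ∉ P, c i z = q.eval z := by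
    intro i
    refine exists_polynomial (fun x => ?_) ⟨fun t => ∑ j, t ^ (n₀ - n j i) * g j i t * f j t,
      Finset.analyticAt_fun_sum _ fun j _ => ((analyticAt_id.fun_pow _).fun_mul (hg j i)).fun_mul
        (hf.1 j), ?_⟩
    · obtain ⟨a, ha, has⟩ := mem_holGerms_coe hε.1 (OnePoint.coe_ne_infty x) (hs x)
      refine ⟨a i, ha i, ?_⟩
      have h1 := germEq_iff.1 has
      rw [nf_coe] at h1
      filter_upwards [h1] with z h1 hz
      simp only [c, dif_pos hz]
      rw [(hε.isB ⟨z, hz⟩).eq_coef (h1 hz)]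
    · rw [← nf_infty]
      filter_upwards [germEq_iff.1 hf.2, eventually_all.2 hSe,
        eventually_all.2 fun j => hgS j i, eventually_infty_ne_zero] with z h1 h2 h3 h0 hz
      simp only [c, dif_pos hz]
      have h2 : ∀ j, res P (e j) ⟨z, hz⟩ = ∑ l, S j l z • res P (ε l) ⟨z, hz⟩ := h2
      have h4 : s ⟨z, hz⟩ = ∑ l, (∑ j, z ^ (k : ℤ) * f j z⁻¹ * S j l z) • res P (ε l) ⟨z, hz⟩ := by
        rw [h1 hz]
        simp only [h2, Finset.smul_sum, smul_smul, Finset.sum_smul]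
        rw [Finset.sum_comm]
      rw [(hε.isB ⟨z, hz⟩).eq_coef h4, Finset.mul_sum]
      refine Finset.sum_congr rfl fun j _ => ?_
      have h5 : n j i ≤ n₀ := (Finset.single_le_sum (f := fun i => n j i)
        (fun _ _ => Nat.zero_le _) (Finset.mem_univ i)).trans
        (Finset.single_le_sum (f := fun j => ∑ i, n j i) (fun _ _ => Nat.zero_le _)
          (Finset.mem_univ j))
      obtain ⟨m, hm⟩ := Nat.exists_eq_add_of_le h5
      rw [h3, zpow_natCast, hm, Nat.add_sub_cancel_left, pow_add, pow_add, inv_pow]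
      field_simp
  choose q hq hqc using hc
  refine ⟨q, hq, funext fun z => ?_⟩
  rw [polySec_apply, ← (hε.isB z).sum_coef (s z)]
  refine Finset.sum_congr rfl fun i _ => ?_
  rw [← hqc i z z.2]
  simp only [c, dif_pos z.2]

theorem polySec_mer (hε : C.E.IsGlobalFrame ε) (q : Fin r → ℂ[X]) :
    polySec P ε q ∈ C.E.merGerms P OnePoint.infty := by
  obtain ⟨U, e, hU, he, -⟩ := C.E.exists_isFrame OnePoint.infty
  obtain ⟨n, h⟩ := exists_infForm_polySec (P := P) hε hU he (∑ i, (q i).natDegree)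
  obtain ⟨f, hf⟩ := h q fun i => Finset.single_le_sum (f := fun i => (q i).natDegree)
    (fun _ _ => Nat.zero_le _) (Finset.mem_univ i)
  exact hf.mer hU he

/-- A polynomial section that vanishes near infinity, vanishes. -/
theorem polySec_eq_zero (hε : C.E.IsGlobalFrame ε) (q : Fin r → ℂ[X])
    (h : GermEq OnePoint.infty (polySec P ε q) 0) : q = 0 := by
  funext i
  have h1 : ∀ᶠ z in nf OnePoint.infty, (q i).eval z = 0 := by
    filter_upwards [germEq_iff.1 h, eventually_infty_notMem P] with z h1 hz
    exact Fintype.linearIndependent_iff.1 (hε.1.isB (OnePoint.coe_ne_infty z)).1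
      (fun i => (q i).eval z) (h1 hz) i
  by_contra h0
  obtain ⟨z, h2, h3⟩ := (h1.and (eventually_infty_eval_ne h0)).exists
  exact h3 h2

/-- Jets of holomorphic germs at a point of `P` are jets of polynomial sections that vanish to a
given order in the other points of `P`. -/
theorem exists_jet (hε : C.E.IsGlobalFrame ε) {p : ℂ} {s : C.E.Sec P}
    (hs : s ∈ C.E.holGerms P (p : CP1)) (n : ℕ) : ∃ q : Fin r → ℂ[X],
      VanishAt n p (s - polySec P ε q) ∧ ∀ p' ∈ P, p' ≠ p → VanishAt n p' (polySec P ε q) := by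
  classical
  have hhol : ∀ x : ℂ, ∀ i, res P (ε i) ∈ C.E.holGerms P (x : CP1) := fun x i =>
    res_mem ((hε.1.2 _ (OnePoint.coe_ne_infty x)).2.2 i)
  obtain ⟨f, hf, hfs⟩ := mem_holGerms_coe hε.1 (OnePoint.coe_ne_infty p) hs
  -- The factor `h` forces the vanishing at the other points of `P`; it is compensated by expanding
  -- `f / h` at `p` instead of `f`.
  let h : ℂ[X] := ∏ c ∈ P.erase p, (X - Polynomial.C c) ^ n
  have hh0 : h.eval p ≠ 0 := by
    simp only [h, eval_prod, eval_pow, eval_sub, eval_X, eval_C]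
    exact Finset.prod_ne_zero_iff.2 fun c hc =>
      pow_ne_zero _ (sub_ne_zero.2 (Finset.ne_of_mem_erase hc).symm)
  choose q g hg hq using fun i => exists_taylor (f := fun z => f i z * (h.eval z)⁻¹)
    ((hf i).fun_mul ((analyticAt_eval h p).fun_inv hh0)) n
  refine ⟨fun i => h * q i, ⟨fun z => ∑ i, (h.eval (z : ℂ) * g i z) • res P (ε i) z,
    holGerms_sum_coe (hhol p) fun i => (analyticAt_eval h p).fun_mul (hg i),
    germEq_iff.2 ?_⟩, fun p' hp' hne => ?_⟩
  · have hev : ∀ᶠ z in nf (p : CP1), h.eval z ≠ 0 := by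
      rw [nf_coe]; exact (analyticAt_eval h p).continuousAt.eventually_ne hh0
    filter_upwards [germEq_iff.1 hfs, hev] with z h1 h2 hz
    rw [Pi.sub_apply, h1 hz, polySec_apply, mulSec_apply, ← Finset.sum_sub_distrib,
      Finset.smul_sum]
    refine Finset.sum_congr rfl fun i _ => ?_
    rw [← sub_smul, smul_smul, eval_mul]
    congr 1
    have h3 : f i z = h.eval z * (f i z * (h.eval z)⁻¹) := by field_simp
    rw [h3, hq i z]
    ring
  · have hmem : p' ∈ P.erase p := Finset.mem_erase.2 ⟨hne, hp'⟩
    refine ⟨polySec P ε fun i => (∏ c ∈ (P.erase p).erase p', (X - Polynomial.C c) ^ n) * q i,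
      polySec_hol hε _ p', germEq_iff.2 (Eventually.of_forall fun z hz => ?_)⟩
    rw [mulSec_apply, polySec_apply, polySec_apply, Finset.smul_sum]
    refine Finset.sum_congr rfl fun i _ => ?_
    simp only [h]
    rw [smul_smul, ← Finset.mul_prod_erase _ _ hmem, mul_assoc, eval_mul]
    simp

end MeroConnection

end MinLaplace

/-! ### Global sections: finiteness, injectivity of `D - ξ`, generation by polynomial sections. -/

namespace MinLaplace

open Filter Set HolBundle Polynomial

universe u

namespace MeroConnection

variable {r : ℕ} {P : Finset ℂ} {C : MeroConnection.{u} r P} {ε : Fin r → ∀ y, C.E.Fib y}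

theorem merGerms_smul {x : CP1} {s : C.E.Sec P} (c : ℂ) (hs : s ∈ C.E.merGerms P x) :
    c • s ∈ C.E.merGerms P x := merGerms_mul (f := fun _ => c) hs analyticAt_const

variable (C) in
theorem D_smul_germ {x : CP1} {s : C.E.Sec P} (c : ℂ) (hs : s ∈ C.E.merGerms P x) :
    GermEq x (C.D (c • s)) (c • C.D s) := by
  refine (C.D_mul_germ (f := fun _ => c) hs (Eventually.of_forall fun z _ => analyticAt_const)).trans
    (germEq_iff.2 (Eventually.of_forall fun z hz => ?_))
  simp [mulSec_apply]

variable (C) in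
theorem D_sub_germ {x : CP1} {s t : C.E.Sec P} (hs : s ∈ C.E.merGerms P x)
    (ht : t ∈ C.E.merGerms P x) : GermEq x (C.D (s - t)) (C.D s - C.D t) := by
  have h1 := C.D_add_germ hs (merGerms_smul (-1) ht)
  have h2 := C.D_smul_germ (-1) ht
  rw [neg_one_smul, ← sub_eq_add_neg] at h1
  refine germEq_iff.2 ?_
  filter_upwards [germEq_iff.1 h1, germEq_iff.1 h2] with z h1 h2 hz
  rw [h1 hz, Pi.add_apply, Pi.sub_apply]
  rw [neg_one_smul, neg_one_smul] at h2
  rw [h2 hz, Pi.neg_apply, sub_eq_add_neg]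

namespace DSubmodule

variable (N : C.DSubmodule)

theorem global_mer (m : N.globalSections) (x : CP1) : (m : C.E.Sec P) ∈ C.E.merGerms P x :=
  N.mem_mer _ _ (N.mem_stalk_of_global m x)

theorem global_hol (m : N.globalSections) {z : ℂ} (hz : z ∉ P) :
    (m : C.E.Sec P) ∈ C.E.holGerms P (z : CP1) :=
  (N.global_mer m _).1 fun h => hz (coe_mem_poles.1 h)

variable {N}

theorem IsFull.global (hN : N.IsFull) (hC : C.ResonanceFree) {s : C.E.Sec P}
    (h : ∀ x : ℂ, s ∈ C.E.holGerms P (x : CP1)) (h' : s ∈ C.E.merGerms P OnePoint.infty) :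
    s ∈ N.globalSections := by
  refine (Submodule.mem_iInf _).2 fun x => ?_
  induction x using OnePoint.rec with
  | infty => exact hN.mer hC h'
  | coe x => exact hN.hol hC (h x)

variable (N) in
/-- The global sections whose poles have bounded orders. -/
def bdd (e : Fin r → ∀ y, C.E.Fib y) (K : ℕ) (k : ℕ) : Submodule ℂ N.globalSections where
  carrier := {m | (∀ p ∈ P, mulSec (fun z => (z - p) ^ K) (m : C.E.Sec P) ∈
    C.E.holGerms P (p : CP1)) ∧ ∃ f, InfForm e k f (m : C.E.Sec P)}
  zero_mem' := ⟨fun p _ => holGerms_congr holGerms_zero (Eventually.of_forall fun z hz => by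
    simp [mulSec_apply]), _, InfForm.zero⟩
  add_mem' := by
    rintro a b ⟨h1, f, h2⟩ ⟨h1', f', h2'⟩
    refine ⟨fun p hp => holGerms_congr (holGerms_add (h1 p hp) (h1' p hp))
      (Eventually.of_forall fun z hz => ?_), _, h2.add h2'⟩
    simp [mulSec_apply]
  smul_mem' := by
    rintro c a ⟨h1, f, h2⟩
    refine ⟨fun p hp => holGerms_congr (holGerms_smul c (h1 p hp))
      (Eventually.of_forall fun z hz => ?_), _, h2.smul c⟩
    simp only [Pi.smul_apply, mulSec_apply, Submodule.coe_smul, smul_comm c]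

/-- Multiplication by a function, on global sections. -/
def mulLin (N : C.DSubmodule) (f : ℂ → ℂ) : N.globalSections →ₗ[ℂ] C.E.Sec P where
  toFun m := mulSec f m
  map_add' a b := by funext z; simp [mulSec_apply]
  map_smul' c a := by
    funext z; simp only [mulSec_apply, Submodule.coe_smul, Pi.smul_apply, RingHom.id_apply,
      smul_comm c]

/-- The common denominator of order `K`. -/
def den (P : Finset ℂ) (K : ℕ) : ℂ[X] := ∏ p ∈ P, (X - Polynomial.C p) ^ K

theorem den_eval_ne {K : ℕ} {z : ℂ} (hz : z ∉ P) : (den P K).eval z ≠ 0 := by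
  simp only [den, eval_prod, eval_pow, eval_sub, eval_X, eval_C]
  exact Finset.prod_ne_zero_iff.2 fun p hp => pow_ne_zero _ (sub_ne_zero.2 fun h => hz (h ▸ hp))

theorem den_monic (K : ℕ) : (den P K).Monic :=
  monic_prod_of_monic _ _ fun p _ => (monic_X_sub_C p).pow K

theorem den_eval_eq [DecidableEq ℂ] {K : ℕ} {p : ℂ} (hp : p ∈ P) (z : ℂ) :
    (den P K).eval z = (den (P.erase p) K).eval z * (z - p) ^ K := by
  rw [den, ← Finset.mul_prod_erase _ _ hp, eval_mul, mul_comm]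
  simp [den]

theorem mulLin_den_injective (N : C.DSubmodule) (K : ℕ) :
    Function.Injective (N.mulLin fun z => (den P K).eval z) := by
  intro a b h
  refine Subtype.ext (funext fun z => ?_)
  have := congrFun h z
  exact smul_right_injective _ (den_eval_ne z.2) this

theorem den_mul_hol {e : Fin r → ∀ y, C.E.Fib y} {K k : ℕ} {m : N.globalSections}
    (hm : m ∈ N.bdd e K k) (x : ℂ) :
    mulSec (fun z => (den P K).eval z) (m : C.E.Sec P) ∈ C.E.holGerms P (x : CP1) := by
  classical
  by_cases hx : x ∈ P
  · refine holGerms_congr (holGerms_mul_coe (hm.1 x hx)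
      (analyticAt_eval (den (P.erase x) K) x)) (Eventually.of_forall fun z hz => ?_)
    simp only [mulSec_apply, smul_smul, den_eval_eq hx]
  · exact holGerms_mul_coe (N.global_hol m hx) (analyticAt_eval _ _)

/-- After multiplication by the denominator, the sections with bounded poles are polynomial. -/
theorem exists_den_mul (hε : C.E.IsGlobalFrame ε) {U : Set CP1} {e : Fin r → ∀ y, C.E.Fib y}
    (hU : OnePoint.infty ∈ U) (he : C.E.IsFrame U e) (K k : ℕ) : ∃ n : ℕ,
      ∀ m ∈ N.bdd e K k, ∃ q : Fin r → ℂ[X], (∀ i, (q i).natDegree ≤ n) ∧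
        mulSec (fun z => (den P K).eval z) (m : C.E.Sec P) = polySec P ε q := by
  obtain ⟨n, hn⟩ := exists_polySec (P := P) hε hU he
  obtain ⟨d, g, hg, hgd⟩ := (MerInf.eval (den P K)).exists_eq
  refine ⟨k + d + n, fun m hm => ?_⟩
  obtain ⟨f, hf⟩ := hm.2
  have h1 := hf.mul _ d g hg hgd
  rw [← Nat.cast_add] at h1
  exact hn (k + d) _ _ (den_mul_hol hm) h1

/-- Multiplication by the common denominator embeds the space into the polynomial sections of
bounded degree. -/
theorem finite_bdd (hε : C.E.IsGlobalFrame ε) {U : Set CP1} {e : Fin r → ∀ y, C.E.Fib y}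
    (hU : OnePoint.infty ∈ U) (he : C.E.IsFrame U e) (K k : ℕ) :
    Module.Finite ℂ (N.bdd e K k) := by
  obtain ⟨n, hn⟩ := exists_den_mul (N := N) hε hU he K k
  let L : (Fin r → degreeLT ℂ (n + 1)) →ₗ[ℂ] C.E.Sec P :=
    (polySec P ε).comp (LinearMap.pi fun i => (degreeLT ℂ (n + 1)).subtype.comp (LinearMap.proj i))
  have : Module.Finite ℂ (degreeLT ℂ (n + 1)) := Module.Finite.equiv (degreeLTEquiv ℂ (n + 1)).symm
  have h : ∀ m : N.bdd e K k, (N.mulLin fun z => (den P K).eval z).comp (N.bdd e K k).subtype m ∈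
      LinearMap.range L := by
    intro m
    obtain ⟨q, hq, hqm⟩ := hn m m.2
    refine ⟨fun i => ⟨q i, mem_degreeLT.2 ?_⟩, ?_⟩
    · exact (degree_le_natDegree).trans_lt (by exact_mod_cast Nat.lt_succ_of_le (hq i))
    · exact hqm.symm
  refine Module.Finite.of_injective (LinearMap.codRestrict _ _ h) fun a b hab => ?_
  exact Subtype.ext (N.mulLin_den_injective K (congrArg Subtype.val hab))

theorem exists_mem_bdd {U : Set CP1} {e : Fin r → ∀ y, C.E.Fib y}
    (hU : OnePoint.infty ∈ U) (he : C.E.IsFrame U e) (m : N.globalSections) :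
    ∃ K k, m ∈ N.bdd e K k := by
  have h1 : ∀ p : P, ∃ k : ℕ, mulSec (fun z => (z - p) ^ k) (m : C.E.Sec P) ∈
      C.E.holGerms P ((p : ℂ) : CP1) := fun p =>
    (N.global_mer m ((p : ℂ) : CP1)).2 (coe_mem_poles.2 p.2)
  choose K hK using h1
  obtain ⟨k, f, hf⟩ := exists_infForm hU he (N.global_mer m OnePoint.infty)
  refine ⟨∑ p, K p, k, fun p hp => ?_, f, hf⟩
  have h2 : K ⟨p, hp⟩ ≤ ∑ p, K p :=
    Finset.single_le_sum (fun _ _ => Nat.zero_le _) (Finset.mem_univ _)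
  exact unif_pow_mem (x := (p : CP1)) h2 (hK ⟨p, hp⟩)

/-- With the denominators cleared, the section is polynomial, and polynomials that vanish near
infinity are zero. So a global section is determined by its germ at infinity. -/
theorem global_eq_zero (hε : C.E.IsGlobalFrame ε) (m : N.globalSections)
    (h : GermEq OnePoint.infty (m : C.E.Sec P) 0) : m = 0 := by
  obtain ⟨U, e, hU, he, -⟩ := C.E.exists_isFrame OnePoint.infty
  obtain ⟨K, k, hm⟩ := exists_mem_bdd hU he m
  obtain ⟨n, hn⟩ := exists_den_mul (N := N) hε hU he K k
  obtain ⟨q, -, hq⟩ := hn m hm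
  have h1 : q = 0 := by
    refine polySec_eq_zero (P := P) hε q (germEq_iff.2 ?_)
    filter_upwards [germEq_iff.1 h] with z h1 hz
    rw [← hq, mulSec_apply, h1 hz]
    simp
  refine N.mulLin_den_injective K ?_
  rw [map_zero]
  exact hq.trans (by rw [h1, map_zero])

/-- The operators `D - ξ` are injective on global sections. -/
theorem dx_sub_injective (hC : C.ResonanceFree) (hε : C.E.IsGlobalFrame ε) (ξ : ℂ) :
    Function.Injective (N.dx - ξ • LinearMap.id : N.globalSections →ₗ[ℂ] N.globalSections) := by
  rw [injective_iff_map_eq_zero]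
  intro m hm
  obtain ⟨e, B, h⟩ := C.exists_isIrr
  refine global_eq_zero hε m (eventually_zero_of_eq hC h (N.global_mer m _) (ξ := ξ) ?_)
  have h1 : C.D (m : C.E.Sec P) - ξ • (m : C.E.Sec P) = 0 := congrArg Subtype.val hm
  rw [sub_eq_zero.1 h1]
  exact GermEq.refl _

theorem polySec_global (hN : N.IsFull) (hC : C.ResonanceFree) (hε : C.E.IsGlobalFrame ε)
    (q : Fin r → ℂ[X]) : polySec P ε q ∈ N.globalSections :=
  hN.global hC (polySec_hol hε q) (polySec_mer hε q)

/-- The global sections of the minimal extension are generated by the polynomial ones. -/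
theorem eq_top_of_stable (hC : C.ResonanceFree) (hN : N.IsMinimalExtension)
    (hε : C.E.IsGlobalFrame ε) (W : Submodule ℂ N.globalSections)
    (hW : ∀ q, (⟨polySec P ε q, polySec_global hN.1.isFull hC hε q⟩ : N.globalSections) ∈ W)
    (hD : ∀ w ∈ W, N.dx w ∈ W) : W = ⊤ := by
  classical
  -- Each germ generated at `p` is approximated by elements of `W` to any order, while these vanish
  -- to the same order at the rest of `P`. The order is left arbitrary because a derivative uses up
  -- one of it.
  have hgen : ∀ (p : ℂ) (s : C.E.Sec P), C.Gen (p : CP1) s → ∀ n : ℕ, ∃ w ∈ W,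
      VanishAt n p (s - (w : C.E.Sec P)) ∧
      ∀ p' ∈ P, p' ≠ p → VanishAt n p' (w : C.E.Sec P) := by
    intro p s hs
    induction hs with
    | hol s hs =>
      intro n
      obtain ⟨q, h1, h2⟩ := exists_jet hε hs n
      exact ⟨_, hW q, h1, h2⟩
    | add s t _ _ h h' =>
      intro n
      obtain ⟨w, hw, h1, h2⟩ := h n
      obtain ⟨w', hw', h1', h2'⟩ := h' n
      refine ⟨w + w', W.add_mem hw hw', ?_, fun p' hp hne => (h2 p' hp hne).add (h2' p' hp hne)⟩
      have := h1.add h1'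
      rwa [sub_add_sub_comm] at this
    | der s hs h =>
      intro n
      obtain ⟨w, hw, h1, h2⟩ := h (n + 1)
      exact ⟨N.dx w, hD w hw, (h1.der hC).congr (C.D_sub_germ (hs.mer hC) (N.global_mer w _)),
        fun p' hp hne => (h2 p' hp hne).der hC⟩
    | congr s t hs h h' =>
      intro n
      obtain ⟨w, hw, h1, h2⟩ := h' n
      refine ⟨w, hw, h1.congr (germEq_iff.2 ?_), h2⟩
      filter_upwards [germEq_iff.1 h] with z h1 hz
      rw [Pi.sub_apply, h1 hz, Pi.sub_apply]
  refine eq_top_iff.2 fun m _ => ?_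
  have h1 : ∀ p : ℂ, C.Gen (p : CP1) (m : C.E.Sec P) := fun p => by
    have := N.mem_stalk_of_global m (p : CP1)
    rwa [stalk_eq_of_isMinimal hC hN] at this
  -- Order zero is enough: the difference of `m` and the approximations becomes holomorphic at all
  -- points of `P`, so it is a polynomial section.
  choose w hw h2 h3 using fun p => hgen p _ (h1 p) 0
  let m' := m - ∑ p ∈ P, w p
  have hm' : ∀ x : ℂ, (m' : C.E.Sec P) ∈ C.E.holGerms P (x : CP1) := by
    intro x
    by_cases hx : x ∈ P
    · have h4 : (m' : C.E.Sec P) = ((m : C.E.Sec P) - w x) +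
          (-1 : ℂ) • ((∑ p ∈ P.erase x, w p : N.globalSections) : C.E.Sec P) := by
        simp only [m', ← Finset.add_sum_erase _ _ hx, Submodule.coe_sub, Submodule.coe_add]
        rw [neg_one_smul]
        abel
      rw [h4]
      refine holGerms_add (h2 x).hol (holGerms_smul _ ?_)
      have h5 : ∀ S : Finset ℂ, (∀ p ∈ S, p ≠ x) → ((∑ p ∈ S, w p : N.globalSections) : C.E.Sec P) ∈
          C.E.holGerms P (x : CP1) := by
        intro S
        induction S using Finset.induction_on with
        | empty => intro _; simpa using holGerms_zero
        | insert a S ha ih =>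
          intro h
          rw [Finset.sum_insert ha]
          exact holGerms_add (h3 a x hx (h a (by simp)).symm).hol
            (ih fun p hp => h p (by simp [hp]))
      exact h5 _ fun p hp => Finset.ne_of_mem_erase hp
    · exact N.global_hol m' hx
  obtain ⟨U, e, hU, he, -⟩ := C.E.exists_isFrame OnePoint.infty
  obtain ⟨n, hn⟩ := exists_polySec (P := P) hε hU he
  obtain ⟨k, f, hf⟩ := exists_infForm hU he (N.global_mer m' OnePoint.infty)
  obtain ⟨q, -, hq⟩ := hn k f _ hm' hf
  have h6 : m' ∈ W := by
    have := hW q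
    simp only [← hq] at this
    exact this
  have h7 : m = m' + ∑ p ∈ P, w p := by simp [m']
  rw [h7]
  exact W.add_mem h6 (W.sum_mem fun p _ => hw p)

/-- The polynomial whose roots are the eigenvalues at infinity. -/
def charPoly (C : MeroConnection.{u} r P) : ℂ[X] := ∏ i, (X - Polynomial.C (C.α i))

theorem charPoly_eval_ne {ξ : ℂ} (h : ξ ∉ C.Phat) : (charPoly C).eval ξ ≠ 0 := by
  simp only [charPoly, eval_prod, eval_sub, eval_X, eval_C]
  refine Finset.prod_ne_zero_iff.2 fun i _ => sub_ne_zero.2 fun hi => h ?_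
  simp [Phat, hi]

/-- Each factor `D - α a` multiplies the leading coefficient with index `i` by `α i - α a` and uses
up one order of vanishing at the points of `P`. The vanishing is assumed because the derivation
would otherwise create poles there. -/
theorem aeval_prod_form (hC : C.ResonanceFree) {e : Fin r → ∀ y, C.E.Fib y}
    {B : Fin r → Fin r → ℂ → ℂ} (h : C.IsIrr e B) (S : Finset (Fin r)) (k : ℤ)
    (f : Fin r → ℂ → ℂ) (m : N.globalSections) (hf : InfForm e k f (m : C.E.Sec P)) (n : ℕ)
    (hm : ∀ p ∈ P, VanishAt (n + S.card) p (m : C.E.Sec P)) :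
    ∃ g, InfForm e k g (aeval N.dx (∏ i ∈ S, (X - Polynomial.C (C.α i))) m : C.E.Sec P) ∧
      (∀ i, g i 0 = (∏ j ∈ S, (C.α i - C.α j)) * f i 0) ∧
      ∀ p ∈ P, VanishAt n p (aeval N.dx (∏ i ∈ S, (X - Polynomial.C (C.α i))) m : C.E.Sec P) := by
  classical
  induction S using Finset.induction_on generalizing n with
  | empty => exact ⟨f, by simpa using hf, fun i => by simp, by simpa using hm⟩
  | insert a S ha ih =>
    obtain ⟨g, hg, hg0, hv⟩ := ih (n + 1) (fun p hp => by
      have := hm p hp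
      rwa [Finset.card_insert_of_notMem ha, ← add_assoc, add_right_comm] at this)
    set w := aeval N.dx (∏ i ∈ S, (X - Polynomial.C (C.α i))) m with hw
    have h1 : (aeval N.dx (∏ i ∈ insert a S, (X - Polynomial.C (C.α i))) m : N.globalSections) =
        N.dx w - C.α a • w := by
      rw [Finset.prod_insert ha, map_mul, Module.End.mul_apply, ← hw, map_sub, aeval_X, aeval_C]
      rfl
    have h2 : ((N.dx w - C.α a • w : N.globalSections) : C.E.Sec P) =
        C.D (w : C.E.Sec P) - C.α a • (w : C.E.Sec P) := rfl
    rw [h1, h2]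
    refine ⟨_, (hg.der h).sub (hg.smul _), fun i => ?_, fun p hp => ?_⟩
    · simp only [infDer, Finset.prod_insert ha, mul_assoc, ← hg0 i]
      simp
      ring
    · have := ((hv p hp).der hC).add ((hv p hp).pred.smul (-C.α a))
      rwa [neg_smul, ← sub_eq_add_neg] at this

/-- The characteristic polynomial lowers the order at infinity, up to derivatives. -/
theorem exists_ladder (hC : C.ResonanceFree) (hN : N.IsFull)
    (hε : C.E.IsGlobalFrame ε) {e : Fin r → ∀ y, C.E.Fib y}
    {B : Fin r → Fin r → ℂ → ℂ} (h : C.IsIrr e B) : ∃ k₀ : ℕ, ∀ k ≥ k₀, ∀ m ∈ N.bdd e 0 (k + 1),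
      ∀ W : Submodule ℂ N.globalSections, N.bdd e 0 k ≤ W → (∀ w ∈ W, N.dx w ∈ W) →
        aeval N.dx (charPoly C) m ∈ W := by
  classical
  obtain ⟨⟨U, hU, he⟩, -, -⟩ := id h
  obtain ⟨k₀, hk₀⟩ := exists_infForm_polySec (P := P) hε hU he (den P r).natDegree
  refine ⟨k₀, fun k hk m hm W hW hD => ?_⟩
  have hhol : ∀ x : ℂ, (m : C.E.Sec P) ∈ C.E.holGerms P (x : CP1) := fun x => by
    refine holGerms_congr (den_mul_hol hm x) (Eventually.of_forall fun z hz => ?_)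
    simp [mulSec_apply, den]
  obtain ⟨n, hn⟩ := exists_polySec (P := P) hε hU he
  obtain ⟨f, hf⟩ := hm.2
  obtain ⟨q, -, hq⟩ := hn _ f _ hhol hf
  have hmod : ∀ i, (q i %ₘ den P r).natDegree ≤ (den P r).natDegree := fun i =>
    natDegree_le_natDegree (degree_modByMonic_lt _ (den_monic r)).le
  -- Division by `den P r` splits off a remainder of bounded degree, whose order at infinity is at
  -- most `k₀`. The rest vanishes to order `r` in `P`, which is just enough for the `r` factors of
  -- `charPoly`.
  let ρ : N.globalSections := ⟨polySec P ε fun i => q i %ₘ den P r, polySec_global hN hC hε _⟩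
  have hρ : ρ ∈ N.bdd e 0 k := by
    obtain ⟨g, hg⟩ := hk₀ (fun i => q i %ₘ den P r) hmod
    refine ⟨fun p hp => holGerms_congr (polySec_hol hε (fun i => q i %ₘ den P r) p)
      (Eventually.of_forall fun z hz => by simp [mulSec_apply, ρ]), ?_⟩
    have := hg.raise (k - k₀)
    rw [← Nat.cast_add, Nat.add_sub_cancel' hk] at this
    exact ⟨_, this⟩
  have hstab : ∀ (p : ℂ[X]), ∀ w ∈ W, aeval N.dx p w ∈ W := by
    intro p w hw
    induction p using Polynomial.induction_on' with
    | add p q hp hq => rw [map_add, LinearMap.add_apply]; exact W.add_mem hp hq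
    | monomial n a =>
      rw [aeval_monomial, Module.End.mul_apply]
      refine W.smul_mem a ?_
      induction n with
      | zero => simpa using hw
      | succ n ih => rw [pow_succ', Module.End.mul_apply]; exact hD _ ih
  have hsplit : m = (m - ρ) + ρ := by simp
  rw [hsplit, map_add]
  refine W.add_mem (hW ?_) (hstab _ _ (hW hρ))
  obtain ⟨g, hg⟩ := hρ.2
  have h1 : InfForm e (k + 1 : ℤ) _ ((m - ρ : N.globalSections) : C.E.Sec P) :=
    (by simpa using hf : InfForm e (k + 1 : ℤ) f (m : C.E.Sec P)).sub
      (by simpa using hg.raise 1 : InfForm e (k + 1 : ℤ) (fun i t => t * g i t) (ρ : C.E.Sec P))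
  have hv : ∀ p ∈ P, VanishAt (0 + (Finset.univ : Finset (Fin r)).card) p
      ((m - ρ : N.globalSections) : C.E.Sec P) := by
    intro p hp
    rw [zero_add, Finset.card_univ, Fintype.card_fin]
    refine ⟨polySec P ε fun i => den (P.erase p) r * (q i /ₘ den P r), polySec_hol hε _ p,
      germEq_iff.2 (Eventually.of_forall fun z hz => ?_)⟩
    rw [mulSec_apply, polySec_apply, Finset.smul_sum, Submodule.coe_sub, Pi.sub_apply, hq,
      polySec_apply]
    simp only [ρ, polySec_apply, ← Finset.sum_sub_distrib]
    refine Finset.sum_congr rfl fun i _ => ?_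
    rw [← sub_smul, smul_smul]
    congr 1
    have h2 := congrArg (eval z) (modByMonic_add_div (q i) (den P r))
    rw [eval_add, eval_mul, den_eval_eq hp] at h2
    rw [eval_mul]
    linear_combination -h2
  -- With all factors present, every leading coefficient is multiplied by `α i - α i = 0`, so the
  -- order at infinity drops, and no poles in `P` have arisen.
  obtain ⟨g', hg', hg0, hv'⟩ := aeval_prod_form hC h Finset.univ _ _ _ h1 0 hv
  refine ⟨fun p hp => holGerms_congr (hv' p hp).hol (Eventually.of_forall fun z hz => by
    simp [mulSec_apply, charPoly]), _, hg'.lower fun i => ?_⟩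
  rw [hg0, Finset.prod_eq_zero (Finset.mem_univ i) (sub_self _), zero_mul]

end DSubmodule

end MeroConnection

end MinLaplace

namespace MinLaplace

open Filter Set Polynomial

universe u

/-! ### Modules over the ring of differential operators in one variable -/

/-- Let `X` act as `T`. Powers of `χ` carry every vector into the submodule generated by the
finite-dimensional space `G k₀`. This submodule is finitely generated and torsion-free over `ℂ[X]`,
hence free. -/
theorem exists_free_generators {M : Type u} [AddCommGroup M] [Module ℂ M] (T : M →ₗ[ℂ] M)
    (hinj : ∀ ξ : ℂ, Function.Injective (T - ξ • LinearMap.id : M →ₗ[ℂ] M))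
    (χ : ℂ[X]) (G : ℕ → Submodule ℂ M) (k₀ : ℕ) (hfin : Module.Finite ℂ (G k₀))
    (hstep : ∀ k ≥ k₀, ∀ m ∈ G (k + 1), ∀ W : Submodule ℂ M, G k ≤ W → (∀ w ∈ W, T w ∈ W) →
      aeval T χ m ∈ W)
    (hmono : Monotone G)
    (hgen : ∀ W : Submodule ℂ M, (∀ k, G k ≤ W) → (∀ w ∈ W, T w ∈ W) → W = ⊤) :
    ∃ (ρ : ℕ) (m : Fin ρ → M), (∀ v : M, ∃ (k : ℕ) (q : Fin ρ → ℂ[X]),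
      aeval T (χ ^ k) v = ∑ i, aeval T (q i) (m i)) ∧
      ∀ q : Fin ρ → ℂ[X], ∑ i, aeval T (q i) (m i) = 0 → q = 0 := by
  classical
  let _ : Module ℂ[X] M := Module.compHom M (aeval T : ℂ[X] →ₐ[ℂ] Module.End ℂ M).toRingHom
  have hsm : ∀ (p : ℂ[X]) (v : M), p • v = aeval T p v := fun _ _ => rfl
  have hcs : ∀ (c : ℂ) (v : M), Polynomial.C c • v = c • v := fun c v => by
    rw [hsm, aeval_C]; rfl
  have : IsScalarTower ℂ ℂ[X] M := ⟨fun c p v => by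
    rw [smul_eq_C_mul, mul_smul, hcs]⟩
  have hT : ∀ v : M, (X : ℂ[X]) • v = T v := fun v => by rw [hsm, aeval_X]
  -- Over `ℂ` a nonzero polynomial in `T` is a product of operators `T - ξ` and a nonzero constant,
  -- hence injective.
  have hnz : ∀ (p : ℂ[X]), p ≠ 0 → ∀ v : M, p • v = 0 → v = 0 := by
    intro p hp
    have hs := IsAlgClosed.splits p
    have h1 := hs.eq_prod_roots
    intro v hv
    rw [h1, mul_smul, hcs] at hv
    have h2 : (Multiset.map (fun a => X - Polynomial.C a) p.roots).prod • v = 0 :=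
      (smul_eq_zero.1 hv).resolve_left (leadingCoeff_ne_zero.2 hp)
    have h3 : ∀ (s : Multiset ℂ) (v : M),
        (Multiset.map (fun a => X - Polynomial.C a) s).prod • v = 0 → v = 0 := by
      intro s
      induction s using Multiset.induction_on with
      | empty => intro v hv; simpa using hv
      | cons a s ih =>
        intro v hv
        rw [Multiset.map_cons, Multiset.prod_cons, mul_smul] at hv
        refine ih v (hinj a ?_)
        rw [map_zero, ← hv, sub_smul, hT, hcs]
        rfl
    exact h3 _ _ h2
  have : Module.IsTorsionFree ℂ[X] M := by
    refine Module.IsTorsionFree.of_smul_eq_zero fun p v h => ?_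
    by_cases hp : p = 0
    · exact Or.inl hp
    · exact Or.inr (hnz p hp v h)
  let M₀ : Submodule ℂ[X] M := Submodule.span ℂ[X] (G k₀ : Set M)
  have hstab : ∀ w ∈ M₀.restrictScalars ℂ, T w ∈ M₀.restrictScalars ℂ := fun w hw => by
    rw [← hT]; exact M₀.smul_mem _ hw
  -- The hypothesis `hstep` is applied to the vectors that `χ ^ n` carries into `M₀`: they contain
  -- `G (k₀ + n)` and are stable under `T`, so one more `χ` takes care of `G (k₀ + n + 1)`.
  have hk : ∀ n k, k ≤ k₀ + n → ∀ m ∈ G k, χ ^ n • m ∈ M₀ := by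
    intro n
    induction n with
    | zero => intro k hk m hm; rw [pow_zero, one_smul]; exact Submodule.subset_span (hmono hk hm)
    | succ n ih =>
      intro k hk m hm
      let W : Submodule ℂ M := (M₀.comap (LinearMap.lsmul ℂ[X] M (χ ^ n))).restrictScalars ℂ
      have hW : ∀ w, w ∈ W ↔ χ ^ n • w ∈ M₀ := fun w => Iff.rfl
      have h1 : aeval T χ m ∈ W := by
        refine hstep (k₀ + n) (by omega) m (hmono hk hm) W (fun w hw => ?_) fun w hw => ?_
        · exact ih (k₀ + n) le_rfl w hw
        · rw [hW] at hw ⊢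
          rw [← hT, smul_comm]
          exact M₀.smul_mem _ hw
      rw [hW, ← hsm, ← mul_smul, ← pow_succ] at h1
      exact h1
  -- The spaces `G k` need not exhaust `M`; they only generate it under `T`, which commutes with
  -- `χ`.
  have hall : ∀ v : M, ∃ n, χ ^ n • v ∈ M₀ := by
    let W : Submodule ℂ M :=
      { carrier := {v | ∃ n, χ ^ n • v ∈ M₀}
        zero_mem' := ⟨0, by simp⟩
        add_mem' := by
          rintro a b ⟨n, hn⟩ ⟨l, hl⟩
          refine ⟨n + l, ?_⟩
          rw [smul_add]
          refine M₀.add_mem ?_ ?_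
          · rw [add_comm, pow_add, mul_smul]; exact M₀.smul_mem _ hn
          · rw [pow_add, mul_smul]; exact M₀.smul_mem _ hl
        smul_mem' := by
          rintro c a ⟨n, hn⟩
          refine ⟨n, ?_⟩
          rw [← hcs, smul_comm]
          exact M₀.smul_mem _ hn }
    have hW : W = ⊤ := hgen W (fun k m hm => ⟨k, hk k k (by omega) m hm⟩) (by
      rintro w ⟨n, hn⟩
      refine ⟨n, ?_⟩
      rw [← hT, smul_comm]
      exact M₀.smul_mem _ hn)
    intro v
    have : v ∈ W := by rw [hW]; trivial
    exact this
  have hM₀ : Module.Finite ℂ[X] M₀ := by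
    obtain ⟨S, hS⟩ := (Module.Finite.iff_fg.1 hfin : (G k₀).FG)
    refine Module.Finite.iff_fg.2 ⟨S, le_antisymm (Submodule.span_mono ?_) ?_⟩
    · rw [← hS]; exact Submodule.subset_span
    · refine Submodule.span_le.2 ?_
      rw [← hS]
      exact Submodule.span_le_restrictScalars ℂ ℂ[X] (S : Set M)
  obtain ⟨ρ, b⟩ := Module.basisOfFiniteTypeTorsionFree' (R := ℂ[X]) (M := M₀)
  refine ⟨ρ, fun i => (b i : M), fun v => ?_, fun q hq => ?_⟩
  · obtain ⟨n, hn⟩ := hall v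
    refine ⟨n, fun i => b.repr ⟨_, hn⟩ i, ?_⟩
    have h1 := congrArg Subtype.val (b.sum_repr ⟨_, hn⟩)
    rw [Submodule.coe_sum] at h1
    exact h1.symm
  · have h1 : ∑ i, q i • b i = 0 := by
      apply Subtype.ext
      rw [Submodule.coe_sum]
      exact hq
    exact funext (Fintype.linearIndependent_iff.1 b.linearIndependent q h1)

end MinLaplace

namespace MinLaplace

open Filter Set HolBundle Polynomial

universe u

/-! ### Meromorphic functions and bundles on the dual sphere -/

section

variable {Q : Finset ℂ} {x : CP1}

theorem funLat_iff {f : Punct Q → ℂ} : FunLat f x ↔ ∃ g : ℂ → ℂ, AnalyticAt ℂ g 0 ∧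
    ∀ᶠ z in nf x, ∀ h : z ∉ Q, f ⟨z, h⟩ = g (unif x z) := by
  constructor
  · rintro ⟨g, hg, hW⟩
    obtain ⟨g', hg', -, hgg⟩ := hg.exists_analyticAt
    refine ⟨g', hg', ?_⟩
    filter_upwards [exists_nhds_iff_nf.1 hW, hgg] with z h1 h2 hz
    rw [h1 hz, ← h2]; rfl
  · rintro ⟨g, hg, h⟩
    obtain ⟨g', hg', -, hgg⟩ := exists_holAt x hg
    refine ⟨g', hg', exists_nhds_iff_nf.2 ?_⟩
    filter_upwards [h] with z h1 hz
    rw [h1 hz, ← hgg]; rfl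

theorem merFun_of_notMem (hx : x ∉ poles Q) {f : Punct Q → ℂ} :
    MerFun f x ↔ FunLat f x :=
  ⟨fun h => h.1 hx, fun h => ⟨fun _ => h, fun h' => absurd h' hx⟩⟩

theorem merFun_of_mem (hx : x ∈ poles Q) {f : Punct Q → ℂ} {g : ℂ → ℂ} (hg : MeromorphicAt g 0)
    (h : ∀ᶠ z in nf x, ∀ h : z ∉ Q, f ⟨z, h⟩ = g (unif x z)) : MerFun f x := by
  refine ⟨fun h' => absurd hx h', fun _ => ?_⟩
  obtain ⟨k, hk⟩ := hg
  simp only [sub_zero] at hk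
  refine ⟨k, funLat_iff.2 ⟨_, hk, ?_⟩⟩
  filter_upwards [h] with z h1 hz
  rw [h1 hz]

/-- The inverse of the local parameter. -/
def chart : CP1 → ℂ → ℂ
  | none, t => t⁻¹
  | some a, t => t + a

theorem chart_unif (x : CP1) (z : ℂ) : chart x (unif x z) = z := by
  induction x using OnePoint.rec with
  | infty => exact inv_inv z
  | coe a => exact sub_add_cancel z a

theorem meromorphicAt_eval_chart (x : CP1) (q : ℂ[X]) :
    MeromorphicAt (fun t => q.eval (chart x t)) 0 := by
  induction x using OnePoint.rec with
  | infty => exact MerInf.eval q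
  | coe a => exact (unif_tendsto_analyticAt (analyticAt_eval q a)).meromorphicAt

end

namespace MeroConnection.DSubmodule

variable {r : ℕ} {P : Finset ℂ} {C : MeroConnection.{u} r P} {N : C.DSubmodule}

theorem laplaceLat_iff {s : ∀ ξ : Punct C.Phat, N.LaplaceFiber ξ} {x : CP1} :
    N.LaplaceLat s x ↔ ∃ (n : ℕ) (m : Fin n → N.globalSections) (f : Fin n → ℂ → ℂ),
      (∀ i, AnalyticAt ℂ (f i) 0) ∧ ∀ᶠ z in nf x, ∀ h : z ∉ C.Phat,
        s ⟨z, h⟩ = ∑ i, f i (unif x z) • N.laplaceClass z (m i) := by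
  constructor
  · rintro ⟨n, m, f, hf, hW⟩
    choose g hg _ hgf using fun i => (hf i).exists_analyticAt
    refine ⟨n, m, g, hg, ?_⟩
    filter_upwards [exists_nhds_iff_nf.1 hW, eventually_all.2 hgf] with z h1 h2 hz
    rw [h1 hz]
    exact Finset.sum_congr rfl fun i _ => by rw [← h2]; rfl
  · rintro ⟨n, m, g, hg, h⟩
    choose f hf _ hfg using fun i => exists_holAt x (hg i)
    refine ⟨n, m, f, hf, exists_nhds_iff_nf.2 ?_⟩
    filter_upwards [h] with z h1 hz
    rw [h1 hz]
    exact Finset.sum_congr rfl fun i _ => by rw [← hfg]; rfl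

variable (N) in
/-- The class of an element in the fibre of the Laplace transform, as a linear map. -/
def laplaceLin (ξ : ℂ) : N.globalSections →ₗ[ℂ] N.LaplaceFiber ξ := Submodule.mkQ _

theorem laplaceLin_apply (ξ : ℂ) (m : N.globalSections) : N.laplaceLin ξ m = N.laplaceClass ξ m :=
  rfl

theorem laplaceClass_eq_zero {ξ : ℂ} {m : N.globalSections} : N.laplaceClass ξ m = 0 ↔
    ∃ w, m = N.dx w - ξ • w := by
  rw [laplaceClass, Submodule.Quotient.mk_eq_zero]
  exact ⟨fun ⟨w, h⟩ => ⟨w, h.symm⟩, fun ⟨w, h⟩ => ⟨w, h.symm⟩⟩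

theorem laplaceClass_dx (ξ : ℂ) (m : N.globalSections) :
    N.laplaceClass ξ (N.dx m) = ξ • N.laplaceClass ξ m := by
  have h : N.laplaceClass ξ (N.dx m - ξ • m) = 0 := laplaceClass_eq_zero.2 ⟨m, rfl⟩
  rw [← laplaceLin_apply, map_sub, map_smul, sub_eq_zero] at h
  exact h

theorem laplaceClass_aeval (ξ : ℂ) (q : ℂ[X]) (m : N.globalSections) :
    N.laplaceClass ξ (aeval N.dx q m) = q.eval ξ • N.laplaceClass ξ m := by
  induction q using Polynomial.induction_on' with
  | add p q hp hq =>
    rw [map_add, LinearMap.add_apply, ← laplaceLin_apply, map_add, laplaceLin_apply,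
      laplaceLin_apply, hp, hq, eval_add, add_smul]
  | monomial n a =>
    have h : ∀ n, N.laplaceClass ξ ((N.dx ^ n) m) = ξ ^ n • N.laplaceClass ξ m := by
      intro n
      induction n with
      | zero => simp
      | succ n ih => rw [pow_succ', Module.End.mul_apply, laplaceClass_dx, ih, smul_smul, pow_succ']
    rw [aeval_monomial, Module.End.mul_apply, Module.algebraMap_end_apply, ← laplaceLin_apply,
      map_smul, laplaceLin_apply, h, eval_monomial, smul_smul]

/-- Free generators of the Laplace transform off the eigenvalues at infinity. -/
def IsGenerator {ρ : ℕ} (m : Fin ρ → N.globalSections) : Prop :=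
  (∀ v : N.globalSections, ∃ (k : ℕ) (q : Fin ρ → ℂ[X]),
    aeval N.dx (charPoly C ^ k) v = ∑ i, aeval N.dx (q i) (m i)) ∧
  ∀ q : Fin ρ → ℂ[X], ∑ i, aeval N.dx (q i) (m i) = 0 → q = 0

variable {ρ : ℕ} {m : Fin ρ → N.globalSections}

theorem IsGenerator.class_eq (h : IsGenerator m) (v : N.globalSections) :
    ∃ (k : ℕ) (q : Fin ρ → ℂ[X]), ∀ ξ ∉ C.Phat, N.laplaceClass ξ v =
      ∑ i, ((charPoly C).eval ξ ^ k)⁻¹ • (q i).eval ξ • N.laplaceClass ξ (m i) := by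
  obtain ⟨k, q, hq⟩ := h.1 v
  refine ⟨k, q, fun ξ hξ => ?_⟩
  have h1 := congrArg (N.laplaceLin ξ) hq
  rw [map_sum] at h1
  simp only [laplaceLin_apply, laplaceClass_aeval, eval_pow] at h1
  rw [← Finset.smul_sum, ← h1, smul_smul, inv_mul_cancel₀ (pow_ne_zero _ (charPoly_eval_ne hξ)),
    one_smul]

/-- A relation `∑ c i • m i = (X - ξ) w` in the global sections is multiplied by a power of
`charPoly` that expresses `w` through the generators. Freeness then yields `c i * charPoly ^ k = (X
- ξ) * q i`, and evaluation at `ξ`, where `charPoly` does not vanish, gives `c i = 0`. -/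
theorem IsGenerator.isB (h : IsGenerator m) {ξ : ℂ} (hξ : ξ ∉ C.Phat) :
    IsB fun i => N.laplaceClass ξ (m i) := by
  constructor
  · refine Fintype.linearIndependent_iff.2 fun c hc => ?_
    have h1 : N.laplaceClass ξ (∑ i, c i • m i) = 0 := by
      rw [← laplaceLin_apply, map_sum]
      simp only [map_smul]
      exact hc
    obtain ⟨w, hw⟩ := laplaceClass_eq_zero.1 h1
    obtain ⟨k, q, hq⟩ := h.1 w
    have h2 : (∑ i, aeval N.dx (Polynomial.C (c i) * charPoly C ^ k -
        (X - Polynomial.C ξ) * q i) (m i)) = 0 := by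
      simp only [map_sub, LinearMap.sub_apply, Finset.sum_sub_distrib]
      have h3 : ∀ i, aeval N.dx (Polynomial.C (c i) * charPoly C ^ k) (m i) =
          aeval N.dx (charPoly C ^ k) (c i • m i) := fun i => by
        rw [mul_comm, map_mul, Module.End.mul_apply, aeval_C, Module.algebraMap_end_apply]
      have h4 : ∀ i, aeval N.dx ((X - Polynomial.C ξ) * q i) (m i) =
          aeval N.dx (X - Polynomial.C ξ) (aeval N.dx (q i) (m i)) := fun i => by
        rw [map_mul, Module.End.mul_apply]
      simp only [h3, h4, ← map_sum]
      rw [← hq, hw, ← Module.End.mul_apply, ← map_mul, mul_comm, map_mul, Module.End.mul_apply,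
        sub_eq_zero]
      congr 1
      rw [map_sub, LinearMap.sub_apply, aeval_X, aeval_C, Module.algebraMap_end_apply]
    intro i
    have h5 := congrArg (eval ξ) (congrFun (h.2 _ h2) i)
    simp only [eval_sub, eval_mul, eval_C, eval_pow, eval_X, sub_self, zero_mul, sub_zero,
      Pi.zero_apply, eval_zero] at h5
    exact (mul_eq_zero.1 h5).resolve_right (pow_ne_zero _ (charPoly_eval_ne hξ))
  · rw [eq_top_iff]
    rintro v -
    obtain ⟨v, rfl⟩ := Submodule.Quotient.mk_surjective _ v
    obtain ⟨k, q, hq⟩ := h.class_eq v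
    change N.laplaceClass ξ v ∈ _
    rw [hq ξ hξ]
    exact Submodule.sum_mem _ fun i _ => Submodule.smul_mem _ _ (Submodule.smul_mem _ _
      (Submodule.subset_span ⟨i, rfl⟩))

/-- The Laplace transform is a meromorphic bundle. -/
theorem IsGenerator.isMeroBundle (h : IsGenerator m) : IsMeroBundle N.LaplaceMer := by
  -- One frame serves for the entire dual sphere: the coordinates of any element are polynomials
  -- divided by powers of `charPoly`, so they have poles only in `Phat` and at infinity.
  refine ⟨ρ, fun x => ⟨univ, isOpen_univ, trivial, fun i ξ => N.laplaceClass ξ (m i),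
    fun ξ _ => h.isB ξ.2, fun y _ s => ⟨fun hs => ?_, ?_⟩⟩⟩
  · by_cases hy : y ∈ poles C.Phat
    · obtain ⟨k, hk⟩ := hs.2 hy
      obtain ⟨n, v, f, hf, hfs⟩ := laplaceLat_iff.1 hk
      choose l q hq using fun j => h.class_eq (v j)
      refine ⟨fun i ξ => (unif y ξ ^ k)⁻¹ * ∑ j, f j (unif y ξ) *
        (((charPoly C).eval (ξ : ℂ) ^ l j)⁻¹ * (q j i).eval (ξ : ℂ)), fun i => ?_,
        exists_nhds_iff_nf.2 ?_⟩
      · refine merFun_of_mem hy (g := fun t => (t ^ k)⁻¹ * ∑ j, f j t *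
          (((charPoly C).eval (chart y t) ^ l j)⁻¹ * (q j i).eval (chart y t))) ?_
          (Eventually.of_forall fun z hz => by simp only [chart_unif])
        exact (((MeromorphicAt.id 0).fun_pow k).fun_inv).fun_mul (MeromorphicAt.fun_sum fun j _ =>
          (hf j).meromorphicAt.fun_mul ((((meromorphicAt_eval_chart y _).fun_pow _).fun_inv).fun_mul
            (meromorphicAt_eval_chart y _)))
      · filter_upwards [hfs, unif_ne_zero hy] with z h1 h2 hz
        have h3 : s ⟨z, hz⟩ = (unif y z ^ k)⁻¹ • (unif y z ^ k • s ⟨z, hz⟩) := by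
          rw [smul_smul, inv_mul_cancel₀ (pow_ne_zero _ (h2 hz)), one_smul]
        have h1 := h1 hz
        rw [h3]
        rw [h1]
        simp only [hq _ z hz, Finset.smul_sum, smul_smul, Finset.sum_smul, Finset.mul_sum]
        rw [Finset.sum_comm]
    · obtain ⟨n, v, f, hf, hfs⟩ := laplaceLat_iff.1 (hs.1 hy)
      choose l q hq using fun j => h.class_eq (v j)
      refine ⟨fun i ξ => ∑ j, f j (unif y ξ) *
        (((charPoly C).eval (ξ : ℂ) ^ l j)⁻¹ * (q j i).eval (ξ : ℂ)), fun i => ?_,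
        exists_nhds_iff_nf.2 ?_⟩
      · rw [merFun_of_notMem hy, funLat_iff]
        refine ⟨fun t => ∑ j, f j t *
          (((charPoly C).eval (chart y t) ^ l j)⁻¹ * (q j i).eval (chart y t)), ?_,
          Eventually.of_forall fun z hz => by simp only [chart_unif]⟩
        induction y using OnePoint.rec with
        | infty => exact absurd infty_mem_poles hy
        | coe a =>
          have ha : a ∉ C.Phat := fun h => hy (coe_mem_poles.2 h)
          have h1 : ∀ q : ℂ[X], AnalyticAt ℂ (fun t => q.eval (chart (a : CP1) t)) 0 :=
            fun q => unif_tendsto_analyticAt (analyticAt_eval q a)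
          refine Finset.analyticAt_fun_sum _ fun j _ => (hf j).fun_mul
            ((((h1 _).fun_pow _).fun_inv (pow_ne_zero _ ?_)).fun_mul (h1 _))
          change (charPoly C).eval (0 + a) ≠ 0
          rw [zero_add]
          exact charPoly_eval_ne ha
      · filter_upwards [hfs] with z h1 hz
        rw [h1 hz]
        simp only [hq _ z hz, Finset.smul_sum, smul_smul, Finset.sum_smul]
        rw [Finset.sum_comm]
  · rintro ⟨f, hf, hW⟩
    have hW := exists_nhds_iff_nf.1 hW
    refine ⟨fun hy => ?_, fun hy => ?_⟩
    · choose g hg hgf using fun i => funLat_iff.1 ((hf i).1 hy)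
      refine laplaceLat_iff.2 ⟨ρ, m, g, hg, ?_⟩
      filter_upwards [hW, eventually_all.2 hgf] with z h1 h2 hz
      rw [h1 hz]
      exact Finset.sum_congr rfl fun i _ => by rw [h2 i hz]
    · choose k hk using fun i => (hf i).2 hy
      choose g hg hgf using fun i => funLat_iff.1 (hk i)
      refine ⟨∑ i, k i, laplaceLat_iff.2 ⟨ρ, m, fun i t => t ^ (∑ i, k i - k i) * g i t,
        fun i => (analyticAt_id.fun_pow _).fun_mul (hg i), ?_⟩⟩
      filter_upwards [hW, eventually_all.2 hgf] with z h1 h2 hz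
      rw [h1 hz, Finset.smul_sum]
      refine Finset.sum_congr rfl fun i _ => ?_
      have h3 : k i ≤ ∑ i, k i :=
        Finset.single_le_sum (fun _ _ => Nat.zero_le _) (Finset.mem_univ i)
      rw [← h2 i hz, smul_smul, smul_eq_mul, ← mul_assoc, ← pow_add, Nat.sub_add_cancel h3]

/-- The Laplace transform of the minimal extension is free off the eigenvalues at infinity. -/
theorem exists_isGenerator (hC : C.ResonanceFree) (hN : N.IsMinimalExtension) :
    ∃ (ρ : ℕ) (m : Fin ρ → N.globalSections), IsGenerator m := by
  obtain ⟨ε, hε⟩ := exists_global_frame C.E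
  have hε : C.E.IsGlobalFrame ε := hε
  obtain ⟨e, B, h⟩ := C.exists_isIrr
  obtain ⟨⟨U, hU, he⟩, -, -⟩ := id h
  obtain ⟨k₀, hk₀⟩ := exists_ladder hC hN.1.isFull hε h
  -- The filtration is by the order at infinity of the sections that are holomorphic on the affine
  -- line. It does not contain the sections with poles in `P`, but it contains the polynomial ones,
  -- which generate.
  refine exists_free_generators N.dx (dx_sub_injective hC hε) (charPoly C) (N.bdd e 0) k₀
    (finite_bdd hε hU he 0 k₀) hk₀ ?_ fun W hW hD => eq_top_of_stable hC hN hε W (fun q => ?_) hD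
  · intro k l hkl m hm
    refine ⟨hm.1, ?_⟩
    obtain ⟨f, hf⟩ := hm.2
    have := hf.raise (l - k)
    rw [← Nat.cast_add, Nat.add_sub_cancel' hkl] at this
    exact ⟨_, this⟩
  · obtain ⟨k, f, hf⟩ := exists_infForm hU he (polySec_mer (P := P) hε q)
    exact hW k ⟨fun p _ => holGerms_congr (polySec_hol hε q p) (Eventually.of_forall fun z hz => by
      simp [mulSec_apply]), f, hf⟩

end MeroConnection.DSubmodule

end MinLaplace

namespace MinLaplace

open Filter Set

/-! ### Solving the additive Cousin problem for a cocycle -/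

/-- An open cover of the sphere indexed by its points, in which every point of `P ∪ {∞}` lies in
one set only, with a partition of unity on the complex line. -/
structure Cover (P : Finset ℂ) where
  U : CP1 → Set CP1
  isOpen : ∀ x, IsOpen (U x)
  mem : ∀ x, x ∈ U x
  sep : ∀ x, ∀ q ∈ U x, q ∈ poles P → q = x
  J : Finset CP1
  χ : J → ℂ → ℂ
  smooth : ∀ j, ContDiff ℝ 2 (χ j)
  supp : ∀ j, ∀ z ∈ tsupport (χ j), (z : CP1) ∈ U j
  sum : ∀ z, ∑ j, χ j z = 1
  R : ℝ
  ρ : ℝ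
  ρ_pos : 0 < ρ
  far : ∀ j : J, (j : CP1) ≠ OnePoint.infty → ∀ z, R < ‖z‖ → χ j z = 0
  near : ∀ p ∈ P, ∀ j : J, (j : CP1) ≠ (p : CP1) → ∀ z ∈ Metric.ball p ρ, χ j z = 0

/-- From each set all poles other than its index are removed, so a pole belongs to the set that it
indexes and to no other. -/
theorem exists_cover (P : Finset ℂ) (U : CP1 → Set CP1) (hU : ∀ x, IsOpen (U x) ∧ x ∈ U x) :
    ∃ 𝒰 : Cover P, ∀ x, 𝒰.U x ⊆ U x := by
  classical
  have hfin : (poles P).Finite := (P.finite_toSet.image _).insert _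
  let U' : CP1 → Set CP1 := fun x => U x \ (poles P \ {x})
  have hU'o : ∀ x, IsOpen (U' x) := fun x =>
    (hU x).1.sdiff (hfin.subset sdiff_subset).isClosed
  have hU'm : ∀ x, x ∈ U' x := fun x => ⟨(hU x).2, fun h => h.2 rfl⟩
  have hsep : ∀ x, ∀ q ∈ U' x, q ∈ poles P → q = x := fun x q hq hp => by
    by_contra hne
    exact hq.2 ⟨hp, hne⟩
  obtain ⟨J, hJ⟩ := isCompact_univ.elim_finite_subcover U' hU'o
    (fun x _ => mem_iUnion.2 ⟨x, hU'm x⟩)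
  have hinf : ∃ R : ℝ, ∀ z : ℂ, R < ‖z‖ → (z : CP1) ∈ U' OnePoint.infty := by
    have h1 : ∀ᶠ z : ℂ in nf OnePoint.infty, (z : CP1) ∈ U' OnePoint.infty :=
      eventually_nf_of_nhds ((hU'o _).mem_nhds (hU'm _))
    rw [nf_infty, ← comap_norm_atTop, eventually_comap] at h1
    obtain ⟨R, hR⟩ := eventually_atTop.1 h1
    exact ⟨R, fun z hz => hR ‖z‖ hz.le z rfl⟩
  obtain ⟨R, hR⟩ := hinf
  -- The finite members are also cut by a ball, so that near infinity the partition consists of a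
  -- single function.
  let V : J → Set ℂ := fun j => if (j : CP1) = OnePoint.infty then (fun z : ℂ => (z : CP1)) ⁻¹' U' j
    else ((fun z : ℂ => (z : CP1)) ⁻¹' U' j) ∩ Metric.ball 0 (R + 1)
  have hVU : ∀ j, V j ⊆ (fun z : ℂ => (z : CP1)) ⁻¹' U' j := fun j => by
    simp only [V]; split_ifs
    · exact Subset.rfl
    · exact inter_subset_left
  have hinfJ : OnePoint.infty ∈ J := by
    obtain ⟨x, hx, h⟩ := mem_iUnion₂.1 (hJ (mem_univ OnePoint.infty))
    rwa [hsep x _ h infty_mem_poles]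
  obtain ⟨χ, hχ, hχs, hχ1⟩ := exists_partition (V := V) (fun j => by
      have h1 : IsOpen ((fun z : ℂ => (z : CP1)) ⁻¹' U' j) :=
        (hU'o _).preimage OnePoint.continuous_coe
      simp only [V]; split_ifs
      · exact h1
      · exact h1.inter Metric.isOpen_ball) (fun z => by
      by_cases hz : R < ‖z‖
      · refine ⟨⟨_, hinfJ⟩, ?_⟩
        simp only [V, if_true]
        exact hR z hz
      · obtain ⟨x, hx, h⟩ := mem_iUnion₂.1 (hJ (mem_univ (z : CP1)))
        refine ⟨⟨x, hx⟩, ?_⟩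
        simp only [V]; split_ifs
        · exact h
        · exact ⟨h, by rw [mem_ball_zero_iff]; linarith⟩)
  have hnear : ∃ ρ > 0, ∀ p ∈ P, ∀ j : J, (j : CP1) ≠ (p : CP1) →
      ∀ z ∈ Metric.ball p ρ, χ j z = 0 := by
    have h1 : ∀ p ∈ P, ∀ j : J, ∃ ρ > 0, (j : CP1) ≠ (p : CP1) →
        ∀ z ∈ Metric.ball p ρ, χ j z = 0 := by
      intro p hp j
      by_cases hj : (j : CP1) = (p : CP1)
      · exact ⟨1, one_pos, fun h => absurd hj h⟩
      · have h2 : p ∉ tsupport (χ j) := fun h => hj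
          (hsep j _ (hVU j (hχs j h)) (coe_mem_poles.2 hp)).symm
        obtain ⟨ρ, hρ, h3⟩ := Metric.eventually_nhds_iff_ball.1 (notMem_tsupport_iff_eventuallyEq.1 h2)
        exact ⟨ρ, hρ, fun _ => h3⟩
    choose! ρ hρ h using h1
    obtain ⟨δ, hδ, hδρ⟩ : ∃ δ > 0, ∀ p ∈ P, ∀ j : J, δ ≤ ρ p j := by
      by_cases hP : (P ×ˢ (Finset.univ : Finset J)).Nonempty
      · refine ⟨(P ×ˢ (Finset.univ : Finset J)).inf' hP fun a => ρ a.1 a.2, ?_, fun p hp j => ?_⟩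
        · rw [gt_iff_lt, Finset.lt_inf'_iff]
          intro a ha
          exact hρ _ (Finset.mem_product.1 ha).1 _
        · exact Finset.inf'_le (f := fun a : ℂ × J => ρ a.1 a.2)
            (Finset.mem_product.2 ⟨hp, Finset.mem_univ j⟩ : (p, j) ∈ _)
      · refine ⟨1, one_pos, fun p hp j => absurd ⟨(p, j), ?_⟩ hP⟩
        exact Finset.mem_product.2 ⟨hp, Finset.mem_univ j⟩
    exact ⟨δ, hδ, fun p hp j hj z hz => h p hp j hj z (Metric.ball_subset_ball (hδρ p hp j) hz)⟩
  obtain ⟨ρ, hρ, hρ0⟩ := hnear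
  refine ⟨⟨U', hU'o, hU'm, hsep, J, χ, hχ, fun j z hz => hVU j (hχs j hz), hχ1, R + 1, ρ, hρ,
    fun j hj z hz => ?_, hρ0⟩, fun x => sdiff_subset⟩
  by_contra h
  have h1 := hχs j (subset_tsupport _ h)
  simp only [V, if_neg hj] at h1
  have := mem_ball_zero_iff.1 h1.2
  linarith

namespace Cover

variable {P : Finset ℂ} (𝒰 : Cover P)

/-- The set that carries the derivatives of the partition of unity. -/
def K : Set ℂ := Metric.closedBall 0 𝒰.R ∩ {z | ∀ p ∈ P, 𝒰.ρ ≤ dist z p}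

theorem isCompact_K : IsCompact 𝒰.K := by
  refine (isCompact_closedBall _ _).inter_right ?_
  have : {z : ℂ | ∀ p ∈ P, 𝒰.ρ ≤ dist z p} = ⋂ p ∈ P, {z | 𝒰.ρ ≤ dist z p} := by ext; simp
  rw [this]
  exact isClosed_biInter fun p _ => isClosed_le continuous_const (by fun_prop)

theorem notMem_of_mem_K {z : ℂ} (hz : z ∈ 𝒰.K) : z ∉ P := fun h => by
  have := hz.2 z h
  rw [dist_self] at this
  exact absurd 𝒰.ρ_pos (not_lt.2 this)

theorem eq_zero_of_notMem {j : 𝒰.J} {z : ℂ} (hz : (z : CP1) ∉ 𝒰.U j) : 𝒰.χ j z = 0 := by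
  by_contra h
  exact hz (𝒰.supp j z (subset_tsupport _ h))

theorem dbar_eq_zero_of_notMem {j : 𝒰.J} {z : ℂ} (hz : (z : CP1) ∉ 𝒰.U j) :
    dbar (𝒰.χ j) z = 0 := by
  have h1 : z ∉ tsupport (𝒰.χ j) := fun h => hz (𝒰.supp j z h)
  rw [dbar_congr (notMem_tsupport_iff_eventuallyEq.1 h1)]
  exact dbar_eq_zero (differentiableAt_const 0)

theorem sum_dbar (z : ℂ) : ∑ j, dbar (𝒰.χ j) z = 0 := by
  rw [← dbar_sum fun j _ => ((𝒰.smooth j).differentiable (by norm_num)).differentiableAt]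
  have : (fun w => ∑ j, 𝒰.χ j w) = fun _ => (1 : ℂ) := funext 𝒰.sum
  rw [this]
  exact dbar_eq_zero (differentiableAt_const 1)

/-- Where only one function of the partition does not vanish, their derivatives vanish. -/
theorem dbar_eq_zero_of_one {j₀ : CP1} {z : ℂ}
    (h : ∀ j : 𝒰.J, (j : CP1) ≠ j₀ → ∀ᶠ w in 𝓝 z, 𝒰.χ j w = 0) (j : 𝒰.J) :
    dbar (𝒰.χ j) z = 0 := by
  have h0 : ∀ j : 𝒰.J, (j : CP1) ≠ j₀ → dbar (𝒰.χ j) z = 0 := fun j hj => by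
    rw [dbar_congr (h j hj)]
    exact dbar_eq_zero (differentiableAt_const 0)
  by_cases hj : (j : CP1) = j₀
  · have h1 := 𝒰.sum_dbar z
    rwa [Finset.sum_eq_single j (fun b _ hb => h0 b fun hb' => hb (Subtype.ext (hb'.trans hj.symm)))
      (fun h => absurd (Finset.mem_univ j) h)] at h1
  · exact h0 j hj

theorem dbar_eq_zero_of_notMem_K {z : ℂ} (hz : z ∉ 𝒰.K) (j : 𝒰.J) : dbar (𝒰.χ j) z = 0 := by
  by_cases h1 : 𝒰.R < ‖z‖
  · exact 𝒰.dbar_eq_zero_of_one (fun j hj => by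
      filter_upwards [(isOpen_lt continuous_const continuous_norm).mem_nhds h1] with w hw
        using 𝒰.far j hj w hw) j
  · have h2 : z ∈ Metric.closedBall (0 : ℂ) 𝒰.R := mem_closedBall_zero_iff.2 (not_lt.1 h1)
    have h3 : ¬ ∀ p ∈ P, 𝒰.ρ ≤ dist z p := fun h => hz ⟨h2, h⟩
    push Not at h3
    obtain ⟨p, hp, hzp⟩ := h3
    exact 𝒰.dbar_eq_zero_of_one (j₀ := (p : CP1)) (fun j hj => by
      filter_upwards [Metric.isOpen_ball.mem_nhds hzp] with w hw using 𝒰.near p hp j hj w hw) j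

/-- A cocycle of holomorphic functions off `P`. -/
structure IsCocycle (β : CP1 → CP1 → ℂ → ℂ) : Prop where
  analyticAt : ∀ x y (z : ℂ), (z : CP1) ∈ 𝒰.U x → (z : CP1) ∈ 𝒰.U y → z ∉ P →
    AnalyticAt ℂ (β x y) z
  eq : ∀ x y w (z : ℂ), (z : CP1) ∈ 𝒰.U x → (z : CP1) ∈ 𝒰.U y → (z : CP1) ∈ 𝒰.U w → z ∉ P →
    β x y z + β y w z = β x w z
  zero : ∀ x y, ∀ z ∈ P, β x y z = 0

/-- The obstruction for the smooth splitting to be holomorphic. -/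
def ω (β : CP1 → CP1 → ℂ → ℂ) (z : ℂ) : ℂ := ∑ j, dbar (𝒰.χ j) z * β j z z

/-- The smooth splitting. -/
def h (β : CP1 → CP1 → ℂ → ℂ) (x : CP1) (z : ℂ) : ℂ := ∑ j, 𝒰.χ j z * β j x z

/-- The holomorphic splitting. -/
def g (β : CP1 → CP1 → ℂ → ℂ) (x : CP1) (z : ℂ) : ℂ := 𝒰.h β x z - cauchyTr (𝒰.ω β) z

variable {𝒰} {β : CP1 → CP1 → ℂ → ℂ}

theorem IsCocycle.self (hβ : 𝒰.IsCocycle β) {x : CP1} {z : ℂ} (hz : (z : CP1) ∈ 𝒰.U x) : β x x z = 0 := by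
  by_cases hP : z ∈ P
  · exact hβ.zero x x z hP
  · simpa using hβ.eq x x x z hz hz hz hP

variable (𝒰 β) in
theorem ω_eq_zero {z : ℂ} (hz : z ∉ 𝒰.K) : 𝒰.ω β z = 0 := by
  simp only [ω, 𝒰.dbar_eq_zero_of_notMem_K hz, zero_mul, Finset.sum_const_zero]

/-- The definition of `ω` uses the set indexed by `z` itself. Since the derivatives of the partition
add up to zero, the cocycle relation allows any fixed `x` instead; this gives smoothness of `ω` and
matches it with the derivative of the smooth splitting. -/
theorem IsCocycle.ω_eq (hβ : 𝒰.IsCocycle β) {x : CP1} {z : ℂ} (hz : (z : CP1) ∈ 𝒰.U x) :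
    𝒰.ω β z = ∑ j, dbar (𝒰.χ j) z * β j x z := by
  by_cases hP : z ∈ P
  · simp only [ω, hβ.zero _ _ z hP]
  · have h1 : ∀ j : 𝒰.J, dbar (𝒰.χ j) z * β j z z =
        dbar (𝒰.χ j) z * β j x z + dbar (𝒰.χ j) z * β x z z := by
      intro j
      by_cases hj : (z : CP1) ∈ 𝒰.U j
      · rw [← hβ.eq j x z z hj hz (𝒰.mem z) hP, mul_add]
      · simp only [𝒰.dbar_eq_zero_of_notMem hj, zero_mul, add_zero]
    simp only [ω, h1, Finset.sum_add_distrib, ← Finset.sum_mul, 𝒰.sum_dbar, zero_mul, add_zero]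

/-- The terms of the splitting are smooth. -/
theorem IsCocycle.contDiffAt (hβ : 𝒰.IsCocycle β) {n : WithTop ℕ∞} {φ : ℂ → ℂ} (hφ : ContDiff ℝ n φ) {j : 𝒰.J} {x : CP1}
    {z : ℂ} (hz : (z : CP1) ∈ 𝒰.U x) (hP : z ∉ P) (hs : tsupport φ ⊆ tsupport (𝒰.χ j)) :
    ContDiffAt ℝ n (fun w => φ w * β j x w) z := by
  by_cases hj : z ∈ tsupport φ
  · exact hφ.contDiffAt.mul ((hβ.analyticAt j x z (𝒰.supp j z (hs hj)) hz hP).contDiffAt.restrict_scalars ℝ)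
  · refine (contDiffAt_const (c := (0 : ℂ))).congr_of_eventuallyEq ?_
    filter_upwards [notMem_tsupport_iff_eventuallyEq.1 hj] with w hw
    rw [hw]; simp

theorem eventually_mem_U {x : CP1} {z : ℂ} (hz : (z : CP1) ∈ 𝒰.U x) :
    ∀ᶠ w : ℂ in 𝓝 z, (w : CP1) ∈ 𝒰.U x := by
  rw [← nf_coe]; exact eventually_nf_of_nhds ((𝒰.isOpen x).mem_nhds hz)

theorem IsCocycle.contDiff_ω (hβ : 𝒰.IsCocycle β) : ContDiff ℝ 1 (𝒰.ω β) := by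
  refine contDiff_iff_contDiffAt.2 fun z => ?_
  by_cases hP : z ∈ P
  · refine (contDiffAt_const (c := (0 : ℂ))).congr_of_eventuallyEq ?_
    have h1 : z ∉ 𝒰.K := fun h => 𝒰.notMem_of_mem_K h hP
    filter_upwards [𝒰.isCompact_K.isClosed.isOpen_compl.mem_nhds h1] with w hw
    exact 𝒰.ω_eq_zero β hw
  · have h1 : ContDiffAt ℝ 1 (fun w => ∑ j, dbar (𝒰.χ j) w * β j z w) z :=
      ContDiffAt.sum fun j _ => hβ.contDiffAt (contDiff_dbar (𝒰.smooth j)) (𝒰.mem z) hP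
        fun w hw => Patch.tsupport_dbar hw
    refine h1.congr_of_eventuallyEq ?_
    filter_upwards [eventually_mem_U (𝒰.mem z)] with w hw using hβ.ω_eq hw

variable (𝒰 β) in
theorem hasCompactSupport_ω : HasCompactSupport (𝒰.ω β) :=
  HasCompactSupport.intro 𝒰.isCompact_K fun _ hz => 𝒰.ω_eq_zero β hz

theorem IsCocycle.sub_g (hβ : 𝒰.IsCocycle β) {x y : CP1} {z : ℂ} (hx : (z : CP1) ∈ 𝒰.U x) (hy : (z : CP1) ∈ 𝒰.U y)
    (hP : z ∉ P) : 𝒰.g β y z - 𝒰.g β x z = β x y z := by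
  simp only [g, h, sub_sub_sub_cancel_right, ← Finset.sum_sub_distrib]
  have h1 : ∀ j : 𝒰.J, 𝒰.χ j z * β j y z - 𝒰.χ j z * β j x z = 𝒰.χ j z * β x y z := by
    intro j
    by_cases hj : (z : CP1) ∈ 𝒰.U j
    · rw [← hβ.eq j x y z hj hx hy hP]; ring
    · rw [𝒰.eq_zero_of_notMem hj]; ring
  simp only [h1, ← Finset.sum_mul, 𝒰.sum, one_mul]

theorem IsCocycle.analyticAt_cauchy (hβ : 𝒰.IsCocycle β) {z : ℂ} (hz : z ∉ 𝒰.K) :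
    AnalyticAt ℂ (cauchyTr (𝒰.ω β)) z := by
  rw [funext fun w => cauchyTr_eq_setIntegral (K := 𝒰.K) (fun w hw => 𝒰.ω_eq_zero β hw) w]
  exact analyticAt_cauchyInt 𝒰.isCompact_K hβ.contDiff_ω.continuous.continuousOn hz

/-- The splitting is holomorphic off `P`. -/
theorem IsCocycle.analyticAt_g (hβ : 𝒰.IsCocycle β) {x : CP1} {z : ℂ} (hx : (z : CP1) ∈ 𝒰.U x) (hP : z ∉ P) :
    AnalyticAt ℂ (𝒰.g β x) z := by
  refine analyticAt_of_dbar_eq_zero ?_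
  have hPo : ∀ᶠ w in 𝓝 z, w ∉ P := P.finite_toSet.isClosed.isOpen_compl.mem_nhds hP
  filter_upwards [eventually_mem_U hx, hPo] with w hw hwP
  have h1 : ∀ j : 𝒰.J, DifferentiableAt ℝ (fun w => 𝒰.χ j w * β j x w) w := fun j =>
    (hβ.contDiffAt (𝒰.smooth j) hw hwP Subset.rfl).differentiableAt (by norm_num)
  have h2 := hasFDerivAt_cauchyTr hβ.contDiff_ω (𝒰.hasCompactSupport_ω β) w
  have h3 : DifferentiableAt ℝ (𝒰.h β x) w := DifferentiableAt.fun_sum fun j _ => h1 j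
  refine ⟨h3.sub h2.1, ?_⟩
  change dbar (fun z => 𝒰.h β x z - cauchyTr (𝒰.ω β) z) w = 0
  rw [dbar_sub h3 h2.1, h2.2, hβ.ω_eq hw]
  change dbar (fun z => ∑ j, 𝒰.χ j z * β j x z) w - _ = 0
  rw [dbar_sum fun j _ => h1 j, sub_eq_zero]
  refine Finset.sum_congr rfl fun j _ => ?_
  by_cases hj : w ∈ tsupport (𝒰.χ j)
  · have h4 := hβ.analyticAt j x w (𝒰.supp j w hj) hw hwP
    rw [dbar_mul (((𝒰.smooth j).differentiable (by norm_num)).differentiableAt)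
      (h4.differentiableAt.restrictScalars ℝ), dbar_eq_zero h4.differentiableAt]
    ring
  · have h5 := notMem_tsupport_iff_eventuallyEq.1 hj
    rw [dbar_congr (g := fun _ => 0) (by filter_upwards [h5] with v hv; rw [hv]; simp),
      dbar_congr h5]
    simp only [Pi.zero_def]
    rw [dbar_eq_zero (differentiableAt_const 0), zero_mul]

/-- The only surviving term contains `β x x = 0`. Near the poles the splitting is therefore minus
the Cauchy transform, which is holomorphic there. -/
theorem IsCocycle.h_eq_zero (hβ : 𝒰.IsCocycle β) {x : CP1} {z : ℂ} (hx : (z : CP1) ∈ 𝒰.U x)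
    (h : ∀ j : 𝒰.J, (j : CP1) ≠ x → 𝒰.χ j z = 0) : 𝒰.h β x z = 0 := by
  refine Finset.sum_eq_zero fun j _ => ?_
  by_cases hj : (j : CP1) = x
  · rw [hj, hβ.self hx, mul_zero]
  · rw [h j hj, zero_mul]

/-- The splitting is holomorphic at the points of `P`. -/
theorem IsCocycle.analyticAt_g_of_mem (hβ : 𝒰.IsCocycle β) {p : ℂ} (hp : p ∈ P) :
    AnalyticAt ℂ (𝒰.g β (p : CP1)) p := by
  have h1 := (hβ.analyticAt_cauchy fun h => 𝒰.notMem_of_mem_K h hp).fun_neg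
  refine h1.congr ?_
  filter_upwards [eventually_mem_U (𝒰.mem (p : CP1)), Metric.ball_mem_nhds p 𝒰.ρ_pos] with z hz hzp
  rw [g, hβ.h_eq_zero hz fun j hj => 𝒰.near p hp j hj z hzp, zero_sub]

theorem IsCocycle.g_infty (hβ : 𝒰.IsCocycle β) : ∀ᶠ z in nf OnePoint.infty, 𝒰.g β OnePoint.infty z =
    -∫ w in 𝒰.K, 𝒰.ω β w * (2 * Real.pi * (z - w))⁻¹ := by
  have h1 : ∀ᶠ z in nf OnePoint.infty, 𝒰.R < ‖z‖ := by
    rw [nf_infty]; exact tendsto_norm_cobounded_atTop.eventually_gt_atTop _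
  filter_upwards [eventually_nf_of_nhds ((𝒰.isOpen _).mem_nhds (𝒰.mem OnePoint.infty)), h1]
    with z h2 h3
  rw [g, hβ.h_eq_zero h2 fun j hj => 𝒰.far j hj z h3, zero_sub,
    cauchyTr_eq_setIntegral (K := 𝒰.K) fun w hw => 𝒰.ω_eq_zero β hw]

end Cover

end MinLaplace

namespace MinLaplace

open Filter Set HolBundle

universe u

namespace MeroConnection

variable {r : ℕ} {P : Finset ℂ} {C : MeroConnection.{u} r P} {ε : Fin r → ∀ y, C.E.Fib y}

/-! ### The coefficients of sections in a frame of the bundle over the affine line -/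

/-- The coefficient of a section in the frame `ε`, as a function on the affine line. -/
def crd (ε : Fin r → ∀ y, C.E.Fib y) (i : Fin r) (s : C.E.Sec P) (w : ℂ) : ℂ :=
  open Classical in
  if h : w ∉ P then coef (fun i => res P (ε i) ⟨w, h⟩) (s ⟨w, h⟩) i else 0

theorem crd_of_notMem (i : Fin r) (s : C.E.Sec P) {w : ℂ} (h : w ∉ P) :
    crd ε i s w = coef (fun i => res P (ε i) ⟨w, h⟩) (s ⟨w, h⟩) i := dif_pos h

theorem crd_of_mem (i : Fin r) (s : C.E.Sec P) {w : ℂ} (h : w ∈ P) : crd ε i s w = 0 :=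
  dif_neg (not_not.2 h)

theorem crd_add (i : Fin r) {s t v : C.E.Sec P} {z : Punct P} (h : s z + t z = v z) :
    crd ε i s z + crd ε i t z = crd ε i v z := by
  simp only [crd_of_notMem i _ z.2, ← Pi.add_apply, ← map_add]
  rw [← h]
  rfl

theorem sum_crd (hε : C.E.IsGlobalFrame ε) (s : C.E.Sec P) (z : Punct P) :
    ∑ i, crd ε i s z • res P (ε i) z = s z := by
  simp only [crd_of_notMem _ s z.2]
  exact (hε.isB z).sum_coef (s z)

theorem crd_eq (hε : C.E.IsGlobalFrame ε) {s : C.E.Sec P} {z : Punct P} {a : Fin r → ℂ}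
    (h : s z = ∑ i, a i • res P (ε i) z) (i : Fin r) : crd ε i s z = a i := by
  rw [crd_of_notMem i s z.2]
  exact congrFun ((hε.isB z).eq_coef h) i

theorem crd_sum (hε : C.E.IsGlobalFrame ε) {n : ℕ} {s : C.E.Sec P} {m : Fin n → C.E.Sec P}
    {z : Punct P} {a : Fin n → ℂ} (h : s z = ∑ k, a k • m k z) (i : Fin r) :
    crd ε i s z = ∑ k, a k * crd ε i (m k) z := by
  refine crd_eq hε (a := fun i => ∑ k, a k * crd ε i (m k) z) ?_ i
  simp only [Finset.sum_smul, ← smul_smul]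
  rw [Finset.sum_comm, h]
  simp only [← Finset.smul_sum, sum_crd hε]

theorem analyticAt_crd (hε : C.E.IsGlobalFrame ε) {s : C.E.Sec P} {z : ℂ} (hz : z ∉ P)
    (hs : s ∈ C.E.holGerms P (z : CP1)) (i : Fin r) : AnalyticAt ℂ (crd ε i s) z := by
  obtain ⟨f, hf, h⟩ := mem_holGerms_coe hε.1 (OnePoint.coe_ne_infty z) hs
  rw [germEq_iff, nf_coe] at h
  refine (hf i).congr ?_
  filter_upwards [h, P.finite_toSet.isClosed.isOpen_compl.mem_nhds hz] with w hw hwP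
  exact (crd_eq hε (z := ⟨w, hwP⟩) (a := fun i => f i w) (hw hwP) i).symm

theorem frame_hol (hε : C.E.IsGlobalFrame ε) (x : ℂ) (i : Fin r) :
    res P (ε i) ∈ C.E.holGerms P (x : CP1) :=
  res_mem ((hε.1.2 _ (OnePoint.coe_ne_infty x)).2.2 i)

theorem frame_mer (hε : C.E.IsGlobalFrame ε) (i : Fin r) :
    res P (ε i) ∈ C.E.merGerms P OnePoint.infty := by
  classical
  have h := polySec_mer (P := P) hε (Pi.single i 1)
  have h1 : polySec P ε (Pi.single i 1) = res P (ε i) := by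
    funext z
    rw [polySec_apply, Finset.sum_eq_single i]
    · simp
    · intro j _ hj; simp [Pi.single_eq_of_ne hj]
    · simp
  rwa [h1] at h

variable (P) in
theorem exists_frame_pow (hε : C.E.IsGlobalFrame ε) : ∃ k : ℕ, ∀ i,
    mulSec (fun z => unif OnePoint.infty z ^ k) (res P (ε i)) ∈ C.E.holGerms P OnePoint.infty := by
  choose k hk using fun i => (mem_merGerms_iff infty_mem_poles).1 (frame_mer (P := P) hε i)
  exact ⟨∑ i, k i, fun i => unif_pow_mem (Finset.single_le_sum (fun _ _ => Nat.zero_le _)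
    (Finset.mem_univ i)) (hk i)⟩

/-! ### First-order operators with constant coefficients -/

variable (C) in
/-- The operator `u ∂ / ∂x - v`. -/
def op (u v : ℂ) (s : C.E.Sec P) : C.E.Sec P := u • C.D s - v • s

variable (C) in
theorem twist_eq_op (ξ : ℂ) : C.twist ξ = C.op 1 ξ := by
  funext s; simp [twist, op]

variable (C) in
theorem twistInf_eq_op (ζ : ℂ) : C.twistInf ζ = C.op ζ 1 := by
  funext s; simp [twistInf, op]

theorem op_apply (u v : ℂ) (s : C.E.Sec P) (z : Punct P) :
    C.op u v s z = u • C.D s z - v • s z := rfl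

theorem op_local {u v : ℂ} {z : Punct P} {s t : C.E.Sec P} (h : GermEq z.pt s t) :
    C.op u v s z = C.op u v t z := by
  obtain ⟨W, hW, h'⟩ := id h
  rw [op_apply, op_apply, C.D_local z s t h, h' z (mem_of_mem_nhds hW)]

theorem op_sub {u v : ℂ} {z : Punct P} {s t : C.E.Sec P} (hs : s ∈ C.E.holGerms P z.pt)
    (ht : t ∈ C.E.holGerms P z.pt) : C.op u v (s - t) z = C.op u v s z - C.op u v t z := by
  have h1 := germEq_iff.1 (C.D_sub_germ (merGerms_of_hol hs) (merGerms_of_hol ht))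
  rw [Punct.pt, nf_coe] at h1
  rw [op_apply, op_apply, op_apply, h1.self_of_nhds z.2]
  simp only [Pi.sub_apply, smul_sub]
  abel

theorem IsCocycle.mono {K₀ K₁ : CP1 → Set (C.E.Sec P)} {d : C.E.Sec P → C.E.Sec P}
    {U U' : CP1 → Set CP1} {c : C.Cochain} (h : C.IsCocycle K₀ K₁ d U c)
    (hU' : ∀ x, IsOpen (U' x) ∧ x ∈ U' x) (hs : ∀ x, U' x ⊆ U x) : C.IsCocycle K₀ K₁ d U' c :=
  ⟨hU', fun x q hq => h.2.1 x q (hs x hq),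
    fun x y q hq => h.2.2.1 x y q ⟨hs x hq.1, hs y hq.2⟩,
    fun x y w z hz => h.2.2.2.1 x y w z ⟨⟨hs x hz.1.1, hs y hz.1.2⟩, hs w hz.2⟩,
    fun x y z hz => h.2.2.2.2 x y z ⟨hs x hz.1, hs y hz.2⟩⟩

/-! ### Splitting a hypercocycle -/

/-- The sections of which the part of degree zero of a cocycle is the coboundary. -/
def gsec (𝒰 : Cover P) (ε : Fin r → ∀ y, C.E.Fib y) (c : C.Cochain) (x : CP1) : C.E.Sec P :=
  fun z => ∑ i, 𝒰.g (fun x y => crd ε i (c.2 x y)) x z • res P (ε i) z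

/-- The global section that is cohomologous to a cocycle. -/
def msec (𝒰 : Cover P) (ε : Fin r → ∀ y, C.E.Fib y) (d : C.E.Sec P → C.E.Sec P)
    (c : C.Cochain) : C.E.Sec P := fun z => c.1 z.pt z - d (gsec 𝒰 ε c z.pt) z

namespace DSubmodule

variable {N : C.DSubmodule}

theorem op_mem {u v : ℂ} {x : CP1} {s : C.E.Sec P} (hs : s ∈ N.stalk x) :
    C.op u v s ∈ N.stalk x :=
  (N.stalk x).sub_mem ((N.stalk x).smul_mem u (N.D_mem x s hs)) ((N.stalk x).smul_mem v hs)

variable {𝒰 : Cover P} {d : C.E.Sec P → C.E.Sec P} {c : C.Cochain}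

theorem isCocycle_crd (hε : C.E.IsGlobalFrame ε)
    (hc : C.IsCocycle N.germs N.germs d 𝒰.U c) (i : Fin r) :
    𝒰.IsCocycle fun x y => crd ε i (c.2 x y) where
  analyticAt x y z hx hy hz := analyticAt_crd hε hz
    (N.hol_of_mem (z := ⟨z, hz⟩) (hc.2.2.1 x y _ ⟨hx, hy⟩)) i
  eq x y w z hx hy hw hz := crd_add i (z := ⟨z, hz⟩) (hc.2.2.2.1 x y w ⟨z, hz⟩ ⟨⟨hx, hy⟩, hw⟩)
  zero _ _ _ hz := crd_of_mem i _ hz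

theorem gsec_sub (hε : C.E.IsGlobalFrame ε)
    (hc : C.IsCocycle N.germs N.germs d 𝒰.U c) {x y : CP1} {z : Punct P}
    (hx : z.pt ∈ 𝒰.U x) (hy : z.pt ∈ 𝒰.U y) :
    gsec 𝒰 ε c y z - gsec 𝒰 ε c x z = c.2 x y z := by
  simp only [gsec, ← Finset.sum_sub_distrib, ← sub_smul]
  rw [← sum_crd hε (c.2 x y) z]
  exact Finset.sum_congr rfl fun i _ => by
    rw [(isCocycle_crd hε hc i).sub_g hx hy z.2]

theorem gsec_hol (hε : C.E.IsGlobalFrame ε) (hc : C.IsCocycle N.germs N.germs d 𝒰.U c)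
    {x : CP1} {z : ℂ} (hx : (z : CP1) ∈ 𝒰.U x) : gsec 𝒰 ε c x ∈ C.E.holGerms P (z : CP1) := by
  refine holGerms_sum_coe (fun i => frame_hol hε z i) fun i => ?_
  have hβ := isCocycle_crd hε hc i
  by_cases hz : z ∈ P
  · have h := 𝒰.sep x z hx (coe_mem_poles.2 hz)
    subst h
    exact hβ.analyticAt_g_of_mem hz
  · exact hβ.analyticAt_g hx hz

theorem gsec_infty (hε : C.E.IsGlobalFrame ε) (hc : C.IsCocycle N.germs N.germs d 𝒰.U c) {k : ℕ}
    (hk : ∀ i, mulSec (fun z => unif OnePoint.infty z ^ k) (res P (ε i)) ∈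
      C.E.holGerms P OnePoint.infty) :
    mulSec (fun z => unif OnePoint.infty z ^ k) (gsec 𝒰 ε c OnePoint.infty) ∈
      C.E.holGerms P OnePoint.infty := by
  choose G hG hG0 h using fun i => cauchyInt_infty 𝒰.isCompact_K
    (isCocycle_crd hε hc i).contDiff_ω.continuous.continuousOn
  refine holGerms_congr (holGerms_sum hk fun i => (hG i).neg) ?_
  have h1 := eventually_all.2 fun i => (isCocycle_crd hε hc i).g_infty
  filter_upwards [h1, eventually_infty_ne_zero] with z h1 h0 hz
  simp only [mulSec_apply, gsec, h1, h _ z h0, Finset.smul_sum, unif_infty, Pi.neg_apply]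
  exact Finset.sum_congr rfl fun i _ => smul_comm _ _ _

/-- The splitting sections are holomorphic on the whole affine line, also in `P`, and at infinity
they have at most the pole of the frame `ε`. A full submodule contains such germs. -/
theorem gsec_mem (hC : C.ResonanceFree) (hN : N.IsFull) (hε : C.E.IsGlobalFrame ε)
    (hc : C.IsCocycle N.germs N.germs d 𝒰.U c) {x q : CP1} (hq : q ∈ 𝒰.U x) :
    gsec 𝒰 ε c x ∈ N.stalk q := by
  induction q using OnePoint.rec with
  | infty =>
    have h := 𝒰.sep x _ hq infty_mem_poles
    subst h
    obtain ⟨k, hk⟩ := exists_frame_pow P hε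
    exact hN.mer hC ((mem_merGerms_iff infty_mem_poles).2 ⟨k, gsec_infty hε hc hk⟩)
  | coe z => exact hN.hol hC (gsec_hol hε hc hq)

variable {u v : ℂ}

/-- By the cocycle condition `c.1 y - c.1 x` is the operator applied to `c.2 x y`, which is the
difference of the splitting sections; so the right-hand side does not depend on `x`. -/
theorem msec_eq (hε : C.E.IsGlobalFrame ε)
    (hc : C.IsCocycle N.germs N.germs (C.op u v) 𝒰.U c) {x : CP1} {z : Punct P}
    (hx : z.pt ∈ 𝒰.U x) : msec 𝒰 ε (C.op u v) c z = c.1 x z - C.op u v (gsec 𝒰 ε c x) z := by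
  have hz := 𝒰.mem z.pt
  have h1 := hc.2.2.2.2 x z.pt z ⟨hx, hz⟩
  have h2 : GermEq z.pt (c.2 x z.pt) (gsec 𝒰 ε c z.pt - gsec 𝒰 ε c x) :=
    ⟨𝒰.U x ∩ 𝒰.U z.pt, ((𝒰.isOpen x).inter (𝒰.isOpen _)).mem_nhds ⟨hx, hz⟩, fun w hw =>
      (gsec_sub hε hc hw.1 hw.2).symm⟩
  rw [op_local h2, op_sub (gsec_hol hε hc hz) (gsec_hol hε hc hx)] at h1
  rw [msec, sub_eq_sub_iff_add_eq_add]
  rw [sub_eq_sub_iff_add_eq_add] at h1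
  rw [add_comm _ (C.op u v (gsec 𝒰 ε c z.pt) z), h1]

theorem msec_germ (hε : C.E.IsGlobalFrame ε)
    (hc : C.IsCocycle N.germs N.germs (C.op u v) 𝒰.U c) (x : CP1) :
    GermEq x (c.1 x - C.op u v (gsec 𝒰 ε c x)) (msec 𝒰 ε (C.op u v) c) :=
  ⟨𝒰.U x, (𝒰.isOpen x).mem_nhds (𝒰.mem x), fun _ hz => (msec_eq hε hc hz).symm⟩

theorem msec_mem (hC : C.ResonanceFree) (hN : N.IsFull) (hε : C.E.IsGlobalFrame ε)
    (hc : C.IsCocycle N.germs N.germs (C.op u v) 𝒰.U c) :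
    msec 𝒰 ε (C.op u v) c ∈ N.globalSections := by
  refine (Submodule.mem_iInf _).2 fun x => ?_
  exact N.congr x _ _ ((N.stalk x).sub_mem (hc.2.1 x x (𝒰.mem x))
    (op_mem (gsec_mem hC hN hε hc (𝒰.mem x)))) (msec_germ hε hc x)

theorem isCoboundary_sub_msec (hC : C.ResonanceFree) (hN : N.IsFull) (hε : C.E.IsGlobalFrame ε)
    (hc : C.IsCocycle N.germs N.germs (C.op u v) 𝒰.U c) :
    C.IsCoboundary N.germs (C.op u v) 𝒰.U (c - (fun _ => msec 𝒰 ε (C.op u v) c, 0)) := by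
  refine ⟨hc.1, gsec 𝒰 ε c, fun x q hq => gsec_mem hC hN hε hc hq, fun x z hz => ?_,
    fun x y z hz => ?_⟩
  · change c.1 x z - msec 𝒰 ε (C.op u v) c z = _
    rw [msec_eq hε hc hz, sub_sub_cancel]
  · change c.2 x y z - 0 = _
    rw [sub_zero, gsec_sub hε hc hz.1 hz.2]

end DSubmodule

end MeroConnection

end MinLaplace

namespace MinLaplace

open Filter Set HolBundle

universe u

/-! ### Holomorphic dependence on a parameter -/

namespace Cover

variable {P : Finset ℂ} {𝒰 : Cover P} {β : ℂ → CP1 → CP1 → ℂ → ℂ} {V : Set ℂ}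

/-- A family of cocycles that depends holomorphically on the parameter `η ∈ V`. -/
structure IsFamily (𝒰 : Cover P) (V : Set ℂ) (β : ℂ → CP1 → CP1 → ℂ → ℂ) : Prop where
  isOpen : IsOpen V
  isCocycle : ∀ η ∈ V, 𝒰.IsCocycle (β η)
  analyticAt : ∀ x y (z : ℂ), (z : CP1) ∈ 𝒰.U x → (z : CP1) ∈ 𝒰.U y → z ∉ P → ∀ η ∈ V,
    AnalyticAt ℂ (fun q : ℂ × ℂ => β q.2 x y q.1) (z, η)

theorem IsFamily.continuousOn (h : 𝒰.IsFamily V β) :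
    ContinuousOn (fun q : ℂ × ℂ => 𝒰.ω (β q.2) q.1) (𝒰.K ×ˢ V) := by
  rintro ⟨w, η⟩ ⟨hw, hη⟩
  refine ContinuousAt.continuousWithinAt ?_
  have h1 : ContinuousAt (fun q : ℂ × ℂ => ∑ j, dbar (𝒰.χ j) q.1 * β q.2 j w q.1) (w, η) := by
    refine tendsto_finsetSum _ fun j _ => ?_
    by_cases hj : w ∈ tsupport (𝒰.χ j)
    · have h2 : ContinuousAt (fun q : ℂ × ℂ => dbar (𝒰.χ j) q.1) (w, η) :=
        ((continuous_dbar ((𝒰.smooth j).of_le (by norm_num))).comp continuous_fst).continuousAt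
      exact h2.mul (h.analyticAt j w w (𝒰.supp j w hj) (𝒰.mem w) (𝒰.notMem_of_mem_K hw) η
        hη).continuousAt
    · have h2 : ∀ᶠ w' in 𝓝 w, dbar (𝒰.χ j) w' = 0 := by
        filter_upwards [(isClosed_tsupport _).isOpen_compl.mem_nhds hj] with w' hw'
        rw [dbar_congr (notMem_tsupport_iff_eventuallyEq.1 hw')]
        exact dbar_eq_zero (differentiableAt_const 0)
      refine (continuousAt_const (y := (0 : ℂ))).congr ?_
      filter_upwards [(continuousAt_fst (p := (w, η))).eventually h2] with q hq
      rw [hq, zero_mul]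
  refine h1.congr ?_
  filter_upwards [(continuousAt_fst (p := (w, η))).eventually (eventually_mem_U (𝒰.mem w)),
    (continuousAt_snd (p := (w, η))).eventually (h.isOpen.mem_nhds hη)] with q h2 h3
  exact ((h.isCocycle _ h3).ω_eq h2).symm

theorem IsFamily.differentiableOn (h : 𝒰.IsFamily V β) {w : ℂ} (hw : w ∈ 𝒰.K) :
    DifferentiableOn ℂ (fun η => 𝒰.ω (β η) w) V := by
  intro η hη
  refine DifferentiableAt.differentiableWithinAt ?_
  refine DifferentiableAt.fun_sum fun j _ => ?_
  by_cases hj : (w : CP1) ∈ 𝒰.U j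
  · have h1 := h.analyticAt j w w hj (𝒰.mem w) (𝒰.notMem_of_mem_K hw) η hη
    exact (AnalyticAt.fun_comp (g := fun q : ℂ × ℂ => β q.2 j w q.1) (f := fun η => (w, η))
      h1 (by fun_prop)).differentiableAt.const_mul _
  · simp only [𝒰.dbar_eq_zero_of_notMem hj, zero_mul]
    exact differentiableAt_const 0

theorem IsFamily.analyticAt_integral (h : 𝒰.IsFamily V β) {k : ℂ → ℂ} (hk : ContinuousOn k 𝒰.K)
    {η : ℂ} (hη : η ∈ V) : AnalyticAt ℂ (fun η => ∫ w in 𝒰.K, 𝒰.ω (β η) w * k w) η := by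
  refine analyticAt_setIntegral_param (g := fun w η => 𝒰.ω (β η) w * k w) 𝒰.isCompact_K h.isOpen
    ?_ (fun w hw => (h.differentiableOn hw).mul_const _) hη
  exact h.continuousOn.mul (hk.comp continuousOn_fst fun q hq => hq.1)

theorem notMem_K_of_lt {z : ℂ} (hz : 𝒰.R < ‖z‖) : z ∉ 𝒰.K := fun h =>
  absurd (mem_closedBall_zero_iff.1 h.1) (not_le.2 hz)

theorem g_eq_of_lt {β : CP1 → CP1 → ℂ → ℂ} (hβ : 𝒰.IsCocycle β) {z : ℂ} (hz : 𝒰.R < ‖z‖)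
    (hU : (z : CP1) ∈ 𝒰.U OnePoint.infty) : 𝒰.g β OnePoint.infty z =
      -∫ w in 𝒰.K, 𝒰.ω β w * (2 * Real.pi * (z - w))⁻¹ := by
  rw [g, hβ.h_eq_zero hU fun j hj => 𝒰.far j hj z hz, zero_sub,
    cauchyTr_eq_setIntegral (K := 𝒰.K) fun w hw => 𝒰.ω_eq_zero β hw]

theorem deriv_g_of_lt {β : CP1 → CP1 → ℂ → ℂ} (hβ : 𝒰.IsCocycle β) {z : ℂ} (hz : 𝒰.R < ‖z‖)
    (hU : (z : CP1) ∈ 𝒰.U OnePoint.infty) : deriv (𝒰.g β OnePoint.infty) z =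
      -∫ w in 𝒰.K, 𝒰.ω β w * deriv (fun z => (2 * Real.pi * (z - w) : ℂ)⁻¹) z := by
  have hR : IsOpen {z : ℂ | 𝒰.R < ‖z‖} := isOpen_lt continuous_const continuous_norm
  have hne : ∀ w ∈ 𝒰.K, ∀ z ∈ {z : ℂ | 𝒰.R < ‖z‖}, (2 * Real.pi * (z - w) : ℂ) ≠ 0 :=
    fun w hw z hz => mul_ne_zero (by simp [Real.pi_ne_zero])
      (sub_ne_zero.2 fun h => notMem_K_of_lt hz (h ▸ hw))
  have h1 := hasDerivAt_setIntegral_param (K := 𝒰.K)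
    (g := fun w z => 𝒰.ω β w * (2 * Real.pi * (z - w) : ℂ)⁻¹) 𝒰.isCompact_K hR
    (by
      refine ContinuousOn.mul (hβ.contDiff_ω.continuous.comp continuous_fst).continuousOn ?_
      exact ContinuousOn.inv₀ (by fun_prop) fun q hq => hne _ hq.1 _ hq.2)
    (fun w hw z hz => by
      have h3 : DifferentiableAt ℂ (fun z => (2 * Real.pi * (z - w) : ℂ)) z := by fun_prop
      exact ((h3.fun_inv (hne w hw z hz)).const_mul _).differentiableWithinAt) hz
  have h2 : (𝒰.g β OnePoint.infty) =ᶠ[𝓝 z] fun z =>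
      -∫ w in 𝒰.K, 𝒰.ω β w * (2 * Real.pi * (z - w))⁻¹ := by
    filter_upwards [hR.mem_nhds hz, eventually_mem_U hU] with z' h3 h4 using g_eq_of_lt hβ h3 h4
  rw [h2.deriv_eq, h1.fun_neg.deriv]
  simp only [deriv_const_mul_field]

/-- Points near infinity suffice, as global sections are determined there. At such a point the
splitting and its derivative are integrals of `ω` over the fixed compact set `K` against smooth
kernels, so they inherit holomorphy in the parameter. -/
theorem IsFamily.analyticAt_g (h : 𝒰.IsFamily V β) {z : ℂ} (hz : 𝒰.R < ‖z‖)
    (hU : (z : CP1) ∈ 𝒰.U OnePoint.infty) {η : ℂ} (hη : η ∈ V) :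
    AnalyticAt ℂ (fun η => 𝒰.g (β η) OnePoint.infty z) η ∧
    AnalyticAt ℂ (fun η => deriv (𝒰.g (β η) OnePoint.infty) z) η := by
  have hne : ∀ w ∈ 𝒰.K, (2 * Real.pi * (z - w) : ℂ) ≠ 0 :=
    fun w hw => mul_ne_zero (by simp [Real.pi_ne_zero])
      (sub_ne_zero.2 fun h => notMem_K_of_lt hz (h ▸ hw))
  constructor
  · have h1 := (h.analyticAt_integral (k := fun w => (2 * Real.pi * (z - w) : ℂ)⁻¹)
      (ContinuousOn.inv₀ (by fun_prop) hne) hη).fun_neg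
    refine h1.congr ?_
    filter_upwards [h.isOpen.mem_nhds hη] with η' hη'
    exact (g_eq_of_lt (h.isCocycle _ hη') hz hU).symm
  · have h1 := (h.analyticAt_integral
      (k := fun w => deriv (fun z => (2 * Real.pi * (z - w) : ℂ)⁻¹) z) (by
        have h2 : ∀ w ∈ 𝒰.K, deriv (fun z => (2 * Real.pi * (z - w) : ℂ)⁻¹) z =
            -(2 * Real.pi : ℂ) / (2 * Real.pi * (z - w)) ^ 2 := fun w hw => by
          have h3 : HasDerivAt (fun z => (2 * Real.pi * (z - w) : ℂ)) (2 * Real.pi) z := by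
            simpa using ((hasDerivAt_id z).sub_const w).const_mul (2 * Real.pi : ℂ)
          exact (h3.fun_inv (hne w hw)).deriv
        refine ContinuousOn.congr ?_ h2
        exact ContinuousOn.div (by fun_prop) (by fun_prop) fun w hw => pow_ne_zero _ (hne w hw))
      hη).fun_neg
    refine h1.congr ?_
    filter_upwards [h.isOpen.mem_nhds hη] with η' hη'
    exact (deriv_g_of_lt (h.isCocycle _ hη') hz hU).symm

end Cover

/-- Coordinates of a map to a space of finite dimension are analytic if the composites with a
separating family of linear forms are. -/
theorem exists_analytic_coordinates {Y : Type*} [AddCommGroup Y] [Module ℂ Y] [Module.Finite ℂ Y]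
    {ι : Type*} (ℓ : ι → Module.Dual ℂ Y) (hℓ : ∀ y, (∀ i, ℓ i y = 0) → y = 0) {F : ℂ → Y} {η : ℂ}
    (hF : ∀ i, AnalyticAt ℂ (fun η => ℓ i (F η)) η) :
    ∃ (n : ℕ) (y : Fin n → Y) (f : Fin n → ℂ → ℂ), (∀ i, AnalyticAt ℂ (f i) η) ∧
      ∀ η, F η = ∑ i, f i η • y i := by
  -- On a finite-dimensional space a separating family spans the dual, so every linear form is an
  -- analytic function along `F`.
  have htop : Submodule.span ℂ (range ℓ) = ⊤ := by
    have h1 : (Submodule.span ℂ (range ℓ)).dualCoannihilator = ⊥ := by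
      refine (Submodule.eq_bot_iff _).2 fun y hy => hℓ y fun i => ?_
      exact (Submodule.mem_dualCoannihilator y).1 hy _ (Submodule.subset_span ⟨i, rfl⟩)
    rw [← Subspace.dualCoannihilator_dualAnnihilator_eq (W := Submodule.span ℂ (range ℓ)), h1,
      Submodule.dualAnnihilator_bot]
  have hall : ∀ φ : Module.Dual ℂ Y, AnalyticAt ℂ (fun η => φ (F η)) η := by
    intro φ
    have hφ : φ ∈ Submodule.span ℂ (range ℓ) := htop ▸ Submodule.mem_top
    induction hφ using Submodule.span_induction with
    | mem φ h => obtain ⟨i, rfl⟩ := h; exact hF i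
    | zero => exact analyticAt_const
    | add a b _ _ ha hb => exact ha.add hb
    | smul a φ _ h => exact analyticAt_const.mul h
  let b := Module.finBasis ℂ Y
  exact ⟨_, b, fun i η => b.coord i (F η), fun i => hall _, fun η => (b.sum_repr (F η)).symm⟩

end MinLaplace

/-! ### Splitting of holomorphic families of hypercocycles. -/

namespace MinLaplace

open Filter Set HolBundle

universe u

theorem HolAt₂.eventually_holAt {f : CP1 → ℂ → ℂ} {x : CP1} {η₀ : ℂ} (h : HolAt₂ f x η₀) :
    ∀ᶠ η in 𝓝 η₀, HolAt (fun y => f y η) x := by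
  have key : ∀ {F : ℂ × ℂ → ℂ} {z : ℂ}, AnalyticAt ℂ F (z, η₀) →
      ∀ᶠ η in 𝓝 η₀, AnalyticAt ℂ (fun w => F (w, η)) z := fun {F z} hF => by
    have h1 : Tendsto (fun η : ℂ => (z, η)) (𝓝 η₀) (𝓝 (z, η₀)) :=
      (Continuous.prodMk continuous_const continuous_id).tendsto _
    filter_upwards [h1.eventually hF.eventually_analyticAt] with η hη
    exact AnalyticAt.fun_comp (g := F) (f := fun w => (w, η)) hη (by fun_prop)
  induction x using OnePoint.rec with
  | coe z => exact (key (h.1 z rfl)).mono fun η hη => holAt_coe.2 hη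
  | infty => exact (key (h.2 rfl)).mono fun η hη => holAt_infty.2 hη

namespace MeroConnection

variable {r : ℕ} {P : Finset ℂ} {C : MeroConnection.{u} r P} {ε : Fin r → ∀ y, C.E.Fib y}

/-- The values of a holomorphic family. -/
theorem HolFamily.eventually {K : CP1 → Set (C.E.Sec P)} {σ : ℂ → C.E.Sec P} {x : CP1} {η₀ : ℂ}
    (h : C.HolFamily K σ x η₀) : ∃ (n : ℕ) (m : Fin n → C.E.Sec P), (∀ i, m i ∈ K x) ∧
      ∀ᶠ η in 𝓝 η₀, ∃ f : Fin n → ℂ → ℂ, (∀ i, AnalyticAt ℂ (f i) 0) ∧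
        GermEq x (σ η) fun z => ∑ i, f i (unif x z) • m i z := by
  obtain ⟨n, m, f, hm, hf, W, hW, V, hV, h⟩ := h
  refine ⟨n, m, hm, ?_⟩
  filter_upwards [hV, eventually_all.2 fun i => (hf i).eventually_holAt] with η hη hfη
  choose g hg hg0 hfg using fun i => (hfη i).exists_analyticAt
  refine ⟨g, hg, germEq_iff.2 ?_⟩
  filter_upwards [eventually_all.2 hfg, eventually_nf_of_nhds hW] with z h1 h2 hz
  rw [h ⟨z, hz⟩ h2 η hη]
  exact Finset.sum_congr rfl fun i _ => by rw [← h1 i]; rfl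

theorem HolFamily.analyticAt_crd {K : CP1 → Set (C.E.Sec P)} (hε : C.E.IsGlobalFrame ε)
    {σ : ℂ → C.E.Sec P} {z : ℂ} (hz : z ∉ P) {η₀ : ℂ} (h : C.HolFamily K σ (z : CP1) η₀)
    (hK : K (z : CP1) ⊆ C.E.holGerms P (z : CP1)) (i : Fin r) :
    AnalyticAt ℂ (fun q : ℂ × ℂ => crd ε i (σ q.2) q.1) (z, η₀) := by
  obtain ⟨n, m, f, hm, hf, W, hW, V, hV, h⟩ := h
  have h1 : AnalyticAt ℂ (fun q : ℂ × ℂ => ∑ k, f k (q.1 : CP1) q.2 * crd ε i (m k) q.1)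
      (z, η₀) := by
    refine Finset.analyticAt_fun_sum _ fun k _ => ((hf k).1 z rfl).mul ?_
    exact AnalyticAt.fun_comp (g := crd ε i (m k)) (f := Prod.fst)
      (MeroConnection.analyticAt_crd hε hz (hK (hm k)) i) analyticAt_fst
  refine h1.congr ?_
  have hW' : ∀ᶠ w : ℂ in 𝓝 z, (w : CP1) ∈ W := by rw [← nf_coe]; exact eventually_nf_of_nhds hW
  filter_upwards [(continuousAt_fst (p := (z, η₀))).eventually hW',
    (continuousAt_fst (p := (z, η₀))).eventually (P.finite_toSet.isClosed.isOpen_compl.mem_nhds hz),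
    (continuousAt_snd (p := (z, η₀))).eventually hV] with q h2 h3 h4
  exact (crd_sum hε (z := ⟨q.1, h3⟩) (h ⟨q.1, h3⟩ h2 q.2 h4) i).symm

/-- The members of a holomorphic family have poles of bounded order. -/
theorem HolFamily.exists_pow {K : CP1 → Set (C.E.Sec P)} {σ : ℂ → C.E.Sec P} {x : CP1} {η₀ : ℂ}
    (h : C.HolFamily K σ x η₀) (hK : K x ⊆ C.E.merGerms P x) (hx : x ∈ poles P) :
    ∃ k : ℕ, ∀ᶠ η in 𝓝 η₀, mulSec (fun z => unif x z ^ k) (σ η) ∈ C.E.holGerms P x := by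
  obtain ⟨n, m, hm, h⟩ := h.eventually
  choose k hk using fun i => (mem_merGerms_iff hx).1 (hK (hm i))
  refine ⟨∑ i, k i, ?_⟩
  filter_upwards [h] with η ⟨f, hf, hη⟩
  have h1 : ∀ i, mulSec (fun z => unif x z ^ ∑ i, k i) (m i) ∈ C.E.holGerms P x := fun i =>
    unif_pow_mem (Finset.single_le_sum (fun _ _ => Nat.zero_le _) (Finset.mem_univ i)) (hk i)
  refine holGerms_congr (holGerms_sum h1 hf) ?_
  filter_upwards [germEq_iff.1 hη] with z hz hP
  rw [mulSec_apply, hz hP, Finset.smul_sum]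
  exact Finset.sum_congr rfl fun i _ => by rw [mulSec_apply, smul_comm]

theorem exists_infForm_of_pow {U : Set CP1} {e : Fin r → ∀ y, C.E.Fib y}
    (hU : OnePoint.infty ∈ U) (he : C.E.IsFrame U e) {k : ℕ} {s : C.E.Sec P}
    (hs : mulSec (fun z => unif OnePoint.infty z ^ k) s ∈ C.E.holGerms P OnePoint.infty) :
    ∃ f, InfForm e k f s := by
  obtain ⟨f, hf, h⟩ := (mem_holGerms_iff he hU).1 hs
  refine ⟨f, hf, germEq_iff.2 ?_⟩
  filter_upwards [h, eventually_infty_ne_zero] with z h1 h0 hz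
  have h2 := h1 hz
  have h3 : z ^ k ≠ 0 := pow_ne_zero _ h0
  rw [mulSec_apply, unif_infty, inv_pow] at h2
  simp only [zpow_natCast, ← smul_smul, ← Finset.smul_sum]
  change (z ^ k)⁻¹ • s ⟨z, hz⟩ = ∑ i, f i z⁻¹ • res P (e i) ⟨z, hz⟩ at h2
  rw [← h2]
  exact (smul_inv_smul₀ h3 _).symm

namespace DSubmodule

variable {N : C.DSubmodule} {𝒰 : Cover P} {V : Set ℂ} {u v : ℂ → ℂ} {c : ℂ → C.Cochain}

theorem IsCocycleFamily.isFamily (hV : IsOpen V) (hε : C.E.IsGlobalFrame ε)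
    (hc : C.IsCocycleFamily N.germs N.germs (fun η => C.op (u η) (v η)) 𝒰.U V c) (i : Fin r) :
    𝒰.IsFamily V fun η x y => crd ε i ((c η).2 x y) where
  isOpen := hV
  isCocycle η hη := isCocycle_crd hε (hc.1 η hη) i
  analyticAt x y z hx hy hz η hη := (hc.2.2 x y z ⟨hx, hy⟩ η hη).analyticAt_crd hε hz
    (fun _ hs => N.hol_of_mem (z := ⟨z, hz⟩) hs) i

/-- In the frame `ε` the section is an explicit expression in the coordinates of the cocycle, the
splitting functions, their derivatives and the fixed connection matrix, each of them holomorphic in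
the parameter. -/
theorem IsCocycleFamily.analyticAt_msec (hV : IsOpen V) (hε : C.E.IsGlobalFrame ε)
    (hc : C.IsCocycleFamily N.germs N.germs (fun η => C.op (u η) (v η)) 𝒰.U V c)
    {η₀ : ℂ} (hη₀ : η₀ ∈ V) (hu : AnalyticAt ℂ u η₀) (hv : AnalyticAt ℂ v η₀) (z : Punct P)
    (hz : 𝒰.R < ‖(z : ℂ)‖) (hzU : z.pt ∈ 𝒰.U OnePoint.infty) (i : Fin r) :
    AnalyticAt ℂ (fun η => crd ε i (msec 𝒰 ε (C.op (u η) (v η)) (c η)) z) η₀ := by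
  have hfam := IsCocycleFamily.isFamily hV hε hc
  have h1 : AnalyticAt ℂ (fun η => crd ε i ((c η).1 OnePoint.infty) z) η₀ :=
    AnalyticAt.fun_comp (g := fun q : ℂ × ℂ => crd ε i ((c q.2).1 OnePoint.infty) q.1)
      (f := fun η => ((z : ℂ), η)) ((hc.2.1 OnePoint.infty z.pt hzU η₀ hη₀).analyticAt_crd hε z.2
        (fun _ hs => N.hol_of_mem (z := z) hs) i) (by fun_prop)
  have hg := fun k => (hfam k).analyticAt_g hz hzU hη₀
  have h2 : AnalyticAt ℂ (fun η => crd ε i ((c η).1 OnePoint.infty) z -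
      (u η * (∑ k, 𝒰.g (fun x y => crd ε k ((c η).2 x y)) OnePoint.infty z *
          crd ε i (C.D (res P (ε k))) z +
        deriv (𝒰.g (fun x y => crd ε i ((c η).2 x y)) OnePoint.infty) z) -
      v η * 𝒰.g (fun x y => crd ε i ((c η).2 x y)) OnePoint.infty z)) η₀ := by
    refine h1.sub ((hu.mul (AnalyticAt.add ?_ (hg i).2)).sub (hv.mul (hg i).1))
    exact Finset.analyticAt_fun_sum _ fun k _ => (hg k).1.mul analyticAt_const
  refine h2.congr ?_
  filter_upwards [hV.mem_nhds hη₀] with η hη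
  refine (crd_eq hε (a := fun i => crd ε i ((c η).1 OnePoint.infty) z -
      (u η * (∑ k, 𝒰.g (fun x y => crd ε k ((c η).2 x y)) OnePoint.infty z *
          crd ε i (C.D (res P (ε k))) z +
        deriv (𝒰.g (fun x y => crd ε i ((c η).2 x y)) OnePoint.infty) z) -
      v η * 𝒰.g (fun x y => crd ε i ((c η).2 x y)) OnePoint.infty z)) ?_ i).symm
  have h3 : C.D (gsec 𝒰 ε (c η) OnePoint.infty) z = _ := C.D_sum z (fun i => 𝒰.g (fun x y => crd ε i ((c η).2 x y)) OnePoint.infty)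
    (fun i => res P (ε i)) (fun i => ((hfam i).isCocycle η hη).analyticAt_g hzU z.2)
    (fun i => frame_hol hε z i)
  rw [msec_eq hε (hc.1 η hη) hzU, op_apply, h3, gsec, ← sum_crd hε ((c η).1 OnePoint.infty) z]
  simp only [Finset.sum_add_distrib, sub_smul, mul_smul, add_smul, Finset.sum_sub_distrib,
    ← Finset.smul_sum, Finset.sum_smul]
  rw [Finset.sum_comm (f := fun i k => 𝒰.g (fun x y => crd ε k ((c η).2 x y)) OnePoint.infty z •
    crd ε i (C.D (res P (ε k))) z • res P (ε i) z)]
  simp only [← Finset.smul_sum, sum_crd hε]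

/-- The degree-one part of the cocycle is locally a combination of finitely many germs with
holomorphic coefficients, which bounds its poles uniformly. The exponent `K + 1` leaves room for the
simple pole that the derivation creates in `P`; at infinity the order of the frame `ε` is added. -/
theorem IsCocycleFamily.exists_bdd (hC : C.ResonanceFree) (hN : N.IsFull)
    (hε : C.E.IsGlobalFrame ε)
    (hc : C.IsCocycleFamily N.germs N.germs (fun η => C.op (u η) (v η)) 𝒰.U V c)
    {η₀ : ℂ} (hη₀ : η₀ ∈ V) {e : Fin r → ∀ y, C.E.Fib y} {B : Fin r → Fin r → ℂ → ℂ}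
    (he : C.IsIrr e B) : ∃ K k : ℕ, ∀ᶠ η in 𝓝 η₀, ∀ hη : η ∈ V,
      (⟨_, msec_mem hC hN hε (hc.1 η hη)⟩ : N.globalSections) ∈ N.bdd e K k := by
  obtain ⟨⟨U, hU, hUe⟩, -⟩ := id he
  have hfin : ∃ K : ℕ, ∀ p ∈ P, ∀ᶠ η in 𝓝 η₀, mulSec (fun z => (z - p) ^ K)
      ((c η).1 (p : CP1)) ∈ C.E.holGerms P (p : CP1) := by
    have h1 : ∀ p ∈ P, ∃ k : ℕ, ∀ᶠ η in 𝓝 η₀, mulSec (fun z => unif (p : CP1) z ^ k)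
        ((c η).1 (p : CP1)) ∈ C.E.holGerms P (p : CP1) := fun p hp =>
      (hc.2.1 p p (𝒰.mem _) η₀ hη₀).exists_pow (fun s hs => N.mem_mer _ s hs) (coe_mem_poles.2 hp)
    choose! k hk using h1
    exact ⟨∑ p ∈ P, k p, fun p hp => (hk p hp).mono fun η hη =>
      unif_pow_mem (Finset.single_le_sum (fun _ _ => Nat.zero_le _) hp) hη⟩
  obtain ⟨K, hK⟩ := hfin
  obtain ⟨k₁, hk₁⟩ := (hc.2.1 _ _ (𝒰.mem OnePoint.infty) η₀ hη₀).exists_pow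
    (fun s hs => N.mem_mer _ s hs) infty_mem_poles
  obtain ⟨k₂, hk₂⟩ := exists_frame_pow P hε
  refine ⟨K + 1, k₁ + k₂, ?_⟩
  filter_upwards [(Finset.eventually_all P).2 hK, hk₁] with η hK hk₁ hη
  have hcη := hc.1 η hη
  refine ⟨fun p hp => ?_, ?_⟩
  · have h1 := holGerms_mul_coe (f := fun z => z - p) (hK p hp) (by fun_prop)
    have h2 := gsec_hol hε hcη (𝒰.mem (p : CP1))
    have h3 := holGerms_mul_coe (f := fun z => -u η * (z - p) ^ K) (hol_unif_D hC h2) (by fun_prop)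
    have h4 := holGerms_mul_coe (f := fun z => v η * (z - p) ^ (K + 1)) h2 (by fun_prop)
    refine holGerms_congr (holGerms_add (holGerms_add h1 h3) h4) ?_
    filter_upwards [germEq_iff.1 (msec_germ hε hcη (p : CP1))] with z hz hzP
    simp only [mulSec_apply, ← hz hzP, Pi.add_apply, Pi.sub_apply, op_apply]
    module
  · obtain ⟨f₁, hf₁⟩ := exists_infForm_of_pow hU hUe (unif_pow_mem (Nat.le_add_right k₁ k₂) hk₁)
    obtain ⟨f₂, hf₂⟩ := exists_infForm_of_pow hU hUe (unif_pow_mem (Nat.le_add_left k₂ k₁)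
      (gsec_infty hε hcη hk₂))
    exact ⟨_, (hf₁.sub (((hf₂.der he).smul (u η)).sub (hf₂.smul (v η)))).congr
      (msec_germ hε hcη OnePoint.infty)⟩

/-- A holomorphic family of cocycles is cohomologous to a combination of global sections with
holomorphic coefficients. -/
theorem exists_split (hC : C.ResonanceFree) (hN : N.IsFull) {U : CP1 → Set CP1}
    {η₀ : ℂ} (hV : V ∈ 𝓝 η₀)
    (hc : C.IsCocycleFamily N.germs N.germs (fun η => C.op (u η) (v η)) U V c)
    (hu : AnalyticAt ℂ u η₀) (hv : AnalyticAt ℂ v η₀) :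
    ∃ (n : ℕ) (m : Fin n → N.globalSections) (f : Fin n → ℂ → ℂ), (∀ i, AnalyticAt ℂ (f i) η₀) ∧
      ∀ᶠ η in 𝓝 η₀, ∃ U', C.IsCoboundary N.germs (C.op (u η) (v η)) U'
        (c η - (fun _ => ((∑ i, f i η • m i : N.globalSections) : C.E.Sec P), 0)) := by
  classical
  obtain ⟨ε, hε⟩ := exists_global_frame C.E
  have hε : C.E.IsGlobalFrame ε := hε
  obtain ⟨e, B, he⟩ := C.exists_isIrr
  obtain ⟨⟨Ue, hUe, hframe⟩, -⟩ := id he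
  obtain ⟨𝒰, h𝒰⟩ := exists_cover P U (hc.1 η₀ (mem_of_mem_nhds hV)).1
  have hη₀ : η₀ ∈ interior V := mem_interior_iff_mem_nhds.2 hV
  have hc' : C.IsCocycleFamily N.germs N.germs (fun η => C.op (u η) (v η)) 𝒰.U (interior V) c :=
    ⟨fun η hη => (hc.1 η (interior_subset hη)).mono (fun x => ⟨𝒰.isOpen x, 𝒰.mem x⟩) h𝒰,
      fun x q hq η hη => hc.2.1 x q (h𝒰 x hq) η (interior_subset hη),
      fun x y q hq η hη => hc.2.2 x y q ⟨h𝒰 x hq.1, h𝒰 y hq.2⟩ η (interior_subset hη)⟩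
  obtain ⟨K, k, hb⟩ := IsCocycleFamily.exists_bdd hC hN hε hc' hη₀ he
  have := finite_bdd (N := N) hε hUe hframe K k
  -- For parameters near `η₀` this is the global section of the splitting, viewed in a
  -- finite-dimensional space; elsewhere zero is an arbitrary value.
  let F : ℂ → N.bdd e K k := fun η =>
    if h : ∃ hη : η ∈ interior V,
      (⟨_, msec_mem hC hN hε (hc'.1 η hη)⟩ : N.globalSections) ∈ N.bdd e K k
    then ⟨_, h.choose_spec⟩ else 0
  have hF : ∀ᶠ η in 𝓝 η₀, ((F η : N.globalSections) : C.E.Sec P) =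
      msec 𝒰 ε (C.op (u η) (v η)) (c η) := by
    filter_upwards [hb, isOpen_interior.mem_nhds hη₀] with η h1 h2
    simp only [F]
    rw [dif_pos ⟨h2, h1 h2⟩]
  let ι := {z : Punct P // 𝒰.R < ‖(z : ℂ)‖ ∧ z.pt ∈ 𝒰.U OnePoint.infty}
  -- The coordinates of the values at points near infinity separate the elements of this space by
  -- `global_eq_zero`, and along `F` they are analytic.
  let ℓ : ι × Fin r → Module.Dual ℂ (N.bdd e K k) := fun a =>
    (LinearMap.proj a.2 : (Fin r → ℂ) →ₗ[ℂ] ℂ) ∘ₗ (coef fun i => res P (ε i) a.1.1) ∘ₗ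
      (LinearMap.proj a.1.1 : C.E.Sec P →ₗ[ℂ] C.E.Fib a.1.1.pt) ∘ₗ
      N.globalSections.subtype ∘ₗ (N.bdd e K k).subtype
  have hℓ : ∀ (a : ι × Fin r) (y : N.bdd e K k), ℓ a y =
      crd ε a.2 ((y : N.globalSections) : C.E.Sec P) a.1.1 := fun a y =>
    (crd_of_notMem a.2 _ a.1.1.2).symm
  obtain ⟨n, y, f, hf, hFf⟩ := exists_analytic_coordinates ℓ (F := F) (η := η₀) (fun y hy => by
      refine Subtype.ext (global_eq_zero hε _ (germEq_iff.2 ?_))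
      have h1 : ∀ᶠ z in nf OnePoint.infty, 𝒰.R < ‖z‖ := by
        rw [nf_infty]; exact tendsto_norm_cobounded_atTop.eventually_gt_atTop _
      filter_upwards [h1, eventually_nf_of_nhds ((𝒰.isOpen _).mem_nhds (𝒰.mem OnePoint.infty))]
        with z h1 h2 hz
      rw [← sum_crd hε ((y : N.globalSections) : C.E.Sec P) ⟨z, hz⟩]
      refine Finset.sum_eq_zero fun i _ => ?_
      have h3 := hy (⟨⟨z, hz⟩, h1, h2⟩, i)
      rw [hℓ] at h3
      change crd ε i _ z • _ = 0
      rw [h3, zero_smul]) (fun a => by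
      refine (IsCocycleFamily.analyticAt_msec isOpen_interior hε hc' hη₀ hu hv a.1.1 a.1.2.1
        a.1.2.2 a.2).congr ?_
      filter_upwards [hF] with η hη
      rw [hℓ, hη])
  refine ⟨n, fun i => y i, f, hf, ?_⟩
  filter_upwards [hF, isOpen_interior.mem_nhds hη₀] with η h1 h2
  refine ⟨𝒰.U, ?_⟩
  have h3 : (∑ i, f i η • (y i : N.globalSections)) = F η := by
    rw [hFf]; simp
  rw [h3, h1]
  exact isCoboundary_sub_msec hC hN hε (hc'.1 η h2)

end DSubmodule

end MeroConnection

end MinLaplace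

namespace MinLaplace

open Filter Set HolBundle

universe u

namespace MeroConnection

variable {r : ℕ} {P : Finset ℂ} {C : MeroConnection.{u} r P}

/-! ### Holomorphic families -/

section

variable {K K' : CP1 → Set (C.E.Sec P)} {σ τ : ℂ → C.E.Sec P} {x : CP1} {η₀ : ℂ}

theorem holAt₂_const (x : CP1) {f : ℂ → ℂ} (hf : AnalyticAt ℂ f η₀) :
    HolAt₂ (fun _ η => f η) x η₀ :=
  ⟨fun z _ => AnalyticAt.fun_comp (g := f) (f := Prod.snd) (x := (z, η₀)) hf analyticAt_snd,
    fun _ => AnalyticAt.fun_comp (g := f) (f := Prod.snd) (x := ((0 : ℂ), η₀)) hf analyticAt_snd⟩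

theorem HolFamily.of_sum {n : ℕ} {m : Fin n → C.E.Sec P} {f : Fin n → ℂ → ℂ}
    (hm : ∀ i, m i ∈ K x) (hf : ∀ i, AnalyticAt ℂ (f i) η₀)
    (h : ∃ W ∈ 𝓝 x, ∀ z : Punct P, z.pt ∈ W → ∀ η, σ η z = ∑ i, f i η • m i z) :
    C.HolFamily K σ x η₀ := by
  obtain ⟨W, hW, h⟩ := h
  exact ⟨n, m, fun i _ => f i, hm, fun i => holAt₂_const x (hf i), W, hW, univ, univ_mem,
    fun z hz η _ => h z hz η⟩

theorem HolFamily.zero : C.HolFamily K 0 x η₀ :=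
  HolFamily.of_sum (n := 0) (m := fun _ => 0) (f := fun _ _ => 0) (fun i => i.elim0)
    (fun i => i.elim0) ⟨univ, univ_mem, fun z _ η => by simp⟩

theorem HolFamily.const {s : C.E.Sec P} (hs : s ∈ K x) : C.HolFamily K (fun _ => s) x η₀ :=
  HolFamily.of_sum (n := 1) (m := fun _ => s) (f := fun _ _ => 1) (fun _ => hs)
    (fun _ => analyticAt_const) ⟨univ, univ_mem, fun z _ η => by simp⟩

theorem HolFamily.mono (h : C.HolFamily K σ x η₀) (hK : K x ⊆ K' x) : C.HolFamily K' σ x η₀ := by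
  obtain ⟨n, m, f, hm, h⟩ := h
  exact ⟨n, m, f, fun i => hK (hm i), h⟩

theorem HolFamily.add (h : C.HolFamily K σ x η₀) (h' : C.HolFamily K τ x η₀) :
    C.HolFamily K (σ + τ) x η₀ := by
  obtain ⟨n, m, f, hm, hf, W, hW, V, hV, h⟩ := h
  obtain ⟨n', m', f', hm', hf', W', hW', V', hV', h'⟩ := h'
  refine ⟨n + n', Fin.append m m', Fin.append f f', fun i => ?_, fun i => ?_, W ∩ W',
    inter_mem hW hW', V ∩ V', inter_mem hV hV', fun z hz η hη => ?_⟩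
  · refine Fin.addCases (fun i => ?_) (fun i => ?_) i
    · rw [Fin.append_left]; exact hm i
    · rw [Fin.append_right]; exact hm' i
  · refine Fin.addCases (fun i => ?_) (fun i => ?_) i
    · rw [Fin.append_left]; exact hf i
    · rw [Fin.append_right]; exact hf' i
  · simp only [Fin.sum_univ_add, Fin.append_left, Fin.append_right, Pi.add_apply,
      h z hz.1 η hη.1, h' z hz.2 η hη.2]

theorem HolFamily.smul (h : C.HolFamily K σ x η₀) {f : ℂ → ℂ} (hf : AnalyticAt ℂ f η₀) :
    C.HolFamily K (fun η => f η • σ η) x η₀ := by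
  obtain ⟨n, m, g, hm, hg, W, hW, V, hV, h⟩ := h
  refine ⟨n, m, fun i y η => f η * g i y η, hm, fun i => ?_, W, hW, V, hV, fun z hz η hη => ?_⟩
  · have h1 := holAt₂_const x hf
    exact ⟨fun z hz => (h1.1 z hz).mul ((hg i).1 z hz), fun hx => (h1.2 hx).mul ((hg i).2 hx)⟩
  · simp only [Pi.smul_apply, h z hz η hη, Finset.smul_sum, mul_smul]

end

theorem IsCocycleFamily.mono {K₀ K₁ K₀' K₁' : CP1 → Set (C.E.Sec P)}
    {d : ℂ → C.E.Sec P → C.E.Sec P} {U : CP1 → Set CP1} {V : Set ℂ} {c : ℂ → C.Cochain}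
    (h : C.IsCocycleFamily K₀ K₁ d U V c) (h₀ : ∀ x, K₀ x ⊆ K₀' x) (h₁ : ∀ x, K₁ x ⊆ K₁' x) :
    C.IsCocycleFamily K₀' K₁' d U V c :=
  ⟨fun η hη => ⟨(h.1 η hη).1, fun x q hq => h₁ q ((h.1 η hη).2.1 x q hq),
    fun x y q hq => h₀ q ((h.1 η hη).2.2.1 x y q hq), (h.1 η hη).2.2.2⟩,
    fun x q hq η hη => (h.2.1 x q hq η hη).mono (h₁ q),
    fun x y q hq η hη => (h.2.2 x y q hq η hη).mono (h₀ q)⟩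

namespace DSubmodule

variable {N : C.DSubmodule}

/-! ### The isomorphism of the fibres -/

variable (N) in
/-- The class of a global section in the first hypercohomology, as a linear map. -/
def globalLin (ξ : ℂ) : N.globalSections →ₗ[ℂ] N.H1 ξ where
  toFun := N.globalClass ξ
  map_add' m m' := by
    rw [globalClass, globalClass, globalClass, ← Submodule.Quotient.mk_add]
    congr 1
    refine Subtype.ext (Prod.ext rfl ?_)
    change (0 : CP1 → CP1 → C.E.Sec P) = 0 + 0
    rw [add_zero]
  map_smul' a m := by
    rw [RingHom.id_apply, globalClass, globalClass, ← Submodule.Quotient.mk_smul]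
    congr 1
    refine Subtype.ext (Prod.ext rfl ?_)
    change (0 : CP1 → CP1 → C.E.Sec P) = a • 0
    rw [smul_zero]

theorem globalLin_apply (ξ : ℂ) (m : N.globalSections) : N.globalLin ξ m = N.globalClass ξ m := rfl

theorem hasClass_iff {ξ : ℂ} {w : N.H1 ξ} {c : C.Cochain} {m : N.globalSections}
    (hc : c ∈ N.cocycles ξ) (h : c - (fun _ => (m : C.E.Sec P), 0) ∈ N.coboundaries ξ) :
    N.HasClass ξ w c ↔ w = N.globalClass ξ m := by
  have h1 : (Submodule.Quotient.mk ⟨c, hc⟩ : N.H1 ξ) = N.globalClass ξ m := by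
    rw [globalClass, Submodule.Quotient.eq]
    exact h
  exact ⟨fun ⟨_, hw⟩ => hw.trans h1, fun hw => ⟨hc, hw.trans h1.symm⟩⟩

/-- If a cocycle without part of degree zero is the coboundary of sections `g x`, these agree on
overlaps, so they form one global section `w` whose image under `∂/∂x - ξ` is the given section. -/
theorem ker_globalLin (ξ : ℂ) :
    LinearMap.ker (N.globalLin ξ) = LinearMap.range (N.laplaceXi - ξ • LinearMap.id) := by
  ext m
  rw [LinearMap.mem_ker, globalLin_apply, globalClass, Submodule.Quotient.mk_eq_zero,
    LinearMap.mem_range]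
  constructor
  · rintro ⟨U, hU, g, hg, h1, h2⟩
    have hG : ∀ x, ∀ z : Punct P, z.pt ∈ U x → g x z = g z.pt z := fun x z hz => by
      have h := h2 x z.pt z ⟨hz, (hU z.pt).2⟩
      exact (sub_eq_zero.1 h.symm).symm
    have hgerm : ∀ x, GermEq x (g x) fun z => g z.pt z := fun x =>
      ⟨U x, (hU x).1.mem_nhds (hU x).2, hG x⟩
    refine ⟨⟨fun z => g z.pt z, (Submodule.mem_iInf _).2 fun x =>
      N.congr x _ _ (hg x x (hU x).2) (hgerm x)⟩, Subtype.ext (funext fun z => ?_)⟩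
    have h3 := h1 z.pt z (hU z.pt).2
    change (m : C.E.Sec P) z = C.twist ξ (g z.pt) z at h3
    change C.twist ξ (fun z => g z.pt z) z = (m : C.E.Sec P) z
    rw [h3, twist_eq_op]
    exact op_local (hgerm z.pt).symm
  · rintro ⟨w, rfl⟩
    refine ⟨fun _ => univ, fun _ => ⟨isOpen_univ, trivial⟩, fun _ => w,
      fun x q _ => N.mem_stalk_of_global w q, fun x z _ => rfl, fun x y z _ => ?_⟩
    exact (sub_self _).symm

/-- A single cocycle is split as a constant family. -/
theorem globalLin_surjective (hC : C.ResonanceFree) (hN : N.IsFull) (ξ : ℂ) :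
    Function.Surjective (N.globalLin ξ) := by
  intro w
  obtain ⟨⟨c, hc⟩, rfl⟩ := Submodule.Quotient.mk_surjective _ w
  obtain ⟨U, hU⟩ := id hc
  rw [twist_eq_op] at hU
  obtain ⟨n, m, f, -, hf⟩ := exists_split (V := univ) (η₀ := 0) (u := fun _ => 1) (v := fun _ => ξ)
    (c := fun _ => c) hC hN univ_mem ⟨fun _ _ => hU, fun x q hq η _ => .const (hU.2.1 x q hq),
      fun x y q hq η _ => .const (hU.2.2.1 x y q hq)⟩ analyticAt_const analyticAt_const
  obtain ⟨U', h⟩ := hf.self_of_nhds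
  rw [← twist_eq_op] at h
  exact ⟨_, ((hasClass_iff hc ⟨U', h⟩).1 ⟨hc, rfl⟩).symm⟩

/-- The isomorphism of the first hypercohomology with the fibre of the Laplace transform. -/
def fiberEquiv (hC : C.ResonanceFree) (hN : N.IsFull) (ξ : ℂ) : N.H1 ξ ≃ₗ[ℂ] N.LaplaceFiber ξ :=
  ((Submodule.quotEquivOfEq _ _ (ker_globalLin ξ).symm).trans
    ((N.globalLin ξ).quotKerEquivOfSurjective (globalLin_surjective hC hN ξ))).symm

theorem fiberEquiv_globalClass (hC : C.ResonanceFree) (hN : N.IsFull) (ξ : ℂ)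
    (m : N.globalSections) : fiberEquiv hC hN ξ (N.globalClass ξ m) = N.laplaceClass ξ m := by
  rw [fiberEquiv, LinearEquiv.symm_apply_eq]
  rfl

theorem fiberEquiv_symm (hC : C.ResonanceFree) (hN : N.IsFull) (ξ : ℂ)
    (m : N.globalSections) : (fiberEquiv hC hN ξ).symm (N.laplaceClass ξ m) = N.globalClass ξ m := by
  rw [← fiberEquiv_globalClass hC hN, LinearEquiv.symm_apply_apply]

theorem fiberEquiv_eq_iff (hC : C.ResonanceFree) (hN : N.IsFull) {ξ : ℂ} {w : N.H1 ξ} {n : ℕ}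
    {m : Fin n → N.globalSections} {a : Fin n → ℂ} :
    fiberEquiv hC hN ξ w = ∑ i, a i • N.laplaceClass ξ (m i) ↔
      w = N.globalClass ξ (∑ i, a i • m i) := by
  rw [← globalLin_apply, map_sum, ← LinearEquiv.eq_symm_apply, map_sum]
  simp only [map_smul, fiberEquiv_symm, globalLin_apply]

/-! ### Sections given by holomorphic families of cocycles -/

/-- The class of a family of cocycles is a combination of classes of global sections. -/
theorem exists_laplace (hC : C.ResonanceFree) (hN : N.IsFull) {s : ∀ ξ : Punct C.Phat, N.H1 ξ}
    {ξ₀ : ℂ} {V : Set ℂ} (hV : V ∈ 𝓝 ξ₀) {U : CP1 → Set CP1} {c : ℂ → C.Cochain}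
    (hc : C.IsCocycleFamily N.germs N.germs C.twist U V c)
    (h : ∀ ξ : Punct C.Phat, (ξ : ℂ) ∈ V → N.HasClass ξ (s ξ) (c ξ)) :
    N.LaplaceLat (fun ξ => fiberEquiv hC hN ξ (s ξ)) (ξ₀ : CP1) := by
  have hd : C.twist = fun η => C.op 1 η := funext C.twist_eq_op
  have hc' := hc
  rw [hd] at hc'
  obtain ⟨n, m, f, hf, hcob⟩ := exists_split hC hN (u := fun _ => 1) (v := fun η => η) hV hc'
    analyticAt_const analyticAt_id
  refine laplaceLat_iff.2 ⟨n, m, fun i t => f i (t + ξ₀), fun i => unif_tendsto_analyticAt (hf i), ?_⟩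
  rw [nf_coe]
  filter_upwards [hcob, hV] with ξ ⟨U', h1⟩ hξ hP
  simp only [unif_coe, sub_add_cancel]
  rw [fiberEquiv_eq_iff hC hN]
  refine (hasClass_iff ⟨U, hc.1 ξ hξ⟩ ⟨U', ?_⟩).1 (h ⟨ξ, hP⟩ hξ)
  rwa [twist_eq_op]

/-- One direction is the splitting of families. For the other, a combination of global sections with
holomorphic coefficients, placed in degree one, is itself a holomorphic family of cocycles. -/
theorem hyperHol_iff (hC : C.ResonanceFree) (hN : N.IsFull) {s : ∀ ξ : Punct C.Phat, N.H1 ξ}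
    {ξ₀ : ℂ} : N.HyperHol s ξ₀ ↔ N.LaplaceLat (fun ξ => fiberEquiv hC hN ξ (s ξ)) (ξ₀ : CP1) := by
  constructor
  · rintro ⟨V, hV, U, c, hc, h⟩
    exact exists_laplace hC hN hV hc h
  · intro h
    obtain ⟨n, m, f, hf, h⟩ := laplaceLat_iff.1 h
    rw [nf_coe] at h
    have h1 : ∀ i, AnalyticAt ℂ (fun η => f i (η - ξ₀)) ξ₀ := fun i =>
      AnalyticAt.fun_comp (g := f i) (f := fun η => η - ξ₀) (by simpa using hf i) (by fun_prop)
    let F : ℂ → N.globalSections := fun η => ∑ i, f i (η - ξ₀) • m i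
    have hF : ∀ η (z : Punct P), (F η : C.E.Sec P) z =
        ∑ i, f i (η - ξ₀) • (m i : C.E.Sec P) z := fun η z => by
      simp [F, Finset.sum_apply]
    have hcoc : ∀ ξ, C.IsCocycle N.germs N.germs (C.twist ξ) (fun _ => univ)
        (fun _ => (F ξ : C.E.Sec P), 0) := fun ξ => ⟨fun _ => ⟨isOpen_univ, trivial⟩,
      fun _ q _ => N.mem_stalk_of_global _ q, fun _ _ q _ => (N.stalk q).zero_mem,
      fun _ _ _ _ _ => by simp, fun _ _ z _ => by simpa using N.twist_zero ξ z⟩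
    refine ⟨_, inter_mem h (eventually_all.2 fun i => (h1 i).eventually_analyticAt),
      fun _ => univ, fun η => (fun _ => (F η : C.E.Sec P), 0), ⟨fun η _ => hcoc η, ?_, ?_⟩, ?_⟩
    · exact fun x q _ η hη => HolFamily.of_sum (fun i => N.mem_stalk_of_global (m i) q) hη.2
        ⟨univ, univ_mem, fun z _ η => hF η z⟩
    · exact fun x y q _ η _ => HolFamily.zero
    · intro ξ hξ
      refine (hasClass_iff (m := F ξ) ⟨_, hcoc ξ⟩ ?_).2 ?_
      · rw [sub_self]; exact (N.coboundaries _).zero_mem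
      · exact (fiberEquiv_eq_iff hC hN).1 (hξ.1 ξ.2)

/-- The complex `E → F` is contained in `N → N`, so its families of cocycles are also families for
`N`, and splitting applies at points of `Phat` too. -/
theorem HyperLatAt.laplaceLat (hC : C.ResonanceFree) (hN : N.IsFull)
    {s : ∀ ξ : Punct C.Phat, N.H1 ξ} {ξ₀ : ℂ} (h : N.HyperLatAt s ξ₀) :
    N.LaplaceLat (fun ξ => fiberEquiv hC hN ξ (s ξ)) (ξ₀ : CP1) := by
  obtain ⟨V, hV, U, c, hc, h⟩ := h
  exact exists_laplace hC hN hV (hc.mono (fun x _ hs => hN.hol hC hs)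
    fun x _ hs => hN.form hC hs) h

/-- A coboundary for `ζ ∂ / ∂x - 1` gives one for `∂ / ∂x - 1 / ζ`. -/
theorem coboundary_of_twistInf {ξ : ℂ} (hξ : ξ ≠ 0) {c : C.Cochain} {m : N.globalSections}
    {U : CP1 → Set CP1}
    (h : C.IsCoboundary N.germs (C.twistInf ξ⁻¹) U (c - (fun _ => (m : C.E.Sec P), 0))) :
    (ξ • c.1, c.2) - (fun _ => ((ξ • m : N.globalSections) : C.E.Sec P), 0) ∈
      N.coboundaries ξ := by
  obtain ⟨hU, g, hg, h1, h2⟩ := h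
  refine ⟨U, hU, g, hg, fun x z hz => ?_, h2⟩
  have h3 := h1 x z hz
  change ξ • c.1 x z - ξ • (m : C.E.Sec P) z = C.D (g x) z - ξ • g x z
  change c.1 x z - (m : C.E.Sec P) z = ξ⁻¹ • C.D (g x) z - g x z at h3
  rw [← smul_sub, h3, smul_sub, smul_inv_smul₀ hξ]

theorem IsCocycle.of_twistInf {ξ : ℂ} (hξ : ξ ≠ 0) {c : C.Cochain} {U : CP1 → Set CP1}
    (h : C.IsCocycle N.germs N.germs (C.twistInf ξ⁻¹) U c) :
    (ξ • c.1, c.2) ∈ N.cocycles ξ := by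
  refine ⟨U, h.1, fun x q hq => (N.stalk q).smul_mem ξ (h.2.1 x q hq), h.2.2.1, h.2.2.2.1,
    fun x y z hz => ?_⟩
  have h3 := h.2.2.2.2 x y z hz
  change C.D (c.2 x y) z - ξ • c.2 x y z = ξ • c.1 y z - ξ • c.1 x z
  change ξ⁻¹ • C.D (c.2 x y) z - c.2 x y z = _ at h3
  rw [← smul_sub, ← h3, smul_sub, smul_inv_smul₀ hξ]

/-- The splitting is done for the operator `ζ ∂/∂x - 1`, which makes sense at `ζ = 0`. Its
degree-one part differs from that for `∂/∂x - ξ` by the factor `ξ`, which the `ξ⁻¹` in the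
conclusion removes. -/
theorem HyperLatInf.laplaceLat (hC : C.ResonanceFree) (hN : N.IsFull)
    {s : ∀ ξ : Punct C.Phat, N.H1 ξ} (h : N.HyperLatInf s) :
    N.LaplaceLat (fun ξ => fiberEquiv hC hN ξ ((ξ : ℂ)⁻¹ • s ξ)) OnePoint.infty := by
  obtain ⟨V, hV, U, c, hc, h⟩ := h
  replace hc := hc.mono (K₀' := N.germs) (K₁' := N.germs) (fun x _ hs => hN.hol hC hs)
    fun x _ hs => hN.form hC hs
  have hd : C.twistInf = fun η => C.op η 1 := funext C.twistInf_eq_op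
  have hc' := hc
  rw [hd] at hc'
  obtain ⟨n, m, f, hf, hcob⟩ := exists_split hC hN (u := fun η => η) (v := fun _ => 1) hV hc'
    analyticAt_id analyticAt_const
  refine laplaceLat_iff.2 ⟨n, m, f, hf, ?_⟩
  filter_upwards [tendsto_inv_nf_infty.eventually hcob, tendsto_inv_nf_infty.eventually hV,
    eventually_infty_ne_zero] with ξ ⟨U', h1⟩ hξ h0 hP
  rw [fiberEquiv_eq_iff hC hN, unif_infty]
  rw [← twistInf_eq_op] at h1
  have h2 := (hasClass_iff (IsCocycle.of_twistInf h0 (hc.1 _ hξ)) (coboundary_of_twistInf h0 h1)).1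
    (h ⟨ξ, hP⟩ h0 hξ)
  rw [h2, ← globalLin_apply, map_smul, globalLin_apply]
  exact inv_smul_smul₀ h0 _

end DSubmodule

end MeroConnection

end MinLaplace

/-! ### Sections with analytic parameters and the reduction of poles at infinity. -/

namespace MinLaplace

open Filter Set HolBundle

universe u

/-- The functions that are holomorphic at a point. -/
def anaAlg (η₀ : ℂ) : Subalgebra ℂ (ℂ → ℂ) where
  carrier := {f | AnalyticAt ℂ f η₀}
  mul_mem' ha hb := AnalyticAt.mul ha hb
  add_mem' ha hb := AnalyticAt.add ha hb
  algebraMap_mem' _ := analyticAt_const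

namespace MeroConnection

variable {r : ℕ} {P : Finset ℂ} {C : MeroConnection.{u} r P} {η₀ : ℂ}

theorem op_add {u v : ℂ} {z : Punct P} {s t : C.E.Sec P} (hs : s ∈ C.E.holGerms P z.pt)
    (ht : t ∈ C.E.holGerms P z.pt) : C.op u v (s + t) z = C.op u v s z + C.op u v t z := by
  rw [op_apply, op_apply, op_apply, C.D_add z s t hs ht]
  simp only [Pi.add_apply, smul_add]
  abel

theorem op_smul {u v : ℂ} {z : Punct P} {s : C.E.Sec P} (a : ℂ) (hs : s ∈ C.E.holGerms P z.pt) :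
    C.op u v (a • s) z = a • C.op u v s z := by
  have h := C.D_leibniz z (fun _ => a) s analyticAt_const hs
  have h1 : C.D (a • s) z = a • C.D s z := by
    have e : HolBundle.mulSec (fun _ => a) s = a • s := rfl
    simpa [e] using h
  rw [op_apply, op_apply, h1, Pi.smul_apply, smul_sub, smul_comm u a, smul_comm v a]

theorem op_zero (u v : ℂ) (z : Punct P) : C.op u v 0 z = 0 := by
  simpa using op_smul (C := C) (u := u) (v := v) (z := z) (s := 0) 0 holGerms_zero

variable (η₀) in
/-- Combinations of sections in `K` with coefficients that are holomorphic functions of a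
parameter. -/
def tame (K : Set (C.E.Sec P)) : Submodule (anaAlg η₀) (ℂ → C.E.Sec P) :=
  Submodule.span (anaAlg η₀) ((fun s (_ : ℂ) => s) '' K)

theorem tame_hol {x : CP1} {G : ℂ → C.E.Sec P} (hG : G ∈ tame η₀ (C.E.merGerms P x)) :
    ∀ᶠ z in nf x, z ∉ P → ∀ η, G η ∈ C.E.holGerms P (z : CP1) := by
  induction hG using Submodule.span_induction with
  | mem G h =>
    obtain ⟨s, hs, rfl⟩ := h
    exact (merGerms_near hs).mono fun z hz hP _ => hz hP
  | zero => exact Eventually.of_forall fun z _ _ => holGerms_zero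
  | add a b _ _ ha hb =>
    filter_upwards [ha, hb] with z ha hb hP η using holGerms_add (ha hP η) (hb hP η)
  | smul a G _ h => exact h.mono fun z hz hP η => holGerms_smul (a.1 η) (hz hP η)

theorem exists_sum_of_tame {K : Set (C.E.Sec P)} {G : ℂ → C.E.Sec P} (hG : G ∈ tame η₀ K) :
    ∃ (n : ℕ) (m : Fin n → C.E.Sec P) (f : Fin n → ℂ → ℂ), (∀ i, m i ∈ K) ∧
      (∀ i, AnalyticAt ℂ (f i) η₀) ∧ ∀ η, G η = ∑ i, f i η • m i := by
  obtain ⟨n, f, g, h⟩ := Submodule.mem_span_set'.1 hG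
  choose m hm hg using fun i => (g i).2
  refine ⟨n, m, fun i => (f i).1, hm, fun i => (f i).2, fun η => ?_⟩
  rw [← h, Finset.sum_apply]
  refine Finset.sum_congr rfl fun i _ => ?_
  rw [← hg i]
  rfl

/-! ### Reduction of the order of the pole at infinity -/

/-- The families of sections that are holomorphic at infinity up to the image of the operators
`u ∂ / ∂x - v`. -/
def reducible (u v : anaAlg η₀) : Submodule (anaAlg η₀) (ℂ → C.E.Sec P) where
  carrier := {σ | ∃ G ∈ tame η₀ (C.E.merGerms P OnePoint.infty),
    ∃ F ∈ tame η₀ (C.E.holGerms P OnePoint.infty), ∀ᶠ z in nf OnePoint.infty, ∀ (hz : z ∉ P) (η : ℂ),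
      σ η ⟨z, hz⟩ = C.op (u.1 η) (v.1 η) (G η) ⟨z, hz⟩ + F η ⟨z, hz⟩}
  zero_mem' := ⟨0, Submodule.zero_mem _, 0, Submodule.zero_mem _, Eventually.of_forall
    fun z hz η => by
      change 0 = C.op _ _ 0 _ + 0
      rw [op_zero, add_zero]⟩
  add_mem' := by
    rintro a b ⟨G, hG, F, hF, h⟩ ⟨G', hG', F', hF', h'⟩
    refine ⟨G + G', Submodule.add_mem _ hG hG', F + F', Submodule.add_mem _ hF hF', ?_⟩
    filter_upwards [h, h', tame_hol hG, tame_hol hG'] with z h h' h1 h2 hz η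
    simp only [Pi.add_apply, h hz η, h' hz η, op_add (z := ⟨z, hz⟩) (h1 hz η) (h2 hz η)]
    abel
  smul_mem' := by
    rintro a σ ⟨G, hG, F, hF, h⟩
    refine ⟨a • G, Submodule.smul_mem _ a hG, a • F, Submodule.smul_mem _ a hF, ?_⟩
    filter_upwards [h, tame_hol hG] with z h h1 hz η
    change a.1 η • σ η ⟨z, hz⟩ = C.op _ _ (a.1 η • G η) _ + a.1 η • F η ⟨z, hz⟩
    rw [h hz η, op_smul (z := ⟨z, hz⟩) _ (h1 hz η), smul_add]

variable (C) in
/-- The determinant of the leading term at infinity of the operator `u ∂ / ∂x - v`. -/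
def symb (u v : anaAlg η₀) : anaAlg η₀ := ∏ l, (C.α l • u - v)

theorem op_mem_reducible {u v : anaAlg η₀} {g : C.E.Sec P}
    (hg : g ∈ C.E.merGerms P OnePoint.infty) :
    (fun η => C.op (u.1 η) (v.1 η) g) ∈ reducible (C := C) u v :=
  ⟨_, Submodule.subset_span ⟨g, hg, rfl⟩, 0, Submodule.zero_mem _, Eventually.of_forall
    fun _ _ _ => (add_zero _).symm⟩

/-- Induction on the order at infinity. With `g i = x ^ (k + 1) • e i` one has `(α i * u - v) g i =
(u D - v) g i - u (D g i - α i g i)`, and the last bracket has order at most `k`. One factor `symb`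
therefore exchanges the leading term of `s` for the image of the operator and terms of lower order.
-/
theorem reducible_of_infForm {e : Fin r → ∀ y, C.E.Fib y} {B : Fin r → Fin r → ℂ → ℂ}
    (he : C.IsIrr e B) (u v : anaAlg η₀) (k : ℕ) {f : Fin r → ℂ → ℂ} {s : C.E.Sec P}
    (hs : InfForm e k f s) : C.symb u v ^ k • (fun _ => s) ∈ reducible (C := C) u v := by
  classical
  obtain ⟨⟨U, hU, hUe⟩, -⟩ := id he
  induction k generalizing f s with
  | zero =>
    rw [pow_zero, one_smul]
    refine ⟨0, Submodule.zero_mem _, _, Submodule.subset_span ⟨s, ?_, rfl⟩, Eventually.of_forall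
      fun z hz η => ?_⟩
    · refine (mem_holGerms_iff hUe hU).2 ⟨f, hs.1, ?_⟩
      filter_upwards [germEq_iff.1 hs.2] with z h1 hz
      rw [h1 hz]
      simp only [Nat.cast_zero, zpow_zero, one_mul, unif_infty]
      rfl
    · change _ = C.op _ _ 0 _ + _
      rw [op_zero, zero_add]
  | succ k ih =>
    let g : Fin r → C.E.Sec P := fun i => mulSec (fun z => z ^ (k + 1)) (res P (e i))
    have hg : ∀ i, InfForm e ((k : ℤ) + 1) (fun j _ => if j = i then 1 else 0) (g i) := fun i =>
      ⟨fun j => analyticAt_const, germEq_iff.2 (Eventually.of_forall fun z hz => by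
        simp only [mulSec_apply, mul_ite, mul_one, mul_zero, ite_smul, zero_smul, g,
          Finset.sum_ite_eq', Finset.mem_univ, if_true]
        norm_cast)⟩
    have hρ : ∀ i, ∃ f', InfForm e k f' (C.D (g i) - C.α i • g i) := fun i => by
      refine ⟨_, (((hg i).der he).sub ((hg i).smul (C.α i))).lower fun j => ?_⟩
      by_cases hj : j = i <;> simp [infDer, hj]
    have hρ' : ∃ f', InfForm e k f' (s - ∑ i, f i 0 • g i) := by
      have h1 : InfForm e ((k : ℤ) + 1) (fun i _ => f i 0) (∑ i, f i 0 • g i) :=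
        ⟨fun j => analyticAt_const, germEq_iff.2 (Eventually.of_forall fun z hz => by
          simp only [Finset.sum_apply, Pi.smul_apply, mulSec_apply, g, smul_smul]
          refine Finset.sum_congr rfl fun i _ => ?_
          rw [mul_comm]
          norm_cast)⟩
      have h2 : InfForm e ((k : ℤ) + 1) f s := by exact_mod_cast hs
      exact ⟨_, (h2.sub h1).lower fun j => sub_self _⟩
    -- The leading coefficient times all the factors of `symb` except the one with index `i`, which
    -- the identity for `g i` supplies.
    let a : Fin r → anaAlg η₀ := fun i => f i 0 • ∏ l ∈ Finset.univ.erase i, (C.α l • u - v)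
    have key : C.symb u v • (fun _ : ℂ => s) =
        ∑ i, (a i • (fun η => C.op (u.1 η) (v.1 η) (g i)) -
          (a i * u) • (fun _ => C.D (g i) - C.α i • g i)) +
        C.symb u v • (fun _ => s - ∑ i, f i 0 • g i) := by
      have h1 : ∀ i, a i • (fun η => C.op (u.1 η) (v.1 η) (g i)) -
          (a i * u) • (fun _ => C.D (g i) - C.α i • g i) =
          C.symb u v • (fun _ : ℂ => f i 0 • g i) := fun i => by
        have h2 : C.symb u v = (C.α i • u - v) *
            ∏ l ∈ Finset.univ.erase i, (C.α l • u - v) :=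
          (Finset.mul_prod_erase _ _ (Finset.mem_univ i)).symm
        funext η
        have h3 : (C.symb u v).1 η = (C.α i * u.1 η - v.1 η) *
          (∏ l ∈ Finset.univ.erase i, (C.α l • u - v)).1 η := by rw [h2]; rfl
        change (f i 0 * (∏ l ∈ Finset.univ.erase i, (C.α l • u - v)).1 η) •
            (u.1 η • C.D (g i) - v.1 η • g i) -
          (f i 0 * (∏ l ∈ Finset.univ.erase i, (C.α l • u - v)).1 η * u.1 η) •
            (C.D (g i) - C.α i • g i) = (C.symb u v).1 η • (f i 0 • g i)
        rw [h3]
        module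
      rw [Finset.sum_congr rfl fun i _ => h1 i, ← Finset.smul_sum, ← smul_add]
      congr 1
      funext η
      simp
    have hgm : ∀ i, g i ∈ C.E.merGerms P OnePoint.infty := fun i =>
      InfForm.mer (k := k + 1) hU hUe (by exact_mod_cast hg i)
    rw [pow_succ, mul_smul, key, smul_add, Finset.smul_sum]
    refine Submodule.add_mem _ (Submodule.sum_mem _ fun i _ => ?_) ?_
    · rw [smul_sub, ← mul_smul, ← mul_smul]
      refine Submodule.sub_mem _ (Submodule.smul_mem _ _ (op_mem_reducible (hgm i))) ?_
      obtain ⟨f', hf'⟩ := hρ i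
      rw [mul_comm, mul_smul]
      exact Submodule.smul_mem _ _ (ih hf')
    · obtain ⟨f', hf'⟩ := hρ'
      rw [← mul_smul, mul_comm, mul_smul]
      exact Submodule.smul_mem _ _ (ih hf')

/-! ### Forms -/

theorem form_sum {x : CP1} {n : ℕ} {s : Fin n → C.E.Sec P} (a : Fin n → ℂ)
    (hs : ∀ k, s k ∈ C.formGerms x) : ∑ k, a k • s k ∈ C.formGerms x := by
  refine ⟨fun hx => ?_, fun p hx => ?_⟩
  · refine holGerms_congr (holGerms_sum (f := fun k _ => a k) (fun k => (hs k).1 hx)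
      fun k => analyticAt_const) (Eventually.of_forall fun z hz => ?_)
    simp [Finset.sum_apply]
  · choose σ hσ h hr using fun k => (hs k).2 p hx
    refine ⟨fun y => ∑ k, a k • σ k y, isHol_sum (f := fun k _ => a k) hσ
      (fun k => HolAt.const _ _), germEq_iff.2 ?_, Submodule.sum_mem _ fun k _ =>
        Submodule.smul_mem _ _ (hr k)⟩
    filter_upwards [eventually_all.2 fun k => germEq_iff.1 (h k)] with z hz hP
    simp only [mulSec_apply, Finset.sum_apply, Pi.smul_apply, Finset.smul_sum, ← hz _ hP]
    exact Finset.sum_congr rfl fun k _ => smul_comm _ _ _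

theorem form_zero {x : CP1} : (0 : C.E.Sec P) ∈ C.formGerms x := by
  simpa using form_sum (n := 0) (x := x) (s := fun _ => (0 : C.E.Sec P)) (fun _ => 0)
    fun k => k.elim0

theorem form_smul {x : CP1} {s : C.E.Sec P} (a : ℂ) (hs : s ∈ C.formGerms x) :
    a • s ∈ C.formGerms x := by
  simpa using form_sum (n := 1) (fun _ => a) fun _ => hs

theorem form_add {x : CP1} {s t : C.E.Sec P} (hs : s ∈ C.formGerms x) (ht : t ∈ C.formGerms x) :
    s + t ∈ C.formGerms x := by
  simpa [Fin.sum_univ_two] using form_sum (n := 2) (s := ![s, t]) (fun _ => 1)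
    (fun k => by fin_cases k <;> assumption)

theorem form_of_hol {x : CP1} {s : C.E.Sec P} (hs : s ∈ C.E.holGerms P x) : s ∈ C.formGerms x := by
  refine ⟨fun _ => hs, fun p hx => ?_⟩
  subst hx
  obtain ⟨σ, hσ, h⟩ := hs
  obtain ⟨f, hf, hf0, hfz⟩ := exists_holAt ((p : ℂ) : CP1) (g := fun t => t) analyticAt_id
  refine ⟨fun y => f y • σ y, ?_, germEq_iff.2 ?_, ?_⟩
  · simpa using isHol_sum (n := 1) (s := fun _ => σ) (f := fun _ => f) (fun _ => hσ) fun _ => hf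
  · filter_upwards [germEq_iff.1 h] with z hz hP
    rw [mulSec_apply, hz hP]
    change _ = f z • _
    rw [hfz, unif_coe]
  · change f _ • σ _ ∈ _
    rw [hf0, zero_smul]
    exact Submodule.zero_mem _

end MeroConnection

end MinLaplace

namespace MinLaplace

open Filter Set HolBundle

universe u

namespace MeroConnection

variable {r : ℕ} {P : Finset ℂ} {C : MeroConnection.{u} r P} {η₀ : ℂ}

/-! ### Families of cocycles of the complexes `E → F` -/

theorem IsCocycleFamily.add {d : ℂ → C.E.Sec P → C.E.Sec P} {u v : ℂ → ℂ}
    (hd : d = fun η => C.op (u η) (v η)) {U U' : CP1 → Set CP1} {V V' : Set ℂ} {c c' : ℂ → C.Cochain}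
    (h : C.IsCocycleFamily (C.E.holGerms P) C.formGerms d U V c)
    (h' : C.IsCocycleFamily (C.E.holGerms P) C.formGerms d U' V' c') :
    C.IsCocycleFamily (C.E.holGerms P) C.formGerms d (fun x => U x ∩ U' x) (V ∩ V') (c + c') := by
  subst hd
  refine ⟨fun η hη => ?_, fun x q hq η hη => (h.2.1 x q hq.1 η hη.1).add (h'.2.1 x q hq.2 η hη.2),
    fun x y q hq η hη => (h.2.2 x y q ⟨hq.1.1, hq.2.1⟩ η hη.1).add
      (h'.2.2 x y q ⟨hq.1.2, hq.2.2⟩ η hη.2)⟩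
  obtain ⟨h1, h2, h3, h4, h5⟩ := h.1 η hη.1
  obtain ⟨h1', h2', h3', h4', h5'⟩ := h'.1 η hη.2
  refine ⟨fun x => ⟨(h1 x).1.inter (h1' x).1, (h1 x).2, (h1' x).2⟩,
    fun x q hq => form_add (h2 x q hq.1) (h2' x q hq.2),
    fun x y q hq => holGerms_add (h3 x y q ⟨hq.1.1, hq.2.1⟩) (h3' x y q ⟨hq.1.2, hq.2.2⟩),
    fun x y w z hz => ?_, fun x y z hz => ?_⟩
  · have e := h4 x y w z ⟨⟨hz.1.1.1, hz.1.2.1⟩, hz.2.1⟩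
    have e' := h4' x y w z ⟨⟨hz.1.1.2, hz.1.2.2⟩, hz.2.2⟩
    simp only [Pi.add_apply, Prod.snd_add, ← e, ← e']
    abel
  · have hz1 : z.pt ∈ U x ∩ U y := ⟨hz.1.1, hz.2.1⟩
    have hz2 : z.pt ∈ U' x ∩ U' y := ⟨hz.1.2, hz.2.2⟩
    have := op_add (u := u η) (v := v η) (h3 x y _ hz1) (h3' x y _ hz2)
    simp only [Pi.add_apply, Prod.snd_add, Prod.fst_add, this, h5 x y z hz1, h5' x y z hz2]
    abel

theorem IsCocycleFamily.smul {d : ℂ → C.E.Sec P → C.E.Sec P} {u v : ℂ → ℂ}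
    (hd : d = fun η => C.op (u η) (v η)) {U : CP1 → Set CP1} {V : Set ℂ} {c : ℂ → C.Cochain}
    (h : C.IsCocycleFamily (C.E.holGerms P) C.formGerms d U V c) (a : ℂ → ℂ) :
    C.IsCocycleFamily (C.E.holGerms P) C.formGerms d U (V ∩ {η | AnalyticAt ℂ a η})
      (fun η => a η • c η) := by
  subst hd
  refine ⟨fun η hη => ?_, fun x q hq η hη => (h.2.1 x q hq η hη.1).smul hη.2,
    fun x y q hq η hη => (h.2.2 x y q hq η hη.1).smul hη.2⟩
  obtain ⟨h1, h2, h3, h4, h5⟩ := h.1 η hη.1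
  refine ⟨h1, fun x q hq => form_smul _ (h2 x q hq), fun x y q hq => holGerms_smul _ (h3 x y q hq),
    fun x y w z hz => ?_, fun x y z hz => ?_⟩
  · simp only [Prod.smul_snd, Pi.smul_apply, ← h4 x y w z hz, smul_add]
  · have := op_smul (u := u η) (v := v η) (a η) (h3 x y _ hz)
    simp only [Prod.smul_snd, Prod.smul_fst, Pi.smul_apply, this, h5 x y z hz, smul_sub]

namespace DSubmodule

variable {N : C.DSubmodule}

theorem isCoboundary_add {u v : ℂ} {U U' : CP1 → Set CP1} {c c' : C.Cochain}
    (h : C.IsCoboundary N.germs (C.op u v) U c) (h' : C.IsCoboundary N.germs (C.op u v) U' c') :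
    C.IsCoboundary N.germs (C.op u v) (fun x => U x ∩ U' x) (c + c') := by
  obtain ⟨h1, g, h2, h3, h4⟩ := h
  obtain ⟨h1', g', h2', h3', h4'⟩ := h'
  refine ⟨fun x => ⟨(h1 x).1.inter (h1' x).1, (h1 x).2, (h1' x).2⟩, g + g',
    fun x q hq => (N.stalk q).add_mem (h2 x q hq.1) (h2' x q hq.2),
    fun x z hz => ?_, fun x y z hz => ?_⟩
  · have := op_add (u := u) (v := v) (N.hol_of_mem (h2 x _ hz.1)) (N.hol_of_mem (h2' x _ hz.2))
    simp only [Prod.fst_add, Pi.add_apply, this, h3 x z hz.1, h3' x z hz.2]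
  · simp only [Prod.snd_add, Pi.add_apply, h4 x y z ⟨hz.1.1, hz.2.1⟩, h4' x y z ⟨hz.1.2, hz.2.2⟩]
    abel

theorem isCoboundary_smul {u v : ℂ} {U : CP1 → Set CP1} {c : C.Cochain} (a : ℂ)
    (h : C.IsCoboundary N.germs (C.op u v) U c) :
    C.IsCoboundary N.germs (C.op u v) U (a • c) := by
  obtain ⟨h1, g, h2, h3, h4⟩ := h
  refine ⟨h1, a • g, fun x q hq => (N.stalk q).smul_mem a (h2 x q hq),
    fun x z hz => ?_, fun x y z hz => ?_⟩
  · have := op_smul (u := u) (v := v) a (N.hol_of_mem (h2 x _ hz))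
    simp only [Prod.smul_fst, Pi.smul_apply, this, h3 x z hz]
  · simp only [Prod.smul_snd, Pi.smul_apply, h4 x y z hz, smul_sub]

/-- The cochain given by a global section in degree one. -/
def globalCochain (m : N.globalSections) : C.Cochain := (fun _ => (m : C.E.Sec P), 0)

variable (N) in
/-- The families of global sections that are, near the parameter `η₀`, cohomologous to
holomorphic families of cocycles of the complexes `u ∇ - v dx : E → F`. -/
def representable (u v : anaAlg η₀) : Submodule (anaAlg η₀) (ℂ → N.globalSections) where
  carrier := {F | ∃ V ∈ 𝓝 η₀, ∃ U c,
    C.IsCocycleFamily (C.E.holGerms P) C.formGerms (fun η => C.op (u.1 η) (v.1 η)) U V c ∧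
    ∀ η ∈ V, ∃ U', C.IsCoboundary N.germs (C.op (u.1 η) (v.1 η)) U' (c η - globalCochain (F η))}
  zero_mem' := by
    refine ⟨univ, univ_mem, fun _ => univ, 0, ⟨fun η _ => ⟨fun _ => ⟨isOpen_univ, trivial⟩,
      fun _ q _ => form_zero, fun _ _ q _ => holGerms_zero, fun _ _ _ _ _ => add_zero _,
      fun _ _ z _ => (op_zero _ _ z).trans (sub_zero _).symm⟩, fun x q _ η _ => HolFamily.zero,
      fun x y q _ η _ => HolFamily.zero⟩, fun η _ => ⟨fun _ => univ,
      fun _ => ⟨isOpen_univ, trivial⟩, 0, fun x q _ => (N.stalk q).zero_mem, fun x z _ => ?_,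
      fun x y z _ => ?_⟩⟩
    · exact (sub_zero (0 : C.E.Fib z.pt)).trans (op_zero _ _ z).symm
    · rfl
  add_mem' := by
    rintro F F' ⟨V, hV, U, c, hc, h⟩ ⟨V', hV', U', c', hc', h'⟩
    refine ⟨V ∩ V', inter_mem hV hV', _, _, hc.add rfl hc', fun η hη => ?_⟩
    obtain ⟨U₁, h₁⟩ := h η hη.1
    obtain ⟨U₂, h₂⟩ := h' η hη.2
    have h3 := isCoboundary_add h₁ h₂
    have h4 : c η - globalCochain (F η) + (c' η - globalCochain (F' η)) =
        (c + c') η - globalCochain ((F + F') η) := by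
      have h5 : globalCochain ((F + F') η) = globalCochain (F η) + globalCochain (F' η) :=
        Prod.ext rfl (add_zero _).symm
      rw [h5, Pi.add_apply]
      abel
    rw [← h4]
    exact ⟨_, h3⟩
  smul_mem' := by
    rintro a F ⟨V, hV, U, c, hc, h⟩
    refine ⟨_, inter_mem hV a.2.eventually_analyticAt, _, _, hc.smul rfl a.1, fun η hη => ?_⟩
    obtain ⟨U₁, h₁⟩ := h η hη.1
    refine ⟨U₁, ?_⟩
    have h3 := isCoboundary_smul (a.1 η) h₁
    have h5 : globalCochain ((a • F) η) = a.1 η • globalCochain (F η) :=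
      Prod.ext rfl (smul_zero _).symm
    rw [h5, ← smul_sub]
    exact h3

variable {u v : anaAlg η₀}

theorem representable_congr {F F' : ℂ → N.globalSections} (h : F ∈ N.representable u v)
    (hF : ∀ᶠ η in 𝓝 η₀, F η = F' η) : F' ∈ N.representable u v := by
  obtain ⟨V, hV, U, c, hc, h⟩ := h
  exact ⟨V ∩ {η | F η = F' η}, inter_mem hV hF, U, c, ⟨fun η hη => hc.1 η hη.1,
    fun x q hq η hη => hc.2.1 x q hq η hη.1, fun x y q hq η hη => hc.2.2 x y q hq η hη.1⟩,
    fun η hη => by have := h η hη.1; rwa [hη.2] at this⟩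

/-- Adding a global section in the image of the operators does not change the class. -/
theorem representable_add_op {F : ℂ → N.globalSections} (h : F ∈ N.representable u v)
    (G : ℂ → N.globalSections) :
    (fun η => F η + (u.1 η • N.dx (G η) - v.1 η • G η)) ∈ N.representable u v := by
  obtain ⟨V, hV, U, c, hc, h⟩ := h
  refine ⟨V, hV, U, c, hc, fun η hη => ?_⟩
  obtain ⟨U₁, h1, g, h2, h3, h4⟩ := h η hη
  refine ⟨U₁, h1, fun x => g x - G η, fun x q hq => (N.stalk q).sub_mem (h2 x q hq)
    (N.mem_stalk_of_global _ q), fun x z hz => ?_, fun x y z hz => ?_⟩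
  · have h5 := h3 x z hz
    rw [op_sub (N.hol_of_mem (h2 x _ hz)) (N.hol_of_mem (N.mem_stalk_of_global _ _)), ← h5]
    change (c η).1 x z - ((F η : C.E.Sec P) z + (C.op (u.1 η) (v.1 η) (G η) z)) =
      (c η).1 x z - (F η : C.E.Sec P) z - _
    abel
  · exact (h4 x y z hz).trans (sub_sub_sub_cancel_right _ _ _).symm

/-- Sections that are holomorphic on the affine line are representable, up to a factor. -/
theorem representable_of_hol (hC : C.ResonanceFree) (hN : N.IsFull) (m : N.globalSections)
    (hm : ∀ x : ℂ, (m : C.E.Sec P) ∈ C.E.holGerms P (x : CP1)) (u v : anaAlg η₀) :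
    ∃ k : ℕ, C.symb u v ^ k • (fun _ => m) ∈ N.representable u v := by
  classical
  obtain ⟨e, B, he⟩ := C.exists_isIrr
  obtain ⟨⟨Ue, hUe, hframe⟩, -⟩ := id he
  obtain ⟨k, f, hf⟩ := exists_infForm hUe hframe (N.global_mer m OnePoint.infty)
  obtain ⟨G, hG, F, hF, hGF⟩ := reducible_of_infForm he u v k hf
  obtain ⟨n, g, a, hg, ha, hGa⟩ := exists_sum_of_tame hG
  obtain ⟨n', g', a', hg', ha', hFa⟩ := exists_sum_of_tame hF
  have hGmer : ∀ η, G η ∈ N.stalk OnePoint.infty := fun η => by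
    rw [hGa]
    exact Submodule.sum_mem _ fun i _ => Submodule.smul_mem _ _ (hN.mer hC (hg i))
  obtain ⟨W, hW, hWe⟩ : ∃ W ∈ 𝓝 OnePoint.infty, ∀ q ∈ W,
      (∀ z : ℂ, q = (z : CP1) → z ∉ P ∧ ∀ i, g i ∈ C.E.holGerms P (z : CP1)) := by
    have h1 : ∀ᶠ z in nf OnePoint.infty, z ∉ P ∧ ∀ i, g i ∈ C.E.holGerms P (z : CP1) := by
      filter_upwards [eventually_infty_notMem P, eventually_all.2 fun i => merGerms_near (hg i)]
        with z h1 h2 using ⟨h1, fun i => h2 i h1⟩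
    obtain ⟨W, hW, h⟩ := (mem_comap).1 h1
    exact ⟨W, hW, fun q hq z hz => h (by rw [mem_preimage]; exact hz ▸ hq)⟩
  obtain ⟨W₁, hW₁, hWeq⟩ := exists_nhds_iff_nf (p := fun z => ∀ η, (C.symb u v ^ k • fun _ =>
    (m : C.E.Sec P)) η z = C.op (u.1 η) (v.1 η) (G η) z + F η z) |>.2 hGF
  have hW₂ := eventually_all.2 fun i => holGerms_eventually (hg' i)
  obtain ⟨O, hOs, hOo, hO⟩ := mem_nhds_iff.1 (inter_mem (inter_mem hW hW₁) hW₂)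
  have hOG : ∀ z : ℂ, (z : CP1) ∈ O → ∀ i, g i ∈ C.E.holGerms P (z : CP1) := fun z hz =>
    (hWe _ (hOs hz).1.1 z rfl).2
  have hGhol : ∀ z : ℂ, (z : CP1) ∈ O → ∀ η, G η ∈ C.E.holGerms P (z : CP1) := fun z hz η => by
    rw [hGa]
    refine holGerms_congr (holGerms_sum (f := fun i _ => a i η) (hOG z hz)
      fun _ => analyticAt_const) (Eventually.of_forall fun w hw => ?_)
    simp [Finset.sum_apply]
  let δ : anaAlg η₀ := C.symb u v ^ k
  -- Two sets suffice: a neighbourhood `O` of infinity, on which the pole has been reduced, and the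
  -- affine line, on which `m` is holomorphic already.
  let U : CP1 → Set CP1 := fun x => if x = OnePoint.infty then O else {OnePoint.infty}ᶜ
  have hU : ∀ x, IsOpen (U x) ∧ x ∈ U x := fun x => by
    by_cases hx : x = OnePoint.infty
    · simp only [U, if_pos hx]; exact ⟨hOo, hx ▸ hO⟩
    · simp only [U, if_neg hx]; exact ⟨isOpen_compl_singleton, hx⟩
  have hUinf : U OnePoint.infty = O := if_pos rfl
  have hUfin : ∀ {x q : CP1}, x ≠ OnePoint.infty → q ∈ U x → q ≠ OnePoint.infty := fun hx hq => by
    simp only [U, if_neg hx] at hq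
    exact hq
  let γ : ℂ → CP1 → C.E.Sec P := fun η x => if x = OnePoint.infty then -G η else 0
  have hγ : ∀ η x (z : ℂ), (z : CP1) ∈ U x → γ η x ∈ C.E.holGerms P (z : CP1) := fun η x z hz => by
    by_cases hx : x = OnePoint.infty
    · simp only [γ, if_pos hx]
      rw [← neg_one_smul ℂ]
      exact holGerms_smul _ (hGhol z (by simpa only [U, if_pos hx] using hz) η)
    · simp only [γ, if_neg hx]; exact holGerms_zero
  have hγN : ∀ η x, ∀ q ∈ U x, γ η x ∈ N.stalk q := fun η x q hq => by
    induction q using OnePoint.rec with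
    | coe z => exact hN.hol hC (hγ η x z hq)
    | infty =>
      by_cases hx : x = OnePoint.infty
      · simp only [γ, if_pos hx]; exact Submodule.neg_mem _ (hGmer η)
      · simp only [γ, if_neg hx]; exact Submodule.zero_mem _
  -- The section `δ • m` is changed by the coboundary of `γ`, that is, of `-G` on `O` and zero on
  -- the affine line. On `O` the degree-one part becomes the holomorphic family `F`, so the cocycle
  -- takes values in `E → F`. As `G` is meromorphic at infinity, it lies in `N`, and the class in
  -- the hypercohomology of `N` is unchanged.
  let c : ℂ → C.Cochain := fun η =>
    (fun x => δ.1 η • (m : C.E.Sec P) + C.op (u.1 η) (v.1 η) (γ η x), fun x y => γ η y - γ η x)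
  have hcinf : ∀ η, ∀ z : Punct P, z.pt ∈ O →
      (c η).1 OnePoint.infty z = ∑ i, a' i η • g' i z := fun η z hz => by
    have h1 := hWeq z (hOs hz).1.2 η
    have h2 : C.op (u.1 η) (v.1 η) (-G η) z = -C.op (u.1 η) (v.1 η) (G η) z := by
      rw [← neg_one_smul ℂ, op_smul _ (hGhol z hz η), neg_one_smul]
    have h3 : F η z = ∑ i, a' i η • g' i z := by rw [hFa]; simp [Finset.sum_apply]
    rw [← h3]
    change δ.1 η • (m : C.E.Sec P) z + C.op _ _ (γ η OnePoint.infty) z = _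
    change δ.1 η • (m : C.E.Sec P) z = _ at h1
    simp only [γ, if_true]
    rw [h2, h1]
    abel
  have hcfin : ∀ η x, x ≠ OnePoint.infty → (c η).1 x = δ.1 η • (m : C.E.Sec P) := fun η x hx => by
    funext z
    change δ.1 η • (m : C.E.Sec P) z + C.op _ _ (γ η x) z = _
    simp only [γ, if_neg hx]
    rw [op_zero, add_zero]
    rfl
  refine ⟨k, {η | (∀ i, AnalyticAt ℂ (a i) η) ∧ (∀ i, AnalyticAt ℂ (a' i) η) ∧
    AnalyticAt ℂ δ.1 η}, ?_, U, c, ⟨fun η _ => ⟨hU, fun x q hq => ?_, fun x y q hq => ?_,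
      fun x y w z hz => ?_, fun x y z hz => ?_⟩, fun x q hq η hη => ?_, fun x y q hq η hη => ?_⟩,
      fun η _ => ⟨U, hU, γ η, hγN η, fun x z hz => ?_, fun x y z hz => ?_⟩⟩
  · filter_upwards [eventually_all.2 fun i => (ha i).eventually_analyticAt,
      eventually_all.2 fun i => (ha' i).eventually_analyticAt, δ.2.eventually_analyticAt]
      with η h1 h2 h3 using ⟨h1, h2, h3⟩
  · by_cases hx : x = OnePoint.infty
    · subst hx
      have hq : q ∈ O := hUinf ▸ hq
      refine form_of_hol (holGerms_congr (holGerms_sum (f := fun i _ => a' i η) (hOs hq).2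
        fun _ => analyticAt_const) ?_)
      filter_upwards [eventually_nf_of_nhds (hOo.mem_nhds hq)] with w hw hP
      exact (hcinf η ⟨w, hP⟩ hw).symm
    · rw [hcfin η x hx]
      obtain ⟨z, rfl⟩ := OnePoint.ne_infty_iff_exists.1 (hUfin hx hq)
      exact form_of_hol (holGerms_smul _ (hm z))
  · by_cases hq' : q = OnePoint.infty
    · subst hq'
      have hx : x = OnePoint.infty := by_contra fun h => hUfin h hq.1 rfl
      have hy : y = OnePoint.infty := by_contra fun h => hUfin h hq.2 rfl
      subst hx hy
      change γ η _ - γ η _ ∈ _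
      rw [sub_self]
      exact holGerms_zero
    · obtain ⟨z, rfl⟩ := OnePoint.ne_infty_iff_exists.1 hq'
      change γ η y - γ η x ∈ _
      rw [sub_eq_add_neg, ← neg_one_smul ℂ]
      exact holGerms_add (hγ η y z hq.2) (holGerms_smul _ (hγ η x z hq.1))
  · change γ η y z - γ η x z + (γ η w z - γ η y z) = γ η w z - γ η x z
    abel
  · change C.op _ _ (γ η y - γ η x) z = (δ.1 η • (m : C.E.Sec P) z + C.op _ _ (γ η y) z) -
      (δ.1 η • (m : C.E.Sec P) z + C.op _ _ (γ η x) z)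
    rw [op_sub (hγ η y z hz.2) (hγ η x z hz.1)]
    abel
  · by_cases hx : x = OnePoint.infty
    · subst hx
      have hq : q ∈ O := hUinf ▸ hq
      exact HolFamily.of_sum (fun i => form_of_hol ((hOs hq).2 i)) hη.2.1
        ⟨O, hOo.mem_nhds hq, fun z hz η => hcinf η z hz⟩
    · obtain ⟨z, rfl⟩ := OnePoint.ne_infty_iff_exists.1 (hUfin hx hq)
      have h1 : (fun η => (c η).1 x) = fun η => δ.1 η • (m : C.E.Sec P) :=
        funext fun η => hcfin η x hx
      rw [h1]
      exact (HolFamily.const (form_of_hol (hm z))).smul hη.2.2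
  · by_cases hx : x = OnePoint.infty
    · by_cases hy : y = OnePoint.infty
      · subst hx hy
        have h1 : (fun η => (c η).2 OnePoint.infty OnePoint.infty) = 0 :=
          funext fun η => sub_self _
        rw [h1]
        exact HolFamily.zero
      · obtain ⟨z, rfl⟩ := OnePoint.ne_infty_iff_exists.1 (hUfin hy hq.2)
        subst hx
        have hq : (z : CP1) ∈ O := hUinf ▸ hq.1
        refine HolFamily.of_sum (hOG z hq) hη.1 ⟨univ, univ_mem, fun w _ η => ?_⟩
        change γ η y w - γ η OnePoint.infty w = _
        simp only [γ, if_neg hy, if_true, hGa]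
        simp [Finset.sum_apply]
    · by_cases hy : y = OnePoint.infty
      · obtain ⟨z, rfl⟩ := OnePoint.ne_infty_iff_exists.1 (hUfin hx hq.1)
        subst hy
        have hq : (z : CP1) ∈ O := hUinf ▸ hq.2
        refine HolFamily.of_sum (f := fun i η => -a i η) (hOG z hq) (fun i => (hη.1 i).fun_neg)
          ⟨univ, univ_mem, fun w _ η => ?_⟩
        change γ η OnePoint.infty w - γ η x w = _
        simp only [γ, if_neg hx, if_true, hGa]
        simp [Finset.sum_apply]
      · have h1 : (fun η => (c η).2 x y) = 0 := funext fun η => by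
          change γ η y - γ η x = 0
          simp only [γ, if_neg hx, if_neg hy, sub_self]
        rw [h1]
        exact HolFamily.zero
  · change δ.1 η • (m : C.E.Sec P) z + C.op _ _ (γ η x) z - δ.1 η • (m : C.E.Sec P) z = _
    abel
  · exact sub_zero _

end DSubmodule

end MeroConnection

end MinLaplace

/-! ### Comparison of the two meromorphic extensions and transport of the bundle structure. -/

namespace MinLaplace

open Filter Set HolBundle

universe u

namespace MeroConnection

variable {r : ℕ} {P : Finset ℂ} {C : MeroConnection.{u} r P} {η₀ : ℂ}

namespace DSubmodule

variable {N : C.DSubmodule}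

/-- The local parameter at `η₀`. -/
def param (η₀ : ℂ) : anaAlg η₀ := ⟨fun η => η - η₀, analyticAt_id.sub analyticAt_const⟩

/-- All global sections are representable, up to powers of the local parameter. -/
theorem exists_representable (hC : C.ResonanceFree) (hN : N.IsMinimalExtension) (u v : anaAlg η₀)
    (hu : ∃ j : ℕ, u = param η₀ ^ j) (hs : ¬ ∀ᶠ η in 𝓝 η₀, (C.symb u v).1 η = 0)
    (m : N.globalSections) : ∃ k : ℕ, param η₀ ^ k • (fun _ => m) ∈ N.representable u v := by
  obtain ⟨ε, hε⟩ := exists_global_frame C.E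
  have hε : C.E.IsGlobalFrame ε := hε
  obtain ⟨j, rfl⟩ := hu
  let W : Submodule ℂ N.globalSections :=
    { carrier := {m | ∃ k : ℕ, param η₀ ^ k • (fun _ => m) ∈ N.representable (param η₀ ^ j) v}
      zero_mem' := ⟨0, by
        have : (fun _ : ℂ => (0 : N.globalSections)) = 0 := rfl
        rw [this, smul_zero]
        exact Submodule.zero_mem _⟩
      add_mem' := by
        rintro a b ⟨k, hk⟩ ⟨l, hl⟩
        refine ⟨k + l, ?_⟩
        have h1 : (fun _ : ℂ => a + b) = (fun _ => a) + fun _ => b := rfl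
        rw [h1, smul_add, pow_add]
        refine Submodule.add_mem _ ?_ ?_
        · rw [mul_comm, mul_smul]; exact Submodule.smul_mem _ _ hk
        · rw [mul_smul]; exact Submodule.smul_mem _ _ hl
      smul_mem' := by
        rintro a m ⟨k, hk⟩
        refine ⟨k, ?_⟩
        have h1 : param η₀ ^ k • (fun _ : ℂ => a • m) =
            algebraMap ℂ (anaAlg η₀) a • param η₀ ^ k • fun _ : ℂ => m := by
          funext η
          change (param η₀ ^ k).1 η • a • m = a • (param η₀ ^ k).1 η • m
          exact smul_comm _ _ _
        rw [h1]
        exact Submodule.smul_mem _ _ hk }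
  -- By `eq_top_of_stable` two checks suffice. Polynomial sections are holomorphic on the affine
  -- line, so `representable_of_hol` applies, and `symb` is a power of the local parameter times a
  -- unit. For stability under the derivation, `u • D w` differs from `v • w` by an element in the
  -- image of the operator, and `u` is a power of the local parameter.
  have hW : W = ⊤ := by
    refine eq_top_of_stable hC hN hε W (fun q => ?_) fun w ⟨k, hk⟩ => ?_
    · obtain ⟨k, hk⟩ := representable_of_hol hC hN.1.isFull
        ⟨polySec P ε q, polySec_global hN.1.isFull hC hε q⟩ (polySec_hol hε q) (param η₀ ^ j) v
      obtain ⟨l, g, hg, hg0, hl⟩ :=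
        (C.symb (param η₀ ^ j) v).2.exists_eventuallyEq_pow_smul_nonzero_iff.2 hs
      have hgi : AnalyticAt ℂ (fun η => (g η)⁻¹ ^ k) η₀ := (hg.inv hg0).pow k
      refine ⟨l * k, representable_congr
        (Submodule.smul_mem _ (⟨_, hgi⟩ : anaAlg η₀) hk) ?_⟩
      filter_upwards [hl, hg.continuousAt.eventually_ne hg0] with η h1 h2
      change (g η)⁻¹ ^ k • (C.symb (param η₀ ^ j) v ^ k).1 η • (_ : N.globalSections) =
        (param η₀ ^ (l * k)).1 η • (_ : N.globalSections)
      change (g η)⁻¹ ^ k • (C.symb (param η₀ ^ j) v).1 η ^ k • (_ : N.globalSections) =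
        (η - η₀) ^ (l * k) • (_ : N.globalSections)
      rw [h1, smul_smul, ← mul_pow, smul_eq_mul, pow_mul]
      congr 2
      field_simp
    · refine ⟨j + k, ?_⟩
      have h1 := representable_add_op (Submodule.smul_mem _ v hk)
        fun η => (param η₀ ^ k).1 η • w
      refine representable_congr h1 (Eventually.of_forall fun η => ?_)
      change v.1 η • (param η₀ ^ k).1 η • w + ((param η₀ ^ j).1 η • N.dx ((param η₀ ^ k).1 η • w) -
        v.1 η • (param η₀ ^ k).1 η • w) = (param η₀ ^ (j + k)).1 η • N.dx w
      have h2 : (param η₀ ^ (j + k)).1 η = (param η₀ ^ j).1 η * (param η₀ ^ k).1 η := by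
        rw [pow_add]; rfl
      rw [h2, map_smul, add_sub_cancel, smul_smul]
  exact (hW ▸ Submodule.mem_top : m ∈ W)

theorem exists_representable_sum (hC : C.ResonanceFree) (hN : N.IsMinimalExtension)
    (u v : anaAlg η₀) (hu : ∃ j : ℕ, u = param η₀ ^ j)
    (hs : ¬ ∀ᶠ η in 𝓝 η₀, (C.symb u v).1 η = 0) {n : ℕ} (m : Fin n → N.globalSections)
    (f : Fin n → anaAlg η₀) : ∃ k : ℕ, param η₀ ^ k • ∑ i, f i • (fun _ => m i) ∈
      N.representable u v := by
  choose k hk using fun i => exists_representable hC hN u v hu hs (m i)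
  refine ⟨∑ i, k i, ?_⟩
  rw [Finset.smul_sum]
  refine Submodule.sum_mem _ fun i hi => ?_
  rw [smul_comm, ← Nat.sub_add_cancel (Finset.single_le_sum (f := k) (fun _ _ => Nat.zero_le _) hi),
    pow_add, mul_smul]
  exact Submodule.smul_mem _ _ (Submodule.smul_mem _ _ (hk i))

/-! ### The comparison of the extensions -/

/-- Here the operator is `∂/∂x - η`, and `symb` is `∏ (α l - η)`, which has isolated zeros; they are
absorbed by the power of the local parameter. -/
theorem hyperLatAt_of_laplaceLat (hC : C.ResonanceFree) (hN : N.IsMinimalExtension)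
    {s : ∀ ξ : Punct C.Phat, N.H1 ξ} {ξ₀ : ℂ}
    (h : N.LaplaceLat (fun ξ => fiberEquiv hC hN.1.isFull ξ (s ξ)) (ξ₀ : CP1)) :
    ∃ k : ℕ, N.HyperLatAt (fun ξ => unif (ξ₀ : CP1) ξ ^ k • s ξ) ξ₀ := by
  obtain ⟨n, m, f, hf, h⟩ := laplaceLat_iff.1 h
  rw [nf_coe] at h
  let F : Fin n → anaAlg ξ₀ := fun i => ⟨fun η => f i (η - ξ₀),
    AnalyticAt.fun_comp (g := f i) (f := fun η => η - ξ₀) (by simpa using hf i) (by fun_prop)⟩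
  let v : anaAlg ξ₀ := ⟨fun η => η, analyticAt_id⟩
  have hsymb : ¬ ∀ᶠ η in 𝓝 ξ₀, (C.symb 1 v).1 η = 0 := fun h0 => by
    have h1 : ∀ᶠ η in 𝓝[≠] ξ₀, η ∉ C.Phat := by
      have := (C.Phat.finite_toSet.subset (sdiff_subset (t := {ξ₀}))).isClosed.isOpen_compl.mem_nhds
        (x := ξ₀) (fun h => h.2 rfl)
      filter_upwards [nhdsWithin_le_nhds this, self_mem_nhdsWithin] with η h2 h3 h4
      exact h2 ⟨h4, h3⟩
    obtain ⟨η, h2, h3⟩ := (h1.and (h0.filter_mono nhdsWithin_le_nhds)).exists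
    have h4 : (C.symb 1 v).1 η = ∏ l, (C.α l - η) := by
      have h5 : (C.symb 1 v).1 = ∏ l, ((C.α l • (1 : anaAlg ξ₀) - v : anaAlg ξ₀) : ℂ → ℂ) :=
        map_prod (anaAlg ξ₀).val _ _
      rw [h5, Finset.prod_apply]
      exact Finset.prod_congr rfl fun l _ => by
        change C.α l * 1 - η = _
        rw [mul_one]
    rw [h4, Finset.prod_eq_zero_iff] at h3
    obtain ⟨l, -, hl⟩ := h3
    exact h2 (by
      classical
      rw [← sub_eq_zero.1 hl, Phat]
      exact Finset.mem_image_of_mem _ (Finset.mem_univ l))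
  obtain ⟨k, V, hV, U, c, hc, hcob⟩ := exists_representable_sum hC hN 1 v ⟨0, (pow_zero _).symm⟩
    hsymb m F
  have hd : (fun η => C.op ((1 : anaAlg ξ₀).1 η) (v.1 η)) = C.twist :=
    funext fun η => (C.twist_eq_op η).symm
  rw [hd] at hc
  refine ⟨k, _, inter_mem hV h, U, c, ⟨fun η hη => hc.1 η hη.1,
    fun x q hq η hη => hc.2.1 x q hq η hη.1, fun x y q hq η hη => hc.2.2 x y q hq η hη.1⟩,
    fun ξ hξ => ?_⟩
  obtain ⟨U', h1⟩ := hcob ξ hξ.1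
  rw [show C.op ((1 : anaAlg ξ₀).1 ξ) (v.1 ξ) = C.twist ξ from congrFun hd ξ] at h1
  have hcN := hc.mono (K₀' := N.germs) (K₁' := N.germs) (fun x _ hs => hN.1.isFull.hol hC hs)
    fun x _ hs => hN.1.isFull.form hC hs
  refine (hasClass_iff ⟨U, hcN.1 ξ hξ.1⟩ ⟨U', h1⟩).2 ?_
  have h2 := (fiberEquiv_eq_iff hC hN.1.isFull).1 (hξ.2 ξ.2)
  have h3 : (param ξ₀ ^ k • ∑ i, F i • (fun _ => m i)) (ξ : ℂ) =
      (ξ - ξ₀ : ℂ) ^ k • ∑ i, f i (ξ - ξ₀) • m i := by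
    change (ξ - ξ₀ : ℂ) ^ k • (∑ i, F i • (fun _ : ℂ => m i)) (ξ : ℂ) = _
    rw [Finset.sum_apply]
    rfl
  rw [h3, ← globalLin_apply, map_smul, globalLin_apply]
  exact congrArg _ h2

/-- For the operator `ζ ∂/∂x - 1` the function `symb` is `∏ (α l * ζ - 1)`, which does not vanish at
`ζ = 0`. -/
theorem hyperLatInf_of_laplaceLat (hC : C.ResonanceFree) (hN : N.IsMinimalExtension)
    {s : ∀ ξ : Punct C.Phat, N.H1 ξ}
    (h : N.LaplaceLat (fun ξ => fiberEquiv hC hN.1.isFull ξ (s ξ)) OnePoint.infty) :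
    ∃ k : ℕ, N.HyperLatInf (fun ξ => unif OnePoint.infty ξ ^ k • s ξ) := by
  obtain ⟨n, m, f, hf, h⟩ := laplaceLat_iff.1 h
  let F : Fin n → anaAlg (0 : ℂ) := fun i => ⟨f i, hf i⟩
  have hsymb : ¬ ∀ᶠ η in 𝓝 0, (C.symb (param 0) 1).1 η = 0 := fun h0 => by
    have h3 := h0.self_of_nhds
    have h5 : (C.symb (param 0) 1).1 =
        ∏ l, ((C.α l • param 0 - 1 : anaAlg (0 : ℂ)) : ℂ → ℂ) :=
      map_prod (anaAlg (0 : ℂ)).val _ _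
    rw [h5, Finset.prod_apply, Finset.prod_eq_zero_iff] at h3
    obtain ⟨l, -, hl⟩ := h3
    change C.α l * (0 - 0) - 1 = 0 at hl
    simp at hl
  obtain ⟨k, hk⟩ := exists_representable_sum hC hN (param 0) 1 ⟨1, (pow_one _).symm⟩ hsymb m F
  -- The additional factor `ζ` cancels the factor `ξ` by which the degree-one part is multiplied in
  -- the identification of the two complexes.
  obtain ⟨V, hV, U, c, hc, hcob⟩ := Submodule.smul_mem _ (param 0) hk
  have hd : (fun η => C.op ((param 0).1 η) ((1 : anaAlg (0 : ℂ)).1 η)) = C.twistInf :=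
    funext fun η => by
      rw [twistInf_eq_op]
      change C.op (η - 0) 1 = _
      rw [sub_zero]
  rw [hd] at hc
  have hev : ∀ᶠ t in 𝓝 (0 : ℂ), t ≠ 0 → ∀ hP : t⁻¹ ∉ C.Phat,
      fiberEquiv hC hN.1.isFull t⁻¹ (s ⟨t⁻¹, hP⟩) = ∑ i, f i t • N.laplaceClass t⁻¹ (m i) := by
    rw [nf_infty] at h
    have h1 : Tendsto (fun t : ℂ => t⁻¹) (𝓝[≠] 0) (Bornology.cobounded ℂ) :=
      Filter.tendsto_inv₀_nhdsNE_zero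
    have h2 := eventually_nhdsWithin_iff.1 (h1.eventually h)
    filter_upwards [h2] with t ht h0 hP
    have h3 := ht h0 hP
    rwa [unif_infty, inv_inv] at h3
  refine ⟨k, _, inter_mem hV hev, U, c, ⟨fun η hη => hc.1 η hη.1,
    fun x q hq η hη => hc.2.1 x q hq η hη.1, fun x y q hq η hη => hc.2.2 x y q hq η hη.1⟩,
    fun ξ h0 hξ => ?_⟩
  obtain ⟨U', h1⟩ := hcob _ hξ.1
  rw [show C.op ((param 0).1 (ξ : ℂ)⁻¹) ((1 : anaAlg (0 : ℂ)).1 (ξ : ℂ)⁻¹) =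
    C.twistInf (ξ : ℂ)⁻¹ from congrFun hd _] at h1
  have hcN := hc.mono (K₀' := N.germs) (K₁' := N.germs) (fun x _ hs => hN.1.isFull.hol hC hs)
    fun x _ hs => hN.1.isFull.form hC hs
  refine (hasClass_iff (IsCocycle.of_twistInf h0 (hcN.1 _ hξ.1)) (coboundary_of_twistInf h0 h1)).2 ?_
  have h2 : s ξ = N.globalClass ξ (∑ i, f i (ξ : ℂ)⁻¹ • m i) := by
    have h4 : ∀ w : ℂ, w = ξ → ∀ hw : w ∉ C.Phat,
        fiberEquiv hC hN.1.isFull w (s ⟨w, hw⟩) = ∑ i, f i (ξ : ℂ)⁻¹ • N.laplaceClass w (m i) →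
        fiberEquiv hC hN.1.isFull ξ (s ξ) = ∑ i, f i (ξ : ℂ)⁻¹ • N.laplaceClass ξ (m i) := by
      rintro w rfl hw h; exact h
    have hi := inv_inv (ξ : ℂ)
    have h5 : (ξ : ℂ)⁻¹⁻¹ ∉ C.Phat := by rw [hi]; exact ξ.2
    exact (fiberEquiv_eq_iff hC hN.1.isFull).1
      (h4 _ hi h5 (hξ.2 (inv_ne_zero h0) h5))
  have h3 : (ξ : ℂ) • (param 0 • param 0 ^ k • ∑ i, F i • (fun _ => m i)) (ξ : ℂ)⁻¹ =
      (ξ : ℂ)⁻¹ ^ k • ∑ i, f i (ξ : ℂ)⁻¹ • m i := by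
    change (ξ : ℂ) • ((ξ : ℂ)⁻¹ - 0) • ((ξ : ℂ)⁻¹ - 0) ^ k •
      (∑ i, F i • (fun _ : ℂ => m i)) (ξ : ℂ)⁻¹ = _
    rw [sub_zero, smul_inv_smul₀ h0, Finset.sum_apply]
    rfl
  rw [h3, ← globalLin_apply, map_smul, globalLin_apply, ← h2]
  rfl

/-- The two kinds of lattices differ only by powers of the local parameter at `Phat` and infinity,
which meromorphic sections do not see; elsewhere `hyperHol_iff` gives equality. -/
theorem hyperMer_iff (hC : C.ResonanceFree) (hN : N.IsMinimalExtension)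
    {s : ∀ ξ : Punct C.Phat, N.H1 ξ} {x : CP1} :
    N.HyperMer s x ↔ N.LaplaceMer (fun ξ => fiberEquiv hC hN.1.isFull ξ (s ξ)) x := by
  induction x using OnePoint.rec with
  | coe ξ₀ =>
    by_cases hx : ξ₀ ∈ C.Phat
    · have hx' := coe_mem_poles.2 hx
      constructor
      · intro h
        obtain ⟨k, hk⟩ := h.2 hx'
        refine ⟨fun h => absurd hx' h, fun _ => ⟨k, ?_⟩⟩
        have h1 := (hk.2.1 ξ₀ rfl hx).laplaceLat hC hN.1.isFull
        simpa only [map_smul] using h1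
      · intro h
        obtain ⟨k, hk⟩ := h.2 hx'
        have hk' : N.LaplaceLat (fun ξ => fiberEquiv hC hN.1.isFull ξ
            (unif (ξ₀ : CP1) ξ ^ k • s ξ)) (ξ₀ : CP1) := by simpa only [map_smul] using hk
        obtain ⟨l, hl⟩ := hyperLatAt_of_laplaceLat hC hN hk'
        refine ⟨fun h => absurd hx' h, fun _ => ⟨l + k, fun ξ₁ h1 h2 => ?_, fun ξ₁ h1 _ => ?_,
          fun h1 => absurd h1 (OnePoint.coe_ne_infty _)⟩⟩
        · rw [← OnePoint.coe_injective h1] at h2; exact absurd hx h2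
        · rw [← OnePoint.coe_injective h1]
          simpa only [pow_add, mul_smul] using hl
    · have hx' : (ξ₀ : CP1) ∉ poles C.Phat := fun h => hx (coe_mem_poles.1 h)
      constructor
      · intro h
        exact ⟨fun _ => (hyperHol_iff hC hN.1.isFull).1 ((h.1 hx').1 ξ₀ rfl hx),
          fun h => absurd h hx'⟩
      · intro h
        refine ⟨fun _ => ⟨fun ξ₁ h1 _ => ?_, fun ξ₁ h1 h2 => ?_,
          fun h1 => absurd h1 (OnePoint.coe_ne_infty _)⟩, fun h => absurd h hx'⟩
        · rw [← OnePoint.coe_injective h1]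
          exact (hyperHol_iff hC hN.1.isFull).2 (h.1 hx')
        · rw [← OnePoint.coe_injective h1] at h2; exact absurd h2 hx
  | infty =>
    have hx' : (OnePoint.infty : CP1) ∈ poles C.Phat := infty_mem_poles
    constructor
    · intro h
      obtain ⟨k, hk⟩ := h.2 hx'
      -- The exponent `1` accounts for the factor `ξ⁻¹` in `HyperLatInf.laplaceLat`.
      refine ⟨fun h => absurd hx' h, fun _ => ⟨1 + k, ?_⟩⟩
      have h1 := (hk.2.2 rfl).laplaceLat hC hN.1.isFull
      simpa only [map_smul, pow_add, mul_smul, pow_one, unif_infty] using h1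
    · intro h
      obtain ⟨k, hk⟩ := h.2 hx'
      have hk' : N.LaplaceLat (fun ξ => fiberEquiv hC hN.1.isFull ξ
          (unif OnePoint.infty ξ ^ k • s ξ)) OnePoint.infty := by simpa only [map_smul] using hk
      obtain ⟨l, hl⟩ := hyperLatInf_of_laplaceLat hC hN hk'
      refine ⟨fun h => absurd hx' h, fun _ => ⟨l + k,
        fun ξ₁ h1 _ => absurd h1 (OnePoint.infty_ne_coe _),
        fun ξ₁ h1 _ => absurd h1 (OnePoint.infty_ne_coe _), fun _ => ?_⟩⟩
      simpa only [pow_add, mul_smul] using hl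

end DSubmodule

end MeroConnection

/-- A family of isomorphisms of the fibres that identifies the admitted sections transports
meromorphic bundles. -/
theorem IsMeroBundle.of_equiv {Q : Finset ℂ} {V V' : Punct Q → Type*} [∀ ξ, AddCommGroup (V ξ)]
    [∀ ξ, Module ℂ (V ξ)] [∀ ξ, AddCommGroup (V' ξ)] [∀ ξ, Module ℂ (V' ξ)]
    {Mer : (∀ ξ, V ξ) → CP1 → Prop} {Mer' : (∀ ξ, V' ξ) → CP1 → Prop} (φ : ∀ ξ, V ξ ≃ₗ[ℂ] V' ξ)
    (h : ∀ s x, Mer s x ↔ Mer' (fun ξ => φ ξ (s ξ)) x) (h' : IsMeroBundle Mer') :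
    IsMeroBundle Mer := by
  obtain ⟨ρ, h'⟩ := h'
  refine ⟨ρ, fun x => ?_⟩
  obtain ⟨W, hW, hx, e, he, hMer⟩ := h' x
  refine ⟨W, hW, hx, fun i ξ => (φ ξ).symm (e i ξ), fun ξ hξ => ⟨?_, ?_⟩, fun y hy s => ?_⟩
  · exact (he ξ hξ).1.map' ((φ ξ).symm : V' ξ →ₗ[ℂ] V ξ) (φ ξ).symm.ker
  · have h1 : (range fun i => (φ ξ).symm (e i ξ)) = (φ ξ).symm '' range fun i => e i ξ :=
      range_comp (φ ξ).symm fun i => e i ξ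
    rw [h1]
    change Submodule.span ℂ (((φ ξ).symm : V' ξ →ₗ[ℂ] V ξ) '' _) = ⊤
    rw [← Submodule.map_span, (he ξ hξ).2, Submodule.map_top, LinearMap.range_eq_top]
    exact (φ ξ).symm.surjective
  · rw [h, hMer y hy]
    refine exists_congr fun f => and_congr_right fun _ => exists_congr fun W' => and_congr_right
      fun _ => forall_congr' fun ξ => imp_congr_right fun _ => ?_
    rw [← LinearEquiv.eq_symm_apply, map_sum]
    simp only [map_smul]

end MinLaplace

end

theorem proposition5p3 {r : ℕ} {P : Finset ℂ} (C : MinLaplace.MeroConnection r P)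
    (hC : C.ResonanceFree) :
    (∃ N : C.DSubmodule, N.IsMinimalExtension) ∧
    ∀ N : C.DSubmodule, N.IsMinimalExtension →
      MinLaplace.IsMeroBundle N.HyperMer ∧
      MinLaplace.IsMeroBundle N.LaplaceMer ∧
      ∃ φ : ∀ ξ : MinLaplace.Punct C.Phat, N.H1 ξ ≃ₗ[ℂ] N.LaplaceFiber ξ,
        (∀ ξ m, φ ξ (N.globalClass ξ m) = N.laplaceClass ξ m) ∧
        (∀ (s : ∀ ξ : MinLaplace.Punct C.Phat, N.H1 ξ) (ξ₀ : MinLaplace.Punct C.Phat),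
          N.HyperHol s ξ₀ ↔ N.LaplaceLat (fun ξ => φ ξ (s ξ)) ξ₀.pt) ∧
        (∀ (s : ∀ ξ : MinLaplace.Punct C.Phat, N.H1 ξ) (x : MinLaplace.CP1),
          N.HyperMer s x ↔ N.LaplaceMer (fun ξ => φ ξ (s ξ)) x) := by
  refine ⟨⟨_, MinLaplace.MeroConnection.minExt_isMinimal hC⟩, fun N hN => ?_⟩
  obtain ⟨ρ, m, hm⟩ := MinLaplace.MeroConnection.DSubmodule.exists_isGenerator hC hN
  have hmer := fun s x =>
    MinLaplace.MeroConnection.DSubmodule.hyperMer_iff hC hN (s := s) (x := x)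
  exact ⟨MinLaplace.IsMeroBundle.of_equiv _ hmer hm.isMeroBundle, hm.isMeroBundle, fun ξ => _,
    fun ξ m => MinLaplace.MeroConnection.DSubmodule.fiberEquiv_globalClass hC hN.1.isFull ξ m,
    fun s ξ₀ => MinLaplace.MeroConnection.DSubmodule.hyperHol_iff hC hN.1.isFull, hmer⟩
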